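/- **Setting.** Let $N\ge 1$ and let $E=\mathbb R^N\times\mathbb R\to\mathbb R^N$ be the trivial line bundle. Its infinite jet bundle $J^\infty E$ has coordinates $x^i$ ($1\le i\le N$) and $u_J$, with $J$ running over the multi-indices in $\mathbb Z_{\ge0}^N$. The algebra $\mathrm{Loc}(E)$ consists of the functions that depend smoothly on $x$ and on finitely many of the $u_J$, and $\frac{d}{dx^i}=\frac{\partial}{\partial x^i}+\sum_J u_{iJ}\frac{\partial}{\partial u_J}$, where $iJ$ is $J$ with its $i$-th entry raised by $1$. Let $\Omega^{k,0}$ be the free $\mathrm{Loc}(E)$-module on the forms $(dx)^S=dx^{s_1}\wedge\cdots\wedge dx^{s_k}$, $S=\{s_1<\dots<s_k\}\subseteq\{1,\dots,N\}$, with $\Omega^{k,0}=0$ for $k<0$ or $k>N$, and let $d_H\omega=\sum_i dx^i\wedge\frac{d}{dx^i}\omega$. Put $X_d=\Omega^{N-d,0}$, a chain complex with differential $d_H$ of degree $-1$. An *$n$-linear local differential operator* (LDO) on $\mathrm{Loc}(E)$ is a map of the form $$A(f_1,\dots,f_n)=\sum p_{I_1,\dots,I_n,\alpha_1,\dots,\alpha_n}\prod_{j=1}^n\Big(\frac{d}{dx}\Big)^{I_j}\Big(\frac{\partial}{\partial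 u}\Big)^{\alpha_j}f_j,\qquad p_{I,\alpha}\in\mathrm{Loc}(E),$$ where the $I_j$ are multi-indices and the $\alpha_j$ are finitely supported $\mathbb Z_{\ge 0}$-valued functions on multi-indices, such that for every $m$ only finitely many $p_{I,\alpha}$ with $\sum_j\deg_f(\alpha_j)\le m$ are nonzero; here $\deg_f(\alpha)$ is the largest $|J|$ with $\alpha(J)\neq0$ (and $0$ if $\alpha=0$). A multilinear operator on horizontal forms is an LDO if all its matrix coefficients with respect to the forms $(dx)^S$ are LDOs. For a top form $\alpha=f\,dx^1\wedge\dots\wedge dx^N\in\Omega^{N,0}$ let $\int\alpha$ be the functional $$\Big(\int\alpha\Big)[\phi]=\int_{\mathbb R^N}\big(f(x,j^\infty\phi(x))-f(x,0)\big)\,dx$$ on smooth compactly supported $\phi:\mathbb R^N\to\mathbb R$, and let $\mathcal F=\{\int\alpha:\alpha\in\Omega^{N,0}\}$ be the vector space of local functionals, two functionals being equal if they agree on all such $\phi$. **Theorem.** Let $\tilde l_2:\Omega^{N,0}\otimes\Omega^{N,0}\to\Omega^{N,0}$ be a bilinear LDO such that 1. $\tilde l_2(\alpha,d_H\beta)\in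 d_H\Omega^{N-1,0}$ for all $\alpha\in\Omega^{N,0}$, $\beta\in\Omega^{N-1,0}$; 2. $\tilde l_2(\alpha,\beta)+\tilde l_2(\beta,\alpha)\in d_H\Omega^{N-1,0}$ for all $\alpha,\beta\in\Omega^{N,0}$; 3. $\sum_{\sigma\in \mathrm{unsh}(2,1)}\epsilon(\sigma)\,\tilde l_2(\tilde l_2(\alpha_{\sigma(1)},\alpha_{\sigma(2)}),\alpha_{\sigma(3)})\in d_H\Omega^{N-1,0}$ for all $\alpha_1,\alpha_2,\alpha_3\in\Omega^{N,0}$. Here $\mathrm{unsh}(k,p)$ is the set of permutations $\sigma$ of $\{1,\dots,k+p\}$ with $\sigma(1)<\dots<\sigma(k)$ and $\sigma(k+1)<\dots<\sigma(k+p)$, and $\epsilon(\sigma)$ is the sign of $\sigma$. Then $$\Big\{\int\alpha_1,\int\alpha_2\Big\}:=\int\tilde l_2(\alpha_1,\alpha_2)$$ is a well-defined bilinear map $\mathcal F\otimes\mathcal F\to\mathcal F$ and a Lie bracket. Moreover it lifts to a strong homotopy Lie algebra structure on $X_*$ by LDOs: there are multilinear maps $l_k$, $k\ge1$, from $X_*^{\otimes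 k}$ to $X_*$, all of them LDOs, such that * $l_1=d_H$, and $\int l_2(\alpha_1,\alpha_2)=\{\int\alpha_1,\int\alpha_2\}$ for all $\alpha_1,\alpha_2\in X_0=\Omega^{N,0}$; * $l_k$ has degree $k-2$, and $l_k(x_{\sigma(1)},\dots,x_{\sigma(k)})=e(\sigma)\epsilon(\sigma)\,l_k(x_1,\dots,x_k)$ for homogeneous $x_1,\dots,x_k$ and every permutation $\sigma$, where $e(\sigma)$ is the Koszul sign; * for all $n\ge1$ and homogeneous $x_1,\dots,x_n$, $$\sum_{i+j=n+1}\ \sum_{\sigma\in\mathrm{unsh}(i,n-i)}e(\sigma)\epsilon(\sigma)(-1)^{i(j-1)}\,l_j\big(l_i(x_{\sigma(1)},\dots,x_{\sigma(i)}),x_{\sigma(i+1)},\dots,x_{\sigma(n)}\big)=0,$$ where $i,j\ge1$. -/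

import Mathlib

open scoped ContDiff

noncomputable section

/-- Multi-indices `J = (j₁, …, j_N)` of non-negative integers. -/
abbrev MultiIdx (N : ℕ) : Type := Fin N → ℕ

/-- Order `|J| = j₁ + ⋯ + j_N`. -/
def MultiIdx.order {N : ℕ} (J : MultiIdx N) : ℕ := ∑ i, J i

/-- Points `(x, u)` of the infinite jet bundle of the trivial line bundle `ℝ^N × ℝ → ℝ^N`,
with coordinates `x^i` and `u_J`. -/
abbrev Jet (N : ℕ) : Type := (Fin N → ℝ) × (MultiIdx N → ℝ)

/-- The projection of the infinite jet bundle that keeps `x` and the finitely many coordinates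
`u_J`, `J ∈ s`. -/
def Jet.proj {N : ℕ} (s : Finset (MultiIdx N)) (z : Jet N) : (Fin N → ℝ) × (s → ℝ) :=
  (z.1, fun J => z.2 J)

/-- A function on the infinite jet bundle is local if it is a smooth function of `x` and of
finitely many of the coordinates `u_J` (equivalently, the pull-back of a smooth function on
some finite jet bundle). -/
def IsLocalFun {N : ℕ} (f : Jet N → ℝ) : Prop :=
  ∃ (s : Finset (MultiIdx N)) (g : (Fin N → ℝ) × (s → ℝ) → ℝ),
    ContDiff ℝ ∞ g ∧ ∀ z, f z = g (Jet.proj s z)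

theorem IsLocalFun.enlarge {N : ℕ} {s t : Finset (MultiIdx N)} (h : s ⊆ t)
    {g : (Fin N → ℝ) × (s → ℝ) → ℝ} (hg : ContDiff ℝ ∞ g) :
    ∃ g' : (Fin N → ℝ) × (t → ℝ) → ℝ, ContDiff ℝ ∞ g' ∧
      ∀ z : Jet N, g (Jet.proj s z) = g' (Jet.proj t z) := by
  refine ⟨fun w => g (w.1, fun J => w.2 ⟨J, h J.2⟩), hg.comp ?_, fun z => rfl⟩
  fun_prop

theorem IsLocalFun.comp₂ {N : ℕ} {f₁ f₂ : Jet N → ℝ} (h₁ : IsLocalFun f₁) (h₂ : IsLocalFun f₂)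
    {q : ℝ × ℝ → ℝ} (hq : ContDiff ℝ ∞ q) : IsLocalFun (fun z => q (f₁ z, f₂ z)) := by
  obtain ⟨s, g, hg, hf⟩ := h₁
  obtain ⟨t, k, hk, hf'⟩ := h₂
  obtain ⟨g', hg', e⟩ := IsLocalFun.enlarge (Finset.subset_union_left (s₁ := s) (s₂ := t)) hg
  obtain ⟨k', hk', e'⟩ := IsLocalFun.enlarge (Finset.subset_union_right (s₁ := s) (s₂ := t)) hk
  refine ⟨s ∪ t, fun w => q (g' w, k' w), hq.comp (hg'.prodMk hk'), fun z => ?_⟩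
  simp only [hf, hf', e, e']

/-- The algebra `Loc(E)` of local functions. -/
def Loc (N : ℕ) : Subalgebra ℝ (Jet N → ℝ) where
  carrier := {f | IsLocalFun f}
  mul_mem' h₁ h₂ := h₁.comp₂ h₂ (q := fun p => p.1 * p.2) (by fun_prop)
  add_mem' h₁ h₂ := h₁.comp₂ h₂ (q := fun p => p.1 + p.2) (by fun_prop)
  algebraMap_mem' r := ⟨∅, fun _ => r, contDiff_const, fun _ => rfl⟩

/-- The coordinate function `u_J`. -/
def Loc.coordU {N : ℕ} (J : MultiIdx N) : Loc N :=
  ⟨fun z => z.2 J, {J}, fun w => w.2 ⟨J, Finset.mem_singleton_self J⟩, by fun_prop, fun _ => rfl⟩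

/-- The partial derivative `∂/∂x^i` of a function on the infinite jet bundle. -/
def partialX {N : ℕ} (i : Fin N) (f : Jet N → ℝ) : Jet N → ℝ :=
  fun z => deriv (fun t => f (Function.update z.1 i t, z.2)) (z.1 i)

/-- The partial derivative `∂/∂u_J` of a function on the infinite jet bundle. -/
def partialU {N : ℕ} (J : MultiIdx N) (f : Jet N → ℝ) : Jet N → ℝ :=
  fun z => deriv (fun t => f (z.1, Function.update z.2 J t)) (z.2 J)

theorem IsLocalFun.partialX {N : ℕ} {f : Jet N → ℝ} (h : IsLocalFun f) (i : Fin N) :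
    IsLocalFun (partialX i f) := by
  obtain ⟨s, g, hg, hf⟩ := h
  refine ⟨s, fun w => fderiv ℝ g w (Pi.single i 1, 0),
    (hg.fderiv_right (m := ∞) (by simp)).clm_apply contDiff_const, fun z => ?_⟩
  have h1 : HasDerivAt (fun t => ((Function.update z.1 i t, fun J : s => z.2 J) :
      (Fin N → ℝ) × (s → ℝ))) (Pi.single i 1, 0) (z.1 i) :=
    (hasDerivAt_update z.1 i (z.1 i)).prodMk (hasDerivAt_const _ _)
  have h2 : HasFDerivAt g (fderiv ℝ g (Jet.proj s z))
      (Function.update z.1 i (z.1 i), fun J : s => z.2 J) := by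
    rw [Function.update_eq_self]
    exact (hg.differentiable (by simp) _).hasFDerivAt
  have h3 := h2.comp_hasDerivAt (z.1 i) h1
  simp only [_root_.partialX, hf]
  exact h3.deriv

theorem IsLocalFun.partialU {N : ℕ} {f : Jet N → ℝ} (h : IsLocalFun f) (J : MultiIdx N) :
    IsLocalFun (partialU J f) := by
  obtain ⟨s, g, hg, hf⟩ := h
  by_cases hJ : J ∈ s
  · refine ⟨s, fun w => fderiv ℝ g w (0, Pi.single ⟨J, hJ⟩ 1),
      (hg.fderiv_right (m := ∞) (by simp)).clm_apply contDiff_const, fun z => ?_⟩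
    have e : ∀ t, Jet.proj s (z.1, Function.update z.2 J t)
        = (z.1, Function.update (fun K : s => z.2 K) ⟨J, hJ⟩ t) := by
      intro t
      refine Prod.ext rfl (funext fun K => ?_)
      by_cases hK : K = ⟨J, hJ⟩
      · subst hK; simp [Jet.proj]
      · have : (K : MultiIdx N) ≠ J := fun h => hK (Subtype.ext h)
        simp [Jet.proj, Function.update_of_ne hK, Function.update_of_ne this]
    have h1 : HasDerivAt (fun t => ((z.1, Function.update (fun K : s => z.2 K) ⟨J, hJ⟩ t) :
        (Fin N → ℝ) × (s → ℝ))) (0, Pi.single ⟨J, hJ⟩ 1) (z.2 J) :=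
      (hasDerivAt_const _ _).prodMk (hasDerivAt_update _ _ _)
    have h2 : HasFDerivAt g (fderiv ℝ g (Jet.proj s z))
        (z.1, Function.update (fun K : s => z.2 K) ⟨J, hJ⟩ (z.2 J)) := by
      rw [← e, Function.update_eq_self]
      exact (hg.differentiable (by simp) _).hasFDerivAt
    have h3 := h2.comp_hasDerivAt (z.2 J) h1
    simp only [_root_.partialU, hf, e]
    exact h3.deriv
  · refine ⟨∅, fun _ => 0, contDiff_const, fun z => ?_⟩
    have e : ∀ t, Jet.proj s (z.1, Function.update z.2 J t) = Jet.proj s z := by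
      intro t
      refine Prod.ext rfl (funext fun K => ?_)
      have : (K : MultiIdx N) ≠ J := fun h => hJ (h ▸ K.2)
      simp [Jet.proj, Function.update_of_ne this]
    simp only [_root_.partialU, hf, e, deriv_const]

/-- `∂/∂x^i` on local functions. -/
def Loc.dX {N : ℕ} (i : Fin N) (f : Loc N) : Loc N := ⟨partialX i f, f.2.partialX i⟩

/-- `∂/∂u_J` on local functions. -/
def Loc.dU {N : ℕ} (J : MultiIdx N) (f : Loc N) : Loc N := ⟨partialU J f, f.2.partialU J⟩

/-- The total derivative `d/dx^i = ∂/∂x^i + ∑_J u_{iJ} ∂/∂u_J`, where `iJ` is `J` with its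
`i`-th entry raised by one. Only finitely many terms of the sum are nonzero, since a local
function depends on finitely many `u_J`. -/
def Loc.totalD {N : ℕ} (i : Fin N) (f : Loc N) : Loc N :=
  Loc.dX i f + ∑ᶠ J : MultiIdx N, Loc.coordU (J + Pi.single i 1) * Loc.dU J f

/-- `(d/dx)^I = (d/dx^1)^{i₁} ⋯ (d/dx^N)^{i_N}`. -/
def Loc.totalDPow {N : ℕ} (I : MultiIdx N) (f : Loc N) : Loc N :=
  (List.finRange N).foldr (fun i g => (Loc.totalD i)^[I i] g) f

/-- `(∂/∂u)^α = ∏_J (∂/∂u_J)^{α(J)}` for a finitely supported exponent `α` (the factors commute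
on local functions, so their order is immaterial). -/
def Loc.dUPow {N : ℕ} (α : MultiIdx N →₀ ℕ) (f : Loc N) : Loc N :=
  α.support.toList.foldr (fun J g => (Loc.dU J)^[α J] g) f

/-- The formal differential degree of `α`: the maximal order of a `J` with `α(J) ≠ 0`
(and `0` for `α = 0`). -/
def degF {N : ℕ} (α : MultiIdx N →₀ ℕ) : ℕ := α.support.sup MultiIdx.order

/-- `A` is an `n`-multilinear local differential operator:
`A(f₁, …, f_n) = ∑ p_{I,α} ∏ⱼ (d/dx)^{I_j} (∂/∂u)^{α_j} f_j` with local coefficients such that,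
for each `m`, only finitely many `p_{I,α}` with `∑ⱼ deg_f(α_j) ≤ m` are nonzero. Under that
condition only finitely many terms are nonzero for given `f₁, …, f_n`. -/
def IsLDO {N n : ℕ} (A : (Fin n → Loc N) → Loc N) : Prop :=
  ∃ p : (Fin n → MultiIdx N) × (Fin n → (MultiIdx N →₀ ℕ)) → Loc N,
    (∀ m : ℕ, {c | ∑ j, degF (c.2 j) ≤ m ∧ p c ≠ 0}.Finite) ∧
    ∀ f : Fin n → Loc N,
      A f = ∑ᶠ c : (Fin n → MultiIdx N) × (Fin n → (MultiIdx N →₀ ℕ)),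
        p c * ∏ j, Loc.totalDPow (c.1 j) (Loc.dUPow (c.2 j) (f j))

/-- Horizontal forms `∑_S w_S (dx)^S` on the infinite jet bundle, of all degrees, given by
their coefficients; `(dx)^S` is the wedge product of the `dx^i`, `i ∈ S`, in increasing order. -/
abbrev HForm (N : ℕ) : Type := Finset (Fin N) → Loc N

/-- The space `Ω^{k,0}` of horizontal `k`-forms (zero unless `0 ≤ k ≤ N`). -/
def Omega (N : ℕ) (k : ℤ) : Submodule ℝ (HForm N) where
  carrier := {w | ∀ S, (S.card : ℤ) ≠ k → w S = 0}
  add_mem' h₁ h₂ S hS := by simp [h₁ S hS, h₂ S hS]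
  zero_mem' S _ := rfl
  smul_mem' c w h S hS := by simp [h S hS]

/-- The horizontal differential `d_H w = ∑_i dx^i ∧ (d/dx^i) w`: since
`dx^i ∧ (dx)^S = (-1)^{#{j ∈ S, j < i}} (dx)^{S ∪ {i}}` for `i ∉ S`, its coefficient at `(dx)^T`
is `∑_{i ∈ T} (-1)^{#{j ∈ T, j < i}} (d/dx^i) w_{T ∖ {i}}`. -/
def dH {N : ℕ} (w : HForm N) : HForm N := fun T =>
  ∑ i ∈ T, (-1 : ℤ) ^ (T.filter (· < i)).card • Loc.totalD i (w (T.erase i))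

/-- The form `f (dx)^S`. -/
def monoForm {N : ℕ} (S : Finset (Fin N)) (f : Loc N) : HForm N := Pi.single S f

/-- The top form `f dx^1 ∧ ⋯ ∧ dx^N`. -/
def topForm {N : ℕ} (f : Loc N) : Omega N N :=
  ⟨monoForm Finset.univ f, fun S hS => by
    have : S ≠ Finset.univ := by rintro rfl; simp at hS
    simp [monoForm, this]⟩

/-- A top form lies in `d_H Ω^{N-1,0}`. -/
def IsDHExact {N : ℕ} (α : Omega N N) : Prop := ∃ β ∈ Omega N ((N : ℤ) - 1), dH β = (α : HForm N)

/-- A multilinear operator on horizontal forms all of whose matrix coefficients are local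
differential operators. -/
def IsFormLDO {N n : ℕ} (A : (Fin n → HForm N) → HForm N) : Prop :=
  ∀ (S : Fin n → Finset (Fin N)) (T : Finset (Fin N)),
    IsLDO (fun f : Fin n → Loc N => A (fun i => monoForm (S i) (f i)) T)

/-- A bilinear operation on top forms is a local differential operator (top forms being
identified with local functions). -/
def IsTopLDO {N : ℕ} (b : Omega N N →ₗ[ℝ] Omega N N →ₗ[ℝ] Omega N N) : Prop :=
  IsLDO (fun f : Fin 2 → Loc N => (b (topForm (f 0)) (topForm (f 1)) : HForm N) Finset.univ)

/-! ### Local functionals -/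

/-- Smooth sections of compact support of the trivial line bundle. -/
abbrev TestSection (N : ℕ) : Type :=
  {φ : (Fin N → ℝ) → ℝ // ContDiff ℝ ∞ φ ∧ HasCompactSupport φ}

/-- `∂φ/∂x^i` for a function on `ℝ^N`. -/
def baseD {N : ℕ} (i : Fin N) (φ : (Fin N → ℝ) → ℝ) : (Fin N → ℝ) → ℝ :=
  fun x => fderiv ℝ φ x (Pi.single i 1)

/-- `(∂/∂x)^J φ` for a function on `ℝ^N`. -/
def baseDPow {N : ℕ} (J : MultiIdx N) (φ : (Fin N → ℝ) → ℝ) : (Fin N → ℝ) → ℝ :=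
  (List.finRange N).foldr (fun i g => (baseD i)^[J i] g) φ

/-- The infinite jet `j^∞φ` at `x`: `u_J(j^∞φ(x)) = (∂/∂x)^J φ(x)`. -/
def jetAt {N : ℕ} (φ : (Fin N → ℝ) → ℝ) (x : Fin N → ℝ) : Jet N := (x, fun J => baseDPow J φ x)

theorem baseDPow_prop {N : ℕ} (J : MultiIdx N) {φ : (Fin N → ℝ) → ℝ} (h : ContDiff ℝ ∞ φ) :
    ContDiff ℝ ∞ (baseDPow J φ) ∧ tsupport (baseDPow J φ) ⊆ tsupport φ := by
  have step : ∀ (i : Fin N) (g : (Fin N → ℝ) → ℝ), (ContDiff ℝ ∞ g ∧ tsupport g ⊆ tsupport φ) →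
      ContDiff ℝ ∞ (baseD i g) ∧ tsupport (baseD i g) ⊆ tsupport φ := by
    intro i g hg
    refine ⟨(hg.1.fderiv_right (m := ∞) (by simp)).clm_apply contDiff_const, ?_⟩
    refine (closure_mono ?_).trans ((tsupport_fderiv_subset ℝ (f := g)).trans hg.2)
    intro x hx hx'
    exact hx (by simp [baseD, hx'])
  have iter : ∀ (i : Fin N) (n : ℕ) (g : (Fin N → ℝ) → ℝ),
      (ContDiff ℝ ∞ g ∧ tsupport g ⊆ tsupport φ) →
      ContDiff ℝ ∞ ((baseD i)^[n] g) ∧ tsupport ((baseD i)^[n] g) ⊆ tsupport φ := by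
    intro i n
    induction n with
    | zero => exact fun g hg => hg
    | succ n ih => exact fun g hg => ih _ (step i g hg)
  unfold baseDPow
  induction List.finRange N with
  | nil => exact ⟨h, subset_rfl⟩
  | cons i L ih => exact iter i (J i) _ ih

/-- The integrand `f(x, j^∞φ(x)) - f(x, 0)` is continuous of compact support. -/
theorem integrand_prop {N : ℕ} (f : Loc N) (φ : TestSection N) :
    MeasureTheory.Integrable
      (fun x => (f : Jet N → ℝ) (jetAt φ.1 x) - (f : Jet N → ℝ) (x, 0)) := by
  obtain ⟨f, s, g, hg, hf⟩ := f
  have hc : ∀ J, Continuous (baseDPow J φ.1) := fun J => (baseDPow_prop J φ.2.1).1.continuous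
  refine Continuous.integrable_of_hasCompactSupport ?_ ?_
  · simp only [hf]
    refine (hg.continuous.comp ?_).sub (hg.continuous.comp ?_)
    · exact continuous_id.prodMk (continuous_pi fun J => hc J)
    · exact continuous_id.prodMk (continuous_pi fun J => continuous_const)
  · refine HasCompactSupport.intro φ.2.2 fun x hx => ?_
    have : jetAt φ.1 x = (x, 0) := by
      refine Prod.ext rfl (funext fun J => ?_)
      have h0 : x ∉ tsupport (baseDPow J φ.1) := fun h => hx ((baseDPow_prop J φ.2.1).2 h)
      show baseDPow J φ.1 x = 0
      exact image_eq_zero_of_notMem_tsupport h0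
    simp [this]

/-- The functional `∫ α`: for a top form `α = f dx^1 ∧ ⋯ ∧ dx^N` it is
`φ ↦ ∫ (f(x, j^∞φ(x)) - f(x, 0)) dx`, that is the integral of the pull-back by `j^∞φ` of
the form normalised to vanish at the zero section (so that the integrand has compact support).
On forms of lower degree it is zero. -/
def integralForm (N : ℕ) : HForm N →ₗ[ℝ] (TestSection N → ℝ) where
  toFun α φ := ∫ x : Fin N → ℝ, ((α Finset.univ : Loc N) : Jet N → ℝ) (jetAt φ.1 x)
    - ((α Finset.univ : Loc N) : Jet N → ℝ) (x, 0)
  map_add' α β := by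
    funext φ
    refine Eq.trans ?_ (MeasureTheory.integral_add (integrand_prop (α Finset.univ) φ)
      (integrand_prop (β Finset.univ) φ))
    refine MeasureTheory.integral_congr_ae (Filter.Eventually.of_forall fun x => ?_)
    exact add_sub_add_comm _ _ _ _
  map_smul' c α := by
    funext φ
    refine Eq.trans ?_ (MeasureTheory.integral_const_mul c _)
    refine MeasureTheory.integral_congr_ae (Filter.Eventually.of_forall fun x => ?_)
    exact (mul_sub c _ _).symm

/-- The space `𝓕` of local functionals. -/
def LocalFunctional (N : ℕ) : Submodule ℝ (TestSection N → ℝ) :=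
  (Omega N N).map (integralForm N)

/-- `∫ α` as an element of `𝓕`, for a top form `α`. -/
def functionalOf {N : ℕ} (α : Omega N N) : LocalFunctional N :=
  ⟨integralForm N α, Submodule.mem_map_of_mem α.2⟩

/-- A bilinear map is a Lie bracket. -/
structure IsLieBracket {V : Type*} [AddCommGroup V] [Module ℝ V] (b : V →ₗ[ℝ] V →ₗ[ℝ] V) :
    Prop where
  alternating : ∀ x, b x x = 0
  jacobi : ∀ x y z, b (b x y) z + b (b y z) x + b (b z x) y = 0

/-! ### Strong homotopy Lie algebras -/

/-- The permutations in `unsh(k, n - k)`: increasing on the first `k` and on the last `n - k`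
places. -/
def unshuffles (n k : ℕ) : Finset (Equiv.Perm (Fin n)) :=
  Finset.univ.filter fun σ => ∀ a b : Fin n, a < b → ((b : ℕ) < k ∨ k ≤ (a : ℕ)) → σ a < σ b

/-- The Koszul sign `e(σ)` of `x_1, …, x_n ↦ x_{σ(1)}, …, x_{σ(n)}`, the degree of `x_i`
being `d i`. -/
def koszulSign {n : ℕ} (d : Fin n → ℤ) (σ : Equiv.Perm (Fin n)) : ℤˣ :=
  ∏ p ∈ Finset.univ.filter (fun p : Fin n × Fin n => p.1 < p.2 ∧ σ p.2 < σ p.1),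
    (d (σ p.1) * d (σ p.2)).negOnePow

/-- The brackets `l_k`, `k ≥ 1`, form a strong homotopy Lie algebra structure on the graded vector
space `⨁_d X d` (with total space `V`): `l_k` has degree `k - 2`, is skew symmetric in the graded
sense, and for each `n ≥ 1` and homogeneous `x_1, …, x_n`
`∑_{i+j=n+1} ∑_{σ ∈ unsh(i,n-i)} e(σ) ε(σ) (-1)^{i(j-1)}
  l_j(l_i(x_{σ(1)}, …, x_{σ(i)}), x_{σ(i+1)}, …, x_{σ(n)}) = 0`.
Below `i` is written `i + 1` with `i : Fin n`, so `j = n - i`, and places are counted from zero.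
The entry `l 0` plays no role. -/
structure IsStrongHomotopyLie {V : Type*} [AddCommGroup V] [Module ℝ V] (X : ℤ → Submodule ℝ V)
    (l : ∀ k : ℕ, MultilinearMap ℝ (fun _ : Fin k => V) V) : Prop where
  isInternal : DirectSum.IsInternal X
  degree : ∀ k, 1 ≤ k → ∀ (d : Fin k → ℤ) (x : Fin k → V), (∀ i, x i ∈ X (d i)) →
    l k x ∈ X (∑ i, d i + k - 2)
  skew : ∀ k, 1 ≤ k → ∀ (d : Fin k → ℤ) (x : Fin k → V), (∀ i, x i ∈ X (d i)) →
    ∀ σ : Equiv.Perm (Fin k),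
      l k (fun i => x (σ i)) = (koszulSign d σ * Equiv.Perm.sign σ) • l k x
  relation : ∀ n, 1 ≤ n → ∀ (d : Fin n → ℤ) (x : Fin n → V), (∀ i, x i ∈ X (d i)) →
    ∑ i : Fin n, ∑ σ ∈ unshuffles n ((i : ℕ) + 1),
      (koszulSign d σ * Equiv.Perm.sign σ * (-1) ^ (((i : ℕ) + 1) * (n - (i : ℕ) - 1))) •
        l (n - (i : ℕ)) (fun b : Fin (n - (i : ℕ)) =>
          if (b : ℕ) = 0 then
            l ((i : ℕ) + 1) (fun a : Fin ((i : ℕ) + 1) =>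
              x (σ ⟨(a : ℕ), lt_of_lt_of_le a.2 i.2⟩))
          else x (σ ⟨(i : ℕ) + (b : ℕ), by omega⟩)) = 0

/-- The regraded horizontal complex `X_d = Ω^{N-d,0}`. -/
def regraded (N : ℕ) (d : ℤ) : Submodule ℝ (HForm N) := Omega N ((N : ℤ) - d)

end

/-! All brackets of arity at least two live on top forms, so the problem takes place in the complex
of horizontal forms whose coefficients are n-linear local differential operators, with `d_H`
composed on the output side. Three facts about this complex, together with a description of the
vanishing functionals, carry the proof.

Acyclicity. Fix one slot. The commutator `a` of an operator with multiplication by `x^i` in that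
slot satisfies `[a, d/dx^i] = 1` and is nilpotent on arguments of bounded jet order. As in a Weyl
algebra, every operator is then `d/dx^i` of another one plus an operator killed by `a` (`totD_divD`,
`divD_totD`, `adSlot_normalPart`), and the Koszul complex of the `d/dx^i` contracts onto the top
forms that commute with every `x^i` in the slot. If such an operator has divergences as values, then
every polynomial in `x` times a value is a divergence. The Euler operator shows that the value does
not depend on `u`, and multiplying the argument by powers of `u` shows that it is zero
(`eq_zero_of_exactValued`). Hence closed forms below the top degree, and top forms with exact
values, have primitives that are again local differential operators (`exists_primitive`).

Annihilating divergences. In one slot the vertical derivatives `∂/∂u_J` can be counted by an Euler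
field `count = ∑_J (symbol derivative along ∂/∂u_J) ∘ ∂/∂u_J`. If an operator kills total
derivatives in the slot, its symbol derivatives are all determined by the one at `J = 0`, and `count
X` becomes that one precomposed with the Euler operator `E`. The count is invertible where vertical
derivatives occur, so `proj X = count⁻¹ (symbol derivative at 0 ∘ E)` is a projection onto the
operators that kill total derivatives. It commutes with `d/dx^i` on the output and with the other
slots. Hence primitives may be chosen to kill divergences, and averaging makes them skew
(`exists_primitive_kills`, `exists_primitive_skew`). The given bracket differs by exact values from
a skew operator `M` that kills divergences (`proj_sub_mem`, `exists_bracket`).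

The homotopies. Let `δ` insert `M` into an operator and antisymmetrize. On skew operators that kill
divergences `δ² = 0` holds strictly: the Jacobi terms become divergences and die, and the terms with
two separate copies of `M` cancel in pairs (`delta_delta`). As `δM` has exact values, one solves
`d_H L_{n+1} = -δ L_n` recursively, starting from `L_0 = M` (`exists_brackets`). Put `l_1 = d_H` and
let `l_{n+2}` apply `L_n` to the top components. Every other composite in the strong homotopy
relation contains a divergence or a form without top component as an argument, so that only `l_1
l_n` and `l_{n-1} l_2` remain, which is the recursion.

The functionals. `∫ α = 0` holds exactly when `α` is `d_H`-exact (`functional_eq_zero_iff`). One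
direction is integration by parts. For the other, the first variation and the fibrewise homotopy
formula reduce exactness to the vanishing of the Euler derivative. Thus the hypotheses modulo exact
forms become a Lie bracket on functionals. -/

noncomputable section

/-! ### Calculus on local functions: partial and total derivatives as derivations. -/

namespace Loc

variable {N : ℕ}

/-- A local function factors through `Jet.proj s` as the smooth function `g`. -/
structure Rep (f : Jet N → ℝ) (s : Finset (MultiIdx N))
    (g : (Fin N → ℝ) × (s → ℝ) → ℝ) : Prop where
  smooth : ContDiff ℝ ∞ g
  eq : ∀ z, f z = g (Jet.proj s z)

theorem exists_rep (f : Loc N) : ∃ s g, Rep (f : Jet N → ℝ) s g := by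
  obtain ⟨f, s, g, hg, hf⟩ := f
  exact ⟨s, g, hg, hf⟩

/-- Calculus on the infinite jet space is done on the finite-dimensional representative: along a
line in any direction the chain rule applies to `g`. -/
theorem Rep.line {f : Jet N → ℝ} {s g} (h : Rep f s g) (z v : Jet N) :
    HasDerivAt (fun t : ℝ => f (z + t • v)) (fderiv ℝ g (Jet.proj s z) (Jet.proj s v)) 0 := by
  have h1 : HasDerivAt (fun t : ℝ => Jet.proj s z + t • Jet.proj s v) (Jet.proj s v) 0 := by
    simpa using ((hasDerivAt_id (0 : ℝ)).smul_const (Jet.proj s v)).const_add (Jet.proj s z)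
  have h2 : HasFDerivAt g (fderiv ℝ g (Jet.proj s z)) (Jet.proj s z + (0 : ℝ) • Jet.proj s v) := by
    simpa using (h.smooth.differentiable (by simp) (Jet.proj s z)).hasFDerivAt
  have h3 := h2.comp_hasDerivAt (0 : ℝ) h1
  refine h3.congr_of_eventuallyEq (Filter.Eventually.of_forall fun t => ?_)
  exact h.eq _

theorem partialX_eq_deriv (i : Fin N) (f : Jet N → ℝ) (z : Jet N) :
    partialX i f z = deriv (fun t : ℝ => f (z + t • ((Pi.single i 1, 0) : Jet N))) 0 := by
  have : (fun t : ℝ => f (z + t • ((Pi.single i 1, 0) : Jet N)))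
      = fun t => (fun t => f (Function.update z.1 i t, z.2)) (z.1 i + t) := by
    funext t
    congr 1
    refine Prod.ext (funext fun j => ?_) (by simp)
    by_cases h : j = i
    · subst h; simp
    · simp [h]
  rw [this]
  simpa [partialX] using
    (deriv_comp_const_add (fun t => f (Function.update z.1 i t, z.2)) (z.1 i) 0).symm

theorem partialU_eq_deriv (J : MultiIdx N) (f : Jet N → ℝ) (z : Jet N) :
    partialU J f z = deriv (fun t : ℝ => f (z + t • ((0, Pi.single J 1) : Jet N))) 0 := by
  have : (fun t : ℝ => f (z + t • ((0, Pi.single J 1) : Jet N)))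
      = fun t => (fun t => f (z.1, Function.update z.2 J t)) (z.2 J + t) := by
    funext t
    congr 1
    refine Prod.ext (by simp) (funext fun j => ?_)
    by_cases h : j = J
    · subst h; simp
    · simp [h]
  rw [this]
  simpa [partialU] using
    (deriv_comp_const_add (fun t => f (z.1, Function.update z.2 J t)) (z.2 J) 0).symm

/-- The derivative of a local function in a coordinate direction. -/
def dirD (v : Jet N) (f : Jet N → ℝ) : Jet N → ℝ := fun z => deriv (fun t : ℝ => f (z + t • v)) 0

theorem Rep.dirD_eq {f : Jet N → ℝ} {s g} (h : Rep f s g) (v z : Jet N) :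
    dirD v f z = fderiv ℝ g (Jet.proj s z) (Jet.proj s v) := (h.line z v).deriv

theorem Rep.dirD {f : Jet N → ℝ} {s g} (h : Rep f s g) (v : Jet N) :
    Rep (dirD v f) s (fun w => fderiv ℝ g w (Jet.proj s v)) :=
  ⟨(h.smooth.fderiv_right (m := ∞) (by simp)).clm_apply contDiff_const, h.dirD_eq v⟩

/-- Symmetry of the second derivative of a representative. Both kinds of partial derivatives are
directional derivatives, so this one statement gives all their commutation relations. -/
theorem dirD_comm (f : Loc N) (v w : Jet N) :
    dirD v (dirD w (f : Jet N → ℝ)) = dirD w (dirD v (f : Jet N → ℝ)) := by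
  obtain ⟨s, g, h⟩ := exists_rep f
  funext z
  rw [(h.dirD w).dirD_eq, (h.dirD v).dirD_eq]
  have hd : DifferentiableAt ℝ (fderiv ℝ g) (Jet.proj s z) :=
    (h.smooth.fderiv_right (m := ∞) (by simp)).differentiable (by simp) _
  rw [fderiv_clm_apply hd (differentiableAt_const _), fderiv_clm_apply hd (differentiableAt_const _)]
  have hsymm : IsSymmSndFDerivAt ℝ g (Jet.proj s z) :=
    h.smooth.contDiffAt.isSymmSndFDerivAt (by simpa using WithTop.coe_le_coe.2 (le_top : (2 : ℕ∞) ≤ ⊤))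
  simpa using hsymm.eq _ _

theorem dirD_add (v : Jet N) (f g : Loc N) :
    dirD v ((f + g : Loc N) : Jet N → ℝ) = dirD v (f : Jet N → ℝ) + dirD v (g : Jet N → ℝ) := by
  obtain ⟨s, a, ha⟩ := exists_rep f
  obtain ⟨t, b, hb⟩ := exists_rep g
  funext z
  exact ((ha.line z v).add (hb.line z v)).deriv.trans
    (congrArg₂ (· + ·) (ha.dirD_eq v z).symm (hb.dirD_eq v z).symm)

theorem dirD_mul (v : Jet N) (f g : Loc N) :
    dirD v ((f * g : Loc N) : Jet N → ℝ)
      = (f : Jet N → ℝ) * dirD v (g : Jet N → ℝ) + (g : Jet N → ℝ) * dirD v (f : Jet N → ℝ) := by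
  obtain ⟨s, a, ha⟩ := exists_rep f
  obtain ⟨t, b, hb⟩ := exists_rep g
  funext z
  refine ((ha.line z v).mul (hb.line z v)).deriv.trans ?_
  simp only [Pi.add_apply, Pi.mul_apply, ha.dirD_eq, hb.dirD_eq, zero_smul, add_zero]
  ring

theorem dX_coe (i : Fin N) (f : Loc N) :
    (dX i f : Jet N → ℝ) = dirD (Pi.single i 1, 0) (f : Jet N → ℝ) :=
  funext (partialX_eq_deriv i f)

theorem dU_coe (J : MultiIdx N) (f : Loc N) :
    (dU J f : Jet N → ℝ) = dirD (0, Pi.single J 1) (f : Jet N → ℝ) :=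
  funext (partialU_eq_deriv J f)

theorem dirD_smul (v : Jet N) (c : ℝ) (f : Loc N) :
    dirD v ((c • f : Loc N) : Jet N → ℝ) = c • dirD v (f : Jet N → ℝ) := by
  funext z
  simp [dirD, deriv_const_mul_field]

/-- `∂/∂x^i` as a derivation. -/
def derX (i : Fin N) : Derivation ℝ (Loc N) (Loc N) :=
  Derivation.mk' { toFun := dX i
                   map_add' := fun f g => Subtype.ext (by
                    rw [Subalgebra.coe_add, dX_coe, dX_coe, dX_coe]; exact dirD_add _ f g)
                   map_smul' := fun c f => Subtype.ext (by
                    rw [RingHom.id_apply, Subalgebra.coe_smul, dX_coe, dX_coe]; exact dirD_smul _ c f) }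
    fun f g => Subtype.ext (by
      simp only [LinearMap.coe_mk, AddHom.coe_mk, dX_coe, smul_eq_mul,
        Subalgebra.coe_add, Subalgebra.coe_mul]
      exact dirD_mul _ f g)

/-- `∂/∂u_J` as a derivation. -/
def derU (J : MultiIdx N) : Derivation ℝ (Loc N) (Loc N) :=
  Derivation.mk' { toFun := dU J
                   map_add' := fun f g => Subtype.ext (by
                    rw [Subalgebra.coe_add, dU_coe, dU_coe, dU_coe]; exact dirD_add _ f g)
                   map_smul' := fun c f => Subtype.ext (by
                    rw [RingHom.id_apply, Subalgebra.coe_smul, dU_coe, dU_coe]; exact dirD_smul _ c f) }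
    fun f g => Subtype.ext (by
      simp only [LinearMap.coe_mk, AddHom.coe_mk, dU_coe, smul_eq_mul,
        Subalgebra.coe_add, Subalgebra.coe_mul]
      exact dirD_mul _ f g)

theorem derX_apply (i : Fin N) (f : Loc N) : derX i f = dX i f := rfl
theorem derU_apply (J : MultiIdx N) (f : Loc N) : derU J f = dU J f := rfl

theorem derU_comm (J K : MultiIdx N) (f : Loc N) : derU J (derU K f) = derU K (derU J f) :=
  Subtype.ext (by simp only [derU_apply, dU_coe, dirD_comm f])

theorem derX_comm (i k : Fin N) (f : Loc N) : derX i (derX k f) = derX k (derX i f) :=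
  Subtype.ext (by simp only [derX_apply, dX_coe, dirD_comm f])

theorem derU_derX_comm (J : MultiIdx N) (i : Fin N) (f : Loc N) :
    derU J (derX i f) = derX i (derU J f) :=
  Subtype.ext (by simp only [derX_apply, derU_apply, dX_coe, dU_coe, dirD_comm f])

/-- The coordinate function `x^i`. -/
def coordX (i : Fin N) : Loc N :=
  ⟨fun z => z.1 i, ∅, fun w => w.1 i, by fun_prop, fun _ => rfl⟩

theorem dirD_coordX (v : Jet N) (i : Fin N) : dirD v (coordX i : Jet N → ℝ) = fun _ => v.1 i := by
  funext z
  have : HasDerivAt (fun t : ℝ => z.1 i + t * v.1 i) (v.1 i) 0 := by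
    simpa using ((hasDerivAt_id (0 : ℝ)).mul_const (v.1 i)).const_add (z.1 i)
  exact this.deriv

theorem dirD_coordU (v : Jet N) (J : MultiIdx N) :
    dirD v (coordU J : Jet N → ℝ) = fun _ => v.2 J := by
  funext z
  have : HasDerivAt (fun t : ℝ => z.2 J + t * v.2 J) (v.2 J) 0 := by
    simpa using ((hasDerivAt_id (0 : ℝ)).mul_const (v.2 J)).const_add (z.2 J)
  exact this.deriv

theorem derX_coordX (i k : Fin N) : derX i (coordX k) = if i = k then 1 else 0 := by
  refine Subtype.ext ?_
  rw [derX_apply, dX_coe, dirD_coordX]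
  by_cases h : i = k
  · subst h; funext z; simp
  · funext z; simp [h, Ne.symm h]

theorem derX_coordU (i : Fin N) (J : MultiIdx N) : derX i (coordU J) = 0 := by
  refine Subtype.ext ?_
  rw [derX_apply, dX_coe, dirD_coordU]
  rfl

theorem derU_coordX (J : MultiIdx N) (i : Fin N) : derU J (coordX i) = 0 := by
  refine Subtype.ext ?_
  rw [derU_apply, dU_coe, dirD_coordX]
  rfl

theorem derU_coordU (J K : MultiIdx N) : derU J (coordU K) = if J = K then 1 else 0 := by
  refine Subtype.ext ?_
  rw [derU_apply, dU_coe, dirD_coordU]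
  by_cases h : J = K
  · subst h; funext z; simp
  · funext z; simp [h, Ne.symm h]

theorem Rep.derU_eq_zero {f : Loc N} {s g} (h : Rep (f : Jet N → ℝ) s g) {J : MultiIdx N}
    (hJ : J ∉ s) : derU J f = 0 := by
  refine Subtype.ext ?_
  rw [derU_apply, dU_coe]
  funext z
  rw [h.dirD_eq]
  have : Jet.proj s ((0, Pi.single J 1) : Jet N) = 0 := by
    refine Prod.ext rfl (funext fun K => ?_)
    have : (K : MultiIdx N) ≠ J := fun h => hJ (h ▸ K.2)
    simp [Jet.proj, this]
  simp [this]

theorem finite_derU (f : Loc N) : {J | derU J f ≠ 0}.Finite := by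
  obtain ⟨s, g, h⟩ := exists_rep f
  refine s.finite_toSet.subset fun J hJ => ?_
  by_contra hs
  exact hJ (h.derU_eq_zero hs)

theorem totalD_eq_sum (i : Fin N) {f : Loc N} {s : Finset (MultiIdx N)}
    (hs : ∀ J ∉ s, derU J f = 0) :
    totalD i f = derX i f + ∑ J ∈ s, coordU (J + Pi.single i 1) * derU J f := by
  unfold totalD
  rw [finsum_eq_sum_of_support_subset (s := s)]
  · rfl
  · intro J hJ
    by_contra h
    exact hJ (by simp only; rw [← derU_apply, hs J h, mul_zero])

/-- Finitely many elements of `Loc` involve only finitely many `u_J`. -/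
theorem exists_common (f g : Loc N) : ∃ s : Finset (MultiIdx N),
    (∀ J ∉ s, derU J f = 0) ∧ (∀ J ∉ s, derU J g = 0) := by
  refine ⟨(finite_derU f).toFinset ∪ (finite_derU g).toFinset, fun J hJ => ?_, fun J hJ => ?_⟩ <;>
  · by_contra h
    exact hJ (by simp [h])

/-- `d/dx^i` as a derivation. -/
def derD (i : Fin N) : Derivation ℝ (Loc N) (Loc N) :=
  Derivation.mk' { toFun := totalD i
                   map_add' := fun f g => by
                    obtain ⟨s, hf, hg⟩ := exists_common f g
                    rw [totalD_eq_sum i hf, totalD_eq_sum i hg, totalD_eq_sum i (s := s)]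
                    · simp only [map_add, mul_add, Finset.sum_add_distrib]; abel
                    · intro J hJ; rw [map_add, hf J hJ, hg J hJ, add_zero]
                   map_smul' := fun c f => by
                    obtain ⟨s, hf, -⟩ := exists_common f f
                    rw [totalD_eq_sum i hf, totalD_eq_sum i (s := s)]
                    · simp [Finset.smul_sum]
                    · intro J hJ; rw [Derivation.map_smul, hf J hJ, smul_zero] }
    fun f g => by
      obtain ⟨s, hf, hg⟩ := exists_common f g
      simp only [LinearMap.coe_mk, AddHom.coe_mk]
      rw [totalD_eq_sum i hf, totalD_eq_sum i hg, totalD_eq_sum i (s := s)]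
      · simp only [Derivation.leibniz, smul_eq_mul, mul_add, Finset.sum_add_distrib,
          Finset.mul_sum]
        have h1 : ∀ J, coordU (J + Pi.single i 1) * (f * derU J g)
            = f * (coordU (J + Pi.single i 1) * derU J g) := fun J => by ring
        have h2 : ∀ J, coordU (J + Pi.single i 1) * (g * derU J f)
            = g * (coordU (J + Pi.single i 1) * derU J f) := fun J => by ring
        simp only [h1, h2]; abel
      · intro J hJ; rw [Derivation.leibniz, hf J hJ, hg J hJ]; simp

theorem derD_apply (i : Fin N) (f : Loc N) : derD i f = totalD i f := rfl

theorem derD_eq_sum (i : Fin N) {f : Loc N} {s : Finset (MultiIdx N)}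
    (hs : ∀ J ∉ s, derU J f = 0) :
    derD i f = derX i f + ∑ J ∈ s, coordU (J + Pi.single i 1) * derU J f := totalD_eq_sum i hs

theorem derD_coordX (i k : Fin N) : derD i (coordX k) = if i = k then 1 else 0 := by
  rw [derD_eq_sum i (s := ∅) (fun J _ => derU_coordX J k), derX_coordX]; simp

theorem derD_coordU (i : Fin N) (J : MultiIdx N) :
    derD i (coordU J) = coordU (J + Pi.single i 1) := by
  rw [derD_eq_sum i (s := {J}) (fun K hK => by
    rw [derU_coordU, if_neg (by simpa using hK)]), derX_coordU]
  simp [derU_coordU]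

/-- The coefficient `u_{K+i}` of `∂/∂u_K` in `d/dx^i` is the coordinate `u_J` exactly when `K = J -
i`, and this contributes `∂/∂u_{J-i}`. The case distinction is needed because subtraction of
multi-indices is truncated. -/
theorem derU_derD (J : MultiIdx N) (i : Fin N) (f : Loc N) :
    derU J (derD i f) = derD i (derU J f)
      + if J i = 0 then 0 else derU (J - Pi.single i 1) f := by
  obtain ⟨s, hf, -⟩ := exists_common f f
  have hf' : ∀ K ∉ s, derU K (derU J f) = 0 := fun K hK => by
    rw [derU_comm, hf K hK, map_zero]
  rw [derD_eq_sum i hf, derD_eq_sum i hf', map_add, map_sum, derU_derX_comm, add_assoc]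
  congr 1
  have h1 : ∀ K, derU J (coordU (K + Pi.single i 1) * derU K f)
      = coordU (K + Pi.single i 1) * derU K (derU J f)
        + if J = K + Pi.single i 1 then derU K f else 0 := by
    intro K
    rw [Derivation.leibniz, derU_coordU, derU_comm J K]
    split_ifs <;> simp
  simp only [h1, Finset.sum_add_distrib]
  congr 1
  by_cases hJ : J i = 0
  · rw [if_pos hJ]
    refine Finset.sum_eq_zero fun K _ => if_neg ?_
    intro h
    have := congrFun h i
    simp [hJ] at this
  · rw [if_neg hJ]
    have hle : Pi.single i 1 ≤ J := by
      intro k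
      by_cases h : k = i
      · subst h; simp; omega
      · simp [h]
    have h2 : ∀ K, (J = K + Pi.single i 1) ↔ (K = J - Pi.single i 1) := fun K =>
      ⟨fun h => by rw [h]; simp, fun h => by rw [h, tsub_add_cancel_of_le hle]⟩
    simp only [h2]
    rw [Finset.sum_ite_eq']
    split_ifs with h3
    · rfl
    · rw [hf _ h3]

/-- The expansion `key` of the second total derivative is visibly symmetric in the two directions,
given that the partial derivatives commute. -/
theorem derD_comm (i k : Fin N) (f : Loc N) : derD i (derD k f) = derD k (derD i f) := by
  obtain ⟨s, hf, -⟩ := exists_common f f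
  have hX : ∀ j, ∀ K ∉ s, derU K (derX j f) = 0 := fun j K hK => by
    rw [derU_derX_comm, hf K hK, map_zero]
  have hU : ∀ J, ∀ K ∉ s, derU K (derU J f) = 0 := fun J K hK => by
    rw [derU_comm, hf K hK, map_zero]
  have key : ∀ i k, derD i (derD k f) = derX i (derX k f)
      + (∑ J ∈ s, coordU (J + Pi.single i 1) * derU J (derX k f)
        + ∑ J ∈ s, coordU (J + Pi.single k 1) * derU J (derX i f))
      + ∑ J ∈ s, coordU (J + (Pi.single i 1 + Pi.single k 1)) * derU J f
      + ∑ J ∈ s, ∑ K ∈ s, coordU (J + Pi.single k 1) * coordU (K + Pi.single i 1)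
          * derU K (derU J f) := by
    intro i k
    rw [derD_eq_sum k hf, map_add, map_sum, derD_eq_sum i (hX k)]
    have h1 : ∀ J, derD i (coordU (J + Pi.single k 1) * derU J f)
        = coordU (J + Pi.single k 1) * derU J (derX i f)
          + ∑ K ∈ s, coordU (J + Pi.single k 1) * coordU (K + Pi.single i 1) * derU K (derU J f)
          + coordU (J + (Pi.single i 1 + Pi.single k 1)) * derU J f := by
      intro J
      rw [Derivation.leibniz, derD_coordU, derD_eq_sum i (hU J), ← derU_derX_comm]
      simp only [smul_eq_mul, mul_add, Finset.mul_sum, mul_assoc]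
      rw [mul_comm (derU J f), add_assoc J, add_comm (Pi.single k 1 : MultiIdx N)]
    simp only [h1, Finset.sum_add_distrib]
    abel
  rw [key i k, key k i, derX_comm]
  congr 1
  · rw [add_comm (Pi.single i 1 : MultiIdx N)]
    congr 2
    exact add_comm _ _
  · rw [Finset.sum_comm]
    refine Finset.sum_congr rfl fun J _ => Finset.sum_congr rfl fun K _ => ?_
    rw [derU_comm]; ring

end Loc

/-! ### Multi-indices and ordered powers of commuting elements. -/

namespace MultiIdx

variable {N : ℕ}

theorem order_add (J K : MultiIdx N) : order (J + K) = order J + order K := by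
  simp [order, Finset.sum_add_distrib]

theorem order_single (i : Fin N) : order (Pi.single i 1 : MultiIdx N) = 1 := by
  simp [order]

theorem order_add_single (J : MultiIdx N) (i : Fin N) :
    order (J + Pi.single i 1) = order J + 1 := by rw [order_add, order_single]

theorem order_zero : order (0 : MultiIdx N) = 0 := by simp [order]

theorem sub_add_single {J : MultiIdx N} {i : Fin N} (h : J i ≠ 0) :
    J - Pi.single i 1 + Pi.single i 1 = J := by
  refine tsub_add_cancel_of_le fun k => ?_
  by_cases hk : k = i
  · subst hk; simp; omega
  · simp [hk]

theorem induct {P : MultiIdx N → Prop} (h0 : P 0)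
    (hs : ∀ L i, P L → P (L + Pi.single i 1)) (L : MultiIdx N) : P L := by
  induction hn : order L generalizing L with
  | zero =>
    have : L = 0 := by
      funext i
      exact (Finset.sum_eq_zero_iff.1 hn) i (Finset.mem_univ i)
    rwa [this]
  | succ n ih =>
    have : ∃ i, L i ≠ 0 := by
      by_contra h
      push Not at h
      simp [order, h] at hn
    obtain ⟨i, hi⟩ := this
    rw [← sub_add_single hi]
    refine hs _ _ (ih _ ?_)
    have h := order_add_single (L - Pi.single i 1) i
    rw [sub_add_single hi, hn] at h
    omega

theorem finite_order_le (m : ℕ) : {J : MultiIdx N | order J ≤ m}.Finite := by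
  refine (Set.finite_Iic (fun _ => m : MultiIdx N)).subset fun J hJ i => ?_
  exact (Finset.single_le_sum (f := J) (fun _ _ => Nat.zero_le _) (Finset.mem_univ i)).trans hJ

/-- The multi-indices of order at most `m`. -/
def upTo (N m : ℕ) : Finset (MultiIdx N) := (finite_order_le m).toFinset

theorem mem_upTo {m : ℕ} {J : MultiIdx N} : J ∈ upTo N m ↔ order J ≤ m := by simp [upTo]

/-- The factorial `L! = ∏ᵢ Lᵢ!`. -/
def fact (L : MultiIdx N) : ℕ := ∏ i, (L i).factorial

theorem fact_ne_zero (L : MultiIdx N) : (fact L : ℝ) ≠ 0 := by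
  simp [fact, Finset.prod_eq_zero_iff, Nat.factorial_ne_zero]

theorem fact_add_single (L : MultiIdx N) (i : Fin N) :
    fact (L + Pi.single i 1) = (L i + 1) * fact L := by
  unfold fact
  rw [← Finset.mul_prod_erase _ _ (Finset.mem_univ i),
    ← Finset.mul_prod_erase (a := i) _ (fun i => (L i).factorial) (Finset.mem_univ i)]
  rw [← mul_assoc]
  congr 1
  · simp [Nat.factorial_succ]
  · refine Finset.prod_congr rfl fun k hk => ?_
    simp [(Finset.mem_erase.1 hk).1]

/-- The ordered product `∏ᵢ xᵢ^{Lᵢ}`. -/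
def pow {M : Type*} [Monoid M] (x : Fin N → M) (L : MultiIdx N) : M :=
  ((List.finRange N).map fun i => x i ^ L i).prod

section pow

variable {M : Type*} [Monoid M] {x : Fin N → M}

theorem pow_zero' : pow x (0 : MultiIdx N) = 1 := by simp [pow]

theorem commute_pow {y : M} (h : ∀ i, Commute y (x i)) (L : MultiIdx N) : Commute y (pow x L) := by
  refine Commute.list_prod_right _ _ fun z hz => ?_
  obtain ⟨i, -, rfl⟩ := List.mem_map.1 hz
  exact (h i).pow_right _

theorem pow_add_single (h : ∀ i k, Commute (x i) (x k)) (L : MultiIdx N) (i : Fin N) :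
    pow x (L + Pi.single i 1) = x i * pow x L := by
  -- An ordered product over a duplicate-free list gains one factor `x i` when `i` occurs in the
  -- list and is unchanged otherwise; commutativity brings the new factor to the front.
  have key : ∀ l : List (Fin N), l.Nodup →
      (i ∉ l → (l.map fun k => x k ^ (L + Pi.single i 1 : MultiIdx N) k).prod
        = (l.map fun k => x k ^ L k).prod) ∧
      (i ∈ l → (l.map fun k => x k ^ (L + Pi.single i 1 : MultiIdx N) k).prod
        = x i * (l.map fun k => x k ^ L k).prod) := by
    intro l
    induction l with
    | nil => simp
    | cons a l ih =>
      intro hl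
      obtain ⟨ha, hl⟩ := List.nodup_cons.1 hl
      refine ⟨fun hi => ?_, fun hi => ?_⟩
      · have h1 : a ≠ i := fun h => hi (by simp [h])
        have h2 : i ∉ l := fun h => hi (by simp [h])
        rw [List.map_cons, List.prod_cons, List.map_cons, List.prod_cons, (ih hl).1 h2]
        simp [h1]
      · rw [List.map_cons, List.prod_cons, List.map_cons, List.prod_cons]
        by_cases h1 : a = i
        · subst h1
          rw [(ih hl).1 ha, ← mul_assoc]
          congr 1
          simp [_root_.pow_succ']
        · have h2 : i ∈ l := by simpa [Ne.symm h1] using hi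
          rw [(ih hl).2 h2, ← mul_assoc, ← mul_assoc]
          congr 1
          simpa [h1] using ((h i a).pow_right (L a)).symm.eq
  exact (key _ (List.nodup_finRange N)).2 (List.mem_finRange i)

theorem pow_add_single' (h : ∀ i k, Commute (x i) (x k)) (L : MultiIdx N) (i : Fin N) :
    pow x (L + Pi.single i 1) = pow x L * x i := by
  rw [pow_add_single h, (commute_pow (h i) L).eq]

end pow

end MultiIdx

/-- A commutative algebra with coordinates `x^i`, `u_J`, total derivatives `d/dx^i` and
vertical derivatives `∂/∂u_J`, in which each element involves finitely many of the `u_J`. -/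
class JetAlgebra (N : outParam ℕ) (A : Type) [CommRing A] [Algebra ℝ A] where
  coordX : Fin N → A
  coordU : MultiIdx N → A
  derD : Fin N → Derivation ℝ A A
  derU : MultiIdx N → Derivation ℝ A A
  finite_derU : ∀ f, {J | derU J f ≠ 0}.Finite
  derU_comm : ∀ J K f, derU J (derU K f) = derU K (derU J f)
  derD_comm : ∀ i k f, derD i (derD k f) = derD k (derD i f)
  derU_derD : ∀ J i f, derU J (derD i f) = derD i (derU J f)
    + if J i = 0 then 0 else derU (J - Pi.single i 1) f
  derD_coordX : ∀ i k, derD i (coordX k) = if i = k then 1 else 0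
  derD_coordU : ∀ i J, derD i (coordU J) = coordU (J + Pi.single i 1)
  derU_coordX : ∀ J i, derU J (coordX i) = 0
  derU_coordU : ∀ J K, derU J (coordU K) = if J = K then 1 else 0

/-! ### Differential operators in one argument, axiomatically. -/

namespace JetAlgebra

variable {N : ℕ} {A : Type} [CommRing A] [Algebra ℝ A] [JetAlgebra N A]

/-- Linear endomorphisms of the algebra. -/
abbrev Op (A : Type) [CommRing A] [Algebra ℝ A] : Type := Module.End ℝ A

/-- Multiplication by an element. -/
def opMul (g : A) : Op A := LinearMap.mulLeft ℝ g

/-- `d/dx^i` as a linear operator. -/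
def opD (i : Fin N) : Op A := (derD i).toLinearMap

/-- `∂/∂u_J` as a linear operator. -/
def opU (J : MultiIdx N) : Op A := (derU J).toLinearMap

@[simp] theorem opMul_apply (g f : A) : opMul g f = g * f := rfl
@[simp] theorem opD_apply (i : Fin N) (f : A) : opD i f = derD i f := rfl
@[simp] theorem opU_apply (J : MultiIdx N) (f : A) : opU J f = derU J f := rfl

/-- The algebra of differential operators of finite order in finitely many variables. -/
def finDiffOp (A : Type) [CommRing A] [Algebra ℝ A] [JetAlgebra N A] :
    Subalgebra ℝ (Op A) :=
  Algebra.adjoin ℝ (Set.range opMul ∪ (Set.range opD ∪ Set.range opU))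

theorem opMul_mem (g : A) : opMul g ∈ finDiffOp A :=
  Algebra.subset_adjoin (Or.inl ⟨g, rfl⟩)
theorem opD_mem (i : Fin N) : opD i ∈ finDiffOp A :=
  Algebra.subset_adjoin (Or.inr (Or.inl ⟨i, rfl⟩))
theorem opU_mem (J : MultiIdx N) : opU J ∈ finDiffOp A :=
  Algebra.subset_adjoin (Or.inr (Or.inr ⟨J, rfl⟩))

theorem finDiffOp_induction {p : Op A → Prop} (hmul : ∀ g, p (opMul g)) (hD : ∀ i, p (opD i))
    (hU : ∀ J, p (opU J)) (hadd : ∀ P Q, p P → p Q → p (P + Q))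
    (hcomp : ∀ P Q, P ∈ finDiffOp A → Q ∈ finDiffOp A → p P → p Q → p (P * Q))
    {P : Op A} (hP : P ∈ finDiffOp A) : p P := by
  induction hP using Algebra.adjoin_induction with
  | mem x hx => rcases hx with ⟨g, rfl⟩ | ⟨i, rfl⟩ | ⟨J, rfl⟩ <;> simp [*]
  | algebraMap r =>
    have : algebraMap ℝ (Op A) r = opMul (algebraMap ℝ A r) := by
      ext1 f; simp [Algebra.smul_def]
    rw [this]; exact hmul _
  | add x y hx hy ihx ihy => exact hadd _ _ ihx ihy
  | mul x y hx hy ihx ihy => exact hcomp _ _ hx hy ihx ihy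

/-- Local functions of `x` and of the `u_J` with `|J| ≤ m`. -/
def jetLE (A : Type) [CommRing A] [Algebra ℝ A] [JetAlgebra N A] (m : ℕ) : Subalgebra ℝ A where
  carrier := {f | ∀ J, m < J.order → derU J f = 0}
  mul_mem' hf hg J hJ := by rw [Derivation.leibniz, hf J hJ, hg J hJ]; simp
  add_mem' hf hg J hJ := by rw [map_add, hf J hJ, hg J hJ, add_zero]
  algebraMap_mem' r J _ := Derivation.map_algebraMap _ _

theorem jetLE_mono {m m' : ℕ} (h : m ≤ m') : jetLE A m ≤ jetLE A m' :=
  fun _ hf J hJ => hf J (h.trans_lt hJ)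

theorem exists_jetLE (f : A) : ∃ m, f ∈ jetLE A m := by
  refine ⟨(finite_derU f).toFinset.sup MultiIdx.order, fun J hJ => ?_⟩
  by_contra h
  exact absurd (Finset.le_sup (f := MultiIdx.order) ((finite_derU f).mem_toFinset.2 h)) (by omega)

theorem exists_jetLE_pi {ι : Type*} [Finite ι] (f : ι → A) : ∃ m, ∀ j, f j ∈ jetLE A m := by
  choose m hm using fun j => exists_jetLE (f j)
  obtain ⟨M, hM⟩ := (Set.finite_range m).bddAbove
  exact ⟨M, fun j => jetLE_mono (hM ⟨j, rfl⟩) (hm j)⟩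

theorem coordX_mem (i : Fin N) (m : ℕ) : coordX i ∈ jetLE A m := fun J _ => derU_coordX J i

theorem coordU_mem {J : MultiIdx N} {m : ℕ} (h : J.order ≤ m) : coordU J ∈ jetLE A m :=
  fun K hK => by rw [derU_coordU, if_neg]; rintro rfl; omega

theorem derD_mem {m : ℕ} {f : A} (hf : f ∈ jetLE A m) (i : Fin N) :
    derD i f ∈ jetLE A (m + 1) := by
  intro J hJ
  rw [derU_derD, hf J (by omega), map_zero, zero_add]
  split_ifs with h
  · rfl
  · refine hf _ ?_
    have := MultiIdx.order_add_single (J - Pi.single i 1) i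
    rw [MultiIdx.sub_add_single h] at this
    omega

theorem derU_mem {m : ℕ} {f : A} (hf : f ∈ jetLE A m) (J : MultiIdx N) :
    derU J f ∈ jetLE A m := fun K hK => by rw [derU_comm, hf K hK, map_zero]

theorem finDiffOp_jetLE {P : Op A} (hP : P ∈ finDiffOp A) :
    ∀ m, ∃ m', ∀ f ∈ jetLE A m, P f ∈ jetLE A m' := by
  refine finDiffOp_induction (p := fun P => ∀ m, ∃ m', ∀ f ∈ jetLE A m, P f ∈ jetLE A m')
    ?_ ?_ ?_ ?_ ?_ hP
  · intro g m
    obtain ⟨k, hk⟩ := exists_jetLE g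
    exact ⟨max k m, fun f hf => mul_mem (jetLE_mono (le_max_left _ _) hk)
      (jetLE_mono (le_max_right _ _) hf)⟩
  · exact fun i m => ⟨m + 1, fun f hf => derD_mem hf i⟩
  · exact fun J m => ⟨m, fun f hf => derU_mem hf J⟩
  · intro P Q hP hQ m
    obtain ⟨k, hk⟩ := hP m
    obtain ⟨l, hl⟩ := hQ m
    exact ⟨max k l, fun f hf => add_mem (jetLE_mono (le_max_left _ _) (hk f hf))
      (jetLE_mono (le_max_right _ _) (hl f hf))⟩
  · intro P Q _ _ hP hQ m
    obtain ⟨l, hl⟩ := hQ m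
    obtain ⟨k, hk⟩ := hP l
    exact ⟨k, fun f hf => hk _ (hl f hf)⟩

/-- Linear local differential operators: on functions of bounded jet order they agree with
differential operators of finite order. -/
def diffOp (A : Type) [CommRing A] [Algebra ℝ A] [JetAlgebra N A] :
    Subalgebra ℝ (Op A) where
  carrier := {T | ∀ m, ∃ P ∈ finDiffOp A, ∀ f ∈ jetLE A m, T f = P f}
  -- The outer operator must be approximated at the jet order reached by the inner one; finite order
  -- of the approximation `Q` bounds that order.
  mul_mem' {S T} hA hB m := by
    obtain ⟨Q, hQ, hBQ⟩ := hB m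
    obtain ⟨k, hk⟩ := finDiffOp_jetLE hQ m
    obtain ⟨P, hP, hAP⟩ := hA k
    exact ⟨P * Q, mul_mem hP hQ, fun f hf => by
      rw [Module.End.mul_apply, Module.End.mul_apply, hBQ f hf, hAP _ (hk f hf)]⟩
  add_mem' {S T} hA hB m := by
    obtain ⟨Q, hQ, hBQ⟩ := hB m
    obtain ⟨P, hP, hAP⟩ := hA m
    exact ⟨P + Q, add_mem hP hQ, fun f hf => by
      rw [LinearMap.add_apply, LinearMap.add_apply, hBQ f hf, hAP f hf]⟩
  algebraMap_mem' r m := ⟨_, (finDiffOp A).algebraMap_mem r, fun _ _ => rfl⟩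

theorem finDiffOp_le : finDiffOp A ≤ diffOp A := fun P hP _ => ⟨P, hP, fun _ _ => rfl⟩

theorem diffOp_jetLE {P : Op A} (hP : P ∈ diffOp A) (m : ℕ) :
    ∃ m', ∀ f ∈ jetLE A m, P f ∈ jetLE A m' := by
  obtain ⟨Q, hQ, h⟩ := hP m
  obtain ⟨k, hk⟩ := finDiffOp_jetLE hQ m
  exact ⟨k, fun f hf => by rw [h f hf]; exact hk f hf⟩

/-! ### Commutators with multiplication operators -/

/-- The commutator `P ↦ [P, g]` with multiplication by `g`. -/
def adMul (g : A) : Module.End ℝ (Op A) where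
  toFun P := P * opMul g - opMul g * P
  map_add' P Q := by rw [add_mul, mul_add]; abel
  map_smul' c P := by
    rw [smul_mul_assoc, mul_smul_comm, ← smul_sub, RingHom.id_apply]

theorem adMul_apply (g : A) (P : Op A) : adMul g P = P * opMul g - opMul g * P := rfl

theorem adMul_mul (g : A) (P Q : Op A) : adMul g (P * Q) = adMul g P * Q + P * adMul g Q := by
  simp only [adMul_apply, sub_mul, mul_sub, mul_assoc]; abel

theorem adMul_opMul (g h : A) : adMul g (opMul h) = 0 := by
  ext1 f; simp [adMul_apply]; ring

theorem adMul_derivation (g : A) (δ : Derivation ℝ A A) :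
    adMul g δ.toLinearMap = opMul (δ g) := by
  ext1 f; simp [adMul_apply, Derivation.leibniz]; ring

/-- A commutator is a derivation, so by Leibniz every term of its `(k+l)`-th power on a product has
`k` commutators on the first factor or `l` on the second. -/
theorem adMul_pow_mul (g : A) : ∀ (s k l : ℕ) (P Q : Op A), k + l = s →
    (adMul g ^ k) P = 0 → (adMul g ^ l) Q = 0 → (adMul g ^ s) (P * Q) = 0 := by
  intro s
  induction s with
  | zero =>
    intro k l P Q h hP _
    obtain rfl : k = 0 := by omega
    rw [show P = 0 from hP]; simp
  | succ s ih =>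
    intro k l P Q h hP hQ
    rcases Nat.eq_zero_or_pos k with rfl | hk
    · rw [show P = 0 from hP]; simp
    rcases Nat.eq_zero_or_pos l with rfl | hl
    · rw [show Q = 0 from hQ]; simp
    obtain ⟨k, rfl⟩ := Nat.exists_eq_add_of_lt hk
    obtain ⟨l, rfl⟩ := Nat.exists_eq_add_of_lt hl
    simp only [zero_add] at *
    rw [pow_succ, Module.End.mul_apply] at hP hQ ⊢
    rw [adMul_mul, map_add, ih k (l + 1) _ _ (by omega) hP, ih (k + 1) l _ _ (by omega) _ hQ,
      add_zero]
    · rw [pow_succ, Module.End.mul_apply]; exact hP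
    · rw [pow_succ, Module.End.mul_apply]; exact hQ

/-- Grothendieck's characterisation of differential operators, in the easy direction: the generators
need at most two commutators, and nilpotency passes to sums and products. -/
theorem adMul_nilpotent (g : A) {P : Op A} (hP : P ∈ finDiffOp A) :
    ∃ k, (adMul g ^ k) P = 0 := by
  have hder : ∀ δ : Derivation ℝ A A, (adMul g ^ 2) δ.toLinearMap = 0 := fun δ => by
    rw [pow_two, Module.End.mul_apply, adMul_derivation, adMul_opMul]
  refine finDiffOp_induction (p := fun P => ∃ k, (adMul g ^ k) P = 0) ?_ ?_ ?_ ?_ ?_ hP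
  · exact fun h => ⟨1, by rw [pow_one, adMul_opMul]⟩
  · exact fun i => ⟨2, hder _⟩
  · exact fun J => ⟨2, hder _⟩
  · rintro P Q ⟨k, hk⟩ ⟨l, hl⟩
    refine ⟨k + l, ?_⟩
    rw [map_add, pow_add, Module.End.mul_apply, Module.End.mul_apply, hl, map_zero, add_zero,
      ← Module.End.mul_apply, ← pow_add, add_comm, pow_add, Module.End.mul_apply, hk, map_zero]
  · rintro P Q - - ⟨k, hk⟩ ⟨l, hl⟩
    exact ⟨k + l, adMul_pow_mul g _ k l P Q rfl hk hl⟩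

end JetAlgebra

/-! ### Multilinear local differential operators and locally finite sums. -/

namespace JetAlgebra

variable {N : ℕ} {A : Type} [CommRing A] [Algebra ℝ A] [JetAlgebra N A] {n : ℕ}

/-- The multilinear operator `f ↦ p ∏ⱼ Pⱼ fⱼ`. -/
def prodOp (p : A) (P : Fin n → Op A) : MultilinearMap ℝ (fun _ : Fin n => A) A :=
  (opMul p).compMultilinearMap ((MultilinearMap.mkPiAlgebra ℝ (Fin n) A).compLinearMap P)

theorem prodOp_apply (p : A) (P : Fin n → Op A) (f : Fin n → A) :
    prodOp p P f = p * ∏ j, P j (f j) := rfl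

/-- The span of the operators `f ↦ p ∏ⱼ Pⱼ fⱼ` with differential operators `Pⱼ` of finite
order. -/
def finMulti (A : Type) [CommRing A] [Algebra ℝ A] [JetAlgebra N A] (n : ℕ) :
    Submodule ℝ (MultilinearMap ℝ (fun _ : Fin n => A) A) :=
  Submodule.span ℝ {T | ∃ p P, (∀ j, P j ∈ finDiffOp A) ∧ T = prodOp p P}

theorem prodOp_mem (p : A) {P : Fin n → Op A} (hP : ∀ j, P j ∈ finDiffOp A) :
    prodOp p P ∈ finMulti A n := Submodule.subset_span ⟨p, P, hP, rfl⟩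

/-- Scalars are absorbed into the coefficient `p`, so only products and sums have to be checked; the
claim is proved for all multiples in order to pass through the span. -/
theorem finMulti_induction {q : MultilinearMap ℝ (fun _ : Fin n => A) A → Prop}
    (hprod : ∀ p P, (∀ j, P j ∈ finDiffOp A) → q (prodOp p P))
    (hadd : ∀ S T, S ∈ finMulti A n → T ∈ finMulti A n → q S → q T → q (S + T))
    {T : MultilinearMap ℝ (fun _ : Fin n => A) A} (hT : T ∈ finMulti A n) : q T := by
  have key : T ∈ finMulti A n ∧ ∀ c : ℝ, q (c • T) := by
    induction hT using Submodule.span_induction with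
    | mem x hx =>
      obtain ⟨p, P, hP, rfl⟩ := hx
      refine ⟨prodOp_mem p hP, fun c => ?_⟩
      have : c • prodOp p P = prodOp (c • p) P := by
        ext f; simp [prodOp_apply]
      rw [this]; exact hprod _ _ hP
    | zero =>
      refine ⟨zero_mem _, fun c => ?_⟩
      have : c • (0 : MultilinearMap ℝ (fun _ : Fin n => A) A)
          = prodOp 0 (fun _ => 1) := by
        ext f; simp [prodOp_apply]
      rw [this]; exact hprod _ _ fun _ => one_mem _
    | add x y _ _ hx hy =>
      exact ⟨add_mem hx.1 hy.1, fun c => by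
        rw [smul_add]
        exact hadd _ _ (Submodule.smul_mem _ _ hx.1) (Submodule.smul_mem _ _ hy.1) (hx.2 c)
          (hy.2 c)⟩
    | smul a x _ hx => exact ⟨Submodule.smul_mem _ _ hx.1, fun c => by rw [smul_smul]; exact hx.2 _⟩
  simpa using key.2 1

theorem derivation_prod (δ : Derivation ℝ A A) {ι : Type*} [DecidableEq ι] (s : Finset ι)
    (g : ι → A) : δ (∏ j ∈ s, g j) = ∑ k ∈ s, δ (g k) * ∏ j ∈ s.erase k, g j := by
  induction s using Finset.induction_on with
  | empty => simp
  | insert a s ha ih =>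
    rw [Finset.prod_insert ha, Derivation.leibniz, ih, Finset.sum_insert ha,
      Finset.erase_insert ha]
    simp only [smul_eq_mul, Finset.mul_sum]
    rw [add_comm, mul_comm]
    congr 1
    refine Finset.sum_congr rfl fun k hk => ?_
    have hka : k ≠ a := fun h => ha (h ▸ hk)
    rw [Finset.erase_insert_of_ne hka.symm, Finset.prod_insert]
    · ring
    · simp [ha]

theorem derivation_prodOp (δ : Derivation ℝ A A) (p : A) (P : Fin n → Op A) :
    δ.toLinearMap.compMultilinearMap (prodOp p P)
      = prodOp (δ p) P + ∑ k, prodOp p (Function.update P k (δ.toLinearMap * P k)) := by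
  ext f
  simp only [LinearMap.compMultilinearMap_apply, add_apply,
    sum_apply, prodOp_apply]
  rw [show ∀ g, (δ : A →ₗ[ℝ] A) g = δ g from fun _ => rfl, Derivation.leibniz, derivation_prod, smul_eq_mul, smul_eq_mul, Finset.mul_sum,
    mul_comm _ (δ p), add_comm]
  congr 1
  refine Finset.sum_congr rfl fun k _ => ?_
  rw [← Finset.mul_prod_erase Finset.univ _ (Finset.mem_univ k)]
  congr 2
  · simp
  · refine Finset.prod_congr rfl fun j hj => ?_
    rw [Function.update_of_ne (Finset.mem_erase.1 hj).1]

theorem update_mem_finDiffOp {P : Fin n → Op A} (hP : ∀ j, P j ∈ finDiffOp A) {k : Fin n}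
    {Q : Op A} (hQ : Q ∈ finDiffOp A) (j : Fin n) : Function.update P k Q j ∈ finDiffOp A := by
  by_cases h : j = k
  · subst h; simpa
  · simpa [h] using hP j

/-- A derivation of the output is distributed over the coefficient and the factors by Leibniz, which
keeps the shape `p ∏ Pⱼ fⱼ`. -/
theorem finMulti_left {Q : Op A} (hQ : Q ∈ finDiffOp A) :
    ∀ T : MultilinearMap ℝ (fun _ : Fin n => A) A, T ∈ finMulti A n →
      Q.compMultilinearMap T ∈ finMulti A n := by
  have hder : ∀ δ : Derivation ℝ A A, δ.toLinearMap ∈ finDiffOp A →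
      ∀ {T : MultilinearMap ℝ (fun _ : Fin n => A) A}, T ∈ finMulti A n →
      δ.toLinearMap.compMultilinearMap T ∈ finMulti A n := by
    intro δ hδ T hT
    refine finMulti_induction (q := fun T => δ.toLinearMap.compMultilinearMap T ∈ finMulti A n)
      ?_ ?_ hT
    · intro p P hP
      rw [derivation_prodOp]
      exact add_mem (prodOp_mem _ hP) (sum_mem fun k _ =>
        prodOp_mem _ (update_mem_finDiffOp hP (mul_mem hδ (hP k))))
    · intro S T _ _ hS hT
      rw [LinearMap.compMultilinearMap_add]
      exact add_mem hS hT
  refine finDiffOp_induction (p := fun Q => ∀ T : MultilinearMap ℝ (fun _ : Fin n => A) A,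
    T ∈ finMulti A n → Q.compMultilinearMap T ∈ finMulti A n) ?_ ?_ ?_ ?_ ?_ hQ
  · intro g T hT
    refine finMulti_induction (q := fun T => (opMul g).compMultilinearMap T ∈ finMulti A n)
      ?_ ?_ hT
    · intro p P hP
      have : (opMul g).compMultilinearMap (prodOp p P) = prodOp (g * p) P := by
        ext f; simp [prodOp_apply, mul_assoc]
      rw [this]; exact prodOp_mem _ hP
    · intro S T _ _ hS hT
      rw [LinearMap.compMultilinearMap_add]
      exact add_mem hS hT
  · exact fun i T hT => hder _ (opD_mem i) hT
  · exact fun J T hT => hder _ (opU_mem J) hT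
  · intro P Q hP hQ T hT
    rw [LinearMap.add_compMultilinearMap]
    exact add_mem (hP T hT) (hQ T hT)
  · intro P Q _ _ hP hQ T hT
    exact hP _ (hQ T hT)

/-- Precomposition with `Q` in the slot `j`. -/
def compSlot (T : MultilinearMap ℝ (fun _ : Fin n => A) A) (j : Fin n) (Q : Op A) :
    MultilinearMap ℝ (fun _ : Fin n => A) A :=
  T.compLinearMap (Function.update (fun _ => LinearMap.id) j Q)

theorem compSlot_apply (T : MultilinearMap ℝ (fun _ : Fin n => A) A) (j : Fin n) (Q : Op A)
    (f : Fin n → A) : compSlot T j Q f = T (Function.update f j (Q (f j))) := by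
  rw [compSlot, MultilinearMap.compLinearMap_apply]
  congr 1
  funext i
  by_cases h : i = j
  · subst h; simp
  · simp [h]

theorem compSlot_prodOp (p : A) (P : Fin n → Op A) (j : Fin n) (Q : Op A) :
    compSlot (prodOp p P) j Q = prodOp p (Function.update P j (P j * Q)) := by
  ext f
  rw [compSlot_apply, prodOp_apply, prodOp_apply]
  congr 1
  refine Finset.prod_congr rfl fun i _ => ?_
  by_cases h : i = j
  · subst h; simp
  · simp [h]

theorem compSlot_add (S T : MultilinearMap ℝ (fun _ : Fin n => A) A) (j : Fin n) (Q : Op A) :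
    compSlot (S + T) j Q = compSlot S j Q + compSlot T j Q := by
  ext f; simp [compSlot_apply]

theorem finMulti_right {T : MultilinearMap ℝ (fun _ : Fin n => A) A} (hT : T ∈ finMulti A n)
    (j : Fin n) {Q : Op A} (hQ : Q ∈ finDiffOp A) : compSlot T j Q ∈ finMulti A n := by
  refine finMulti_induction (q := fun T => compSlot T j Q ∈ finMulti A n) ?_ ?_ hT
  · intro p P hP
    rw [compSlot_prodOp]
    exact prodOp_mem _ (update_mem_finDiffOp hP (mul_mem (hP j) hQ))
  · intro S T _ _ hS hT
    rw [compSlot_add]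
    exact add_mem hS hT

/-- Families of elements of jet order at most `m`. -/
def box (A : Type) [CommRing A] [Algebra ℝ A] [JetAlgebra N A] (n m : ℕ) : Set (Fin n → A) :=
  {f | ∀ j, f j ∈ jetLE A m}

theorem box_mono {m m' : ℕ} (h : m ≤ m') : box A n m ⊆ box A n m' :=
  fun _ hf j => jetLE_mono h (hf j)

theorem exists_box (f : Fin n → A) : ∃ m, f ∈ box A n m := exists_jetLE_pi f

theorem update_mem_box {m : ℕ} {f : Fin n → A} (hf : f ∈ box A n m) {j : Fin n} {g : A}
    (hg : g ∈ jetLE A m) : Function.update f j g ∈ box A n m := by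
  intro i
  by_cases h : i = j
  · subst h; simpa
  · simpa [h] using hf i

theorem finMulti_jetLE {T : MultilinearMap ℝ (fun _ : Fin n => A) A} (hT : T ∈ finMulti A n)
    (m : ℕ) : ∃ m', ∀ f ∈ box A n m, T f ∈ jetLE A m' := by
  refine finMulti_induction (q := fun T => ∃ m', ∀ f ∈ box A n m, T f ∈ jetLE A m') ?_ ?_ hT
  · intro p P hP
    obtain ⟨k, hk⟩ := exists_jetLE p
    choose l hl using fun j => finDiffOp_jetLE (hP j) m
    refine ⟨max k (Finset.univ.sup l), fun f hf => ?_⟩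
    rw [prodOp_apply]
    refine mul_mem (jetLE_mono (le_max_left _ _) hk) (prod_mem fun j _ => ?_)
    exact jetLE_mono ((Finset.le_sup (Finset.mem_univ j)).trans (le_max_right _ _)) (hl j _ (hf j))
  · rintro S T _ _ ⟨k, hk⟩ ⟨l, hl⟩
    exact ⟨max k l, fun f hf => add_mem (jetLE_mono (le_max_left _ _) (hk f hf))
      (jetLE_mono (le_max_right _ _) (hl f hf))⟩

/-- Multilinear local differential operators: on arguments of bounded jet order they agree with
differential operators of finite order. -/
def ldo (A : Type) [CommRing A] [Algebra ℝ A] [JetAlgebra N A] (n : ℕ) :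
    Submodule ℝ (MultilinearMap ℝ (fun _ : Fin n => A) A) where
  carrier := {T | ∀ m, ∃ F ∈ finMulti A n, ∀ f ∈ box A n m, T f = F f}
  add_mem' {S T} hS hT m := by
    obtain ⟨F, hF, hF'⟩ := hS m
    obtain ⟨G, hG, hG'⟩ := hT m
    exact ⟨F + G, add_mem hF hG, fun f hf => by
      rw [add_apply, add_apply, hF' f hf, hG' f hf]⟩
  zero_mem' m := ⟨0, zero_mem _, fun _ _ => rfl⟩
  smul_mem' c T hT m := by
    obtain ⟨F, hF, hF'⟩ := hT m
    exact ⟨c • F, Submodule.smul_mem _ _ hF, fun f hf => by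
      rw [smul_apply, smul_apply, hF' f hf]⟩

/-- The type of multilinear local differential operators. -/
structure LDO (A : Type) [CommRing A] [Algebra ℝ A] [JetAlgebra N A] (n : ℕ) where
  val : MultilinearMap ℝ (fun _ : Fin n => A) A
  property : val ∈ ldo A n

namespace LDO

/-- Bundled and unbundled operators. -/
def equiv : LDO A n ≃ ldo A n where
  toFun X := ⟨X.1, X.2⟩
  invFun X := ⟨X.1, X.2⟩

instance : AddCommGroup (LDO A n) := equiv.addCommGroup
instance : Module ℝ (LDO A n) := equiv.module ℝ

@[simp] theorem add_apply (X Y : LDO A n) (f : Fin n → A) : (X + Y).1 f = X.1 f + Y.1 f := rfl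
@[simp] theorem sub_apply (X Y : LDO A n) (f : Fin n → A) : (X - Y).1 f = X.1 f - Y.1 f := rfl
@[simp] theorem neg_apply (X : LDO A n) (f : Fin n → A) : (-X).1 f = -X.1 f := rfl
@[simp] theorem zero_apply (f : Fin n → A) : (0 : LDO A n).1 f = 0 := rfl
@[simp] theorem smul_apply (c : ℝ) (X : LDO A n) (f : Fin n → A) : (c • X).1 f = c • X.1 f := rfl

/-- Evaluation at a family of arguments. -/
def eval (f : Fin n → A) : LDO A n →ₗ[ℝ] A where
  toFun X := X.1 f
  map_add' _ _ := rfl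
  map_smul' _ _ := rfl

@[simp] theorem sum_apply {ι : Type*} (s : Finset ι) (X : ι → LDO A n) (f : Fin n → A) :
    (∑ k ∈ s, X k).1 f = ∑ k ∈ s, (X k).1 f := map_sum (eval f) X s

end LDO

theorem finMulti_le : finMulti A n ≤ ldo A n := fun F hF _ => ⟨F, hF, fun _ _ => rfl⟩

theorem ldo_jetLE (X : LDO A n) (m : ℕ) : ∃ m', ∀ f ∈ box A n m, X.1 f ∈ jetLE A m' := by
  obtain ⟨F, hF, h⟩ := X.2 m
  obtain ⟨k, hk⟩ := finMulti_jetLE hF m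
  exact ⟨k, fun f hf => by rw [h f hf]; exact hk f hf⟩

@[ext] theorem ldo_ext {X Y : LDO A n} (h : ∀ f, X.1 f = Y.1 f) : X = Y :=
  by
    obtain ⟨X, hX⟩ := X
    obtain ⟨Y, hY⟩ := Y
    obtain rfl : X = Y := MultilinearMap.ext h
    rfl

/-- Postcomposition with a local differential operator. -/
def lft (P : diffOp A) : LDO A n →ₗ[ℝ] LDO A n where
  toFun X := ⟨P.1.compMultilinearMap X.1, fun m => by
    obtain ⟨F, hF, h⟩ := X.2 m
    obtain ⟨k, hk⟩ := finMulti_jetLE hF m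
    obtain ⟨Q, hQ, h'⟩ := P.2 k
    exact ⟨Q.compMultilinearMap F, finMulti_left hQ F hF, fun f hf => by
      rw [LinearMap.compMultilinearMap_apply, LinearMap.compMultilinearMap_apply, h f hf,
        h' _ (hk f hf)]⟩⟩
  map_add' X Y := by ext f; simp
  map_smul' c X := by ext f; simp

@[simp] theorem lft_apply (P : diffOp A) (X : LDO A n) (f : Fin n → A) :
    (lft P X).1 f = P.1 (X.1 f) := rfl

/-- Precomposition with a local differential operator in the slot `j`. -/
def rgt (j : Fin n) (Q : diffOp A) : LDO A n →ₗ[ℝ] LDO A n where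
  toFun X := ⟨compSlot X.1 j Q.1, fun m => by
    obtain ⟨k, hk⟩ := diffOp_jetLE Q.2 m
    obtain ⟨P, hP, h'⟩ := Q.2 m
    -- The slot `j` now carries an argument of jet order `k`, while the other slots still have order
    -- `m`.
    obtain ⟨F, hF, h⟩ := X.2 (max m k)
    refine ⟨compSlot F j P, finMulti_right hF j hP, fun f hf => ?_⟩
    rw [compSlot_apply, compSlot_apply, ← h' _ (hf j), h]
    exact update_mem_box (box_mono (le_max_left _ _) hf)
      (jetLE_mono (le_max_right _ _) (hk _ (hf j)))⟩
  map_add' X Y := by ext f; simp [compSlot_apply]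
  map_smul' c X := by ext f; simp [compSlot_apply]

@[simp] theorem rgt_apply (j : Fin n) (Q : diffOp A) (X : LDO A n) (f : Fin n → A) :
    (rgt j Q X).1 f = X.1 (Function.update f j (Q.1 (f j))) := compSlot_apply _ _ _ _

/-- Multiplication by `g`. -/
def mulBy (g : A) : diffOp A := ⟨opMul g, finDiffOp_le (opMul_mem g)⟩
/-- `d/dx^i`. -/
def totD (i : Fin N) : diffOp A := ⟨opD i, finDiffOp_le (opD_mem i)⟩
/-- `∂/∂u_J`. -/
def verD (J : MultiIdx N) : diffOp A := ⟨opU J, finDiffOp_le (opU_mem J)⟩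

@[simp] theorem mulBy_apply (g f : A) : (mulBy g).1 f = g * f := rfl
@[simp] theorem totD_apply (i : Fin N) (f : A) : (totD i).1 f = derD i f := rfl
@[simp] theorem verD_apply (J : MultiIdx N) (f : A) : (verD J).1 f = derU J f := rfl

/-- The operators that vanish on all arguments of jet order at most `m`. -/
def vanish (A : Type) [CommRing A] [Algebra ℝ A] [JetAlgebra N A] (n m : ℕ) :
    Submodule ℝ (LDO A n) where
  carrier := {X | ∀ f ∈ box A n m, X.1 f = 0}
  add_mem' {X Y} hX hY f hf := by
    rw [LDO.add_apply, hX f hf, hY f hf, add_zero]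
  zero_mem' f _ := rfl
  smul_mem' c X hX f hf := by
    rw [LDO.smul_apply, hX f hf, smul_zero]

theorem vanish_anti {m m' : ℕ} (h : m ≤ m') : vanish A n m' ≤ vanish A n m :=
  fun _ hX f hf => hX f (box_mono h hf)

theorem eq_zero_of_vanish {X : LDO A n} (h : ∀ m, X ∈ vanish A n m) : X = 0 := by
  ext f
  obtain ⟨m, hm⟩ := exists_box f
  exact h m f hm

theorem lft_vanish (P : diffOp A) {m : ℕ} {X : LDO A n} (hX : X ∈ vanish A n m) :
    lft P X ∈ vanish A n m := fun f hf => by rw [lft_apply, hX f hf, map_zero]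

theorem rgt_vanish (j : Fin n) {Q : diffOp A} {m : ℕ} (hQ : ∀ f ∈ jetLE A m, Q.1 f ∈ jetLE A m)
    {X : LDO A n} (hX : X ∈ vanish A n m) : rgt j Q X ∈ vanish A n m := fun f hf => by
  rw [rgt_apply, hX _ (update_mem_box hf (hQ _ (hf j)))]

theorem exists_finMulti (X : LDO A n) (m : ℕ) :
    ∃ F : LDO A n, F.1 ∈ finMulti A n ∧ X - F ∈ vanish A n m := by
  obtain ⟨F, hF, h⟩ := X.2 m
  exact ⟨⟨F, finMulti_le hF⟩, hF, fun f hf => sub_eq_zero.2 (h f hf)⟩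

/-! ### Locally finite sums -/

section lsum

variable {ι : Type*}

/-- On arguments of bounded jet order all but finitely many of the operators vanish. -/
def LocallyZero (X : ι → LDO A n) : Prop := ∀ m, {k | X k ∉ vanish A n m}.Finite

theorem LocallyZero.finset {X : ι → LDO A n} (h : LocallyZero X) (m : ℕ) :
    ∃ s : Finset ι, ∀ k ∉ s, X k ∈ vanish A n m :=
  ⟨(h m).toFinset, fun k hk => by simpa using hk⟩

theorem locallyZero_of_finset {X : ι → LDO A n}
    (h : ∀ m, ∃ s : Finset ι, ∀ k ∉ s, X k ∈ vanish A n m) : LocallyZero X := fun m => by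
  obtain ⟨s, hs⟩ := h m
  exact s.finite_toSet.subset fun k hk => by
    by_contra h'
    exact hk (hs k h')

/-- On a box of bounded jet order a locally finite sum is a finite sum of operators. All statements
about `lsum` are reduced to this. -/
theorem finsum_eq_of_vanish {X : ι → LDO A n} {m : ℕ} {s : Finset ι}
    (hs : ∀ k ∉ s, X k ∈ vanish A n m) {f : Fin n → A} (hf : f ∈ box A n m) :
    ∑ᶠ k, (X k).1 f = (∑ k ∈ s, X k : LDO A n).1 f := by
  rw [finsum_eq_sum_of_support_subset (s := s)]
  · simp
  · intro k hk
    by_contra h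
    exact hk (hs k h f hf)

open Classical in
/-- The sum of a locally finite family of operators (zero if the family is not locally finite). -/
def lsum (X : ι → LDO A n) : LDO A n :=
  if h : LocallyZero X then
    ⟨{ toFun := fun f => ∑ᶠ k, (X k).1 f
       map_update_add' := by
        intro dec f j x y
        obtain ⟨m, hm⟩ := exists_box (Function.update f j x)
        obtain ⟨m', hm'⟩ := exists_box (Function.update f j y)
        have hx : x ∈ jetLE A (max m m') :=
          jetLE_mono (le_max_left _ _) (by simpa using hm j)
        have hy : y ∈ jetLE A (max m m') :=
          jetLE_mono (le_max_right _ _) (by simpa using hm' j)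
        have hu : ∀ z ∈ jetLE A (max m m'), Function.update f j z ∈ box A n (max m m') := by
          intro z hz i
          by_cases hi : i = j
          · subst hi; simpa
          · simpa [hi] using jetLE_mono (le_max_left m m') (by simpa [hi] using hm i)
        obtain ⟨s, hs⟩ := h.finset (max m m')
        have e : dec = instDecidableEqFin n := Subsingleton.elim _ _
        subst e
        rw [finsum_eq_of_vanish hs (hu _ (add_mem hx hy)), finsum_eq_of_vanish hs (hu _ hx),
          finsum_eq_of_vanish hs (hu _ hy), MultilinearMap.map_update_add]
       map_update_smul' := by
        intro dec f j c x
        obtain ⟨m, hm⟩ := exists_box (Function.update f j x)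
        have hx : x ∈ jetLE A m := by simpa using hm j
        have hu : ∀ z ∈ jetLE A m, Function.update f j z ∈ box A n m := by
          intro z hz i
          by_cases hi : i = j
          · subst hi; simpa
          · simpa [hi] using hm i
        obtain ⟨s, hs⟩ := h.finset m
        have e : dec = instDecidableEqFin n := Subsingleton.elim _ _
        subst e
        rw [finsum_eq_of_vanish hs (hu _ (Subalgebra.smul_mem _ hx c)),
          finsum_eq_of_vanish hs (hu _ hx), MultilinearMap.map_update_smul] }, fun m => by
      obtain ⟨s, hs⟩ := h.finset m
      obtain ⟨F, hF, hF'⟩ := (∑ k ∈ s, X k : LDO A n).2 m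
      exact ⟨F, hF, fun f hf => (finsum_eq_of_vanish hs hf).trans (hF' f hf)⟩⟩
  else 0

theorem lsum_apply {X : ι → LDO A n} (h : LocallyZero X) (f : Fin n → A) :
    (lsum X).1 f = ∑ᶠ k, (X k).1 f := by rw [lsum, dif_pos h]; rfl

theorem lsum_sub_sum {X : ι → LDO A n} (h : LocallyZero X) {m : ℕ} {s : Finset ι}
    (hs : ∀ k ∉ s, X k ∈ vanish A n m) : lsum X - ∑ k ∈ s, X k ∈ vanish A n m := fun f hf => by
  have := (lsum_apply h f).trans (finsum_eq_of_vanish hs hf)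
  exact sub_eq_zero.2 this

theorem lsum_apply_sum {X : ι → LDO A n} (h : LocallyZero X) {m : ℕ} {s : Finset ι}
    (hs : ∀ k ∉ s, X k ∈ vanish A n m) {f : Fin n → A} (hf : f ∈ box A n m) :
    (lsum X).1 f = ∑ k ∈ s, (X k).1 f := by
  rw [lsum_apply h, finsum_eq_of_vanish hs hf]; simp

/-- A locally finite family evaluates to a family of finite support. -/
theorem LocallyZero.finite_support {X : ι → LDO A n} (h : LocallyZero X) (f : Fin n → A) :
    (Function.support fun k => (X k).1 f).Finite := by
  obtain ⟨m, hm⟩ := exists_box f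
  exact (h m).subset fun k hk hk' => hk (hk' f hm)

theorem lsum_vanish {X : ι → LDO A n} (h : LocallyZero X) {m : ℕ}
    (hX : ∀ k, X k ∈ vanish A n m) : lsum X ∈ vanish A n m := fun f hf => by
  rw [lsum_apply h]
  exact (finsum_congr fun k => hX k f hf).trans finsum_zero

theorem LocallyZero.lft {X : ι → LDO A n} (h : LocallyZero X) (P : ι → diffOp A) :
    LocallyZero fun k => lft (P k) (X k) := fun m =>
  (h m).subset fun _ hk hk' => hk (lft_vanish _ hk')

theorem LocallyZero.rgt {X : ι → LDO A n} (h : LocallyZero X) (j : Fin n) (Q : diffOp A) :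
    LocallyZero fun k => rgt j Q (X k) := fun m => by
  obtain ⟨l, hl⟩ := diffOp_jetLE Q.2 m
  refine (h (max m l)).subset fun k hk hk' => hk fun f hf => ?_
  rw [rgt_apply]
  exact hk' _ (update_mem_box (box_mono (le_max_left _ _) hf)
    (jetLE_mono (le_max_right _ _) (hl _ (hf j))))

theorem LocallyZero.add {X Y : ι → LDO A n} (hX : LocallyZero X) (hY : LocallyZero Y) :
    LocallyZero fun k => X k + Y k := fun m =>
  ((hX m).union (hY m)).subset fun k hk => by
    by_contra h
    simp only [Set.mem_union, Set.mem_ofPred_eq, not_or, not_not] at h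
    exact hk (add_mem h.1 h.2)

theorem LocallyZero.smul {X : ι → LDO A n} (hX : LocallyZero X) (c : ι → ℝ) :
    LocallyZero fun k => c k • X k := fun m =>
  (hX m).subset fun _ hk h => hk (Submodule.smul_mem _ _ h)

theorem LocallyZero.neg {X : ι → LDO A n} (hX : LocallyZero X) : LocallyZero fun k => -X k :=
  fun m => (hX m).subset fun _ hk h => hk (neg_mem h)

theorem LocallyZero.sub {X Y : ι → LDO A n} (hX : LocallyZero X) (hY : LocallyZero Y) :
    LocallyZero fun k => X k - Y k := by
  simpa [sub_eq_add_neg] using hX.add hY.neg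

theorem LocallyZero.comp_injective {κ : Type*} {X : ι → LDO A n} (hX : LocallyZero X) {e : κ → ι}
    (he : Function.Injective e) : LocallyZero fun k => X (e k) :=
  fun m => (hX m).preimage he.injOn

theorem lft_lsum {X : ι → LDO A n} (h : LocallyZero X) (P : diffOp A) :
    lft P (lsum X) = lsum fun k => lft P (X k) := by
  ext f
  rw [lft_apply, lsum_apply h, lsum_apply (h.lft fun _ => P),
    show P.1 (∑ᶠ k, (X k).1 f) = P.1.toAddMonoidHom (∑ᶠ k, (X k).1 f) from rfl,
    AddMonoidHom.map_finsum _ (h.finite_support f)]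
  rfl

theorem rgt_lsum {X : ι → LDO A n} (h : LocallyZero X) (j : Fin n) (Q : diffOp A) :
    rgt j Q (lsum X) = lsum fun k => rgt j Q (X k) := by
  ext f
  rw [rgt_apply, lsum_apply h, lsum_apply (h.rgt j Q)]
  simp

theorem lsum_add {X Y : ι → LDO A n} (hX : LocallyZero X) (hY : LocallyZero Y) :
    lsum (fun k => X k + Y k) = lsum X + lsum Y := by
  ext f
  rw [lsum_apply (hX.add hY), LDO.add_apply, lsum_apply hX,
    lsum_apply hY, ← finsum_add_distrib (hX.finite_support f) (hY.finite_support f)]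
  rfl

theorem lsum_smul {X : ι → LDO A n} (hX : LocallyZero X) (c : ℝ) :
    lsum (fun k => c • X k) = c • lsum X := by
  ext f
  rw [lsum_apply (hX.smul fun _ => c), LDO.smul_apply,
    lsum_apply hX, smul_finsum' c (hX.finite_support f)]
  rfl

theorem lsum_sub {X Y : ι → LDO A n} (hX : LocallyZero X) (hY : LocallyZero Y) :
    lsum (fun k => X k - Y k) = lsum X - lsum Y := by
  have h : LocallyZero fun k => (-1 : ℝ) • Y k := hY.smul fun _ => -1
  have : (fun k => X k - Y k) = fun k => X k + (-1 : ℝ) • Y k := by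
    funext k; rw [neg_one_smul, sub_eq_add_neg]
  rw [this, lsum_add hX h, lsum_smul hY, neg_one_smul, sub_eq_add_neg]

/-- Terms off the range of an injection may be dropped if they vanish. -/
theorem lsum_comp_injective {κ : Type*} {X : ι → LDO A n} (hX : LocallyZero X) {e : κ → ι}
    (he : Function.Injective e) (h0 : ∀ k, k ∉ Set.range e → X k = 0) :
    lsum (fun k => X (e k)) = lsum X := by
  ext f
  rw [lsum_apply hX, lsum_apply (hX.comp_injective he)]
  rw [← finsum_mem_range (f := fun k => (X k).1 f) he,
    ← finsum_mem_univ (f := fun k => (X k).1 f)]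
  refine finsum_mem_inter_support_eq' _ _ _ fun k hk => ?_
  refine iff_of_true ?_ trivial
  by_contra h
  exact hk (by simp [h0 k h])

/-- A telescoping locally finite sum. -/
theorem lsum_telescope {X : ℕ → LDO A n} (hX : LocallyZero X) :
    lsum (fun k => X k - X (k + 1)) = X 0 := by
  have h1 : LocallyZero fun k => X (k + 1) := hX.comp_injective (add_left_injective 1)
  ext f
  rw [lsum_sub hX h1]
  obtain ⟨m, hm⟩ := exists_box f
  obtain ⟨s, hs⟩ := hX.finset m
  obtain ⟨K, hK⟩ := s.bddAbove
  have hr : ∀ k ∉ Finset.range (K + 1), X k ∈ vanish A n m := fun k hk =>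
    hs k fun h => hk (Finset.mem_range.2 (Nat.lt_succ_of_le (hK h)))
  have hr1 : ∀ k ∉ Finset.range (K + 1), X (k + 1) ∈ vanish A n m := fun k hk =>
    hr _ (by simp at hk ⊢; omega)
  rw [LDO.sub_apply, lsum_apply_sum hX hr hm,
    lsum_apply_sum h1 hr1 hm, ← Finset.sum_sub_distrib, Finset.sum_range_sub']
  rw [hr (K + 1) (by simp) f hm, sub_zero]

end lsum

/-! ### Commutators with a multiplication operator in one slot -/

/-- The commutator with multiplication by `g` in the slot `j`. -/
def adSlot (j : Fin n) (g : A) : Module.End ℝ (LDO A n) := (rgt j (mulBy g) : LDO A n →ₗ[ℝ] LDO A n) - lft (mulBy g)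

theorem adSlot_apply (j : Fin n) (g : A) (X : LDO A n) (f : Fin n → A) :
    (adSlot j g X).1 f = X.1 (Function.update f j (g * f j)) - g * X.1 f := by
  simp [adSlot]

theorem adSlot_vanish {j : Fin n} {g : A} {m : ℕ} (hg : g ∈ jetLE A m) {X : LDO A n}
    (hX : X ∈ vanish A n m) : adSlot j g X ∈ vanish A n m :=
  sub_mem (rgt_vanish j (fun _ hf => mul_mem hg hf) hX) (lft_vanish _ hX)

theorem adSlot_pow_vanish {j : Fin n} {g : A} {m : ℕ} (hg : g ∈ jetLE A m) {X : LDO A n}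
    (hX : X ∈ vanish A n m) (k : ℕ) : (adSlot j g ^ k) X ∈ vanish A n m := by
  induction k with
  | zero => exact hX
  | succ k ih => rw [pow_succ', Module.End.mul_apply]; exact adSlot_vanish hg ih

theorem adSlot_finMulti_nilpotent (j : Fin n) (g : A) {F : LDO A n} (hF : F.1 ∈ finMulti A n) :
    ∃ k, (adSlot j g ^ k) F = 0 := by
  obtain ⟨F, hF'⟩ := F
  replace hF : F ∈ finMulti A n := hF
  revert hF'
  refine finMulti_induction (q := fun F => ∀ hF', ∃ k, (adSlot j g ^ k) ⟨F, hF'⟩ = 0) ?_ ?_ hF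
  · intro p P hP hF'
    obtain ⟨k, hk⟩ := adMul_nilpotent g (hP j)
    -- The commutator in the slot `j` acts on the factor `P j` only, as multiplication by `g`
    -- commutes with the other factors and with `p`.
    have key : ∀ l, ∀ f, ((adSlot j g ^ l) ⟨prodOp p P, hF'⟩).1 f
        = prodOp p (Function.update P j ((adMul g ^ l) (P j))) f := by
      intro l
      induction l with
      | zero => intro f; simp
      | succ l ih =>
        intro f
        rw [pow_succ', Module.End.mul_apply, adSlot_apply, ih, ih, pow_succ',
          Module.End.mul_apply]
        simp only [prodOp_apply, ← Finset.mul_prod_erase Finset.univ _ (Finset.mem_univ j)]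
        have e : ∀ (Q : Op A) (h : A), ∏ x ∈ Finset.univ.erase j,
            (Function.update P j Q x) (Function.update f j h x)
              = ∏ x ∈ Finset.univ.erase j, P x (f x) := fun Q h =>
          Finset.prod_congr rfl fun i hi => by
            rw [Function.update_of_ne (Finset.mem_erase.1 hi).1,
              Function.update_of_ne (Finset.mem_erase.1 hi).1]
        have e' : ∀ (Q : Op A), ∏ x ∈ Finset.univ.erase j,
            (Function.update P j Q x) (f x)
              = ∏ x ∈ Finset.univ.erase j, P x (f x) := fun Q =>
          Finset.prod_congr rfl fun i hi => by
            rw [Function.update_of_ne (Finset.mem_erase.1 hi).1]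
        rw [e, e', e']
        simp only [Function.update_self, adMul_apply, LinearMap.sub_apply, Module.End.mul_apply,
          opMul_apply]
        ring
    refine ⟨k, ?_⟩
    ext f
    rw [key, hk, prodOp_apply, ← Finset.mul_prod_erase Finset.univ _ (Finset.mem_univ j)]
    simp
  · intro S T hS hT ihS ihT hF'
    obtain ⟨k, hk⟩ := ihS (finMulti_le hS)
    obtain ⟨l, hl⟩ := ihT (finMulti_le hT)
    refine ⟨k + l, ?_⟩
    rw [show (⟨S + T, hF'⟩ : LDO A n) = ⟨S, finMulti_le hS⟩ + ⟨T, finMulti_le hT⟩ from rfl, map_add]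
    have h1 : (adSlot j g ^ (k + l)) (⟨S, finMulti_le hS⟩ : LDO A n) = 0 := by
      rw [add_comm, pow_add, Module.End.mul_apply, hk, map_zero]
    have h2 : (adSlot j g ^ (k + l)) (⟨T, finMulti_le hT⟩ : LDO A n) = 0 := by
      rw [pow_add, Module.End.mul_apply, hl, map_zero]
    rw [h1, h2, add_zero]

/-- Nilpotency is only local: the exponent depends on the jet order `m` of the arguments. The
hypothesis on `g` ensures that multiplication by `g` does not leave the box on which the finite
approximation is valid. -/
theorem adSlot_nilpotent (j : Fin n) {g : A} {m : ℕ} (hg : g ∈ jetLE A m) (X : LDO A n) :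
    ∃ K, ∀ k, K ≤ k → (adSlot j g ^ k) X ∈ vanish A n m := by
  obtain ⟨F, hF, h⟩ := exists_finMulti X m
  obtain ⟨K, hK⟩ := adSlot_finMulti_nilpotent j g hF
  refine ⟨K, fun k hk => ?_⟩
  have h1 := adSlot_pow_vanish (j := j) hg h k
  rw [map_sub] at h1
  have h2 : (adSlot j g ^ k) F = 0 := by
    obtain ⟨l, rfl⟩ := Nat.exists_eq_add_of_le hk
    rw [add_comm, pow_add, Module.End.mul_apply, hK, map_zero]
  rwa [h2, sub_zero] at h1

end JetAlgebra

/-! ### The Koszul complex of commuting operators with one-sided inverses. -/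

namespace Koszul

variable {N : ℕ} {V : Type*} [AddCommGroup V]

/-- The sign of `dx^i ∧ (dx)^{T ∖ i} = ± (dx)^T`. -/
def sgn (i : Fin N) (T : Finset (Fin N)) : ℤ := (-1) ^ (T.filter (· < i)).card

theorem sgn_mul_self (i : Fin N) (T : Finset (Fin N)) : sgn i T * sgn i T = 1 := by
  rw [sgn, ← mul_pow]; simp

theorem card_filter_erase {i k : Fin N} {U : Finset (Fin N)} (hi : i ∈ U) :
    ((U.erase i).filter (· < k)).card + (if i < k then 1 else 0) = (U.filter (· < k)).card := by
  rw [Finset.filter_erase]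
  split_ifs with h
  · exact Finset.card_erase_add_one (Finset.mem_filter.2 ⟨hi, h⟩)
  · rw [Finset.erase_eq_of_notMem (s := U.filter (· < k)) (fun h' => h (Finset.mem_filter.1 h').2), add_zero]

/-- Removing the smaller index first lowers the position of the larger one by one; the other order
has no such effect. -/
theorem sgn_erase {i k : Fin N} {U : Finset (Fin N)} (hi : i ∈ U) (hk : k ∈ U) (hik : i ≠ k) :
    sgn i U * sgn k (U.erase i) = -(sgn k U * sgn i (U.erase k)) := by
  have key : ∀ i k : Fin N, i ∈ U → k ∈ U → i < k →
      sgn i U * sgn k (U.erase i) = -(sgn k U * sgn i (U.erase k)) := by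
    intro i k hi hk h
    have h1 := card_filter_erase (k := k) hi
    have h2 := card_filter_erase (k := i) hk
    rw [if_pos h] at h1
    rw [if_neg (by exact not_lt.2 h.le)] at h2
    unfold sgn
    rw [← h1, ← h2, pow_succ]
    ring
  rcases lt_or_gt_of_ne hik with h | h
  · exact key i k hi hk h
  · rw [key k i hk hi h, neg_neg]

/-- The Koszul differential `∑ᵢ dx^i ∧ dᵢ`. -/
def diff (d : Fin N → V →+ V) (w : Finset (Fin N) → V) : Finset (Fin N) → V := fun T =>
  ∑ i ∈ T, sgn i T • d i (w (T.erase i))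

theorem diff_add (d : Fin N → V →+ V) (w v : Finset (Fin N) → V) :
    diff d (w + v) = diff d w + diff d v := by
  funext T; simp [diff, Finset.sum_add_distrib]

theorem diff_sub (d : Fin N → V →+ V) (w v : Finset (Fin N) → V) :
    diff d (w - v) = diff d w - diff d v := by
  funext T; simp [diff, Finset.sum_sub_distrib, smul_sub]

theorem diff_zero (d : Fin N → V →+ V) : diff d 0 = 0 := by
  funext T; simp [diff]

theorem diff_map {W : Type*} [AddCommGroup W] {d : Fin N → V →+ V} {e : Fin N → W →+ W}
    (φ : V →+ W) (h : ∀ i v, φ (d i v) = e i (φ v)) (w : Finset (Fin N) → V)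
    (T : Finset (Fin N)) : φ (diff d w T) = diff e (fun S => φ (w S)) T := by
  simp only [diff, map_sum, map_zsmul, h]

theorem diff_diff (d : Fin N → V →+ V) (hd : ∀ i k v, d i (d k v) = d k (d i v))
    (w : Finset (Fin N) → V) : diff d (diff d w) = 0 := by
  funext T
  have h1 : diff d (diff d w) T
      = ∑ p ∈ T.sigma fun i => T.erase i,
        (sgn p.1 T * sgn p.2 (T.erase p.1)) • d p.1 (d p.2 (w ((T.erase p.1).erase p.2))) := by
    rw [Finset.sum_sigma]
    simp only [diff, map_sum, map_zsmul, Finset.smul_sum, smul_smul]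
  rw [h1]
  refine Finset.sum_involution (fun p _ => ⟨p.2, p.1⟩) ?_ ?_ ?_ ?_
  · rintro ⟨i, k⟩ hp
    simp only [Finset.mem_sigma, Finset.mem_erase] at hp
    obtain ⟨hi, hk, hkT⟩ := hp
    simp only
    rw [sgn_erase hi hkT (Ne.symm hk), hd k i, Finset.erase_right_comm, neg_smul, neg_add_cancel]
  · rintro ⟨i, k⟩ hp _ h
    simp only [Finset.mem_sigma, Finset.mem_erase] at hp
    simp only [Sigma.mk.injEq, heq_eq_eq] at h
    exact hp.2.1 h.1
  · rintro ⟨i, k⟩ hp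
    simp only [Finset.mem_sigma, Finset.mem_erase] at hp ⊢
    exact ⟨hp.2.2, Ne.symm hp.2.1, hp.1⟩
  · rintro ⟨i, k⟩ _
    rfl

open Classical in
/-- Contraction with `∂/∂x^i` followed by `s`. -/
def contract (s : V →+ V) (i : Fin N) (w : Finset (Fin N) → V) : Finset (Fin N) → V := fun S =>
  if i ∈ S then 0 else sgn i (insert i S) • s (w (insert i S))

theorem contract_zero (s : V →+ V) (i : Fin N) : contract s i 0 = 0 := by
  funext S; simp [contract]

/-- Homotopy formula for one direction. The left inverse `s` of `d i` undoes the `i`-th summand of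
the differential, the other summands cancel because `s` commutes with `d k`, and the defect `p` of
`s` as a right inverse appears on the components containing `dx^i`. -/
theorem diff_contract {d : Fin N → V →+ V} {i : Fin N} {s p : V →+ V}
    (h1 : ∀ v, d i (s v) = v - p v) (h2 : ∀ v, s (d i v) = v)
    (h3 : ∀ k v, k ≠ i → s (d k v) = d k (s v)) (w : Finset (Fin N) → V) (T : Finset (Fin N)) :
    diff d (contract s i w) T + contract s i (diff d w) T = w T - if i ∈ T then p (w T) else 0 := by
  classical
  by_cases hi : i ∈ T
  · have e1 : diff d (contract s i w) T = w T - p (w T) := by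
      unfold diff
      rw [Finset.sum_eq_single_of_mem i hi]
      · unfold contract
        rw [if_neg (by simp), Finset.insert_erase hi, map_zsmul, smul_smul, sgn_mul_self, one_smul,
          h1]
      · intro k hk hki
        unfold contract
        rw [if_pos (Finset.mem_erase.2 ⟨Ne.symm hki, hi⟩), map_zero, smul_zero]
    rw [e1, contract, if_pos hi, if_pos hi, add_zero]
  · rw [if_neg hi, sub_zero]
    unfold contract
    rw [if_neg hi]
    unfold diff
    rw [Finset.sum_insert hi, map_add, smul_add, map_zsmul, smul_smul, sgn_mul_self, one_smul,
      Finset.erase_insert hi, h2, add_comm, add_assoc]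
    refine add_eq_left.2 ?_
    rw [map_sum, Finset.smul_sum, ← Finset.sum_add_distrib]
    refine Finset.sum_eq_zero fun k hk => ?_
    have hki : k ≠ i := fun h => hi (h ▸ hk)
    have hiT : i ∉ T.erase k := fun h => hi (Finset.mem_of_mem_erase h)
    simp only [if_neg hiT]
    rw [map_zsmul, map_zsmul, smul_smul, smul_smul, h3 k _ hki]
    have e : insert i (T.erase k) = (insert i T).erase k := by
      rw [Finset.erase_insert_of_ne (Ne.symm hki)]
    rw [e, ← add_smul]
    have h := sgn_erase (U := insert i T) (i := i) (k := k) (by simp) (by simp [hk]) (Ne.symm hki)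
    rw [Finset.erase_insert hi] at h
    -- This is `sgn_erase` multiplied by the two signs at `i`, whose squares are one.
    have hz : sgn i (insert i T) * sgn k (insert i T)
        + sgn k T * sgn i ((insert i T).erase k) = 0 := by
      have ha := sgn_mul_self i (insert i T)
      have he := sgn_mul_self i ((insert i T).erase k)
      linear_combination (-(sgn k T * sgn i ((insert i T).erase k))) * ha
        + sgn i (insert i T) * sgn i ((insert i T).erase k) * h
        - sgn i (insert i T) * sgn k (insert i T) * he
    rw [hz, zero_smul]

/-- Forms of degree `k`. -/
def IsForm (k : ℤ) (w : Finset (Fin N) → V) : Prop := ∀ S, (S.card : ℤ) ≠ k → w S = 0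

theorem IsForm.diff {k : ℤ} {w : Finset (Fin N) → V} (h : IsForm k w) (d : Fin N → V →+ V) :
    IsForm (k + 1) (diff d w) := fun T hT =>
  Finset.sum_eq_zero fun i hi => by
    have := Finset.card_erase_add_one hi
    rw [h _ (by intro h'; apply hT; rw [← this]; push_cast; omega), map_zero, smul_zero]

theorem IsForm.contract {k : ℤ} {w : Finset (Fin N) → V} (h : IsForm k w) (s : V →+ V)
    (i : Fin N) : IsForm (k - 1) (contract s i w) := fun S hS => by
  classical
  unfold Koszul.contract
  split_ifs with hi
  · rfl
  · rw [h _ (by rw [Finset.card_insert_of_notMem hi]; push_cast; omega), map_zero, smul_zero]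

/-- A closed form is cohomologous to one that involves all the `dx^i`. -/
theorem exists_reduction {d s p : Fin N → V →+ V} (hd : ∀ i k v, d i (d k v) = d k (d i v))
    (h1 : ∀ i v, d i (s i v) = v - p i v) (h2 : ∀ i v, s i (d i v) = v)
    (h3 : ∀ i k v, k ≠ i → s i (d k v) = d k (s i v))
    {a : Fin N → V →+ V} (ha : ∀ i v, a i (p i v) = 0)
    (hap : ∀ i k v, k ≠ i → a k (p i v) = p i (a k v))
    {k : ℤ} {w : Finset (Fin N) → V} (hw : IsForm k w) (hc : diff d w = 0) :
    ∃ e v, w = diff d e + v ∧ IsForm (k - 1) e ∧ IsForm k v ∧ (∀ S, S ≠ Finset.univ → v S = 0) ∧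
      ∀ i S, a i (v S) = 0 := by
  classical
  -- The directions are treated one after the other. After those in `I`, the remainder contains
  -- `dx^i` and is annihilated by `a i` for every `i ∈ I`; the next contraction preserves this since
  -- `p i` commutes with the other `a k`.
  have key : ∀ I : Finset (Fin N), ∃ e v, w = diff d e + v ∧ IsForm (k - 1) e ∧ IsForm k v ∧
      diff d v = 0 ∧ ∀ i ∈ I, (∀ S, i ∉ S → v S = 0) ∧ ∀ S, a i (v S) = 0 := by
    intro I
    induction I using Finset.induction_on with
    | empty => exact ⟨0, w, by rw [diff_zero, zero_add], fun _ _ => rfl, hw, hc, by simp⟩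
    | insert i I hi ih =>
      obtain ⟨e, v, he, hek, hvk, hv, hI⟩ := ih
      refine ⟨e + contract (s i) i v, fun T => if i ∈ T then p i (v T) else 0, ?_, ?_, ?_, ?_, ?_⟩
      · rw [diff_add, add_assoc, he]
        congr 1
        funext T
        have := diff_contract (h1 i) (h2 i) (h3 i) v T
        rw [hv, contract_zero, Pi.zero_apply, add_zero] at this
        rw [Pi.add_apply, this, sub_add_cancel]
      · intro S hS
        rw [Pi.add_apply, hek S hS, hvk.contract (s i) i S hS, add_zero]
      · intro S hS
        show (if i ∈ S then p i (v S) else 0) = 0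
        rw [hvk S hS, map_zero, ite_self]
      · have : (fun T => if i ∈ T then p i (v T) else 0) = v - diff d (contract (s i) i v) := by
          funext T
          have := diff_contract (h1 i) (h2 i) (h3 i) v T
          rw [hv, contract_zero, Pi.zero_apply, add_zero] at this
          rw [Pi.sub_apply, this, sub_sub_cancel]
        rw [this, diff_sub, hv, diff_diff d hd, sub_zero]
      · intro l hl
        refine ⟨fun S hS => ?_, fun S => ?_⟩
        · simp only
          split_ifs with h
          · have hli : l ≠ i := fun h' => hS (h' ▸ h)
            rw [(hI l (Finset.mem_of_mem_insert_of_ne hl hli)).1 S hS, map_zero]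
          · rfl
        · simp only
          split_ifs with h
          · by_cases hli : l = i
            · rw [hli, ha]
            · rw [hap i l _ hli, (hI l (Finset.mem_of_mem_insert_of_ne hl hli)).2 S, map_zero]
          · rw [map_zero]
  obtain ⟨e, v, he, hek, hvk, -, hI⟩ := key Finset.univ
  refine ⟨e, v, he, hek, hvk, fun S hS => ?_, fun i S => (hI i (Finset.mem_univ i)).2 S⟩
  obtain ⟨i, hi⟩ : ∃ i, i ∉ S := by
    by_contra h
    push Not at h
    exact hS (Finset.eq_univ_iff_forall.2 h)
  exact (hI i (Finset.mem_univ i)).1 S hi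

end Koszul

/-! ### Division of operators by total derivatives. -/

namespace JetAlgebra

variable {N : ℕ} {A : Type} [CommRing A] [Algebra ℝ A] [JetAlgebra N A] {n : ℕ}

/-- A linear map that commutes with locally finite sums. -/
def Summing (Φ : Module.End ℝ (LDO A n)) : Prop :=
  ∀ ⦃ι : Type⦄ (X : ι → LDO A n), LocallyZero X →
    LocallyZero (fun k => Φ (X k)) ∧ Φ (lsum X) = lsum fun k => Φ (X k)

theorem summing_lft (P : diffOp A) : Summing (lft P : LDO A n →ₗ[ℝ] LDO A n) :=
  fun _ _ h => ⟨h.lft fun _ => P, lft_lsum h P⟩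

theorem summing_rgt (j : Fin n) (Q : diffOp A) : Summing (rgt j Q : LDO A n →ₗ[ℝ] LDO A n) :=
  fun _ _ h => ⟨h.rgt j Q, rgt_lsum h j Q⟩

theorem summing_adSlot (j : Fin n) (g : A) : Summing (adSlot j g : Module.End ℝ (LDO A n)) :=
  fun _ X h => ⟨(h.rgt j (mulBy g)).sub (h.lft fun _ => mulBy g), by
    have := lsum_sub (h.rgt j (mulBy g)) (h.lft fun _ => mulBy g)
    refine Eq.trans ?_ this.symm
    rw [← lft_lsum h, ← rgt_lsum h]; rfl⟩

theorem lsum_succ {X : ℕ → LDO A n} (hX : LocallyZero X) :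
    lsum X = X 0 + lsum fun k => X (k + 1) := by
  have h1 : LocallyZero fun k => X (k + 1) := hX.comp_injective (add_left_injective 1)
  rw [← lsum_telescope hX, lsum_sub hX h1, sub_add_cancel]

theorem lsum_zero {ι : Type*} : lsum (fun _ : ι => (0 : LDO A n)) = 0 := by
  have h : LocallyZero (fun _ : ι => (0 : LDO A n)) := fun m => by
    simp [zero_mem]
  ext f
  rw [lsum_apply h]; simp

/-- The coordinate `x^i` lies in every `jetLE A m`, so local nilpotency is available at all jet
orders. This makes the power series below meaningful. -/
theorem locallyZero_adSlot_pow (j : Fin n) (i : Fin N) (X : LDO A n) :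
    LocallyZero fun k => (adSlot j (coordX i) ^ k) X := locallyZero_of_finset fun m => by
  obtain ⟨K, hK⟩ := adSlot_nilpotent j (coordX_mem (A := A) i m) X
  exact ⟨Finset.range K, fun k hk => hK k (by simpa using hk)⟩

theorem adSlot_comm (j : Fin n) (g h : A) (X : LDO A n) :
    adSlot j g (adSlot j h X) = adSlot j h (adSlot j g X) := by
  ext f
  simp only [adSlot_apply, Function.update_self, Function.update_idem]
  rw [show g * (h * f j) = h * (g * f j) by ring]
  ring

/-- The Heisenberg relation between commutation with `x^i` in a slot and total derivatives of the
output. -/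
theorem adSlot_totD (j : Fin n) (i k : Fin N) (X : LDO A n) :
    adSlot j (coordX i) (lft (totD k) X)
      = lft (totD k) (adSlot j (coordX i) X) + if k = i then X else 0 := by
  ext f
  rw [LDO.add_apply]
  simp only [adSlot_apply, lft_apply, totD_apply, map_sub, Derivation.leibniz, derD_coordX,
    smul_eq_mul]
  split_ifs
  · simp only [mul_one]; ring
  · simp

theorem lft_mul (P Q : diffOp A) (X : LDO A n) : lft (P * Q) X = lft P (lft Q X) := rfl

theorem lft_totD_comm (i k : Fin N) (X : LDO A n) :
    lft (totD i) (lft (totD k) X) = lft (totD k) (lft (totD i) X) := by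
  ext f; exact derD_comm i k _

/-- `a^k d = d a^k + k a^{k-1}` and its companion, from `a d = d a + 1`. -/
theorem heisenberg {V : Type*} [AddCommGroup V] [Module ℝ V] {a d : Module.End ℝ V}
    (h : a * d = d * a + 1) (k : ℕ) :
    a ^ (k + 1) * d = d * a ^ (k + 1) + ((k : ℝ) + 1) • a ^ k ∧
      a * d ^ (k + 1) = d ^ (k + 1) * a + ((k : ℝ) + 1) • d ^ k := by
  induction k with
  | zero => simp [h]
  | succ k ih =>
    refine ⟨?_, ?_⟩
    · rw [pow_succ' a (k + 1), mul_assoc, ih.1, mul_add, ← mul_assoc, h, add_mul, one_mul,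
        mul_assoc, mul_smul_comm, ← pow_succ' a k, ← pow_succ' a (k + 1), add_assoc]
      congr 1
      push_cast
      module
    · rw [pow_succ d (k + 1), ← mul_assoc, ih.2, add_mul, mul_assoc, h, mul_add, mul_one,
        ← mul_assoc, smul_mul_assoc, ← pow_succ d k, ← pow_succ d (k + 1), add_assoc]
      congr 1
      push_cast
      module

section division

variable (j : Fin n) (i : Fin N)

/-- `(-1)^k / k! · d^k a^k`, with `d` the total derivative and `a` the commutator with `x^i`. -/
def taylorTerm (k : ℕ) (X : LDO A n) : LDO A n :=
  ((-1 : ℝ) ^ k / k.factorial) • lft (totD i ^ k) ((adSlot j (coordX i) ^ k) X)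

/-- The term `(-1)^k / (k + 1)! · d^k a^{k+1}`. -/
def divTerm (k : ℕ) (X : LDO A n) : LDO A n :=
  ((-1 : ℝ) ^ k / (k + 1).factorial) • lft (totD i ^ k) ((adSlot j (coordX i) ^ (k + 1)) X)

theorem locallyZero_taylorTerm (X : LDO A n) : LocallyZero fun k => taylorTerm j i k X :=
  ((locallyZero_adSlot_pow j i X).lft _).smul _

theorem locallyZero_divTerm (X : LDO A n) : LocallyZero fun k => divTerm j i k X :=
  (((locallyZero_adSlot_pow j i X).comp_injective (add_left_injective 1)).lft _).smul _

/-- The part of an operator that is not in the image of `d/dx^i`. -/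
def normalPart (X : LDO A n) : LDO A n := lsum fun k => taylorTerm j i k X

/-- The quotient of an operator by `d/dx^i`. -/
def divD (X : LDO A n) : LDO A n := lsum fun k => divTerm j i k X

theorem taylorTerm_zero (X : LDO A n) : taylorTerm j i 0 X = X := by
  ext f; simp [taylorTerm]

theorem totD_divTerm (k : ℕ) (X : LDO A n) :
    lft (totD i) (divTerm j i k X) = (-1 : ℝ) • taylorTerm j i (k + 1) X := by
  rw [divTerm, taylorTerm, map_smul, ← lft_mul, ← pow_succ', smul_smul]
  congr 1
  ring

/-- Applying `d` to the series for the quotient gives minus the series for the normal part without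
its zeroth term, which is `X`. -/
theorem totD_divD (X : LDO A n) : lft (totD i) (divD j i X) = X - normalPart j i X := by
  have hW := locallyZero_taylorTerm j i X
  rw [divD, lft_lsum (locallyZero_divTerm j i X), normalPart, lsum_succ hW, taylorTerm_zero]
  simp only [totD_divTerm]
  rw [lsum_smul (hW.comp_injective (add_left_injective 1))]
  rw [neg_one_smul]; abel

theorem lft_totD_pow (k : ℕ) (X : LDO A n) :
    lft (totD i ^ k) X = ((lft (totD i) : Module.End ℝ (LDO A n)) ^ k) X := by
  induction k generalizing X with
  | zero => rfl
  | succ k ih => rw [pow_succ, lft_mul, ih, pow_succ, Module.End.mul_apply]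

theorem adSlot_mul_totD :
    (adSlot j (coordX i) : Module.End ℝ (LDO A n)) * (lft (totD i) : Module.End ℝ (LDO A n))
      = (lft (totD i) : Module.End ℝ (LDO A n)) * adSlot j (coordX i) + 1 := by
  refine LinearMap.ext fun X => ?_
  have := adSlot_totD j i i X
  rw [if_pos rfl] at this
  exact this

theorem divTerm_totD (k : ℕ) (X : LDO A n) :
    divTerm j i k (lft (totD i) X) = taylorTerm j i k X - taylorTerm j i (k + 1) X := by
  have h := LinearMap.congr_fun (heisenberg (adSlot_mul_totD (A := A) j i) k).1 X
  simp only [Module.End.mul_apply, LinearMap.add_apply, LinearMap.smul_apply] at h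
  rw [divTerm, h, map_add, map_smul, ← lft_mul, ← pow_succ, taylorTerm, taylorTerm, smul_add,
    smul_smul, add_comm, sub_eq_add_neg, ← neg_smul]
  have hf : (k.factorial : ℝ) ≠ 0 := by exact_mod_cast k.factorial_ne_zero
  have hk : (k : ℝ) + 1 ≠ 0 := by positivity
  congr 2
  · rw [Nat.factorial_succ]; push_cast; field_simp
  · ring

/-- Moving `d` to the left through `a^{k+1}` turns the `k`-th term into a difference of consecutive
terms of the normal part, so the series telescopes to `X`. -/
theorem divD_totD (X : LDO A n) : divD j i (lft (totD i) X) = X := by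
  have hW := locallyZero_taylorTerm j i X
  rw [divD]
  simp only [divTerm_totD]
  rw [lsum_telescope hW, taylorTerm_zero]

/-- Commuting `a` past `d^{k+1}` makes the terms `V (k+1) - V k`, while the zeroth term contributes
`V 0`; the total cancels. -/
theorem adSlot_normalPart (X : LDO A n) : adSlot j (coordX i) (normalPart j i X) = 0 := by
  have hW := locallyZero_taylorTerm j i X
  have hA := (summing_adSlot j (coordX (A := A) i) _ hW)
  let V : ℕ → LDO A n := fun k =>
    ((-1 : ℝ) ^ k / k.factorial) • lft (totD i ^ k) ((adSlot j (coordX i) ^ (k + 1)) X)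
  have hV : LocallyZero V :=
    (((locallyZero_adSlot_pow j i X).comp_injective (add_left_injective 1)).lft _).smul _
  have e : ∀ k, adSlot j (coordX i) (taylorTerm j i (k + 1) X) = V (k + 1) - V k := by
    intro k
    have h := LinearMap.congr_fun (heisenberg (adSlot_mul_totD (A := A) j i) k).2
      ((adSlot j (coordX i) ^ (k + 1)) X)
    simp only [Module.End.mul_apply, LinearMap.add_apply, LinearMap.smul_apply] at h
    have h' : adSlot j (coordX i) ((adSlot j (coordX i) ^ (k + 1)) X)
        = (adSlot j (coordX i) ^ (k + 1 + 1)) X := by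
      rw [pow_succ' _ (k + 1), Module.End.mul_apply]
    rw [taylorTerm, map_smul, lft_totD_pow, h, ← lft_totD_pow, ← lft_totD_pow, h', smul_add, smul_smul, sub_eq_add_neg, ← neg_smul]
    have hf : (k.factorial : ℝ) ≠ 0 := by exact_mod_cast k.factorial_ne_zero
    have hk : (k : ℝ) + 1 ≠ 0 := by positivity
    congr 2
    rw [Nat.factorial_succ]; push_cast; field_simp; ring
  have e0 : adSlot j (coordX i) (taylorTerm j i 0 X) = V 0 := by
    rw [taylorTerm_zero]
    ext f
    simp [V]
  rw [normalPart, hA.2, lsum_succ hA.1, e0]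
  simp only [e]
  rw [lsum_sub (hV.comp_injective (add_left_injective 1)) hV, lsum_succ hV]
  abel

variable {j i}

/-- Division commutes with every summing map that commutes with `d` and `a`. -/
theorem divD_comm {Φ : Module.End ℝ (LDO A n)} (hΦ : Summing Φ)
    (hd : ∀ X, Φ (lft (totD i) X) = lft (totD i) (Φ X))
    (ha : ∀ X, Φ (adSlot j (coordX i) X) = adSlot j (coordX i) (Φ X)) (X : LDO A n) :
    divD j i (Φ X) = Φ (divD j i X) ∧ normalPart j i (Φ X) = Φ (normalPart j i X) := by
  have hd' : ∀ k X, Φ (lft (totD i ^ k) X) = lft (totD i ^ k) (Φ X) := by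
    intro k
    induction k with
    | zero => intro X; rfl
    | succ k ih => intro X; rw [pow_succ, lft_mul, ih, hd, lft_mul]
  have ha' : ∀ k X, Φ ((adSlot j (coordX i) ^ k) X) = (adSlot j (coordX i) ^ k) (Φ X) := by
    intro k
    induction k with
    | zero => intro X; rfl
    | succ k ih => intro X; rw [pow_succ, Module.End.mul_apply, ih, ha, Module.End.mul_apply]
  refine ⟨?_, ?_⟩
  · rw [divD, divD, (hΦ _ (locallyZero_divTerm j i X)).2]
    congr 1; funext k
    rw [divTerm, divTerm, map_smul, hd', ha']
  · rw [normalPart, normalPart, (hΦ _ (locallyZero_taylorTerm j i X)).2]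
    congr 1; funext k
    rw [taylorTerm, taylorTerm, map_smul, hd', ha']

theorem divD_lft_totD {k : Fin N} (h : k ≠ i) (X : LDO A n) :
    divD j i (lft (totD k) X) = lft (totD k) (divD j i X) := by
  refine (divD_comm (summing_lft (totD k)) (fun X => lft_totD_comm _ _ X) (fun X => ?_) X).1
  rw [adSlot_totD, if_neg h, add_zero]

theorem normalPart_adSlot {k : Fin N} (h : k ≠ i) (X : LDO A n) :
    adSlot j (coordX k) (normalPart j i X) = normalPart j i (adSlot j (coordX k) X) := by
  refine (divD_comm (summing_adSlot j (coordX k)) (fun X => ?_) (fun X => ?_) X).2.symm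
  · rw [adSlot_totD, if_neg (Ne.symm h), add_zero]
  · exact adSlot_comm j _ _ X

theorem divD_add (X Y : LDO A n) : divD j i (X + Y) = divD j i X + divD j i Y := by
  rw [divD, divD, divD, ← lsum_add (locallyZero_divTerm j i X) (locallyZero_divTerm j i Y)]
  congr 1; funext k
  simp [divTerm]

theorem normalPart_add (X Y : LDO A n) :
    normalPart j i (X + Y) = normalPart j i X + normalPart j i Y := by
  rw [normalPart, normalPart, normalPart,
    ← lsum_add (locallyZero_taylorTerm j i X) (locallyZero_taylorTerm j i Y)]
  congr 1; funext k
  simp [taylorTerm]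

end division

/-- `d_H` on forms with coefficients in the local differential operators. -/
def ldoD (i : Fin N) : LDO A n →+ LDO A n := (lft (totD i) : LDO A n →ₗ[ℝ] LDO A n).toAddMonoidHom

/-- A `d_H`-closed form of operators is `d_H`-exact up to a top form without total derivatives in
the slot `j`. -/
theorem exists_primitive_add_normal (j : Fin n) {k : ℤ} {w : Finset (Fin N) → LDO A n}
    (hw : Koszul.IsForm k w) (hc : Koszul.diff ldoD w = 0) :
    ∃ e v, w = Koszul.diff ldoD e + v ∧ Koszul.IsForm (k - 1) e ∧ Koszul.IsForm k v ∧
      (∀ S, S ≠ Finset.univ → v S = 0) ∧ ∀ i S, adSlot j (coordX i) (v S) = 0 :=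
  Koszul.exists_reduction (d := ldoD)
    (s := fun i => { toFun := divD j i, map_zero' := by
                      simpa using (divD_add (j := j) (i := i) (0 : LDO A n) 0)
                     map_add' := divD_add })
    (p := fun i => { toFun := normalPart j i, map_zero' := by
                      simpa using (normalPart_add (j := j) (i := i) (0 : LDO A n) 0)
                     map_add' := normalPart_add })
    (a := fun i => (adSlot j (coordX i)).toAddMonoidHom)
    (fun i k v => lft_totD_comm i k v) (fun i v => totD_divD j i v) (fun i v => divD_totD j i v)
    (fun _ _ v h => divD_lft_totD h v) (fun i v => adSlot_normalPart j i v)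
    (fun _ _ v h => normalPart_adSlot h v) hw hc

end JetAlgebra

/-! ### The Euler operator, and operators with exact values. -/

namespace JetAlgebra

variable {N : ℕ} {A : Type} [CommRing A] [Algebra ℝ A] [JetAlgebra N A] {n : ℕ}

/-- The total divergences `∑ᵢ dβᵢ/dx^i`. -/
def exact (A : Type) [CommRing A] [Algebra ℝ A] [JetAlgebra N A] : Submodule ℝ A where
  carrier := {g | ∃ β : Fin N → A, g = ∑ i, derD i (β i)}
  add_mem' := by
    rintro _ _ ⟨β, rfl⟩ ⟨γ, rfl⟩
    exact ⟨β + γ, by simp [Finset.sum_add_distrib]⟩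
  zero_mem' := ⟨0, by simp⟩
  smul_mem' := by
    rintro c _ ⟨β, rfl⟩
    exact ⟨c • β, by simp [Finset.smul_sum]⟩

theorem derD_mem_exact (i : Fin N) (g : A) : derD i g ∈ exact A :=
  ⟨Pi.single i g, by
    rw [Finset.sum_eq_single i]
    · simp
    · intro k _ hk; simp [hk]
    · simp⟩

/-- Integration by parts, in the form in which `-d/dx^i` is the adjoint of `d/dx^i`. -/
theorem mul_derD_sub_mem (i : Fin N) (g h : A) : g * derD i h - -derD i g * h ∈ exact A := by
  have := derD_mem_exact i (g * h)
  rw [Derivation.leibniz, smul_eq_mul, smul_eq_mul] at this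
  convert this using 1
  ring

/-- `(-d/dx)^J`. -/
def negPow (J : MultiIdx N) : diffOp A := MultiIdx.pow (fun i => -totD i) J

theorem totD_commute (i k : Fin N) : Commute (-totD i : diffOp A) (-totD k) := by
  refine Subtype.ext (LinearMap.ext fun f => ?_)
  show -derD i (-derD k f) = -derD k (-derD i f)
  rw [map_neg, map_neg, derD_comm]

theorem negPow_zero : (negPow 0 : diffOp A) = 1 := MultiIdx.pow_zero'

theorem negPow_add_single (J : MultiIdx N) (i : Fin N) :
    (negPow (J + Pi.single i 1) : diffOp A) = -totD i * negPow J :=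
  MultiIdx.pow_add_single totD_commute J i

theorem negPow_add_single_apply (J : MultiIdx N) (i : Fin N) (f : A) :
    (negPow (J + Pi.single i 1)).1 f = -derD i ((negPow J).1 f) := by
  rw [negPow_add_single]; rfl

theorem negPow_derD (J : MultiIdx N) (i : Fin N) (f : A) :
    (negPow J).1 (derD i f) = -(negPow (J + Pi.single i 1)).1 f := by
  have h : (negPow (J + Pi.single i 1) : diffOp A) = negPow J * -totD i :=
    MultiIdx.pow_add_single' totD_commute J i
  rw [h]
  show _ = -((negPow J).1 (-derD i f))
  rw [map_neg, neg_neg]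

theorem negPow_mem_finDiffOp (J : MultiIdx N) : (negPow J : diffOp A).1 ∈ finDiffOp A := by
  induction J using MultiIdx.induct with
  | h0 => rw [negPow_zero]; exact one_mem _
  | hs J i ih =>
    rw [negPow_add_single]
    exact mul_mem (neg_mem (opD_mem i)) ih

/-- The Euler operator `∑_J (-d/dx)^J ∂/∂u_J`. -/
def euler (A : Type) [CommRing A] [Algebra ℝ A] [JetAlgebra N A] : diffOp A :=
  have fin : ∀ {f : A} {m : ℕ}, f ∈ jetLE A m →
      ∑ᶠ J, (negPow J).1 (derU J f) = ∑ J ∈ MultiIdx.upTo N m, (negPow J).1 (derU J f) := by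
    intro f m hf
    refine finsum_eq_sum_of_support_subset _ fun J hJ => ?_
    by_contra h
    exact hJ (by
      show (negPow J).1 (derU J f) = 0
      rw [hf J (by simpa [MultiIdx.mem_upTo] using h), map_zero])
  ⟨{ toFun := fun f => ∑ᶠ J, (negPow J).1 (derU J f)
     map_add' := fun f g => by
      obtain ⟨m, hf⟩ := exists_jetLE f
      obtain ⟨m', hg⟩ := exists_jetLE g
      have hf' := jetLE_mono (le_max_left m m') hf
      have hg' := jetLE_mono (le_max_right m m') hg
      rw [fin (add_mem hf' hg'), fin hf', fin hg', ← Finset.sum_add_distrib]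
      simp
     map_smul' := fun c f => by
      obtain ⟨m, hf⟩ := exists_jetLE f
      rw [fin (Subalgebra.smul_mem _ hf c), fin hf]
      simp [Finset.smul_sum] }, fun m =>
  ⟨∑ J ∈ MultiIdx.upTo N m, (negPow J).1 * opU J,
    sum_mem fun J _ => mul_mem (negPow_mem_finDiffOp J) (opU_mem J), fun f hf => by
      refine (fin hf).trans ?_
      simp⟩⟩

theorem euler_apply {f : A} {m : ℕ} (hf : f ∈ jetLE A m) :
    (euler A).1 f = ∑ J ∈ MultiIdx.upTo N m, (negPow J).1 (derU J f) := by
  refine finsum_eq_sum_of_support_subset _ fun J hJ => ?_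
  by_contra h
  exact hJ (by
      show (negPow J).1 (derU J f) = 0
      rw [hf J (by simpa [MultiIdx.mem_upTo] using h), map_zero])

/-- Commuting `∂/∂u_J` past `d/dx^i` produces `∂/∂u_{J-i}`; after the shift `J ↦ J + i` these terms
cancel those in which `(-d/dx)^J` has absorbed the derivative with a sign. -/
theorem euler_derD (i : Fin N) (f : A) : (euler A).1 (derD i f) = 0 := by
  obtain ⟨m, hf⟩ := exists_jetLE f
  rw [euler_apply (derD_mem hf i)]
  simp only [derU_derD, map_add, negPow_derD, Finset.sum_add_distrib, Finset.sum_neg_distrib]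
  rw [neg_add_eq_zero]
  have h1 : ∑ J ∈ MultiIdx.upTo N m, (negPow (J + Pi.single i 1)).1 (derU J f)
      = ∑ J ∈ MultiIdx.upTo N (m + 1), (negPow (J + Pi.single i 1)).1 (derU J f) := by
    refine Finset.sum_subset (fun J hJ => ?_) fun J _ hJ => ?_
    · rw [MultiIdx.mem_upTo] at *; omega
    · rw [hf J (by simpa [MultiIdx.mem_upTo] using hJ), map_zero]
  rw [← h1]
  refine Finset.sum_of_injOn (fun J => J + Pi.single i 1) (add_left_injective _).injOn ?_ ?_ ?_
  · intro J hJ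
    have := MultiIdx.order_add_single J i
    simp only [Finset.mem_coe, MultiIdx.mem_upTo] at *
    omega
  · intro J hJ hJ'
    split_ifs with h
    · exact map_zero _
    · refine absurd ⟨J - Pi.single i 1, ?_, MultiIdx.sub_add_single h⟩ hJ'
      have := MultiIdx.order_add_single (J - Pi.single i 1) i
      rw [MultiIdx.sub_add_single h] at this
      simp only [Finset.mem_coe, MultiIdx.mem_upTo] at *
      omega
  · intro J _
    rw [if_neg (by simp), add_tsub_cancel_right]

theorem euler_exact {g : A} (hg : g ∈ exact A) : (euler A).1 g = 0 := by
  obtain ⟨β, rfl⟩ := hg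
  rw [map_sum]
  exact Finset.sum_eq_zero fun i _ => euler_derD i _

/-! ### Iterated commutators with the coordinates `x^i` -/

/-- The iterated commutator with the `x^i` in the slot `j`. -/
def adPow (j : Fin n) (L : MultiIdx N) : Module.End ℝ (LDO A n) :=
  MultiIdx.pow (fun i => adSlot j (coordX i)) L

theorem adPow_zero (j : Fin n) (X : LDO A n) : adPow j 0 X = X := by
  rw [adPow, MultiIdx.pow_zero']; rfl

theorem adSlot_commute (j : Fin n) (g h : A) :
    Commute (adSlot j g : Module.End ℝ (LDO A n)) (adSlot j h) :=
  LinearMap.ext fun X => adSlot_comm j g h X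

theorem adPow_add_single (j : Fin n) (L : MultiIdx N) (i : Fin N) (X : LDO A n) :
    adPow j (L + Pi.single i 1) X = adSlot j (coordX i) (adPow j L X) :=
  LinearMap.congr_fun (MultiIdx.pow_add_single (fun _ _ => adSlot_commute j _ _) L i) X

theorem adPow_apply_eq_zero {j : Fin n} {S : Set (Fin n → A)}
    (hS : ∀ f ∈ S, ∀ i, Function.update f j (coordX i * f j) ∈ S) {X : LDO A n}
    (hX : ∀ f ∈ S, X.1 f = 0) (L : MultiIdx N) : ∀ f ∈ S, (adPow j L X).1 f = 0 := by
  induction L using MultiIdx.induct with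
  | h0 => intro f hf; rw [adPow_zero, hX f hf]
  | hs L i ih =>
    intro f hf
    rw [adPow_add_single, adSlot_apply, ih _ (hS f hf i), ih f hf, mul_zero, sub_zero]

theorem lft_negPow_add_single (J : MultiIdx N) (i : Fin N) (X : LDO A n) :
    lft (negPow (J + Pi.single i 1)) X = (-1 : ℝ) • lft (totD i) (lft (negPow J) X) := by
  ext f
  rw [lft_apply, negPow_add_single_apply, LDO.smul_apply, neg_one_smul]; rfl

theorem adSlot_negPow (j : Fin n) (i : Fin N) (J : MultiIdx N) (X : LDO A n) :
    adSlot j (coordX i) (lft (negPow J) X) = lft (negPow J) (adSlot j (coordX i) X)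
      - (J i : ℝ) • lft (negPow (J - Pi.single i 1)) X := by
  induction J using MultiIdx.induct with
  | h0 =>
    have h : ∀ Y : LDO A n, lft (negPow 0) Y = Y := fun Y => by rw [negPow_zero]; rfl
    rw [h, h]; simp
  | hs J k ih =>
    rw [lft_negPow_add_single, map_smul, adSlot_totD, ih, map_sub, map_smul,
      lft_negPow_add_single]
    by_cases hk : k = i
    · subst hk
      have h2 : (J k : ℝ) • lft (totD k) (lft (negPow (J - Pi.single k 1)) X)
          = (-(J k : ℝ)) • lft (negPow J) X := by
        by_cases h0 : J k = 0
        · simp [h0]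
        · conv_rhs => rw [← MultiIdx.sub_add_single h0]
          rw [lft_negPow_add_single, smul_smul]
          congr 1
          rw [MultiIdx.sub_add_single h0]; ring
      rw [if_pos rfl, h2, add_tsub_cancel_right, Pi.add_apply, Pi.single_eq_same]
      push_cast
      module
    · rw [if_neg hk, Pi.add_apply, Pi.single_eq_of_ne (Ne.symm hk)]
      have h2 : (J i : ℝ) • lft (negPow (J + Pi.single k 1 - Pi.single i 1)) X
          = (J i : ℝ) • (-1 : ℝ) • lft (totD k) (lft (negPow (J - Pi.single i 1)) X) := by
        by_cases h0 : J i = 0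
        · simp [h0]
        · rw [← lft_negPow_add_single]
          congr 2
          refine congrArg (fun K => lft (negPow K)) (funext fun l => ?_)
          by_cases hl : l = i
          · subst hl; simp [Ne.symm hk]
          · simp [hl]
      rw [add_zero, add_zero, h2]
      module

/-- Each commutator with `x^i` differentiates the symbol `(-d)^J` and lowers `J` by one in direction
`i`, with factor minus the current exponent. Only the vanishing of the resulting constant is needed,
not its value. -/
theorem exists_adPow_negPow (j : Fin n) (L J : MultiIdx N) : ∃ c : ℝ, (c ≠ 0 ↔ L ≤ J) ∧
    ∀ X : LDO A n, (∀ i, adSlot j (coordX i) X = 0) →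
      adPow j L (lft (negPow J) X) = c • lft (negPow (J - L)) X := by
  induction L using MultiIdx.induct with
  | h0 => exact ⟨1, by simp, fun X _ => by rw [adPow_zero, one_smul, tsub_zero]⟩
  | hs L i ih =>
    obtain ⟨c, hc, h⟩ := ih
    refine ⟨-(c * ((J - L) i : ℕ)), ?_, fun X hX => ?_⟩
    · rw [neg_ne_zero, mul_ne_zero_iff, hc, Nat.cast_ne_zero]
      constructor
      · rintro ⟨h1, h2⟩ k
        have := h1 k
        by_cases hk : k = i
        · subst hk; simp at h2 ⊢; omega
        · simpa [hk] using this
      · intro h1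
        refine ⟨fun k => le_trans (by simp) (h1 k), ?_⟩
        have := h1 i
        simp at this ⊢; omega
    · rw [adPow_add_single, h X hX, map_smul, adSlot_negPow, hX i, map_zero, zero_sub,
        tsub_add_eq_tsub_tsub]
      module

/-- The operator `f ↦ g ∏ⱼ fⱼ`. -/
def mulProd (n : ℕ) (g : A) : LDO A n :=
  ⟨prodOp g fun _ => 1, finMulti_le (prodOp_mem g fun _ => one_mem _)⟩

theorem mulProd_apply (g : A) (f : Fin n → A) : (mulProd n g).1 f = g * ∏ j, f j := rfl

theorem prod_update_mul {R : Type*} [CommRing R] (f : Fin n → R) (j : Fin n) (g : R) :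
    ∏ k, Function.update f j (g * f j) k = g * ∏ k, f k := by
  rw [Finset.prod_update_of_mem (Finset.mem_univ j), mul_assoc, ← Finset.mul_prod_erase
    Finset.univ f (Finset.mem_univ j), Finset.sdiff_singleton_eq_erase]

theorem adSlot_mulProd (j : Fin n) (g h : A) : adSlot j g (mulProd n h) = 0 := by
  ext f
  rw [adSlot_apply, mulProd_apply, mulProd_apply, prod_update_mul, LDO.zero_apply]
  ring

/-- The polynomials in the `x^i`. -/
def xPoly (A : Type) [CommRing A] [Algebra ℝ A] [JetAlgebra N A] : Subalgebra ℝ A :=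
  Algebra.adjoin ℝ (Set.range coordX)

theorem coordX_mem_xPoly (i : Fin N) : (coordX i : A) ∈ xPoly A :=
  Algebra.subset_adjoin ⟨i, rfl⟩

/-- The elements that do not depend on the `u_J`. -/
def jetFree (A : Type) [CommRing A] [Algebra ℝ A] [JetAlgebra N A] : Subalgebra ℝ A where
  carrier := {f | ∀ J, derU J f = 0}
  mul_mem' hf hg J := by rw [Derivation.leibniz, hf J, hg J]; simp
  add_mem' hf hg J := by rw [map_add, hf J, hg J, add_zero]
  algebraMap_mem' r J := Derivation.map_algebraMap _ _

theorem coordX_mem_jetFree (i : Fin N) : (coordX i : A) ∈ jetFree A := fun J => derU_coordX J i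

theorem xPoly_le_jetFree : xPoly A ≤ jetFree A :=
  Algebra.adjoin_le (by rintro _ ⟨i, rfl⟩; exact coordX_mem_jetFree i)

theorem jetFree_le (m : ℕ) : jetFree A ≤ jetLE A m := fun _ hf J _ => hf J

theorem derD_mem_jetFree {f : A} (hf : f ∈ jetFree A) (i : Fin N) : derD i f ∈ jetFree A := by
  intro J
  rw [derU_derD, hf J, map_zero, zero_add]
  split_ifs
  · rfl
  · exact hf _

/-- If all `h q`, with `h` a polynomial in the `x^i`, are annihilated by the Euler operator, then
`q` does not depend on the `u_J`. -/
theorem jetFree_of_euler {q : A} (h : ∀ p ∈ xPoly A, (euler A).1 (p * q) = 0) :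
    q ∈ jetFree A := by
  have key : ∀ m, q ∈ jetLE A m → ∀ L : MultiIdx N, L.order = m → derU L q = 0 := by
    intro m hm L hL
    -- On a polynomial `f` in `x` the value is `E(f q)`, because `f` does not depend on the `u_J`;
    -- hence `X` vanishes there.
    let X : LDO A 1 := ∑ J ∈ MultiIdx.upTo N m, lft (negPow J) (mulProd 1 (derU J q))
    let S : Set (Fin 1 → A) := {f | f 0 ∈ xPoly A}
    have hX : ∀ f ∈ S, X.1 f = 0 := by
      intro f hf
      rw [← h _ hf, euler_apply (mul_mem (jetFree_le m (xPoly_le_jetFree hf)) hm), LDO.sum_apply]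
      refine Finset.sum_congr rfl fun J _ => ?_
      rw [lft_apply, mulProd_apply, Derivation.leibniz, xPoly_le_jetFree hf J]
      simp [mul_comm]
    -- Commuting `L` times with the coordinates keeps the terms with `J ≥ L`. As `L` has the top
    -- order `m`, only `J = L` survives, and its value at `1` is a nonzero multiple of `∂q/∂u_L`.
    have h1 := adPow_apply_eq_zero (j := (0 : Fin 1)) (S := S) (fun f hf i => by
      simpa [S] using mul_mem (coordX_mem_xPoly i) hf) hX L (fun _ => 1) (one_mem (xPoly A))
    rw [map_sum, Finset.sum_eq_single L] at h1
    · obtain ⟨c, hc, hc'⟩ := exists_adPow_negPow (A := A) (0 : Fin 1) L L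
      rw [hc' _ fun i => adSlot_mulProd _ _ _, tsub_self, negPow_zero, LDO.smul_apply] at h1
      refine (smul_eq_zero.1 h1).resolve_left (hc.2 le_rfl) |> fun h2 => ?_
      rw [lft_apply, mulProd_apply] at h2
      simpa using h2
    · intro J hJ hJL
      obtain ⟨c, hc, hc'⟩ := exists_adPow_negPow (A := A) (0 : Fin 1) L J
      have h0 : c = 0 := by
        by_contra hcn
        have hle := hc.1 hcn
        have ho : J.order ≤ L.order := by rw [hL]; exact MultiIdx.mem_upTo.1 hJ
        refine hJL (funext fun i => ?_)
        have := (Finset.sum_eq_sum_iff_of_le fun i _ => hle i).1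
          (le_antisymm (Finset.sum_le_sum fun i _ => hle i) ho)
        exact (this i (Finset.mem_univ i)).symm
      rw [hc' _ fun i => adSlot_mulProd _ _ _, h0, zero_smul]
    · intro hL'
      exact absurd (MultiIdx.mem_upTo.2 hL.le) hL'
  obtain ⟨m, hm⟩ := exists_jetLE q
  induction m with
  | zero =>
    intro J
    by_cases h0 : J.order = 0
    · exact key 0 hm J h0
    · exact hm J (Nat.pos_of_ne_zero h0)
  | succ m ih =>
    refine ih fun J hJ => ?_
    rcases Nat.lt_or_ge (m + 1) J.order with h1 | h1
    · exact hm J h1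
    · exact key (m + 1) hm J (by omega)

/-- Binomial theorem: multiplication by `g` in the slot commutes with multiplication of the output
by `-g`. -/
theorem adSlot_pow_apply (j : Fin n) (g : A) (r : ℕ) (X : LDO A n) (f : Fin n → A) :
    ((adSlot j g ^ r) X).1 f = ∑ i ∈ Finset.range (r + 1),
      (r.choose i : A) * (-g) ^ (r - i) * X.1 (Function.update f j (g ^ i * f j)) := by
  have hc : Commute (rgt j (mulBy g) : Module.End ℝ (LDO A n)) (-lft (mulBy g)) :=
    LinearMap.ext fun X => by
      ext f
      simp only [Module.End.mul_apply, LinearMap.neg_apply, LDO.neg_apply, rgt_apply, lft_apply]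
  have hr : ∀ i (X : LDO A n) f, (((rgt j (mulBy g) : Module.End ℝ (LDO A n)) ^ i) X).1 f
      = X.1 (Function.update f j (g ^ i * f j)) := by
    intro i
    induction i with
    | zero => intro X f; simp
    | succ i ih =>
      intro X f
      rw [pow_succ, Module.End.mul_apply, ih, rgt_apply]
      simp [pow_succ', mul_assoc]
  have hl : ∀ i (X : LDO A n) f, (((-lft (mulBy g) : Module.End ℝ (LDO A n)) ^ i) X).1 f
      = (-g) ^ i * X.1 f := by
    intro i
    induction i with
    | zero => intro X f; simp
    | succ i ih =>
      intro X f
      rw [pow_succ, Module.End.mul_apply, ih, LinearMap.neg_apply, LDO.neg_apply, lft_apply,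
        mulBy_apply]
      ring
  have hs : (adSlot j g : Module.End ℝ (LDO A n)) = rgt j (mulBy g) + -lft (mulBy g) :=
    sub_eq_add_neg _ _
  rw [hs, hc.add_pow, LinearMap.sum_apply, LDO.sum_apply]
  refine Finset.sum_congr rfl fun i _ => ?_
  rw [Module.End.mul_apply, Module.End.mul_apply, hr, hl, ← nsmul_one (r.choose i),
    LinearMap.smul_apply, Module.End.one_apply, ← Nat.cast_smul_eq_nsmul ℝ, LDO.smul_apply,
    Algebra.smul_def]
  simp only [map_natCast]
  ring

theorem iterate_derivation_mul {δ : Derivation ℝ A A} {v : A} (hv : δ v = 0) (w : A) (r : ℕ) :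
    (δ^[r]) (w * v) = (δ^[r]) w * v := by
  induction r generalizing w with
  | zero => rfl
  | succ r ih =>
    rw [Function.iterate_succ_apply, Function.iterate_succ_apply, Derivation.leibniz, hv,
      smul_zero, zero_add, smul_eq_mul, mul_comm v, ih]

theorem iterate_derivation_pow {δ : Derivation ℝ A A} {g : A} (hg : δ g = -1) (r : ℕ) :
    (∀ s < r, (δ^[r]) (g ^ s) = 0) ∧ (δ^[r]) (g ^ r) = (-1) ^ r * (r.factorial : A) := by
  have h0 : ∀ s, δ (g ^ (s + 1)) = g ^ s * (-(s + 1 : ℕ) : A) := fun s => by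
    rw [Derivation.leibniz_pow, hg]
    simp [nsmul_eq_mul]; ring
  have hc : ∀ s : ℕ, δ (-(s + 1 : ℕ) : A) = 0 := fun s => by
    rw [map_neg, Derivation.map_natCast, neg_zero]
  induction r with
  | zero => simp
  | succ r ih =>
    refine ⟨fun s hs => ?_, ?_⟩
    · rcases s with _ | s
      · rw [pow_zero, Function.iterate_succ_apply, Derivation.map_one_eq_zero]
        exact iterate_map_zero δ r
      · rw [Function.iterate_succ_apply, h0, iterate_derivation_mul (hc s), ih.1 s (by omega),
          zero_mul]
    · rw [Function.iterate_succ_apply, h0, iterate_derivation_mul (hc r), ih.2,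
        Nat.factorial_succ]
      push_cast; ring

/-- An operator whose values do not depend on `u` vanishes. -/
theorem apply_eq_zero_of_derU {X : LDO A n} {j : Fin n} {m : ℕ} {S : Set (Fin n → A)}
    (hSm : S ⊆ box A n m)
    (hS : ∀ f ∈ S, Function.update f j (coordU 0 * f j) ∈ S)
    (hX : ∀ f ∈ S, derU 0 (X.1 f) = 0) : ∀ f ∈ S, X.1 f = 0 := by
  intro f hf
  obtain ⟨K, hK⟩ := adSlot_nilpotent j (coordU_mem (A := A) (J := (0 : MultiIdx N)) (m := m)
    (by simp [MultiIdx.order_zero])) X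
  -- The `K`-fold commutator with `u_0` vanishes on `f`. Expanded binomially and differentiated `K`
  -- times along `u_0`, it keeps only the term with `(-u_0)^K`, since all values of `X` involved are
  -- constant in `u_0`; what remains is `± K! X f`.
  have h1 := hK K le_rfl f (hSm hf)
  rw [adSlot_pow_apply] at h1
  have hpow : ∀ i, Function.update f j (coordU 0 ^ i * f j) ∈ S := by
    intro i
    induction i with
    | zero => simpa using hf
    | succ i ih => simpa [pow_succ', mul_assoc] using hS _ ih
  have hg : derU (0 : MultiIdx N) (-(coordU 0 : A)) = -1 := by
    rw [map_neg, derU_coordU, if_pos rfl]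
  have h2 := congrArg ((derU (0 : MultiIdx N) : Derivation ℝ A A).toLinearMap ^ K) h1
  rw [map_sum, map_zero, Finset.sum_eq_single 0] at h2
  · rw [Module.End.pow_apply] at h2
    change (derU (0 : MultiIdx N))^[K] _ = 0 at h2
    simp only [Nat.choose_zero_right, Nat.cast_one, one_mul, pow_zero, Nat.sub_zero] at h2
    rw [Function.update_eq_self, iterate_derivation_mul (hX f hf),
      (iterate_derivation_pow hg K).2] at h2
    have h3 : ((-1) ^ K * (K.factorial : ℝ)) • X.1 f = 0 := by
      rw [Algebra.smul_def]
      simpa using h2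
    refine (smul_eq_zero.1 h3).resolve_left ?_
    exact mul_ne_zero (pow_ne_zero _ (by norm_num)) (by exact_mod_cast K.factorial_ne_zero)
  · intro i hi hi0
    rw [Module.End.pow_apply]
    change (derU (0 : MultiIdx N))^[K] _ = 0
    have hi' := Finset.mem_range.1 hi
    have hc : derU (0 : MultiIdx N) (K.choose i : A) = 0 := Derivation.map_natCast _ _
    rw [iterate_derivation_mul (hX _ (hpow i)), mul_comm (K.choose i : A),
      iterate_derivation_mul hc, (iterate_derivation_pow hg K).1 _ (by omega)]
    simp
  · simp

/-- The operators with values in the total divergences. -/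
def exactValued (A : Type) [CommRing A] [Algebra ℝ A] [JetAlgebra N A] (n : ℕ) :
    Submodule ℝ (LDO A n) where
  carrier := {X | ∀ f, X.1 f ∈ exact A}
  add_mem' hX hY f := add_mem (hX f) (hY f)
  zero_mem' _ := zero_mem _
  smul_mem' c _ hX f := Submodule.smul_mem _ c (hX f)

/-- Commuting with the `x^i` makes `X` linear in the slot over polynomials in `x`. So all polynomial
multiples of a value are exact, which forces the value to be independent of `u`; then
`apply_eq_zero_of_derU` applies. -/
theorem eq_zero_of_exactValued {X : LDO A n} (j : Fin n) (hX : X ∈ exactValued A n)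
    (ha : ∀ i, adSlot j (coordX i) X = 0) : X = 0 := by
  have h1 : ∀ p ∈ xPoly A, ∀ f, X.1 (Function.update f j (p * f j)) = p * X.1 f := by
    intro p hp
    induction hp using Algebra.adjoin_induction with
    | mem x hx =>
      obtain ⟨i, rfl⟩ := hx
      intro f
      have := congrArg (fun Y : LDO A n => Y.1 f) (ha i)
      rw [← sub_eq_zero]
      simpa only [adSlot_apply, LDO.zero_apply] using this
    | algebraMap r =>
      intro f
      rw [← Algebra.smul_def, MultilinearMap.map_update_smul, Function.update_eq_self,
        ← Algebra.smul_def]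
    | add x y _ _ hx hy =>
      intro f
      rw [add_mul, MultilinearMap.map_update_add, hx, hy, add_mul]
    | mul x y _ _ hx hy =>
      intro f
      have := hx (Function.update f j (y * f j))
      rw [Function.update_idem, Function.update_self, ← mul_assoc] at this
      rw [this, hy, mul_assoc]
  have h2 : ∀ f, X.1 f ∈ jetFree A := fun f => jetFree_of_euler fun p hp => by
    rw [← h1 p hp]; exact euler_exact (hX _)
  ext f
  obtain ⟨m, hm⟩ := exists_box f
  exact apply_eq_zero_of_derU (j := j) (m := m) (S := box A n m) subset_rfl
    (fun f hf => update_mem_box hf (mul_mem (coordU_mem (by simp [MultiIdx.order_zero])) (hf j)))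
    (fun f _ => h2 f 0) f hm

theorem diff_ldoD_apply (e : Finset (Fin N) → LDO A n) (T : Finset (Fin N)) (f : Fin n → A) :
    (Koszul.diff ldoD e T).1 f
      = ∑ i ∈ T, Koszul.sgn i T • derD i ((e (T.erase i)).1 f) := by
  rw [Koszul.diff, LDO.sum_apply]
  refine Finset.sum_congr rfl fun i _ => ?_
  exact map_zsmul (LDO.eval f) _ _

theorem diff_ldoD_mem (e : Finset (Fin N) → LDO A n) (T : Finset (Fin N)) :
    Koszul.diff ldoD e T ∈ exactValued A n := fun f => by
  rw [diff_ldoD_apply]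
  exact sum_mem fun i _ => zsmul_mem (derD_mem_exact i _) _

/-- Closed operator-valued forms of degree less than `N`, and operator-valued top forms with exact
values, are exact. -/
theorem exists_primitive (j : Fin n) {k : ℤ} {w : Finset (Fin N) → LDO A n}
    (hw : Koszul.IsForm k w) (hc : Koszul.diff ldoD w = 0)
    (hN : k = N → w Finset.univ ∈ exactValued A n) :
    ∃ e, Koszul.IsForm (k - 1) e ∧ Koszul.diff ldoD e = w := by
  obtain ⟨e, v, h, he, hv, hvu, ha⟩ := exists_primitive_add_normal j hw hc
  refine ⟨e, he, ?_⟩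
  have hv0 : v = 0 := by
    funext S
    by_cases hS : S = Finset.univ
    · subst hS
      by_cases hk : k = N
      · refine eq_zero_of_exactValued j ?_ fun i => ha i _
        have : v Finset.univ = w Finset.univ - Koszul.diff ldoD e Finset.univ := by
          rw [h, Pi.add_apply, add_sub_cancel_left]
        rw [this]
        exact sub_mem (hN hk) (diff_ldoD_mem e _)
      · exact hv _ (by simpa using Ne.symm hk)
    · exact hvu S hS
  rw [h, hv0, add_zero]

/-- Pointwise exactness of the values is lifted to a formula with operators: the top form with
coefficient `X` has a primitive, whose components are the `Y i` up to sign. -/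
theorem exists_divergence (j : Fin n) {X : LDO A n} (hX : X ∈ exactValued A n) :
    ∃ Y : Fin N → LDO A n, X = ∑ i, lft (totD i) (Y i) := by
  classical
  let w : Finset (Fin N) → LDO A n := Pi.single Finset.univ X
  have hw : Koszul.IsForm (N : ℤ) w := fun S hS => by
    have : S ≠ Finset.univ := by rintro rfl; simp at hS
    simp [w, this]
  have hc : Koszul.diff ldoD w = 0 := by
    funext T
    refine (hw.diff ldoD) T fun h => ?_
    have := Finset.card_le_univ T
    simp only [Fintype.card_fin] at this
    omega
  obtain ⟨e, -, he⟩ := exists_primitive j hw hc fun _ => by simpa [w] using hX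
  refine ⟨fun i => (Koszul.sgn i Finset.univ) • e (Finset.univ.erase i), ?_⟩
  have := congrFun he Finset.univ
  simp only [w, Pi.single_eq_same] at this
  rw [← this, Koszul.diff]
  refine Finset.sum_congr rfl fun i _ => ?_
  rw [map_zsmul]; rfl

end JetAlgebra

/-! ### Symbol calculus: counting vertical derivatives in a slot. -/

namespace JetAlgebra

variable {N : ℕ} {A : Type} [CommRing A] [Algebra ℝ A] [JetAlgebra N A] {n : ℕ}

theorem rgt_comm {j k : Fin n} (h : j ≠ k) (P Q : diffOp A) (X : LDO A n) :
    rgt j P (rgt k Q X) = rgt k Q (rgt j P X) := by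
  ext f
  simp only [rgt_apply]
  rw [Function.update_comm h, Function.update_of_ne (Ne.symm h), Function.update_of_ne h]

theorem rgt_mul (j : Fin n) (P Q : diffOp A) (X : LDO A n) :
    rgt j (P * Q) X = rgt j Q (rgt j P X) := by
  ext f
  simp only [rgt_apply, Function.update_self, Function.update_idem]
  rfl

theorem lft_rgt (j : Fin n) (P Q : diffOp A) (X : LDO A n) :
    lft P (rgt j Q X) = rgt j Q (lft P X) := rfl

theorem adSlot_rgt {j k : Fin n} (h : j ≠ k) (g : A) (Q : diffOp A) (X : LDO A n) :
    adSlot j g (rgt k Q X) = rgt k Q (adSlot j g X) := by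
  show rgt j (mulBy g) (rgt k Q X) - lft (mulBy g) (rgt k Q X) = _
  rw [rgt_comm h, lft_rgt, ← map_sub]; rfl

theorem adSlot_verD (j : Fin n) (i : Fin N) (K : MultiIdx N) (X : LDO A n) :
    adSlot j (coordX i) (rgt j (verD K) X) = rgt j (verD K) (adSlot j (coordX i) X) := by
  ext f
  simp only [adSlot_apply, rgt_apply, Function.update_self, Function.update_idem, verD_apply,
    Derivation.leibniz, derU_coordX, mul_zero, add_zero, smul_eq_mul]

theorem adSlot_rgt_totD (j : Fin n) (k i : Fin N) (X : LDO A n) :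
    adSlot j (coordX k) (rgt j (totD i) X)
      = rgt j (totD i) (adSlot j (coordX k) X) + if k = i then X else 0 := by
  ext f
  rw [LDO.add_apply]
  simp only [adSlot_apply, rgt_apply, Function.update_self, Function.update_idem, totD_apply,
    Derivation.leibniz, derD_coordX, smul_eq_mul, MultilinearMap.map_update_add]
  by_cases h : k = i
  · subst h
    simp only [if_true, mul_one, Function.update_eq_self]
    ring
  · simp only [if_neg h, if_neg (Ne.symm h), mul_zero, LDO.zero_apply, add_zero,
      MultilinearMap.map_update_zero]

theorem adPow_comm {j : Fin n} {T : Module.End ℝ (LDO A n)}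
    (hT : ∀ i X, adSlot j (coordX i) (T X) = T (adSlot j (coordX i) X)) (L : MultiIdx N)
    (X : LDO A n) : adPow j L (T X) = T (adPow j L X) := by
  induction L using MultiIdx.induct with
  | h0 => rw [adPow_zero, adPow_zero]
  | hs L i ih => rw [adPow_add_single, adPow_add_single, ih, hT]

/-- Any operation with a Heisenberg commutation relation behaves like multiplication of symbols by a
variable; this covers total derivatives on the input and on the output alike. -/
theorem adPow_heisenberg {j : Fin n} {i : Fin N} {T : Module.End ℝ (LDO A n)}
    (hT : ∀ k X, adSlot j (coordX k) (T X) = T (adSlot j (coordX k) X) + if k = i then X else 0)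
    (L : MultiIdx N) (X : LDO A n) :
    adPow j L (T X) = T (adPow j L X) + (L i : ℝ) • adPow j (L - Pi.single i 1) X := by
  induction L using MultiIdx.induct with
  | h0 => simp [adPow_zero]
  | hs L k ih =>
    rw [adPow_add_single, adPow_add_single, ih, map_add, map_smul, hT, add_assoc]
    congr 1
    rw [← adPow_add_single]
    by_cases hk : k = i
    · subst hk
      rw [if_pos rfl, add_tsub_cancel_right, Pi.add_apply, Pi.single_eq_same]
      by_cases h0 : L k = 0
      · simp [h0]
      · rw [MultiIdx.sub_add_single h0]
        push_cast
        module
    · rw [if_neg hk, zero_add, Pi.add_apply, Pi.single_eq_of_ne (Ne.symm hk), add_zero]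
      congr 2
      refine congrArg (adPow j) (funext fun l => ?_)
      by_cases hl : l = i
      · subst hl; simp [Ne.symm hk]
      · simp [hl]

theorem adPow_rgt_totD (j : Fin n) (i : Fin N) (L : MultiIdx N) (X : LDO A n) :
    adPow j L (rgt j (totD i) X)
      = rgt j (totD i) (adPow j L X) + (L i : ℝ) • adPow j (L - Pi.single i 1) X :=
  adPow_heisenberg (T := rgt j (totD i)) (fun k X => adSlot_rgt_totD j k i X) L X

theorem adPow_lft_totD (j : Fin n) (i : Fin N) (L : MultiIdx N) (X : LDO A n) :
    adPow j L (lft (totD i) X)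
      = lft (totD i) (adPow j L X) + (L i : ℝ) • adPow j (L - Pi.single i 1) X :=
  adPow_heisenberg (T := lft (totD i))
    (fun k X => by rw [adSlot_totD]; simp only [eq_comm]) L X

theorem adPow_mulProd {j : Fin n} {L : MultiIdx N} (hL : L ≠ 0) (g : A) :
    adPow j L (mulProd n g) = 0 := by
  induction L using MultiIdx.induct with
  | h0 => exact absurd rfl hL
  | hs L i ih =>
    rw [adPow_add_single]
    by_cases h : L = 0
    · rw [h, adPow_zero, adSlot_mulProd]
    · rw [ih h, map_zero]

theorem adPow_vanish (j : Fin n) {m : ℕ} {X : LDO A n} (hX : X ∈ vanish A n m) (L : MultiIdx N) :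
    adPow j L X ∈ vanish A n m := by
  induction L using MultiIdx.induct with
  | h0 => rwa [adPow_zero]
  | hs L i ih => rw [adPow_add_single]; exact adSlot_vanish (coordX_mem i m) ih

theorem adPow_nilpotent (j : Fin n) (i : Fin N) (m : ℕ) (L : MultiIdx N) : ∀ (K : ℕ) (X : LDO A n),
    (∀ k, K ≤ k → (adSlot j (coordX i) ^ k) X ∈ vanish A n m) → K ≤ L i →
      adPow j L X ∈ vanish A n m := by
  induction L using MultiIdx.induct with
  | h0 =>
    intro K X h hK
    rw [adPow_zero]
    exact h 0 hK
  | hs L k ih =>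
    intro K X h hK
    have e : adPow j (L + Pi.single k 1) X = adPow j L (adSlot j (coordX k) X) :=
      LinearMap.congr_fun (MultiIdx.pow_add_single' (fun _ _ => adSlot_commute j _ _) L k) X
    rw [e]
    by_cases hk : k = i
    · subst hk
      refine ih (K - 1) _ (fun r hr => ?_) (by simp at hK; omega)
      have := h (r + 1) (by omega)
      rwa [pow_succ, Module.End.mul_apply] at this
    · refine ih K _ (fun r hr => ?_) (by simpa [Ne.symm hk] using hK)
      have e' : (adSlot j (coordX i) ^ r) (adSlot j (coordX k) X)
          = adSlot j (coordX k) ((adSlot j (coordX i) ^ r) X) :=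
        LinearMap.congr_fun ((adSlot_commute (n := n) j (coordX (A := A) i) (coordX k)).pow_left r) X
      rw [e']
      exact adSlot_vanish (coordX_mem k m) (h r hr)

theorem locallyZero_adPow (j : Fin n) (X : LDO A n) : LocallyZero fun L => adPow j L X :=
  locallyZero_of_finset fun m => by
    choose K hK using fun i => adSlot_nilpotent j (coordX_mem (A := A) i m) X
    refine ⟨Finset.Iic K, fun L hL => ?_⟩
    rw [Finset.mem_Iic, Pi.le_def] at hL
    -- Outside the finite box `Iic K` some exponent exceeds its nilpotency bound.
    push Not at hL
    obtain ⟨i, hi⟩ := hL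
    exact adPow_nilpotent j i m L (K i) X (hK i) hi.le

/-- The sum of a pointwise locally finite family of linear maps. -/
def lsumMap {ι : Type*} (Φ : ι → Module.End ℝ (LDO A n)) (h : ∀ X, LocallyZero fun k => Φ k X) :
    Module.End ℝ (LDO A n) where
  toFun X := lsum fun k => Φ k X
  map_add' X Y := by simp only [map_add]; exact lsum_add (h X) (h Y)
  map_smul' c X := by simp only [map_smul]; exact lsum_smul (h X) c

/-! ### The symbol derivative -/

section symbol

variable (j : Fin n) (J : MultiIdx N)

/-- `1 / L! · u_{J + L} ad_x^L X`. -/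
def symTerm (L : MultiIdx N) (X : LDO A n) : LDO A n :=
  ((MultiIdx.fact L : ℝ)⁻¹) • lft (mulBy (coordU (J + L))) (adPow j L X)

theorem locallyZero_symTerm (X : LDO A n) : LocallyZero fun L => symTerm j J L X :=
  ((locallyZero_adPow j X).lft fun L => mulBy (coordU (J + L))).smul _

/-- `∑_L 1 / L! · u_{J + L} ad_x^L X`. -/
def symSum (X : LDO A n) : LDO A n := lsum fun L => symTerm j J L X

/-- The derivative of the symbol of an operator with respect to the symbol of `∂/∂u_J` in the
slot `j`. -/
def symDer : Module.End ℝ (LDO A n) where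
  -- Precomposition with `u_J` acts both through `∂/∂u_J` and through the total derivatives in `X`.
  -- By Leibniz `d^I u_J = ∑_L binom(I,L) u_{J+L} d^{I-L}`, and `ad_x^L / L!` replaces `d^I` by
  -- `binom(I,L) d^{I-L}`. Subtracting the sum, whose zeroth term is `u_J X`, removes the second
  -- effect and leaves the first.
  toFun X := rgt j (mulBy (coordU J)) X - symSum j J X
  map_add' X Y := by
    have : symSum j J (X + Y) = symSum j J X + symSum j J Y := by
      rw [symSum, symSum, symSum,
        ← lsum_add (locallyZero_symTerm j J X) (locallyZero_symTerm j J Y)]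
      congr 1; funext L
      simp [symTerm]
    rw [this, map_add]; abel
  map_smul' c X := by
    have : symSum j J (c • X) = c • symSum j J X := by
      rw [symSum, symSum, ← lsum_smul (locallyZero_symTerm j J X)]
      congr 1; funext L
      rw [symTerm, symTerm, map_smul, map_smul, smul_comm]
    rw [this, map_smul, smul_sub, RingHom.id_apply]

theorem symDer_eq (X : LDO A n) :
    symDer j J X = rgt j (mulBy (coordU J)) X - symSum j J X := rfl

variable {j}

theorem symSum_comm {Φ : Module.End ℝ (LDO A n)} (hΦ : Summing Φ)
    (hl : ∀ P X, Φ (lft P X) = lft P (Φ X))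
    (ha : ∀ i X, adSlot j (coordX i) (Φ X) = Φ (adSlot j (coordX i) X)) (X : LDO A n) :
    symSum j J (Φ X) = Φ (symSum j J X) := by
  rw [symSum, symSum, (hΦ _ (locallyZero_symTerm j J X)).2]
  congr 1; funext L
  rw [symTerm, symTerm, adPow_comm ha, map_smul, hl]

theorem symDer_rgt {k : Fin n} (h : j ≠ k) (Q : diffOp A) (X : LDO A n) :
    symDer j J (rgt k Q X) = rgt k Q (symDer j J X) := by
  rw [symDer_eq, symDer_eq, map_sub, rgt_comm h,
    symSum_comm J (summing_rgt k Q) (fun _ _ => rfl) fun i X => adSlot_rgt h _ Q X]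

/-- The canonical relation `[∂/∂p_J, p_K] = δ_{JK}` on symbols, which justifies the name of the
operation. -/
theorem symDer_verD (K : MultiIdx N) (X : LDO A n) :
    symDer j J (rgt j (verD K) X)
      = rgt j (verD K) (symDer j J X) + if J = K then X else 0 := by
  rw [symDer_eq, symDer_eq, map_sub,
    symSum_comm J (summing_rgt j (verD K)) (fun _ _ => rfl) fun i X => adSlot_verD j i K X]
  have : rgt j (mulBy (coordU J)) (rgt j (verD K) X)
      = rgt j (verD K) (rgt j (mulBy (coordU J)) X) + if J = K then X else 0 := by
    ext f
    rw [LDO.add_apply]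
    simp only [rgt_apply, Function.update_self, Function.update_idem, verD_apply, mulBy_apply,
      Derivation.leibniz, derU_coordU, smul_eq_mul, MultilinearMap.map_update_add]
    by_cases h : J = K
    · subst h
      simp only [if_true, mul_one, Function.update_eq_self]
    · simp only [if_neg h, if_neg (Ne.symm h), mul_zero, LDO.zero_apply, add_zero,
        MultilinearMap.map_update_zero]
  rw [this]; abel

/-- Shifting the index in the sum that defines the symbol derivative. -/
theorem lsum_shift (i : Fin N) (X : LDO A n) :
    LocallyZero (fun L => ((MultiIdx.fact L : ℝ)⁻¹) • lft (mulBy (coordU (J + L)))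
      ((L i : ℝ) • adPow j (L - Pi.single i 1) X)) ∧
    lsum (fun L => ((MultiIdx.fact L : ℝ)⁻¹) • lft (mulBy (coordU (J + L)))
      ((L i : ℝ) • adPow j (L - Pi.single i 1) X)) = symSum j (J + Pi.single i 1) X := by
  have hz : LocallyZero (fun L => ((MultiIdx.fact L : ℝ)⁻¹) • lft (mulBy (coordU (J + L)))
      ((L i : ℝ) • adPow j (L - Pi.single i 1) X)) := by
    have h1 : LocallyZero fun L : MultiIdx N => (L i : ℝ) • adPow j (L - Pi.single i 1) X := by
      refine locallyZero_of_finset fun m => ?_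
      obtain ⟨s, hs⟩ := (locallyZero_adPow j X).finset m
      classical
      refine ⟨s.image (· + Pi.single i 1), fun L hL => ?_⟩
      by_cases h0 : L i = 0
      · rw [h0, Nat.cast_zero, zero_smul]; exact zero_mem _
      · refine Submodule.smul_mem _ _ (hs _ fun h => hL ?_)
        exact Finset.mem_image.2 ⟨_, h, MultiIdx.sub_add_single h0⟩
    exact (h1.lft _).smul _
  refine ⟨hz, ?_⟩
  rw [← lsum_comp_injective hz (e := fun J : MultiIdx N => J + Pi.single i 1)
      (fun _ _ h => add_right_cancel h), symSum]
  · congr 1; funext L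
    rw [symTerm, map_smul, smul_smul, add_tsub_cancel_right, MultiIdx.fact_add_single, add_assoc,
      add_comm (Pi.single i 1 : MultiIdx N) L]
    congr 1
    have := MultiIdx.fact_ne_zero L
    have h2 : (L i : ℝ) + 1 ≠ 0 := by positivity
    simp only [Pi.add_apply, Pi.single_eq_same]
    push_cast
    field_simp
  · intro L hL
    have h0 : L i = 0 := by
      by_contra h0
      exact hL ⟨L - Pi.single i 1, MultiIdx.sub_add_single h0⟩
    simp [h0]

/-- The additional term reflects `∂/∂u_{J+i} ∘ d/dx^i = d/dx^i ∘ ∂/∂u_{J+i} + ∂/∂u_J`: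
precomposition with `d/dx^i` creates a `∂/∂u_J` out of every `∂/∂u_{J+i}`. -/
theorem symDer_rgt_totD (i : Fin N) (X : LDO A n) :
    symDer j J (rgt j (totD i) X)
      = rgt j (totD i) (symDer j J X) + symDer j (J + Pi.single i 1) X := by
  have h1 : rgt j (mulBy (coordU J)) (rgt j (totD i) X)
      = rgt j (totD i) (rgt j (mulBy (coordU J)) X) + rgt j (mulBy (coordU (J + Pi.single i 1))) X := by
    ext f
    rw [LDO.add_apply]
    simp only [rgt_apply, Function.update_self, Function.update_idem, totD_apply, mulBy_apply,
      Derivation.leibniz, derD_coordU, smul_eq_mul, MultilinearMap.map_update_add]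
    rw [mul_comm (f j)]
  have h2 : symSum j J (rgt j (totD i) X)
      = rgt j (totD i) (symSum j J X) + symSum j (J + Pi.single i 1) X := by
    obtain ⟨hz, hs⟩ := lsum_shift (j := j) J i X
    rw [← hs, symSum, symSum, rgt_lsum (locallyZero_symTerm j J X), ← lsum_add _ hz]
    · congr 1; funext L
      rw [symTerm, symTerm, adPow_rgt_totD, map_add, smul_add, map_smul (rgt j (totD i)), lft_rgt]
    · exact (locallyZero_symTerm j J X).rgt j _
  rw [symDer_eq, symDer_eq, symDer_eq, h1, h2, map_sub]; abel

/-- On the output side the shifted sum from `ad_x^L` cancels against the derivative of the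
coefficients `u_{J+L}`, so no correction remains. -/
theorem symDer_lft_totD (i : Fin N) (X : LDO A n) :
    symDer j J (lft (totD i) X) = lft (totD i) (symDer j J X) := by
  have h2 : symSum j J (lft (totD i) X) = lft (totD i) (symSum j J X) := by
    obtain ⟨hz, hs⟩ := lsum_shift (j := j) J i X
    have h3 : LocallyZero fun L => lft (totD i) (symTerm j J L X) :=
      (locallyZero_symTerm j J X).lft fun _ => totD i
    have h4 := locallyZero_symTerm j (J + Pi.single i 1) X
    have h5 : lft (totD i) (symSum j J X)
        = lsum (fun L => lft (totD i) (symTerm j J L X) - symTerm j (J + Pi.single i 1) L X)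
          + symSum j (J + Pi.single i 1) X := by
      rw [lsum_sub h3 h4, symSum, lft_lsum (locallyZero_symTerm j J X)]
      exact (sub_add_cancel _ _).symm
    rw [h5, ← hs, symSum, ← lsum_add (h3.sub h4) hz]
    congr 1; funext L
    rw [symTerm, symTerm, symTerm, adPow_lft_totD, map_add, smul_add, map_smul (lft (totD i)),
      ← smul_sub]
    congr 2
    ext f
    simp only [lft_apply, mulBy_apply, totD_apply, LDO.sub_apply, Derivation.leibniz, smul_eq_mul,
      derD_coordU]
    rw [add_right_comm J L]
    ring
  rw [symDer_eq, symDer_eq, h2, map_sub]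
  rfl

theorem symDer_mulProd (g : A) : symDer j J (mulProd n g) = 0 := by
  have h : symSum j J (mulProd n g) = rgt j (mulBy (coordU J)) (mulProd n g) := by
    have hz := locallyZero_symTerm j J (mulProd n g)
    rw [symSum, ← lsum_comp_injective hz (e := fun _ : Unit => 0) (fun _ _ _ => rfl)]
    · ext f
      rw [lsum_apply (hz.comp_injective fun _ _ _ => rfl), finsum_unique, symTerm, adPow_zero]
      simp only [MultiIdx.fact, Pi.zero_apply, Nat.factorial_zero, Finset.prod_const_one,
        Nat.cast_one, inv_one, one_smul, add_zero, lft_apply, rgt_apply, mulBy_apply,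
        mulProd_apply, prod_update_mul]
      ring
    · intro L hL
      rw [symTerm, adPow_mulProd (fun h => hL ⟨(), h.symm⟩), map_zero, smul_zero]
  rw [symDer_eq, h, sub_self]

theorem symDer_vanish {m : ℕ} (hJ : J.order ≤ m) {X : LDO A n} (hX : X ∈ vanish A n m) :
    symDer j J X ∈ vanish A n m :=
  sub_mem (rgt_vanish j (fun _ hf => mul_mem (coordU_mem hJ) hf) hX)
    (lsum_vanish (locallyZero_symTerm j J X) fun L =>
      Submodule.smul_mem _ _ (lft_vanish _ (adPow_vanish j hX L)))

end symbol

/-! ### Counting the vertical derivatives in one slot -/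

section count

variable (j : Fin n)

/-- Arguments of jet order `m` have no derivatives of higher order. Hence `∑_J X_J ∘ ∂/∂u_J` is
locally finite for an arbitrary family `X_J`. -/
theorem verD_vanish {m : ℕ} {J : MultiIdx N} (hJ : m < J.order) (X : LDO A n) :
    rgt j (verD J) X ∈ vanish A n m := fun f hf => by
  rw [rgt_apply, verD_apply, hf j J hJ, MultilinearMap.map_update_zero]

theorem locallyZero_verD (X : MultiIdx N → LDO A n) :
    LocallyZero fun J => rgt j (verD J) (X J) := locallyZero_of_finset fun m =>
  ⟨MultiIdx.upTo N m, fun J hJ => verD_vanish j (by simpa [MultiIdx.mem_upTo] using hJ) _⟩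

/-- The operator that multiplies an operator with `k` vertical derivatives in the slot `j`
by `k`. -/
def count : Module.End ℝ (LDO A n) :=
  lsumMap (fun J => (rgt j (verD J) : Module.End ℝ (LDO A n)) * symDer j J)
    fun _ => locallyZero_verD j _

theorem count_eq (X : LDO A n) : count j X = lsum fun J => rgt j (verD J) (symDer j J X) := rfl

theorem count_sub_sum (X : LDO A n) (m : ℕ) :
    count j X - ∑ J ∈ MultiIdx.upTo N m, rgt j (verD J) (symDer j J X) ∈ vanish A n m :=
  lsum_sub_sum (locallyZero_verD j _) fun J hJ =>
    verD_vanish j (by simpa [MultiIdx.mem_upTo] using hJ) _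

theorem count_vanish {m : ℕ} {X : LDO A n} (hX : X ∈ vanish A n m) : count j X ∈ vanish A n m := by
  have h := count_sub_sum j X m
  have h2 : ∑ J ∈ MultiIdx.upTo N m, rgt j (verD J) (symDer j J X) ∈ vanish A n m :=
    sum_mem fun J hJ => rgt_vanish j (fun f hf => derU_mem hf J)
      (symDer_vanish J (MultiIdx.mem_upTo.1 hJ) hX)
  simpa using add_mem h h2

theorem count_rgt {k : Fin n} (h : j ≠ k) (Q : diffOp A) (X : LDO A n) :
    count j (rgt k Q X) = rgt k Q (count j X) := by
  rw [count_eq, count_eq, rgt_lsum (locallyZero_verD j _)]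
  congr 1; funext J
  rw [symDer_rgt J h, rgt_comm h]

theorem count_lft_totD (i : Fin N) (X : LDO A n) :
    count j (lft (totD i) X) = lft (totD i) (count j X) := by
  rw [count_eq, count_eq, lft_lsum (locallyZero_verD j _)]
  congr 1; funext J
  rw [symDer_lft_totD, lft_rgt]

theorem count_mulProd (g : A) : count j (mulProd n g) = 0 := by
  rw [count_eq]
  simp only [symDer_mulProd, map_zero]
  exact lsum_zero

theorem count_verD (K : MultiIdx N) (X : LDO A n) :
    count j (rgt j (verD K) X) = rgt j (verD K) (count j X) + rgt j (verD K) X := by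
  have hz : LocallyZero fun J : MultiIdx N => rgt j (verD J) (if J = K then X else 0) :=
    locallyZero_verD j _
  have h1 : lsum (fun J : MultiIdx N => rgt j (verD J) (if J = K then X else 0))
      = rgt j (verD K) X := by
    rw [← lsum_comp_injective hz (e := fun _ : Unit => K) (fun _ _ _ => rfl)]
    · ext f
      rw [lsum_apply (hz.comp_injective fun _ _ _ => rfl), finsum_unique, if_pos rfl]
    · intro L hL
      rw [if_neg (fun h => hL ⟨(), h.symm⟩), map_zero]
  rw [count_eq, count_eq, rgt_lsum (locallyZero_verD j _)]
  conv_rhs => rw [← h1]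
  rw [← lsum_add ((locallyZero_verD j _).rgt j _) hz]
  congr 1; funext J
  rw [symDer_verD, map_add]
  congr 1
  ext f
  simp only [rgt_apply, Function.update_self, Function.update_idem, verD_apply, derU_comm J K]

theorem rgt_totD_verD (i : Fin N) (J : MultiIdx N) (X : LDO A n) :
    rgt j (verD J) (rgt j (totD i) X) = rgt j (totD i) (rgt j (verD J) X)
      - if J i = 0 then 0 else rgt j (verD (J - Pi.single i 1)) X := by
  ext f
  rw [LDO.sub_apply]
  split_ifs with h
  · simp only [rgt_apply, Function.update_self, Function.update_idem, verD_apply, totD_apply,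
      derU_derD, if_pos h, LDO.zero_apply, sub_zero, add_zero]
  · simp only [rgt_apply, Function.update_self, Function.update_idem, verD_apply, totD_apply,
      derU_derD, if_neg h, MultilinearMap.map_update_add, add_sub_cancel_right]

/-- The corrections from the symbol derivative and from commuting `∂/∂u_J` past `d/dx^i` are the
same sum up to the shift `J ↦ J + i`, with opposite signs. -/
theorem count_rgt_totD (i : Fin N) (X : LDO A n) :
    count j (rgt j (totD i) X) = rgt j (totD i) (count j X) := by
  have h1 := (locallyZero_verD (A := A) j fun J => symDer j J X).rgt j (totD i)
  have h2 : LocallyZero fun J => rgt j (verD J) (symDer j (J + Pi.single i 1) X) :=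
    locallyZero_verD j _
  have h3 : LocallyZero fun J : MultiIdx N => if J i = 0 then (0 : LDO A n) else
      rgt j (verD (J - Pi.single i 1)) (symDer j J X) := by
    refine locallyZero_of_finset fun m => ⟨MultiIdx.upTo N (m + 1), fun J hJ => ?_⟩
    rw [MultiIdx.mem_upTo] at hJ
    split_ifs with h
    · exact zero_mem _
    · refine verD_vanish j ?_ _
      have := MultiIdx.order_add_single (J - Pi.single i 1) i
      rw [MultiIdx.sub_add_single h] at this
      omega
  have h4 : lsum (fun J => rgt j (verD J) (symDer j (J + Pi.single i 1) X))
      = lsum fun J : MultiIdx N => if J i = 0 then (0 : LDO A n) else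
        rgt j (verD (J - Pi.single i 1)) (symDer j J X) := by
    rw [← lsum_comp_injective h3 (e := fun J : MultiIdx N => J + Pi.single i 1)
      (fun _ _ h => add_right_cancel h)]
    · congr 1; funext J
      rw [if_neg (by simp), add_tsub_cancel_right]
    · intro J hJ
      rw [if_pos]
      by_contra h0
      exact hJ ⟨J - Pi.single i 1, MultiIdx.sub_add_single h0⟩
  have h5 : count j (rgt j (totD i) X)
      = lsum (fun J => rgt j (totD i) (rgt j (verD J) (symDer j J X))
        - if J i = 0 then (0 : LDO A n) else rgt j (verD (J - Pi.single i 1)) (symDer j J X))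
        + lsum fun J => rgt j (verD J) (symDer j (J + Pi.single i 1) X) := by
    rw [← lsum_add (h1.sub h3) h2, count_eq]
    congr 1; funext J
    rw [symDer_rgt_totD, map_add, rgt_totD_verD]
  rw [h5, lsum_sub h1 h3, h4, sub_add_cancel, count_eq, rgt_lsum (locallyZero_verD j _)]

/-- `∏_{t = 1}^s (1 - y / t)` at `y = count`. -/
def binom : ℕ → Module.End ℝ (LDO A n)
  | 0 => 1
  | s + 1 => binom s - ((s : ℝ) + 1)⁻¹ • (count j * binom s)

theorem binom_zero (X : LDO A n) : binom j 0 X = X := rfl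

theorem binom_succ (s : ℕ) (X : LDO A n) :
    binom j (s + 1) X = binom j s X - ((s : ℝ) + 1)⁻¹ • count j (binom j s X) := rfl

variable {j}

theorem binom_comm {Φ : Module.End ℝ (LDO A n)} (h : ∀ X, count j (Φ X) = Φ (count j X)) (s : ℕ)
    (X : LDO A n) : binom j s (Φ X) = Φ (binom j s X) := by
  induction s with
  | zero => rfl
  | succ s ih => rw [binom_succ, binom_succ, ih, h, map_sub, map_smul]

theorem binom_vanish {m : ℕ} {X : LDO A n} (hX : X ∈ vanish A n m) (s : ℕ) :
    binom j s X ∈ vanish A n m := by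
  induction s with
  | zero => exact hX
  | succ s ih => rw [binom_succ]; exact sub_mem ih (Submodule.smul_mem _ _ (count_vanish j ih))

/-- The factor with `t = k + 1` of `∏ (1 - y / t)` vanishes at the eigenvalue `k + 1`. -/
theorem binom_eq_zero {X : LDO A n} {k : ℕ} (hX : count j X = ((k : ℝ) + 1) • X) {s : ℕ}
    (hs : k < s) : binom j s X = 0 := by
  obtain ⟨s, rfl⟩ := Nat.exists_eq_add_of_lt hs
  induction s with
  | zero =>
    have h : count j (binom j k X) = ((k : ℝ) + 1) • binom j k X := by
      rw [← binom_comm (Φ := count j) (fun _ => rfl), hX, map_smul]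
    show binom j (k + 1) X = 0
    rw [binom_succ, h, smul_smul, inv_mul_cancel₀ (by positivity), one_smul, sub_self]
  | succ s ih =>
    have := ih (by omega)
    rw [show k + (s + 1) + 1 = (k + s + 1) + 1 by ring, binom_succ, this, map_zero, smul_zero,
      sub_self]

theorem binom_of_count_eq_zero {X : LDO A n} (hX : count j X = 0) (s : ℕ) : binom j s X = X := by
  induction s with
  | zero => rfl
  | succ s ih => rw [binom_succ, ih, hX, smul_zero, sub_zero]

end count

/-! ### Generators -/

/-- The operators generated by `f ↦ g ∏ⱼ fⱼ` under precomposition with total derivatives and, in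
the slots in `U`, with vertical derivatives. -/
inductive Gen (U : Set (Fin n)) : LDO A n → Prop
  | mulProd (g : A) : Gen U (mulProd n g)
  | add {X Y : LDO A n} : Gen U X → Gen U Y → Gen U (X + Y)
  | totD {X : LDO A n} (k : Fin n) (i : Fin N) : Gen U X → Gen U (rgt k (totD i) X)
  | verD {X : LDO A n} (k : Fin n) (J : MultiIdx N) : k ∈ U → Gen U X → Gen U (rgt k (verD J) X)

theorem Gen.zero {U : Set (Fin n)} : Gen U (0 : LDO A n) := by
  have : (0 : LDO A n) = JetAlgebra.mulProd n 0 := by ext f; simp [mulProd_apply]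
  rw [this]; exact Gen.mulProd 0

/-- Multiplication is not among the generating operations; it is moved inwards through the
derivations by Leibniz until it is absorbed by `mulProd`. -/
theorem Gen.mulBy {U : Set (Fin n)} {X : LDO A n} (hX : Gen U X) :
    ∀ (k : Fin n) (g : A), Gen U (rgt k (mulBy g) X) := by
  have hder : ∀ {T : diffOp A} (δ : Derivation ℝ A A), (∀ f, T.1 f = δ f) → ∀ (k l : Fin n) (g : A)
      (X : LDO A n), (∀ g, Gen U (rgt l T (rgt k (JetAlgebra.mulBy g) X))) →
      (∀ g, Gen U (rgt k (JetAlgebra.mulBy g) X)) →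
      Gen U (rgt k (JetAlgebra.mulBy g) (rgt l T X)) := by
    intro T δ hδ k l g X h1 h2
    by_cases hkl : k = l
    · subst hkl
      have : rgt k (JetAlgebra.mulBy g) (rgt k T X)
          = rgt k T (rgt k (JetAlgebra.mulBy g) X) + rgt k (JetAlgebra.mulBy (δ g)) X := by
        ext f
        rw [LDO.add_apply]
        simp only [rgt_apply, Function.update_self, Function.update_idem, hδ, mulBy_apply,
          Derivation.leibniz, smul_eq_mul, MultilinearMap.map_update_add]
        rw [mul_comm (f k)]
      rw [this]
      exact (h1 g).add (h2 _)
    · rw [rgt_comm hkl]; exact h1 g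
  induction hX with
  | mulProd h =>
    intro k g
    have : rgt k (JetAlgebra.mulBy g) (JetAlgebra.mulProd n h) = JetAlgebra.mulProd n (g * h) := by
      ext f
      rw [rgt_apply, mulProd_apply, mulBy_apply, prod_update_mul, mulProd_apply]; ring
    rw [this]; exact Gen.mulProd _
  | add _ _ hX hY => intro k g; rw [map_add]; exact (hX k g).add (hY k g)
  | totD l i _ hX =>
    exact fun k g => hder (derD i) (fun _ => rfl) k l g _ (fun g => (hX k g).totD l i) (hX k)
  | verD l J hl _ hX =>
    exact fun k g => hder (derU J) (fun _ => rfl) k l g _ (fun g => (hX k g).verD l J hl) (hX k)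

/-- The statement is proved for all generated `X` at once, so that it passes to compositions of
operators. -/
theorem Gen.finDiffOp {X : LDO A n} (hX : Gen Set.univ X) (k : Fin n) {P : Op A}
    (hP : P ∈ JetAlgebra.finDiffOp A) : Gen Set.univ (rgt k ⟨P, finDiffOp_le hP⟩ X) := by
  have key : ∃ hP : P ∈ diffOp A, ∀ X : LDO A n, Gen Set.univ X →
      Gen Set.univ (rgt k ⟨P, hP⟩ X) := by
    refine finDiffOp_induction (p := fun P => ∃ hP : P ∈ diffOp A, ∀ X : LDO A n,
      Gen Set.univ X → Gen Set.univ (rgt k ⟨P, hP⟩ X)) ?_ ?_ ?_ ?_ ?_ hP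
    · exact fun g => ⟨_, fun X hX => hX.mulBy k g⟩
    · exact fun i => ⟨_, fun X hX => hX.totD k i⟩
    · exact fun J => ⟨_, fun X hX => hX.verD k J trivial⟩
    · rintro P Q ⟨hP, hP'⟩ ⟨hQ, hQ'⟩
      refine ⟨add_mem hP hQ, fun X hX => ?_⟩
      have : rgt k ⟨P + Q, add_mem hP hQ⟩ X = rgt k ⟨P, hP⟩ X + rgt k ⟨Q, hQ⟩ X := by
        ext f
        rw [LDO.add_apply, rgt_apply, rgt_apply, rgt_apply, ← MultilinearMap.map_update_add]
        rfl
      rw [this]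
      exact (hP' X hX).add (hQ' X hX)
    · rintro P Q - - ⟨hP, hP'⟩ ⟨hQ, hQ'⟩
      refine ⟨mul_mem hP hQ, fun X hX => ?_⟩
      have h := hQ' _ (hP' X hX)
      rwa [← rgt_mul] at h
  exact key.2 X hX

theorem gen_of_finMulti {F : LDO A n} (hF : F.1 ∈ finMulti A n) : Gen Set.univ F := by
  obtain ⟨F, hF'⟩ := F
  replace hF : F ∈ finMulti A n := hF
  have key : ∀ (p : A) (P : Fin n → Op A) (hP : ∀ j, P j ∈ JetAlgebra.finDiffOp A)
      (s : Finset (Fin n)), Gen Set.univ (⟨prodOp p fun j => if j ∈ s then P j else 1,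
        finMulti_le (prodOp_mem p fun j => by split_ifs; exacts [hP j, one_mem _])⟩ : LDO A n) := by
    intro p P hP s
    induction s using Finset.induction_on with
    | empty =>
      simp only [Finset.notMem_empty, if_false]
      exact Gen.mulProd p
    | insert a s ha ih =>
      have h := ih.finDiffOp a (hP a)
      convert h using 1
      ext f
      rw [rgt_apply]
      simp only [prodOp_apply]
      congr 1
      refine Finset.prod_congr rfl fun j _ => ?_
      by_cases hj : j = a
      · subst hj; simp [ha]
      · simp [hj]
  revert hF'
  refine finMulti_induction (q := fun F => ∀ hF', Gen Set.univ (⟨F, hF'⟩ : LDO A n)) ?_ ?_ hF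
  · intro p P hP hF'
    have := key p P hP Finset.univ
    simpa using this
  · intro S T hS hT ihS ihT _
    exact (ihS (finMulti_le hS)).add (ihT (finMulti_le hT))

end JetAlgebra

/-! ### Weight decomposition, Taylor's formula and the projection `proj`. -/

namespace JetAlgebra

variable {N : ℕ} {A : Type} [CommRing A] [Algebra ℝ A] [JetAlgebra N A] {n : ℕ}

/-- Decomposition according to the number of vertical derivatives in the slot `j`. -/
theorem Gen.exists_decomposition (j : Fin n) {F : LDO A n} (hF : Gen Set.univ F) :
    ∃ (K : ℕ) (G : ℕ → LDO A n), (∀ k, count j (G k) = (k : ℝ) • G k) ∧ Gen {j}ᶜ (G 0) ∧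
      ∀ k, K ≤ k → F = ∑ i ∈ Finset.range (k + 1), G i := by
  induction hF with
  | mulProd g =>
    refine ⟨0, fun k => if k = 0 then JetAlgebra.mulProd n g else 0, fun k => ?_, Gen.mulProd g,
      fun k _ => by simp⟩
    by_cases h : k = 0
    · subst h; simp [count_mulProd]
    · simp [h]
  | add _ _ hX hY =>
    obtain ⟨K, G, hG, h0, hs⟩ := hX
    obtain ⟨L, H, hH, h0', hs'⟩ := hY
    refine ⟨max K L, fun k => G k + H k, fun k => ?_, h0.add h0', fun k hk => ?_⟩
    · rw [map_add, hG, hH, smul_add]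
    · rw [Finset.sum_add_distrib, ← hs k (le_trans (le_max_left _ _) hk),
        ← hs' k (le_trans (le_max_right _ _) hk)]
  | totD l i _ hX =>
    obtain ⟨K, G, hG, h0, hs⟩ := hX
    refine ⟨K, fun k => rgt l (JetAlgebra.totD i) (G k), fun k => ?_, h0.totD l i, fun k hk => ?_⟩
    · by_cases h : j = l
      · subst h; rw [count_rgt_totD, hG, map_smul]
      · rw [count_rgt j h, hG, map_smul]
    · rw [hs k hk, map_sum]
  | verD l J _ _ hX =>
    obtain ⟨K, G, hG, h0, hs⟩ := hX
    by_cases h : j = l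
    · subst h
      refine ⟨K + 1, fun k => Nat.casesOn k 0 fun k => rgt j (JetAlgebra.verD J) (G k), fun k => ?_,
        Gen.zero, fun k hk => ?_⟩
      · rcases k with _ | k
        · simp
        · show count j (rgt j (JetAlgebra.verD J) (G k)) = _ • rgt j (JetAlgebra.verD J) (G k)
          rw [count_verD, hG, map_smul]
          push_cast
          module
      · obtain ⟨k, rfl⟩ := Nat.exists_eq_add_of_le' (show 1 ≤ k by omega)
        rw [Finset.sum_range_succ', hs k (by omega), map_sum]
        exact (add_zero _).symm
    · refine ⟨K, fun k => rgt l (JetAlgebra.verD J) (G k), fun k => ?_,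
        h0.verD l J (by simpa using Ne.symm h), fun k hk => ?_⟩
      · rw [count_rgt j h, hG, map_smul]
      · rw [hs k hk, map_sum]

theorem exists_decomposition (j : Fin n) (X : LDO A n) (m : ℕ) :
    ∃ (K : ℕ) (G : ℕ → LDO A n), (∀ k, count j (G k) = (k : ℝ) • G k) ∧ Gen {j}ᶜ (G 0) ∧
      X - ∑ i ∈ Finset.range (K + 1), G i ∈ vanish A n m := by
  obtain ⟨F, hF, h⟩ := exists_finMulti X m
  obtain ⟨K, G, hG, h0, hs⟩ := (gen_of_finMulti hF).exists_decomposition j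
  exact ⟨K, G, hG, h0, by rwa [← hs K le_rfl]⟩

/-- `(d/dx)^J`. -/
def totPow (J : MultiIdx N) : diffOp A := MultiIdx.pow totD J

theorem totPow_zero_apply (f : A) : (totPow 0).1 f = f := by
  rw [totPow, MultiIdx.pow_zero']; rfl

theorem totD_commute' (i k : Fin N) : Commute (totD i : diffOp A) (totD k) :=
  Subtype.ext (LinearMap.ext fun f => derD_comm i k f)

theorem totPow_add_single (J : MultiIdx N) (i : Fin N) (f : A) :
    (totPow (J + Pi.single i 1)).1 f = derD i ((totPow J).1 f) := by
  rw [totPow, MultiIdx.pow_add_single totD_commute']; rfl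

theorem totPow_derD (J : MultiIdx N) (i : Fin N) (f : A) :
    (totPow J).1 (derD i f) = (totPow (J + Pi.single i 1)).1 f := by
  rw [totPow, totPow, MultiIdx.pow_add_single' totD_commute']; rfl

theorem mul_totPow_sub_mem (J : MultiIdx N) (g h : A) :
    g * (totPow J).1 h - (negPow J).1 g * h ∈ exact A := by
  induction J using MultiIdx.induct generalizing h with
  | h0 =>
    rw [totPow_zero_apply, negPow_zero]
    show g * h - g * h ∈ exact A
    rw [sub_self]; exact zero_mem _
  | hs J i ih =>
    rw [← totPow_derD, negPow_add_single_apply]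
    have := add_mem (ih (derD i h)) (mul_derD_sub_mem i ((negPow J).1 g) h)
    convert this using 1
    ring

/-- Taylor's formula for operators without vertical derivatives in the slot `j`. -/
theorem Gen.taylor (j : Fin n) {F : LDO A n} (hF : Gen {j}ᶜ F) (f : Fin n → A) :
    F.1 f = ∑ᶠ L : MultiIdx N, ((MultiIdx.fact L : ℝ)⁻¹) •
      ((adPow j L F).1 (Function.update f j 1) * (totPow L).1 (f j)) := by
  have hfin : ∀ (X : LDO A n) (f : Fin n → A) (g : MultiIdx N → A),
      (Function.support fun L : MultiIdx N => ((MultiIdx.fact L : ℝ)⁻¹) •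
        ((adPow j L X).1 f * g L)).Finite := fun X f g =>
    ((locallyZero_adPow j X).finite_support f).subset fun L hL h => hL (by
      have h' : (adPow j L X).1 f = 0 := h
      simp [h'])
  induction hF generalizing f with
  | mulProd g =>
    rw [finsum_eq_single _ (0 : MultiIdx N)]
    · rw [adPow_zero, totPow_zero_apply, mulProd_apply, mulProd_apply,
        Finset.prod_update_of_mem (Finset.mem_univ j),
        ← Finset.mul_prod_erase Finset.univ f (Finset.mem_univ j),
        Finset.sdiff_singleton_eq_erase]
      simp [MultiIdx.fact]; ring
    · intro L hL
      rw [adPow_mulProd hL]; simp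
  | @add X Y _ _ hX hY =>
    rw [LDO.add_apply, hX, hY, ← finsum_add_distrib (hfin _ _ _) (hfin _ _ _)]
    refine finsum_congr fun L => ?_
    rw [map_add, LDO.add_apply, add_mul, smul_add]
  | @totD X k i _ hX =>
    by_cases hk : j = k
    · subst hk
      rw [rgt_apply, hX]
      have e : ∀ L : MultiIdx N, ((MultiIdx.fact L : ℝ)⁻¹) •
          ((adPow j L (rgt j (JetAlgebra.totD i) X)).1 (Function.update f j 1)
            * (totPow L).1 (f j))
          = ((MultiIdx.fact L : ℝ)⁻¹) • ((L i : ℝ) •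
          ((adPow j (L - Pi.single i 1) X).1 (Function.update f j 1) * (totPow L).1 (f j))) := by
        intro L
        rw [adPow_rgt_totD, LDO.add_apply, rgt_apply, LDO.smul_apply, Function.update_self,
          totD_apply, Derivation.map_one_eq_zero, MultilinearMap.map_update_zero, zero_add,
          smul_mul_assoc]
      rw [finsum_congr e, ← finsum_mem_univ, ← finsum_mem_univ]
      symm
      -- Total derivatives kill the inserted `1`, so only the commutator term of `ad^L (X ∘ d/dx^i)`
      -- survives. The shift of `L` by `i` turns it into the expansion of `X` at the argument `d f_j
      -- / dx^i`, the factor `L_i` adjusting the factorial.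
      have h1 : ∑ᶠ L ∈ Set.range (fun L : MultiIdx N => L + Pi.single i 1),
          ((MultiIdx.fact L : ℝ)⁻¹) • ((L i : ℝ) •
          ((adPow j (L - Pi.single i 1) X).1 (Function.update f j 1) * (totPow L).1 (f j)))
          = ∑ᶠ L : MultiIdx N, ((MultiIdx.fact L : ℝ)⁻¹) •
      ((adPow j L X).1 (Function.update (Function.update f j ((JetAlgebra.totD i).1 (f j))) j 1)
        * (totPow L).1 (Function.update f j ((JetAlgebra.totD i).1 (f j)) j)) := by
        rw [finsum_mem_range (fun _ _ h => add_right_cancel h)]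
        refine finsum_congr fun L => ?_
        rw [add_tsub_cancel_right, MultiIdx.fact_add_single, Function.update_idem,
          Function.update_self, totD_apply, totPow_derD, smul_smul]
        congr 1
        have := MultiIdx.fact_ne_zero L
        have h2 : (L i : ℝ) + 1 ≠ 0 := by positivity
        simp only [Pi.add_apply, Pi.single_eq_same]
        push_cast
        field_simp
      rw [finsum_mem_univ, finsum_mem_univ, ← h1, ← finsum_mem_univ]
      refine finsum_mem_inter_support_eq' _ _ _ fun L hL => iff_of_true trivial ?_
      have h0 : L i ≠ 0 := fun h0 => hL (by simp [h0])
      exact ⟨L - Pi.single i 1, MultiIdx.sub_add_single h0⟩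
    · rw [rgt_apply, hX]
      refine finsum_congr fun L => ?_
      rw [adPow_comm (T := rgt k (JetAlgebra.totD i)) (fun l Y => adSlot_rgt hk _ _ _), rgt_apply,
        Function.update_of_ne hk, Function.update_of_ne (Ne.symm hk),
        Function.update_comm hk]
  | @verD X k J hk _ hX =>
    have hk : j ≠ k := Ne.symm (by simpa using hk)
    rw [rgt_apply, hX]
    refine finsum_congr fun L => ?_
    rw [adPow_comm (T := rgt k (JetAlgebra.verD J)) (fun l Y => adSlot_rgt hk _ _ _), rgt_apply,
      Function.update_of_ne hk, Function.update_of_ne (Ne.symm hk), Function.update_comm hk]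

/-- Families of bounded jet order whose entry in the slot `j` does not depend on `u`. -/
def freeBox (A : Type) [CommRing A] [Algebra ℝ A] [JetAlgebra N A] (j : Fin n) (m : ℕ) :
    Set (Fin n → A) := {f | f ∈ box A n m ∧ f j ∈ jetFree A}

theorem update_mem_freeBox {j : Fin n} {m : ℕ} {f : Fin n → A} (hf : f ∈ box A n m) {g : A}
    (hg : g ∈ jetFree A) : Function.update f j g ∈ freeBox A j m :=
  ⟨update_mem_box hf (jetFree_le m hg), by simpa using hg⟩

theorem freeBox_mul {j : Fin n} {m : ℕ} {f : Fin n → A} (hf : f ∈ freeBox A j m) (i : Fin N) :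
    Function.update f j (coordX i * f j) ∈ freeBox A j m :=
  update_mem_freeBox hf.1 (mul_mem (coordX_mem_jetFree i) hf.2)

/-- An operator that annihilates total derivatives annihilates the functions of `x`. -/
theorem apply_freeBox_of_rgt_totD {j : Fin n} (i : Fin N) {X : LDO A n}
    (hX : rgt j (totD i) X = 0) {m : ℕ} : ∀ f ∈ freeBox A j m, X.1 f = 0 := by
  obtain ⟨K, hK⟩ := adSlot_nilpotent j (coordX_mem (A := A) i m) X
  have hh : (adSlot j (coordX i) : Module.End ℝ (LDO A n)) * rgt j (totD i)
      = (rgt j (totD i) : Module.End ℝ (LDO A n)) * adSlot j (coordX i) + 1 := by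
    refine LinearMap.ext fun Y => ?_
    have := adSlot_rgt_totD j i i Y
    rw [if_pos rfl] at this
    exact this
  -- From `X ∘ d/dx^i = 0` the Heisenberg relation gives `(k+1) a^k X = -(a^{k+1} X) ∘ d/dx^i`.
  -- Functions of `x` are stable under `d/dx^i`, so vanishing descends from a large power of `a` to
  -- `X` without integrating the argument.
  have step : ∀ k, (∀ f ∈ freeBox A j m, ((adSlot j (coordX i) ^ (k + 1)) X).1 f = 0) →
      ∀ f ∈ freeBox A j m, ((adSlot j (coordX i) ^ k) X).1 f = 0 := by
    intro k hk f hf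
    have h := LinearMap.congr_fun (heisenberg hh k).1 X
    simp only [Module.End.mul_apply, LinearMap.add_apply, LinearMap.smul_apply] at h
    rw [hX, map_zero] at h
    have h2 := congrArg (fun Y : LDO A n => Y.1 f) h
    simp only [LDO.zero_apply, LDO.add_apply, LDO.smul_apply, rgt_apply] at h2
    rw [totD_apply, hk _ (update_mem_freeBox hf.1 (derD_mem_jetFree hf.2 i)), zero_add] at h2
    exact (smul_eq_zero.1 h2.symm).resolve_left (by positivity)
  have : ∀ k, ∀ f ∈ freeBox A j m, ((adSlot j (coordX i) ^ (K - k)) X).1 f = 0 := by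
    intro k
    induction k with
    | zero => exact fun f hf => hK _ le_rfl f hf.1
    | succ k ih =>
      by_cases h : k < K
      · refine step _ ?_
        rwa [show K - (k + 1) + 1 = K - k by omega]
      · rwa [show K - (k + 1) = K - k by omega]
  simpa using this K

theorem apply_freeBox_of_count {j : Fin n} {c : ℝ} (hc : c ≠ 0) {X : LDO A n}
    (hX : count j X = c • X) {m : ℕ} : ∀ f ∈ freeBox A j m, X.1 f = 0 := by
  intro f hf
  have h : (count j X).1 f = 0 := by
    rw [count_eq, lsum_apply (locallyZero_verD j _)]
    refine (finsum_congr fun J => ?_).trans finsum_zero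
    rw [rgt_apply, verD_apply, hf.2 J, MultilinearMap.map_update_zero]
  rw [hX, LDO.smul_apply] at h
  exact (smul_eq_zero.1 h).resolve_left hc

/-- In Taylor's formula the operator enters only through its commutators evaluated with the slot
filled by the constant `1`, which is a function of `x`. -/
theorem Gen.vanish_of_freeBox {j : Fin n} {F : LDO A n} (hF : Gen {j}ᶜ F) {m : ℕ}
    (h : ∀ f ∈ freeBox A j m, F.1 f = 0) : F ∈ vanish A n m := by
  intro f hf
  rw [hF.taylor j f]
  refine (finsum_congr fun L => ?_).trans finsum_zero
  rw [adPow_apply_eq_zero (fun f hf i => freeBox_mul hf i) h L _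
    (update_mem_freeBox hf (one_mem _)), zero_mul, smul_zero]

/-- On arguments of bounded jet order only finitely many of the operators `binom s X` are
nonzero. -/
def Pos (j : Fin n) (X : LDO A n) : Prop := ∀ m, ∃ S, ∀ s, S ≤ s → binom j s X ∈ vanish A n m

theorem Pos.locallyZero {j : Fin n} {X : LDO A n} (h : Pos j X) :
    LocallyZero fun s => binom j s X := locallyZero_of_finset fun m => by
  obtain ⟨S, hS⟩ := h m
  exact ⟨Finset.range S, fun s hs => hS s (by simpa using hs)⟩

/-- For `s ≥ K` the polynomial `binom s` kills the weights `1, …, K` and is the identity on weight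
zero, so it isolates the part without vertical derivatives. -/
theorem binom_sum_vanish {j : Fin n} {m K : ℕ} {X : LDO A n} {G : ℕ → LDO A n}
    (hG : ∀ k, count j (G k) = (k : ℝ) • G k)
    (hX : X - ∑ i ∈ Finset.range (K + 1), G i ∈ vanish A n m) {s : ℕ} (hs : K ≤ s) :
    binom j s X - G 0 ∈ vanish A n m := by
  have h1 := binom_vanish (j := j) hX s
  rw [map_sub, map_sum, Finset.sum_range_succ', Finset.sum_eq_zero, zero_add,
    binom_of_count_eq_zero (X := G 0)] at h1
  · exact h1
  · rw [hG]; simp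
  · intro k hk
    exact binom_eq_zero (k := k) (by rw [hG]; push_cast; rfl)
      (by have := Finset.mem_range.1 hk; omega)

/-- On functions of `x` both `X` and the components of positive weight vanish, hence so does the
component `G 0`. It contains no vertical derivatives in the slot and is therefore zero at this jet
order. -/
theorem pos_of_rgt_totD {j : Fin n} (i : Fin N) {X : LDO A n} (hX : rgt j (totD i) X = 0) :
    Pos j X := by
  intro m
  obtain ⟨K, G, hG, h0, h⟩ := exists_decomposition j X m
  have hG0 : G 0 ∈ vanish A n m := h0.vanish_of_freeBox fun f hf => by
    have h1 := h f hf.1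
    rw [LDO.sub_apply, apply_freeBox_of_rgt_totD i hX f hf, LDO.sum_apply,
      Finset.sum_range_succ', Finset.sum_eq_zero, zero_add, zero_sub, neg_eq_zero] at h1
    · exact h1
    · intro k _
      exact apply_freeBox_of_count (c := ((k + 1 : ℕ) : ℝ)) (by positivity) (hG _) f hf
  exact ⟨K, fun s hs => by simpa using add_mem (binom_sum_vanish hG h hs) hG0⟩

theorem pos_verD {j : Fin n} (J : MultiIdx N) (Z : LDO A n) (m : ℕ) :
    ∃ S, ∀ s, S ≤ s → binom j s (rgt j (verD J) Z) ∈ vanish A n m := by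
  obtain ⟨K, G, hG, -, h⟩ := exists_decomposition j Z m
  refine ⟨K + 1, fun s hs => ?_⟩
  have h1 := rgt_vanish j (fun f hf => derU_mem hf J) h (Q := verD J)
  have h2 := binom_vanish (j := j) h1 s
  rw [map_sub, map_sub, map_sum, map_sum, Finset.sum_eq_zero, sub_zero] at h2
  · exact h2
  · intro k hk
    refine binom_eq_zero (k := k) ?_ (by have := Finset.mem_range.1 hk; omega)
    rw [count_verD, hG, map_smul]
    module

/-- An operator that factors through vertical derivatives has no component of weight zero. -/
theorem pos_of_sub_sum {j : Fin n} {X : LDO A n}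
    (h : ∀ m, ∃ Z : MultiIdx N → LDO A n,
      X - ∑ J ∈ MultiIdx.upTo N m, rgt j (verD J) (Z J) ∈ vanish A n m) : Pos j X := by
  intro m
  obtain ⟨Z, hZ⟩ := h m
  choose S hS using fun J => pos_verD (j := j) J (Z J) m
  refine ⟨(MultiIdx.upTo N m).sup S, fun s hs => ?_⟩
  have h1 := binom_vanish (j := j) hZ s
  rw [map_sub, map_sum] at h1
  simpa using add_mem h1 (sum_mem fun J hJ => hS J s ((Finset.le_sup hJ).trans hs))

theorem pos_count (j : Fin n) (X : LDO A n) : Pos j (count j X) :=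
  pos_of_sub_sum fun m => ⟨_, count_sub_sum j X m⟩

theorem rgt_euler_sub_mem (j : Fin n) (Z : LDO A n) (m : ℕ) :
    rgt j (euler A) Z - ∑ J ∈ MultiIdx.upTo N m, rgt j (verD J) (rgt j (negPow J) Z)
      ∈ vanish A n m := fun f hf => by
  rw [LDO.sub_apply, LDO.sum_apply, rgt_apply, euler_apply (hf j), MultilinearMap.map_update_sum,
    sub_eq_zero]
  refine Finset.sum_congr rfl fun J _ => ?_
  rw [rgt_apply, rgt_apply, Function.update_idem, Function.update_self, verD_apply]

theorem pos_euler (j : Fin n) (Z : LDO A n) : Pos j (rgt j (euler A) Z) :=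
  pos_of_sub_sum fun m => ⟨_, rgt_euler_sub_mem j Z m⟩

/-- The inverse of `count`. -/
def invCount (j : Fin n) (X : LDO A n) : LDO A n :=
  lsum fun s : ℕ => ((s : ℝ) + 1)⁻¹ • binom j s X

/-- With `y = count` one has `y / (s+1) · binom s = binom s - binom (s+1)`, so the series telescopes
to `binom 0 = 1`; `Pos` makes it converge. -/
theorem invCount_count {j : Fin n} {X : LDO A n} (hX : Pos j X) : invCount j (count j X) = X := by
  have h := hX.locallyZero
  refine Eq.trans ?_ (lsum_telescope h)
  rw [invCount]
  congr 1; funext s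
  rw [binom_comm (Φ := count j) (fun _ => rfl), binom_succ, sub_sub_cancel]

theorem invCount_comm {j : Fin n} {Φ : Module.End ℝ (LDO A n)} (hΦ : Summing Φ)
    (h : ∀ X, count j (Φ X) = Φ (count j X)) {X : LDO A n} (hX : Pos j X) :
    invCount j (Φ X) = Φ (invCount j X) := by
  rw [invCount, invCount, (hΦ _ (hX.locallyZero.smul _)).2]
  congr 1; funext s
  rw [binom_comm h, map_smul]

/-- The projection onto the operators that annihilate total divergences in the slot `j`. -/
def proj (j : Fin n) (X : LDO A n) : LDO A n := invCount j (rgt j (euler A) (symDer j 0 X))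

theorem proj_add (j : Fin n) (X Y : LDO A n) : proj j (X + Y) = proj j X + proj j Y := by
  have h : ∀ X, LocallyZero fun s : ℕ =>
      ((s : ℝ) + 1)⁻¹ • binom j s (rgt j (euler A) (symDer j 0 X)) :=
    fun X => (pos_euler j _).locallyZero.smul _
  rw [proj, proj, proj, invCount, invCount, invCount, ← lsum_add (h X) (h Y)]
  simp only [map_add, smul_add]

theorem proj_lft_totD (j : Fin n) (i : Fin N) (X : LDO A n) :
    proj j (lft (totD i) X) = lft (totD i) (proj j X) := by
  rw [proj, symDer_lft_totD, ← lft_rgt,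
    invCount_comm (Φ := lft (totD i)) (summing_lft _) (fun X => count_lft_totD j i X)
      (pos_euler j _)]
  rfl

theorem proj_rgt {j k : Fin n} (h : j ≠ k) (Q : diffOp A) (X : LDO A n) :
    proj j (rgt k Q X) = rgt k Q (proj j X) := by
  rw [proj, symDer_rgt 0 h, rgt_comm h,
    invCount_comm (Φ := rgt k Q) (summing_rgt k Q) (fun X => count_rgt j h Q X) (pos_euler j _)]
  rfl

/-- Precomposition with `d/dx^i` commutes with the inversion of the count and meets the Euler
operator, which annihilates total derivatives. -/
theorem rgt_totD_proj (j : Fin n) (i : Fin N) (X : LDO A n) : rgt j (totD i) (proj j X) = 0 := by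
  rw [proj, ← invCount_comm (Φ := rgt j (totD i)) (summing_rgt _ _)
    (fun X => count_rgt_totD j i X) (pos_euler j _)]
  have : rgt j (totD i) (rgt j (euler A) (symDer j 0 X)) = 0 := by
    ext f
    rw [rgt_apply, rgt_apply, Function.update_self, Function.update_idem, totD_apply, euler_derD,
      MultilinearMap.map_update_zero, LDO.zero_apply]
  rw [this, invCount]
  simp only [map_zero, smul_zero]
  exact lsum_zero

theorem count_eq_of_symDer {j : Fin n} {X : LDO A n}
    (h : ∀ J, symDer j J X = rgt j (negPow J) (symDer j 0 X)) :
    count j X = rgt j (euler A) (symDer j 0 X) := by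
  refine sub_eq_zero.1 (eq_zero_of_vanish fun m => ?_)
  have h1 := sub_mem (count_sub_sum j X m) (rgt_euler_sub_mem j (symDer j 0 X) m)
  simp only [← h] at h1
  rwa [sub_sub_sub_cancel_right] at h1

theorem rgt_negPow_add_single (j : Fin n) (J : MultiIdx N) (i : Fin N) (X : LDO A n) :
    rgt j (negPow (J + Pi.single i 1)) X = -rgt j (totD i) (rgt j (negPow J) X) := by
  have : (negPow (J + Pi.single i 1) : diffOp A) = negPow J * -totD i :=
    MultiIdx.pow_add_single' totD_commute J i
  rw [this, rgt_mul]
  ext f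
  have e : (negPow J).1 ((-totD i : diffOp A).1 (f j))
      = (-1 : ℝ) • (negPow J).1 (derD i (f j)) := by
    show (negPow J).1 (-derD i (f j)) = _
    rw [map_neg, neg_one_smul]
  simp only [LDO.neg_apply, rgt_apply, Function.update_self, Function.update_idem, totD_apply]
  rw [e, MultilinearMap.map_update_smul, neg_one_smul]

/-- The projection fixes the operators that annihilate total derivatives. -/
theorem proj_eq_self {j : Fin n} [Nonempty (Fin N)] {X : LDO A n}
    (hX : ∀ i, rgt j (totD i) X = 0) : proj j X = X := by
  have h : ∀ J, symDer j J X = rgt j (negPow J) (symDer j 0 X) := by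
    intro J
    induction J using MultiIdx.induct with
    | h0 => rw [negPow_zero]; ext f; rw [rgt_apply]; simp
    | hs J i ih =>
      -- Since `X ∘ d/dx^i = 0`, this gives `symDer_{J+i} X = -(symDer_J X) ∘ d/dx^i`, a recursion
      -- with solution `(symDer_0 X) ∘ (-d/dx)^J`.
      have := symDer_rgt_totD (j := j) J i X
      rw [hX i, map_zero] at this
      rw [rgt_negPow_add_single, ← ih]
      exact (neg_eq_of_add_eq_zero_right this.symm).symm
  rw [proj, ← count_eq_of_symDer h]
  exact invCount_count (pos_of_rgt_totD (Classical.arbitrary _) (hX _))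

end JetAlgebra

/-! ### Correcting an operator by exact values so that it kills total derivatives. -/

namespace JetAlgebra

variable {N : ℕ} {A : Type} [CommRing A] [Algebra ℝ A] [JetAlgebra N A] {n : ℕ}

/-! ### Operators with exact values -/

theorem lft_totD_mem (i : Fin N) (X : LDO A n) : lft (totD i) X ∈ exactValued A n :=
  fun _ => derD_mem_exact i _

theorem rgt_mem_exactValued (j : Fin n) (Q : diffOp A) {X : LDO A n} (hX : X ∈ exactValued A n) :
    rgt j Q X ∈ exactValued A n := fun f => by rw [rgt_apply]; exact hX _

/-- Additive maps that commute with total derivatives preserve exactness of the values. -/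
theorem map_mem_exactValued (j : Fin n) {Φ : LDO A n → LDO A n}
    (hadd : ∀ X Y, Φ (X + Y) = Φ X + Φ Y)
    (hd : ∀ i X, Φ (lft (totD i) X) = lft (totD i) (Φ X)) {X : LDO A n}
    (hX : X ∈ exactValued A n) : Φ X ∈ exactValued A n := by
  obtain ⟨Y, rfl⟩ := exists_divergence j hX
  have := map_sum (AddMonoidHom.mk' Φ hadd) (fun i => lft (totD i) (Y i)) Finset.univ
  simp only [AddMonoidHom.mk'_apply] at this
  rw [this]
  exact sum_mem fun i _ => by rw [hd]; exact lft_totD_mem i _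

theorem proj_mem_exactValued (j : Fin n) {X : LDO A n} (hX : X ∈ exactValued A n) :
    proj j X ∈ exactValued A n :=
  map_mem_exactValued j (proj_add j) (fun i X => proj_lft_totD j i X) hX

theorem binom_mem_exactValued (j : Fin n) {X : LDO A n} (hX : X ∈ exactValued A n) (s : ℕ) :
    binom j s X ∈ exactValued A n :=
  map_mem_exactValued j (map_add _)
    (fun i X => binom_comm (Φ := lft (totD i)) (fun X => count_lft_totD j i X) s X) hX

theorem symDer_mem_exactValued (j : Fin n) (J : MultiIdx N) {X : LDO A n}
    (hX : X ∈ exactValued A n) : symDer j J X ∈ exactValued A n :=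
  map_mem_exactValued j (map_add _) (fun i X => symDer_lft_totD J i X) hX

theorem lsum_mem_exactValued {ι : Type*} {X : ι → LDO A n} (h : LocallyZero X)
    (hX : ∀ k, X k ∈ exactValued A n) : lsum X ∈ exactValued A n := fun f => by
  obtain ⟨m, hm⟩ := exists_box f
  obtain ⟨s, hs⟩ := h.finset m
  rw [lsum_apply_sum h hs hm]
  exact sum_mem fun k _ => hX k f

theorem mem_exactValued_of_vanish {X : LDO A n}
    (h : ∀ m, ∃ Y ∈ exactValued A n, X - Y ∈ vanish A n m) : X ∈ exactValued A n := fun f => by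
  obtain ⟨m, hm⟩ := exists_box f
  obtain ⟨Y, hY, hXY⟩ := h m
  have := hXY f hm
  rw [LDO.sub_apply, sub_eq_zero] at this
  rw [this]; exact hY f

/-! ### Making an operator annihilate the total derivatives -/

/-- Polynomials in the `x^i` have antiderivatives. -/
theorem exists_antiderivative (i : Fin N) {p : A} (hp : p ∈ xPoly A) : ∃ q, derD i q = p := by
  rw [xPoly, Algebra.adjoin_range_eq_range_aeval] at hp
  obtain ⟨p, rfl⟩ := hp
  induction p using MvPolynomial.induction_on' with
  | monomial s c =>
    let R : A := ∏ k ∈ Finset.univ.erase i, coordX k ^ s k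
    have hR : derD i R = 0 := by
      refine Finset.prod_induction _ (fun g : A => derD i g = 0) (fun f g hf hg => ?_)
        (Derivation.map_one_eq_zero _) fun k hk => ?_
      · rw [Derivation.leibniz, hf, hg]; simp
      · rw [Derivation.leibniz_pow, derD_coordX, if_neg (Ne.symm (Finset.mem_erase.1 hk).1)]
        simp
    refine ⟨(c / (s i + 1 : ℝ)) • (coordX i ^ (s i + 1) * R), ?_⟩
    rw [Derivation.map_smul, Derivation.leibniz, hR, smul_zero, zero_add, Derivation.leibniz_pow,
      derD_coordX, if_pos rfl]
    have e : MvPolynomial.aeval coordX (MvPolynomial.monomial s c) = c • (coordX i ^ s i * R) := by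
      rw [MvPolynomial.aeval_monomial, Finsupp.prod_fintype _ _ fun _ => pow_zero _,
        Finset.mul_prod_erase Finset.univ (fun k => (coordX k : A) ^ s k) (Finset.mem_univ i),
        Algebra.smul_def]
    refine Eq.trans ?_ e.symm
    have h1 : (s i : ℝ) + 1 ≠ 0 := by positivity
    rw [add_tsub_cancel_right, ← Nat.cast_smul_eq_nsmul ℝ, smul_eq_mul, smul_eq_mul, mul_one,
      mul_smul_comm, smul_smul, mul_comm R]
    congr 1
    push_cast
    field_simp
  | add p q hp hq =>
    obtain ⟨a, ha⟩ := hp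
    obtain ⟨b, hb⟩ := hq
    exact ⟨a + b, by rw [map_add, ha, hb]; exact (map_add (MvPolynomial.aeval coordX) p q).symm⟩

/-- An operator without vertical derivatives in the slot `j` is, modulo divergences, the
multiplication of `f_j` by an operator in the other slots. -/
theorem Gen.exists_adjoint (j : Fin n) {F : LDO A n} (hF : Gen {j}ᶜ F) :
    ∃ Q : LDO A n, ∀ f, F.1 f - Q.1 (Function.update f j 1) * f j ∈ exact A := by
  have hz : LocallyZero fun L : MultiIdx N =>
      ((MultiIdx.fact L : ℝ)⁻¹) • lft (negPow L) (adPow j L F) :=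
    ((locallyZero_adPow j F).lft _).smul _
  refine ⟨lsum fun L : MultiIdx N =>
    ((MultiIdx.fact L : ℝ)⁻¹) • lft (negPow L) (adPow j L F), fun f => ?_⟩
  have hs := (locallyZero_adPow j F).finite_support (Function.update f j 1)
  have h0 : ∀ L ∉ hs.toFinset, (adPow j L F).1 (Function.update f j 1) = 0 := fun L hL => by
    simpa using hL
  rw [hF.taylor j f, lsum_apply hz, finsum_eq_sum_of_support_subset (s := hs.toFinset),
    finsum_eq_sum_of_support_subset (s := hs.toFinset), Finset.sum_mul, ← Finset.sum_sub_distrib]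
  · refine sum_mem fun L _ => ?_
    have := Submodule.smul_mem _ ((MultiIdx.fact L : ℝ)⁻¹)
      (mul_totPow_sub_mem L ((adPow j L F).1 (Function.update f j 1)) (f j))
    rw [smul_sub] at this
    rw [LDO.smul_apply, smul_mul_assoc, lft_apply]
    exact this
  · intro L hL
    by_contra h
    exact hL (by simp [h0 L h])
  · intro L hL
    by_contra h
    exact hL (by simp [h0 L h])

/-- An operator that maps total derivatives in the slot `j` to total divergences agrees modulo
operators with exact values with one that annihilates total derivatives. -/
theorem proj_sub_mem [Nonempty (Fin N)] {j r : Fin n} (hr : r ≠ j) {X : LDO A n}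
    (hX : ∀ i, rgt j (totD i) X ∈ exactValued A n) : proj j X - X ∈ exactValued A n := by
  -- The recursion behind `proj_eq_self`, now modulo operators with exact values. All operations
  -- used preserve these, because exact values come from an operator-valued divergence.
  have h1 : ∀ J, symDer j J X - rgt j (negPow J) (symDer j 0 X) ∈ exactValued A n := by
    intro J
    induction J using MultiIdx.induct with
    | h0 =>
      have : rgt j (negPow 0) (symDer j 0 X) = symDer j 0 X := by
        rw [negPow_zero]; ext f; rw [rgt_apply]; simp
      rw [this, sub_self]; exact zero_mem _
    | hs J i ih =>
      have h := symDer_mem_exactValued j J (hX i)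
      rw [symDer_rgt_totD] at h
      rw [rgt_negPow_add_single]
      have := sub_mem h (rgt_mem_exactValued j (totD i) ih)
      rw [map_sub] at this
      convert this using 1
      abel
  have h2 : rgt j (euler A) (symDer j 0 X) - count j X ∈ exactValued A n := by
    refine mem_exactValued_of_vanish fun m => ⟨∑ J ∈ MultiIdx.upTo N m,
      rgt j (verD J) (rgt j (negPow J) (symDer j 0 X) - symDer j J X), sum_mem fun J _ =>
        rgt_mem_exactValued j _ (by simpa using neg_mem (h1 J)), ?_⟩
    have := sub_mem (rgt_euler_sub_mem j (symDer j 0 X) m) (count_sub_sum j X m)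
    simp only [map_sub, Finset.sum_sub_distrib]
    convert this using 1
    abel
  have h3 : proj j X - invCount j (count j X) ∈ exactValued A n := by
    have ha := (pos_euler j (symDer j 0 X)).locallyZero.smul fun s : ℕ => ((s : ℝ) + 1)⁻¹
    have hb := (pos_count j X).locallyZero.smul fun s : ℕ => ((s : ℝ) + 1)⁻¹
    rw [proj, invCount, invCount, ← lsum_sub ha hb]
    refine lsum_mem_exactValued (ha.sub hb) fun s => ?_
    rw [← smul_sub, ← map_sub]
    exact Submodule.smul_mem _ _ (binom_mem_exactValued j h2 s)
  -- Inverting the count loses the component `G 0` of weight zero; it remains to show that this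
  -- component has exact values.
  suffices h4 : invCount j (count j X) - X ∈ exactValued A n by
    simpa using add_mem h3 h4
  intro f
  obtain ⟨m, hm⟩ := exists_box f
  obtain ⟨K, G, hG, hG0, hK⟩ := exists_decomposition j X m
  obtain ⟨S, hS⟩ := pos_count j X m
  have hz := (pos_count j X).locallyZero.smul fun s : ℕ => ((s : ℝ) + 1)⁻¹
  have e : (invCount j (count j X)).1 f = X.1 f - (G 0).1 f := by
    rw [invCount, lsum_apply_sum hz (s := Finset.range (max S K)) (fun s hs =>
      Submodule.smul_mem _ _ (hS s ((le_max_left _ _).trans (by simpa using hs)))) hm]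
    have : ∀ s : ℕ, (((s : ℝ) + 1)⁻¹ • binom j s (count j X)).1 f
        = (binom j s X).1 f - (binom j (s + 1) X).1 f := by
      intro s
      rw [binom_comm (Φ := count j) (fun _ => rfl), ← LDO.sub_apply, binom_succ, sub_sub_cancel]
    simp only [this]
    rw [Finset.sum_range_sub', binom_zero]
    have h := binom_sum_vanish hG hK (le_max_right S K) f hm
    rw [LDO.sub_apply, sub_eq_zero] at h
    rw [h]
  rw [LDO.sub_apply, e, sub_sub_cancel_left]
  refine neg_mem ?_
  -- Modulo divergences `G 0` is multiplication of `f_j` by `Q`. If `f_j = p` is a polynomial in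
  -- `x`, then `p = dq/dx^i`, so `X` and with it `p Q` is exact. Hence `Q` takes values independent
  -- of `u`.
  obtain ⟨Q, hQ⟩ := hG0.exists_adjoint j
  let T : Set (Fin n → A) := {g | g ∈ box A n m ∧ g j = 1}
  have hT : ∀ g ∈ T, Q.1 g ∈ jetFree A := by
    intro g hg
    refine jetFree_of_euler fun p hp => ?_
    obtain ⟨i⟩ := ‹Nonempty (Fin N)›
    obtain ⟨q, rfl⟩ := exists_antiderivative i hp
    have hf := update_mem_freeBox (j := j) hg.1 (xPoly_le_jetFree hp)
    have h5 := hQ (Function.update g j (derD i q))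
    have h6 := hK _ hf.1
    rw [LDO.sub_apply, LDO.sum_apply, Finset.sum_range_succ', Finset.sum_eq_zero, zero_add,
      sub_eq_zero] at h6
    · rw [← h6, Function.update_idem, Function.update_self] at h5
      have h7 := hX i (Function.update g j q)
      rw [rgt_apply, Function.update_idem, Function.update_self, totD_apply] at h7
      have h8 : Function.update g j 1 = g := by rw [← hg.2, Function.update_eq_self]
      rw [h8] at h5
      have := euler_exact (sub_mem h7 h5)
      rwa [sub_sub_cancel, mul_comm] at this
    · intro k _
      exact apply_freeBox_of_count (c := ((k + 1 : ℕ) : ℝ)) (by positivity) (hG _) _ hf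
  -- Here the second slot `r` is used: the slot `j` is frozen at `1`, so it is the argument in `r`
  -- that is multiplied by powers of `u`.
  have hQ0 := apply_eq_zero_of_derU (X := Q) (j := r) (m := m) (S := T) (fun g hg => hg.1)
    (fun g hg => ⟨update_mem_box hg.1 (mul_mem (coordU_mem (by simp [MultiIdx.order_zero]))
      (hg.1 r)), by rw [Function.update_of_ne (Ne.symm hr)]; exact hg.2⟩) fun g hg => hT g hg 0
  have := hQ f
  rwa [hQ0 _ ⟨update_mem_box hm (one_mem _), Function.update_self _ _ _⟩, zero_mul,
    sub_zero] at this

end JetAlgebra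

/-! ### Signed sums over permutations. -/

theorem sum_sign_smul_eq_zero_of_swap {M : Type*} [AddCommGroup M] [Module ℝ M] {n : ℕ}
    {T : Equiv.Perm (Fin n) → M} (ρ : Equiv.Perm (Fin n)) (hρ : Equiv.Perm.sign ρ = 1)
    (h : ∀ τ, T (τ * ρ) = -T τ) : ∑ τ, Equiv.Perm.sign τ • T τ = 0 := by
  have h1 : ∑ τ, Equiv.Perm.sign τ • T τ = -∑ τ, Equiv.Perm.sign τ • T τ := by
    conv_lhs => rw [← Equiv.sum_comp (Equiv.mulRight ρ)]
    simp only [Equiv.coe_mulRight, Equiv.Perm.sign_mul, hρ, mul_one, h, smul_neg,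
      Finset.sum_neg_distrib]
  have h2 : (2 : ℝ) • ∑ τ, Equiv.Perm.sign τ • T τ = 0 := by
    rw [two_smul]
    nth_rewrite 1 [h1]
    exact neg_add_cancel _
  exact (smul_eq_zero.1 h2).resolve_left (by norm_num)

theorem sum_sign_smul_eq_zero_of_cycle {M : Type*} [AddCommGroup M] [Module ℝ M] {n : ℕ}
    {T : Equiv.Perm (Fin n) → M} (ρ : Equiv.Perm (Fin n)) (hρ : Equiv.Perm.sign ρ = 1)
    (h : ∀ τ, T τ + T (τ * ρ) + T (τ * ρ * ρ) = 0) : ∑ τ, Equiv.Perm.sign τ • T τ = 0 := by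
  have h1 : ∀ T' : Equiv.Perm (Fin n) → M,
      ∑ τ, Equiv.Perm.sign τ • T' (τ * ρ) = ∑ τ, Equiv.Perm.sign τ • T' τ := fun T' => by
    conv_rhs => rw [← Equiv.sum_comp (Equiv.mulRight ρ)]
    simp only [Equiv.coe_mulRight, Equiv.Perm.sign_mul, hρ, mul_one]
  have h2 : (3 : ℝ) • ∑ τ, Equiv.Perm.sign τ • T τ = 0 := by
    have : ∑ τ, Equiv.Perm.sign τ • (T τ + T (τ * ρ) + T (τ * ρ * ρ)) = 0 := by simp [h]
    simp only [smul_add, Finset.sum_add_distrib] at this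
    rw [h1 fun τ => T (τ * ρ), h1 T] at this
    rw [← this]
    module
  exact (smul_eq_zero.1 h2).resolve_left (by norm_num)

/-! ### Skew operators and the Chevalley–Eilenberg operator. -/

namespace JetAlgebra

variable {N : ℕ} {A : Type} [CommRing A] [Algebra ℝ A] [JetAlgebra N A] {n : ℕ}

/-! ### Permuting the arguments -/

theorem finMulti_domDomCongr (σ : Equiv.Perm (Fin n))
    {T : MultilinearMap ℝ (fun _ : Fin n => A) A} (hT : T ∈ finMulti A n) :
    T.domDomCongr σ ∈ finMulti A n := by
  refine finMulti_induction (q := fun T => T.domDomCongr σ ∈ finMulti A n) ?_ ?_ hT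
  · intro p P hP
    have : (prodOp p P).domDomCongr σ = prodOp p (fun i => P (σ.symm i)) := by
      ext f
      rw [MultilinearMap.domDomCongr_apply, prodOp_apply, prodOp_apply,
        ← Equiv.prod_comp σ fun i => P (σ.symm i) (f i)]
      simp
    rw [this]; exact prodOp_mem p fun j => hP _
  · intro S T _ _ hS hT
    exact add_mem hS hT

/-- Permutation of the arguments. -/
def perm (σ : Equiv.Perm (Fin n)) : LDO A n →ₗ[ℝ] LDO A n where
  toFun X := ⟨X.1.domDomCongr σ, fun m => by
    obtain ⟨F, hF, h⟩ := X.2 m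
    exact ⟨_, finMulti_domDomCongr σ hF, fun f hf => h _ fun j => hf _⟩⟩
  map_add' _ _ := rfl
  map_smul' _ _ := rfl

@[simp] theorem perm_apply (σ : Equiv.Perm (Fin n)) (X : LDO A n) (f : Fin n → A) :
    (perm σ X).1 f = X.1 fun i => f (σ i) := rfl

theorem map_units_smul {V W : Type*} [AddCommGroup V] [AddCommGroup W] (φ : V →+ W) (z : ℤˣ)
    (v : V) : φ (z • v) = z • φ v := map_zsmul φ (z : ℤ) v

/-- Skew-symmetric operators. -/
def Skew (X : LDO A n) : Prop := ∀ (σ : Equiv.Perm (Fin n)) (f : Fin n → A),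
  X.1 (fun i => f (σ i)) = Equiv.Perm.sign σ • X.1 f

/-- The antisymmetrization `∑_σ ε(σ) σ^* X`. -/
def asym : LDO A n →ₗ[ℝ] LDO A n := ∑ σ : Equiv.Perm (Fin n), ((Equiv.Perm.sign σ : ℤ) : ℝ) • perm σ

theorem asym_apply (X : LDO A n) (f : Fin n → A) :
    (asym X).1 f = ∑ σ : Equiv.Perm (Fin n), Equiv.Perm.sign σ • X.1 fun i => f (σ i) := by
  rw [asym, LinearMap.sum_apply, LDO.sum_apply]
  refine Finset.sum_congr rfl fun σ _ => ?_
  rw [LinearMap.smul_apply, LDO.smul_apply, perm_apply, Int.cast_smul_eq_zsmul, Units.smul_def]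

theorem asym_skew (X : LDO A n) : Skew (asym X) := by
  intro τ f
  rw [asym_apply, asym_apply, Finset.smul_sum]
  conv_rhs => rw [← Equiv.sum_comp (Equiv.mulLeft τ)]
  refine Finset.sum_congr rfl fun σ _ => ?_
  rw [Equiv.coe_mulLeft, Equiv.Perm.sign_mul, smul_smul, ← mul_assoc, Int.units_mul_self, one_mul]
  rfl

theorem Skew.asym {X : LDO A n} (hX : Skew X) : asym X = (n.factorial : ℝ) • X := by
  ext f
  rw [asym_apply, LDO.smul_apply]
  simp only [hX _ f, smul_smul, Int.units_mul_self, one_smul, Finset.sum_const, Finset.card_univ,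
    Fintype.card_perm, Fintype.card_fin, Nat.cast_smul_eq_nsmul]

/-- Operators that annihilate total derivatives in all slots. -/
def Kills (X : LDO A n) : Prop := ∀ j i, rgt j (totD i) X = 0

theorem kills_iff {X : LDO A n} :
    Kills X ↔ ∀ f j i g, X.1 (Function.update f j (derD i g)) = 0 := by
  refine ⟨fun h f j i g => ?_, fun h j i => ?_⟩
  · have := congrArg (fun Y : LDO A n => Y.1 (Function.update f j g)) (h j i)
    simpa using this
  · ext f
    rw [rgt_apply]; exact h _ _ _ _

/-- What makes the strict identities possible: after insertion into such an operator, identities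
modulo divergences become identities. -/
theorem Kills.exact {X : LDO A n} (h : Kills X) (f : Fin n → A) (j : Fin n) {g : A}
    (hg : g ∈ exact A) : X.1 (Function.update f j g) = 0 := by
  obtain ⟨β, rfl⟩ := hg
  rw [MultilinearMap.map_update_sum]
  exact Finset.sum_eq_zero fun i _ => kills_iff.1 h _ _ _ _

theorem Kills.perm {X : LDO A n} (h : Kills X) (σ : Equiv.Perm (Fin n)) : Kills (perm σ X) := by
  rw [kills_iff]
  intro f j i g
  rw [perm_apply]
  have : (fun k => Function.update f j (derD i g) (σ k))
      = Function.update (fun k => f (σ k)) (σ.symm j) (derD i g) :=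
    Function.update_comp_equiv f σ.symm.symm j (derD i g) |> fun h => by
      simpa [Function.comp_def] using h
  rw [this]
  exact kills_iff.1 h _ _ _ _

theorem Kills.smul {X : LDO A n} (hX : Kills X) (c : ℝ) : Kills (c • X) := fun j i => by
  rw [map_smul, hX, smul_zero]

theorem Kills.sum {ι : Type*} {s : Finset ι} {X : ι → LDO A n} (hX : ∀ k ∈ s, Kills (X k)) :
    Kills (∑ k ∈ s, X k) := fun j i => by
  rw [map_sum]; exact Finset.sum_eq_zero fun k hk => hX k hk j i

theorem Kills.asym {X : LDO A n} (h : Kills X) : Kills (asym X) := by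
  rw [JetAlgebra.asym, LinearMap.sum_apply]
  exact Kills.sum fun σ _ => (h.perm σ).smul _

/-! ### Inserting a bilinear operator -/

/-- Two arguments for the inner and `n` for the outer operator. -/
def splitTwo (n : ℕ) : Fin 2 ⊕ Fin n ≃ Fin (n + 2) :=
  finSumFinEquiv.trans (finCongr (Nat.add_comm 2 n))

theorem splitTwo_inr (k : Fin n) : splitTwo n (Sum.inr k) = k.succ.succ := by
  ext; simp [splitTwo]

/-- `f ↦ L (M (f₀, f₁), f₂, …)`. -/
def insMap (L : MultilinearMap ℝ (fun _ : Fin (n + 1) => A) A)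
    (M : MultilinearMap ℝ (fun _ : Fin 2 => A) A) : MultilinearMap ℝ (fun _ : Fin (n + 2) => A) A :=
  (L.curryLeft.compMultilinearMap M).uncurrySum.domDomCongr (splitTwo n)

theorem insMap_apply (L : MultilinearMap ℝ (fun _ : Fin (n + 1) => A) A)
    (M : MultilinearMap ℝ (fun _ : Fin 2 => A) A) (f : Fin (n + 2) → A) :
    insMap L M f = L (Fin.cons (M ![f 0, f 1]) fun k => f k.succ.succ) := by
  have h1 : (fun i : Fin 2 => f (splitTwo n (Sum.inl i))) = ![f 0, f 1] := by
    funext i; fin_cases i <;> rfl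
  have h2 : (fun i : Fin n => f (splitTwo n (Sum.inr i))) = fun k => f k.succ.succ := by
    funext i; rw [splitTwo_inr]
  rw [← h1, ← h2]
  rfl

theorem finMulti_insMap {L : MultilinearMap ℝ (fun _ : Fin (n + 1) => A) A}
    (hL : L ∈ finMulti A (n + 1)) {M : MultilinearMap ℝ (fun _ : Fin 2 => A) A}
    (hM : M ∈ finMulti A 2) : insMap L M ∈ finMulti A (n + 2) := by
  refine finMulti_induction (q := fun L => insMap L M ∈ finMulti A (n + 2)) ?_ ?_ hL
  · intro p P hP
    -- The operator `P 0` applied to the value of `M` is first absorbed into `M` by Leibniz, so it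
    -- suffices to insert a product of factors into a plain multiplication.
    have key : ∀ M ∈ finMulti A 2, insMap (prodOp p (Function.update P 0 1)) M
        ∈ finMulti A (n + 2) := by
      intro M hM
      refine finMulti_induction (q := fun M => insMap (prodOp p (Function.update P 0 1)) M
        ∈ finMulti A (n + 2)) ?_ ?_ hM
      · intro q Q hQ
        have : insMap (prodOp p (Function.update P 0 1)) (prodOp q Q)
            = prodOp (p * q) (Fin.cons (Q 0) (Fin.cons (Q 1) fun k => P k.succ)) := by
          ext f
          rw [insMap_apply, prodOp_apply, prodOp_apply, prodOp_apply]
          simp only [Fin.prod_univ_succ, Fin.cons_zero, Fin.cons_succ, Fin.prod_univ_zero,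
            Function.update_self, Function.update_of_ne (Fin.succ_ne_zero _), Module.End.one_apply]
          simp only [Matrix.cons_val_zero, Matrix.cons_val_one, mul_one, Fin.succ_zero_eq_one]
          ring
        rw [this]
        refine prodOp_mem _ fun j => ?_
        refine Fin.cases (hQ 0) (fun j => ?_) j
        exact Fin.cases (hQ 1) (fun j => hP _) j
      · intro S T _ _ hS hT
        have : insMap (prodOp p (Function.update P 0 1)) (S + T)
            = insMap (prodOp p (Function.update P 0 1)) S
              + insMap (prodOp p (Function.update P 0 1)) T := by
          ext f
          rw [add_apply, insMap_apply, insMap_apply, insMap_apply, add_apply,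
            MultilinearMap.cons_add]
        rw [this]; exact add_mem hS hT
    have : insMap (prodOp p P) M
        = insMap (prodOp p (Function.update P 0 1)) ((P 0).compMultilinearMap M) := by
      ext f
      rw [insMap_apply, insMap_apply, prodOp_apply, prodOp_apply]
      simp [Fin.prod_univ_succ]
    rw [this]
    exact key _ (finMulti_left (hP 0) M hM)
  · intro S T _ _ hS hT
    exact add_mem hS hT

theorem cons_mem_box {m : ℕ} {g : A} (hg : g ∈ jetLE A m) {f : Fin n → A} (hf : f ∈ box A n m) :
    (Fin.cons g f : Fin (n + 1) → A) ∈ box A (n + 1) m :=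
  fun j => Fin.cases hg hf j

/-- `f ↦ L (M (f₀, f₁), f₂, …)` as a local differential operator. -/
def ins (M : LDO A 2) : LDO A (n + 1) →ₗ[ℝ] LDO A (n + 2) where
  toFun L := ⟨insMap L.1 M.1, fun m => by
    obtain ⟨k, hk⟩ := ldo_jetLE M m
    obtain ⟨F, hF, hF'⟩ := M.2 m
    obtain ⟨G, hG, hG'⟩ := L.2 (max m k)
    refine ⟨insMap G F, finMulti_insMap hG hF, fun f hf => ?_⟩
    have h2 : ![f 0, f 1] ∈ box A 2 m := fun j => by fin_cases j <;> exact hf _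
    rw [insMap_apply, insMap_apply, ← hF' _ h2, hG']
    exact cons_mem_box (jetLE_mono (le_max_right _ _) (hk _ h2))
      fun j => jetLE_mono (le_max_left _ _) (hf _)⟩
  map_add' _ _ := rfl
  map_smul' _ _ := rfl

theorem ins_apply (M : LDO A 2) (L : LDO A (n + 1)) (f : Fin (n + 2) → A) :
    (ins M L).1 f = L.1 (Fin.cons (M.1 ![f 0, f 1]) fun k => f k.succ.succ) := insMap_apply _ _ _

theorem apply_cons_zero (L : LDO A (n + 1)) (f : Fin n → A) : L.1 (Fin.cons 0 f) = 0 :=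
  L.1.map_coord_zero 0 rfl

theorem Kills.ins {M : LDO A 2} (hM : Kills M) {L : LDO A (n + 1)} (hL : Kills L) :
    Kills (ins M L) := by
  rw [kills_iff] at *
  intro f j i g
  rw [ins_apply]
  refine Fin.cases ?_ (fun j => Fin.cases ?_ (fun j => ?_) j) j
  · have : ![Function.update f 0 (derD i g) 0, Function.update f 0 (derD i g) 1]
        = Function.update ![f 0, f 1] 0 (derD i g) := by
      funext k; fin_cases k <;> rfl
    rw [this, hM, apply_cons_zero]
  · have : ![Function.update f (Fin.succ 0) (derD i g) 0, Function.update f (Fin.succ 0) (derD i g) 1]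
        = Function.update ![f 0, f 1] 1 (derD i g) := by
      funext k; fin_cases k <;> rfl
    rw [this, hM, apply_cons_zero]
  · have : (Fin.cons (M.1 ![Function.update f j.succ.succ (derD i g) 0,
          Function.update f j.succ.succ (derD i g) 1])
          fun k => Function.update f j.succ.succ (derD i g) k.succ.succ : Fin (n + 1) → A)
        = Function.update (Fin.cons (M.1 ![f 0, f 1]) fun k => f k.succ.succ) j.succ
          (derD i g) := by
      funext k
      refine Fin.cases ?_ (fun k => ?_) k
      · rw [Function.update_of_ne (Fin.succ_ne_zero j).symm, Fin.cons_zero, Fin.cons_zero,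
          Function.update_of_ne (Fin.succ_ne_zero _).symm, Function.update_of_ne]
        exact fun h => Fin.succ_ne_zero j (Fin.succ_injective _ h.symm)
      · by_cases h : k = j
        · subst h; simp
        · simp [Function.update_of_ne, h]
    rw [this, hL]

theorem ins_lft (M : LDO A 2) (P : diffOp A) (L : LDO A (n + 1)) :
    ins M (lft P L) = lft P (ins M L) := rfl

theorem asym_lft (P : diffOp A) (X : LDO A n) : asym (lft P X) = lft P (asym X) := by
  rw [asym, LinearMap.sum_apply, LinearMap.sum_apply, map_sum]
  refine Finset.sum_congr rfl fun σ _ => ?_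
  rw [LinearMap.smul_apply, LinearMap.smul_apply, map_smul]
  rfl

/-- The Chevalley–Eilenberg operator `∑ ± L (M (f_{σ0}, f_{σ1}), f_{σ2}, …)`. -/
def delta (M : LDO A 2) : LDO A (n + 1) →ₗ[ℝ] LDO A (n + 2) :=
  ((2 : ℝ) * n.factorial)⁻¹ • asym ∘ₗ ins M

theorem delta_eq (M : LDO A 2) (L : LDO A (n + 1)) :
    delta M L = ((2 : ℝ) * n.factorial)⁻¹ • asym (ins M L) := rfl

theorem delta_lft (M : LDO A 2) (P : diffOp A) (L : LDO A (n + 1)) :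
    delta M (lft P L) = lft P (delta M L) := by
  rw [delta_eq, delta_eq, ins_lft, asym_lft, map_smul]

theorem Skew.smul {X : LDO A n} (h : Skew X) (c : ℝ) : Skew (c • X) := fun σ f => by
  rw [LDO.smul_apply, LDO.smul_apply, h σ f, smul_comm]

theorem delta_skew (M : LDO A 2) (L : LDO A (n + 1)) : Skew (delta M L) := (asym_skew _).smul _

theorem Kills.delta {M : LDO A 2} (hM : Kills M) {L : LDO A (n + 1)} (hL : Kills L) :
    Kills (delta M L) := (hM.ins hL).asym.smul _

/-! ### The square of the Chevalley–Eilenberg operator -/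

theorem skew_two {M : LDO A 2} (hM : Skew M) (f g : A) : M.1 ![f, g] = -M.1 ![g, f] := by
  have := hM (Equiv.swap 0 1) ![g, f]
  rw [Equiv.Perm.sign_swap (by decide)] at this
  rw [← neg_one_smul ℤ]
  refine Eq.trans (congrArg _ ?_) this
  funext k; fin_cases k <;> rfl

/-- The Jacobi identity up to divergences. -/
def JacobiExact (M : LDO A 2) : Prop := ∀ f g h : A,
  M.1 ![M.1 ![f, g], h] + M.1 ![M.1 ![g, h], f] + M.1 ![M.1 ![h, f], g] ∈ exact A

/-- The even 3-cycle `0 ↦ 1 ↦ c ↦ 0` groups the permutations in threes. Each group is `L` with a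
Jacobi sum in its first slot, hence `L` of a divergence; the remaining slots `r k` are fixed by the
cycle. -/
theorem sum_jacobi {M : LDO A 2} (hJ : JacobiExact M) {L : LDO A (n + 1)} (hL : Kills L)
    (f : Fin (n + 3) → A) (c : Fin (n + 3)) (h0 : c ≠ 0) (h1 : c ≠ 1) (r : Fin n → Fin (n + 3))
    (hr : ∀ k, r k ≠ 0 ∧ r k ≠ 1 ∧ r k ≠ c) :
    ∑ τ : Equiv.Perm (Fin (n + 3)), Equiv.Perm.sign τ •
      L.1 (Fin.cons (M.1 ![M.1 ![f (τ 0), f (τ 1)], f (τ c)]) fun k => f (τ (r k))) = 0 := by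
  have h01 : (0 : Fin (n + 3)) ≠ 1 := by simp
  let ρ : Equiv.Perm (Fin (n + 3)) := Equiv.swap 0 1 * Equiv.swap 1 c
  have e0 : ρ 0 = 1 := by
    simp only [ρ, Equiv.Perm.mul_apply, Equiv.swap_apply_of_ne_of_ne h01 (Ne.symm h0),
      Equiv.swap_apply_left]
  have e1 : ρ 1 = c := by
    simp only [ρ, Equiv.Perm.mul_apply, Equiv.swap_apply_left, Equiv.swap_apply_of_ne_of_ne h0 h1]
  have ec : ρ c = 0 := by
    simp only [ρ, Equiv.Perm.mul_apply, Equiv.swap_apply_right]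
  have er : ∀ k, ρ (r k) = r k := fun k => by
    simp only [ρ, Equiv.Perm.mul_apply,
      Equiv.swap_apply_of_ne_of_ne (hr k).2.1 (hr k).2.2,
      Equiv.swap_apply_of_ne_of_ne (hr k).1 (hr k).2.1]
  refine sum_sign_smul_eq_zero_of_cycle ρ ?_ fun τ => ?_
  · rw [Equiv.Perm.sign_mul, Equiv.Perm.sign_swap h01, Equiv.Perm.sign_swap (Ne.symm h1)]; rfl
  · simp only [Equiv.Perm.mul_apply, e0, e1, ec, er]
    rw [← MultilinearMap.cons_add, ← MultilinearMap.cons_add]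
    have := hL.exact (Fin.cons 0 fun k => f (τ (r k))) 0 (hJ (f (τ 0)) (f (τ 1)) (f (τ c)))
    rwa [Fin.update_cons_zero] at this

theorem delta_delta {M : LDO A 2} (hM : Skew M) (hJ : JacobiExact M) {L : LDO A (n + 1)}
    (hL : Kills L) (hs : Skew L) : delta M (delta M L) = 0 := by
  rw [delta_eq, delta_eq, map_smul, map_smul]
  suffices h : asym (ins M (asym (ins M L))) = 0 by rw [h, smul_zero, smul_zero]
  ext f
  rw [asym_apply, LDO.zero_apply]
  simp only [ins_apply, asym_apply, Finset.smul_sum]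
  rw [Finset.sum_comm]
  refine Finset.sum_eq_zero fun σ _ => ?_
  simp only [smul_comm _ (Equiv.Perm.sign σ)]
  rw [← Finset.smul_sum]
  let g : Equiv.Perm (Fin (n + 3)) → Fin (n + 2) → A := fun τ =>
    Fin.cons (M.1 ![f (τ 0), f (τ 1)]) fun k => f (τ k.succ.succ)
  have hg0 : ∀ τ, g τ 0 = M.1 ![f (τ 0), f (τ 1)] := fun τ => rfl
  have hg : ∀ τ x, x ≠ 0 → g τ x = f (τ x.succ) := fun τ x hx => by
    obtain ⟨y, rfl⟩ := Fin.exists_succ_eq.2 hx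
    rfl
  have hne : ∀ {x y : Fin (n + 2)}, x ≠ y → σ x ≠ σ y := fun h h' => h (σ.injective h')
  have s1 : ∀ {x : Fin (n + 2)}, x ≠ 0 → x.succ ≠ (1 : Fin (n + 3)) := fun hx h =>
    hx (Fin.succ_injective _ h)
  have k0 : ∀ k : Fin n, (k.succ.succ : Fin (n + 2)) ≠ 0 := fun k => Fin.succ_ne_zero _
  have k1 : ∀ k : Fin n, (k.succ.succ : Fin (n + 2)) ≠ 1 := fun k h =>
    Fin.succ_ne_zero k (Fin.succ_injective _ h)
  have h01 : (0 : Fin (n + 2)) ≠ 1 := by simp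
  change Equiv.Perm.sign σ • ∑ τ, Equiv.Perm.sign τ •
    L.1 (Fin.cons (M.1 ![g τ (σ 0), g τ (σ 1)]) fun k => g τ (σ k.succ.succ)) = 0
  suffices h : ∑ τ, Equiv.Perm.sign τ •
    L.1 (Fin.cons (M.1 ![g τ (σ 0), g τ (σ 1)]) fun k => g τ (σ k.succ.succ)) = 0 by
    rw [h, smul_zero]
  -- For fixed `σ` there are three positions for the inner value `M(f, f)`: it is the first or the
  -- second argument of the outer `M`, where the Jacobi identity applies, or it stays among the
  -- arguments of `L`.
  by_cases c0 : σ 0 = 0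
  · have hs1 : σ 1 ≠ 0 := fun h => hne h01.symm (h.trans c0.symm)
    have hsk : ∀ k : Fin n, σ k.succ.succ ≠ 0 := fun k h => hne (k0 k) (h.trans c0.symm)
    simp only [c0, hg0, hg _ _ hs1, hg _ _ (hsk _)]
    exact sum_jacobi hJ hL f (σ 1).succ (Fin.succ_ne_zero _) (s1 hs1) _ fun k =>
      ⟨Fin.succ_ne_zero _, s1 (hsk k), fun h => hne (k1 k) (Fin.succ_injective _ h)⟩
  by_cases c1 : σ 1 = 0
  · have hsk : ∀ k : Fin n, σ k.succ.succ ≠ 0 := fun k h => hne (k1 k) (h.trans c1.symm)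
    have := sum_jacobi hJ hL f (σ 0).succ (Fin.succ_ne_zero _) (s1 c0)
      (fun k => (σ k.succ.succ).succ) fun k =>
      ⟨Fin.succ_ne_zero _, s1 (hsk k), fun h => hne (k0 k) (Fin.succ_injective _ h)⟩
    simp only [c1, hg0, hg _ _ c0, hg _ _ (hsk _)]
    rw [← neg_eq_zero, ← Finset.sum_neg_distrib, ← this]
    refine Finset.sum_congr rfl fun τ _ => ?_
    rw [skew_two hM, ← neg_one_smul ℝ (M.1 _), MultilinearMap.cons_smul, neg_one_smul, smul_neg,
      neg_neg]
  · obtain ⟨q, hq⟩ : ∃ q : Fin n, σ q.succ.succ = 0 := by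
      obtain ⟨x, hx⟩ := σ.surjective 0
      obtain ⟨y, rfl⟩ := Fin.exists_succ_eq.2 (fun h : x = 0 => c0 (h ▸ hx))
      obtain ⟨q, rfl⟩ := Fin.exists_succ_eq.2 (fun h : y = 0 => c1 (by rw [h] at hx; exact hx))
      exact ⟨q, hx⟩
    have h01' : (0 : Fin (n + 3)) ≠ 1 := by simp
    have hab : (σ 0).succ ≠ (σ 1).succ := fun h => hne h01 (Fin.succ_injective _ h)
    -- Two separate copies of `M` are arguments of `L`. The permutation `ρ` exchanges their pairs of
    -- arguments and is even, whereas exchanging the two values inside the skew `L` costs a sign;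
    -- the terms cancel.
    let ρ : Equiv.Perm (Fin (n + 3)) := Equiv.swap 0 (σ 0).succ * Equiv.swap 1 (σ 1).succ
    have e0 : ρ 0 = (σ 0).succ := by
      simp only [ρ, Equiv.Perm.mul_apply,
        Equiv.swap_apply_of_ne_of_ne h01' (Fin.succ_ne_zero (σ 1)).symm, Equiv.swap_apply_left]
    have e1 : ρ 1 = (σ 1).succ := by
      simp only [ρ, Equiv.Perm.mul_apply, Equiv.swap_apply_left,
        Equiv.swap_apply_of_ne_of_ne (Fin.succ_ne_zero (σ 1)) hab.symm]
    have ea : ρ (σ 0).succ = 0 := by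
      simp only [ρ, Equiv.Perm.mul_apply, Equiv.swap_apply_of_ne_of_ne (s1 c0) hab,
        Equiv.swap_apply_right]
    have eb : ρ (σ 1).succ = 1 := by
      simp only [ρ, Equiv.Perm.mul_apply, Equiv.swap_apply_right,
        Equiv.swap_apply_of_ne_of_ne h01'.symm (s1 c0).symm]
    have hτ : ∀ (τ : Equiv.Perm (Fin (n + 3))) x, (τ * ρ) x = τ (ρ x) := fun _ _ => rfl
    refine sum_sign_smul_eq_zero_of_swap ρ ?_ fun τ => ?_
    · rw [Equiv.Perm.sign_mul, Equiv.Perm.sign_swap (Fin.succ_ne_zero _).symm,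
        Equiv.Perm.sign_swap (s1 c1).symm]; rfl
    · have := hs (Equiv.swap 0 q.succ)
        (Fin.cons (M.1 ![g τ (σ 0), g τ (σ 1)]) fun k => g τ (σ k.succ.succ))
      rw [Equiv.Perm.sign_swap (Fin.succ_ne_zero _).symm] at this
      rw [← neg_one_smul ℤ]
      refine Eq.trans (congrArg _ (funext fun x => ?_)) this
      refine Fin.cases ?_ (fun k => ?_) x
      · rw [Equiv.swap_apply_left, Fin.cons_zero, Fin.cons_succ, hq, hg _ _ c0, hg _ _ c1,
          hτ, hτ, ea, eb, hg0]
      · rw [Fin.cons_succ]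
        by_cases hk : k = q
        · subst hk
          rw [Equiv.swap_apply_right, Fin.cons_zero, hq, hg0, hg _ _ c0, hg _ _ c1,
            hτ, hτ, e0, e1]
        · have hk0 : σ k.succ.succ ≠ 0 := fun h => by
            have := σ.injective (h.trans hq.symm)
            exact hk (Fin.succ_injective _ (Fin.succ_injective _ this))
          rw [Equiv.swap_apply_of_ne_of_ne (Fin.succ_ne_zero _)
            (fun h => hk (Fin.succ_injective _ h)), Fin.cons_succ, hg _ _ hk0, hg _ _ hk0,
            Equiv.Perm.mul_apply]
          congr 2
          simp only [ρ, Equiv.Perm.mul_apply]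
          rw [Equiv.swap_apply_of_ne_of_ne (s1 hk0)
              (fun h => hne (k1 k) (Fin.succ_injective _ h)),
            Equiv.swap_apply_of_ne_of_ne (Fin.succ_ne_zero _)
              (fun h => hne (k0 k) (Fin.succ_injective _ h))]

/-- The values of `δM` are exact. -/
theorem delta_self_mem {M : LDO A 2} (hJ : JacobiExact M) : delta M M ∈ exactValued A 3 := by
  refine Submodule.smul_mem _ _ fun f => ?_
  change (asym (ins M M)).1 f ∈ exact A
  rw [asym_apply]
  simp only [ins_apply]
  let T : Equiv.Perm (Fin 3) → A := fun τ =>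
    M.1 (Fin.cons (M.1 ![f (τ 0), f (τ 1)]) fun k => f (τ k.succ.succ))
  have hT : ∀ τ, T τ = M.1 ![M.1 ![f (τ 0), f (τ 1)], f (τ 2)] := fun τ =>
    congrArg _ (funext fun k => by fin_cases k <;> rfl)
  have h := sum_sign_smul_eq_zero_of_cycle (M := A ⧸ exact A) (T := fun τ => (exact A).mkQ (T τ))
    (Equiv.swap 0 1 * Equiv.swap 1 2) (by decide) fun τ => by
      rw [← map_add, ← map_add, Submodule.mkQ_apply, Submodule.Quotient.mk_eq_zero]
      simp only [hT, Equiv.Perm.mul_apply]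
      exact hJ (f (τ 0)) (f (τ 1)) (f (τ 2))
  rw [← Submodule.Quotient.mk_eq_zero, ← Submodule.mkQ_apply, map_sum, ← h]
  exact Finset.sum_congr rfl fun τ _ => map_units_smul (exact A).mkQ.toAddMonoidHom _ _

end JetAlgebra

/-! ### Recursive construction of the higher brackets. -/

namespace JetAlgebra

variable {N : ℕ} {A : Type} [CommRing A] [Algebra ℝ A] [JetAlgebra N A] {n : ℕ}

theorem diff_neg (w : Finset (Fin N) → LDO A n) :
    Koszul.diff ldoD (fun S => -w S) = fun T => -Koszul.diff ldoD w T :=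
  funext fun T => (Koszul.diff_map (e := ldoD) (d := ldoD) (-AddMonoidHom.id (LDO A n))
    (fun i v => (map_neg (ldoD i) v).symm) w T).symm

/-- Primitives of operators that annihilate divergences may be chosen to annihilate divergences. -/
theorem exists_primitive_kills [Nonempty (Fin N)] {k : ℤ} {v e : Finset (Fin N) → LDO A n}
    (hv : ∀ S, Kills (v S)) (he : Koszul.IsForm k e) (hd : Koszul.diff ldoD e = v) :
    ∃ e', Koszul.IsForm k e' ∧ Koszul.diff ldoD e' = v ∧ ∀ S, Kills (e' S) := by
  -- The projections are applied slot by slot. Each commutes with `d_H`, fixes `v`, and preserves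
  -- what was achieved in earlier slots since it commutes with precomposition there.
  have key : ∀ s : Finset (Fin n), ∃ e', Koszul.IsForm k e' ∧ Koszul.diff ldoD e' = v ∧
      ∀ S, ∀ j ∈ s, ∀ i, rgt j (totD i) (e' S) = 0 := by
    intro s
    induction s using Finset.induction_on with
    | empty => exact ⟨e, he, hd, by simp⟩
    | insert j s hj ih =>
      obtain ⟨e', he', hd', hk⟩ := ih
      have h0 : proj j (0 : LDO A n) = 0 := by
        have := proj_add j (0 : LDO A n) 0
        simpa using this
      refine ⟨fun S => proj j (e' S), fun S hS => ?_, ?_, fun S l hl i => ?_⟩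
      · show proj j (e' S) = 0
        rw [he' S hS, h0]
      · funext T
        have := Koszul.diff_map (d := ldoD) (e := ldoD) (AddMonoidHom.mk' (proj j) (proj_add j))
          (fun i X => proj_lft_totD j i X) e' T
        rw [hd'] at this
        exact this.symm.trans (proj_eq_self fun i => hv T j i)
      · by_cases hlj : l = j
        · subst hlj; exact rgt_totD_proj l i _
        · rw [← proj_rgt (Ne.symm hlj), hk S l (Finset.mem_of_mem_insert_of_ne hl hlj), h0]
  obtain ⟨e', he', hd', hk⟩ := key Finset.univ
  exact ⟨e', he', hd', fun S j i => hk S j (Finset.mem_univ j) i⟩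

/-- Primitives of skew-symmetric operators may be chosen skew-symmetric. -/
theorem exists_primitive_skew {k : ℤ} {v e : Finset (Fin N) → LDO A n}
    (hv : ∀ S, Skew (v S)) (he : Koszul.IsForm k e) (hd : Koszul.diff ldoD e = v)
    (hk : ∀ S, Kills (e S)) :
    ∃ e', Koszul.IsForm k e' ∧ Koszul.diff ldoD e' = v ∧ (∀ S, Kills (e' S)) ∧
      ∀ S, Skew (e' S) := by
  refine ⟨fun S => ((n.factorial : ℝ)⁻¹ • asym : LDO A n →ₗ[ℝ] LDO A n) (e S), fun S hS => ?_, ?_,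
    fun S => ((hk S).asym).smul _, fun S => (asym_skew _).smul _⟩
  · show ((n.factorial : ℝ)⁻¹ • asym : LDO A n →ₗ[ℝ] LDO A n) (e S) = 0
    rw [he S hS, map_zero]
  · funext T
    have := Koszul.diff_map (d := ldoD) (e := ldoD)
      ((n.factorial : ℝ)⁻¹ • asym : LDO A n →ₗ[ℝ] LDO A n).toAddMonoidHom
      (fun i X => by
        show (n.factorial : ℝ)⁻¹ • asym (lft (totD i) X) = lft (totD i) ((n.factorial : ℝ)⁻¹ • asym X)
        rw [asym_lft, map_smul]) e T
    rw [hd] at this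
    refine this.symm.trans ?_
    show (n.factorial : ℝ)⁻¹ • asym (v T) = v T
    rw [(hv T).asym, smul_smul, inv_mul_cancel₀ (by exact_mod_cast n.factorial_ne_zero), one_smul]

/-- The higher brackets: `d L_{n+1} = -δ L_n`. -/
theorem exists_brackets [Nonempty (Fin N)] {M : LDO A 2} (hs : Skew M) (hk : Kills M)
    (hJ : JacobiExact M) :
    ∃ L : ∀ n : ℕ, Finset (Fin N) → LDO A (n + 2), L 0 = Pi.single Finset.univ M ∧
      (∀ n : ℕ, Koszul.IsForm ((N : ℤ) - n) (L n)) ∧ (∀ n S, Skew (L n S)) ∧ (∀ n S, Kills (L n S)) ∧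
      ∀ n, Koszul.diff ldoD (L (n + 1)) = fun S => -delta M (L n S) := by
  -- The invariant of the recursion contains what is needed to solve for the next bracket: `δ w` is
  -- closed and, for top forms, has exact values. The latter is relevant only at `n = 0`.
  let P : ∀ n : ℕ, (Finset (Fin N) → LDO A (n + 2)) → Prop := fun n w =>
    Koszul.IsForm ((N : ℤ) - n) w ∧ (∀ S, Skew (w S)) ∧ (∀ S, Kills (w S)) ∧
      Koszul.diff ldoD (fun S => delta M (w S)) = 0 ∧
      (n = 0 → delta M (w Finset.univ) ∈ exactValued A (n + 3))
  have step : ∀ n w, P n w → ∃ w', P (n + 1) w' ∧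
      Koszul.diff ldoD w' = fun S => -delta M (w S) := by
    rintro n w ⟨h1, h2, h3, h4, h5⟩
    have hvf : Koszul.IsForm ((N : ℤ) - n) fun S => -delta M (w S) := fun S hS => by
      show -delta M (w S) = 0
      rw [h1 S hS, map_zero, neg_zero]
    have hvk : ∀ S, Kills (-delta M (w S)) := fun S => by
      rw [← neg_one_smul ℝ (delta M (w S))]; exact (hk.delta (h3 S)).smul _
    have hvs : ∀ S, Skew (-delta M (w S)) := fun S => by
      rw [← neg_one_smul ℝ (delta M (w S))]; exact (delta_skew M (w S)).smul _
    obtain ⟨e, he, hd⟩ := exists_primitive (0 : Fin (n + 3)) hvf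
      (by rw [diff_neg, h4]; funext T; exact neg_zero)
      (fun h => neg_mem (h5 (by omega)))
    obtain ⟨e, he, hd, hek⟩ := exists_primitive_kills hvk he hd
    obtain ⟨e, he, hd, hek, hes⟩ := exists_primitive_skew hvs he hd hek
    refine ⟨e, ⟨?_, hes, hek, ?_, fun h => absurd h (Nat.succ_ne_zero n)⟩, hd⟩
    · convert he using 1; push_cast; ring
    · funext T
      have := Koszul.diff_map (d := ldoD) (e := ldoD)
        (delta M : LDO A (n + 3) →ₗ[ℝ] LDO A (n + 4)).toAddMonoidHom
        (fun i X => delta_lft M (totD i) X) e T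
      rw [hd] at this
      refine this.symm.trans ?_
      show delta M (-delta M (w T)) = 0
      -- Closedness of the next right-hand side: `d δ w' = δ d w' = -δ δ w = 0`.
      rw [map_neg, delta_delta hs hJ (h3 T) (h2 T), neg_zero]
  have h0 : P 0 (Pi.single Finset.univ M) := by
    have hf : Koszul.IsForm ((N : ℤ) - (0 : ℕ)) (Pi.single Finset.univ M :
        Finset (Fin N) → LDO A 2) := fun S hS => by
      have : S ≠ Finset.univ := by rintro rfl; simp at hS
      rw [Pi.single_eq_of_ne this]
    refine ⟨hf, fun S => ?_, fun S => ?_, ?_, fun _ => ?_⟩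
    · by_cases h : S = Finset.univ
      · subst h; rwa [Pi.single_eq_same]
      · rw [Pi.single_eq_of_ne h]; intro σ f; simp
    · by_cases h : S = Finset.univ
      · subst h; rwa [Pi.single_eq_same]
      · rw [Pi.single_eq_of_ne h]; intro σ f; simp
    · have hf' : Koszul.IsForm (N : ℤ) fun S => delta M ((Pi.single Finset.univ M :
        Finset (Fin N) → LDO A 2) S) := fun S hS => by
        show delta M ((Pi.single Finset.univ M : Finset (Fin N) → LDO A 2) S) = 0
        rw [hf S (by simpa using hS), map_zero]
      funext T
      refine (hf'.diff ldoD) T fun h => ?_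
      have := Finset.card_le_univ T
      simp only [Fintype.card_fin] at this
      omega
    · rw [Pi.single_eq_same]; exact delta_self_mem hJ
  let L : ∀ n : ℕ, {w : Finset (Fin N) → LDO A (n + 2) // P n w} := fun n =>
    Nat.rec ⟨_, h0⟩ (fun n w => ⟨(step n w.1 w.2).choose, (step n w.1 w.2).choose_spec.1⟩) n
  exact ⟨fun n => (L n).1, rfl, fun n => (L n).2.1, fun n => (L n).2.2.1, fun n => (L n).2.2.2.1,
    fun n => (step n (L n).1 (L n).2).choose_spec.2⟩

/-- A bracket of top forms may be corrected by exact terms so that it is skew-symmetric and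
annihilates total derivatives. -/
theorem exists_bracket [Nonempty (Fin N)] {b : LDO A 2}
    (h1 : ∀ f g i, b.1 ![f, derD i g] ∈ exact A) (h2 : ∀ f g, b.1 ![f, g] + b.1 ![g, f] ∈ exact A) :
    ∃ M : LDO A 2, Skew M ∧ Kills M ∧ M - b ∈ exactValued A 2 := by
  have e2 : ∀ f : Fin 2 → A, f = ![f 0, f 1] := fun f => by
    funext k; fin_cases k <;> rfl
  have r1 : ∀ i, rgt 1 (totD i) b ∈ exactValued A 2 := fun i f => by
    have : Function.update f 1 (derD i (f 1)) = ![f 0, derD i (f 1)] := by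
      funext k; fin_cases k <;> rfl
    rw [rgt_apply, totD_apply, this]; exact h1 _ _ _
  have r0 : ∀ i, rgt 0 (totD i) b ∈ exactValued A 2 := fun i f => by
    have : Function.update f 0 (derD i (f 0)) = ![derD i (f 0), f 1] := by
      funext k; fin_cases k <;> rfl
    rw [rgt_apply, totD_apply, this]
    have := sub_mem (h2 (derD i (f 0)) (f 1)) (h1 (f 1) (f 0) i)
    rwa [add_sub_cancel_right] at this
  have p1 := proj_sub_mem (j := (1 : Fin 2)) (r := 0) (by decide) r1
  -- The correction in slot `1` keeps the hypothesis for slot `0`; the later correction in slot `0`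
  -- keeps the annihilation in slot `1`, because the projection commutes with the other slot.
  have r0' : ∀ i, rgt 0 (totD i) (proj 1 b) ∈ exactValued A 2 := fun i => by
    rw [← proj_rgt (by decide)]; exact proj_mem_exactValued 1 (r0 i)
  have p0 := proj_sub_mem (j := (0 : Fin 2)) (r := 1) (by decide) r0'
  let c := proj 0 (proj (1 : Fin 2) b)
  have hc : Kills c := fun j i => by
    fin_cases j
    · exact rgt_totD_proj 0 i _
    · show rgt 1 (totD i) (proj 0 (proj 1 b)) = 0
      rw [← proj_rgt (by decide), rgt_totD_proj]
      have := proj_add (0 : Fin 2) (0 : LDO A 2) 0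
      simpa using this
  have hcb : c - b ∈ exactValued A 2 := by
    have := add_mem p0 p1
    rwa [sub_add_sub_cancel] at this
  refine ⟨(2 : ℝ)⁻¹ • asym c, (asym_skew c).smul _, hc.asym.smul _, fun f => ?_⟩
  have hu : (Finset.univ : Finset (Equiv.Perm (Fin 2))) = {1, Equiv.swap 0 1} := by decide
  rw [LDO.sub_apply, LDO.smul_apply, asym_apply, hu, Finset.sum_pair (by decide),
    Equiv.Perm.sign_swap (by decide), Equiv.Perm.sign_one]
  have hsw : (fun i => f ((Equiv.swap 0 1 : Equiv.Perm (Fin 2)) i)) = ![f 1, f 0] := by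
    funext k; fin_cases k <;> rfl
  rw [hsw]
  simp only [Equiv.Perm.one_apply, one_smul, Units.neg_smul]
  have ha := hcb f
  have hb := hcb ![f 1, f 0]
  have hd := h2 (f 0) (f 1)
  rw [← e2 f] at hd
  rw [LDO.sub_apply] at ha hb
  -- Antisymmetrizing `c` changes it modulo exact values only by half of `b(f,g) + b(g,f)`, which is
  -- exact.
  have := sub_mem (Submodule.smul_mem _ (2 : ℝ)⁻¹ (sub_mem ha hb))
    (Submodule.smul_mem _ (2 : ℝ)⁻¹ hd)
  convert this using 1
  module

/-- The outer replacement of `M` by `b` costs a divergence by hypothesis. The inner one costs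
nothing, because the divergence `M - b` is an argument of an operator that kills it. -/
theorem jacobiExact_of_sub_mem {M b : LDO A 2} (hM : Kills M) (hb : M - b ∈ exactValued A 2)
    (hJ : ∀ f g h, b.1 ![b.1 ![f, g], h] + b.1 ![b.1 ![g, h], f] + b.1 ![b.1 ![h, f], g]
      ∈ exact A) : JacobiExact M := by
  have key : ∀ f g h, M.1 ![M.1 ![f, g], h] - b.1 ![b.1 ![f, g], h] ∈ exact A := by
    intro f g h
    have e : ∀ x, ![x, h] = Function.update ![0, h] 0 x := fun x => by
      funext k; fin_cases k <;> rfl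
    have h1 : M.1 ![M.1 ![f, g], h] = M.1 ![b.1 ![f, g], h] := by
      rw [← sub_eq_zero, e, e (b.1 _), ← MultilinearMap.map_update_sub]
      exact hM.exact _ 0 (hb ![f, g])
    rw [h1]
    exact hb _
  intro f g h
  have := add_mem (add_mem (add_mem (key f g h) (key g h f)) (key h f g)) (hJ f g h)
  convert this using 1
  abel

end JetAlgebra

/-! ### Unshuffles -/

/-- Permutation of the two blocks. -/
def blockPerm {n : ℕ} (s : Equiv.Perm (Fin 2)) (t : Equiv.Perm (Fin n)) :
    Equiv.Perm (Fin (n + 2)) := (JetAlgebra.splitTwo n).permCongr (Equiv.Perm.sumCongr s t)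

theorem blockPerm_inl {n : ℕ} (s : Equiv.Perm (Fin 2)) (t : Equiv.Perm (Fin n)) (a : Fin 2) :
    blockPerm s t (JetAlgebra.splitTwo n (Sum.inl a)) = JetAlgebra.splitTwo n (Sum.inl (s a)) := by
  simp [blockPerm, Equiv.permCongr_apply]

theorem blockPerm_inr {n : ℕ} (s : Equiv.Perm (Fin 2)) (t : Equiv.Perm (Fin n)) (a : Fin n) :
    blockPerm s t (JetAlgebra.splitTwo n (Sum.inr a)) = JetAlgebra.splitTwo n (Sum.inr (t a)) := by
  simp [blockPerm, Equiv.permCongr_apply]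

theorem sign_blockPerm {n : ℕ} (s : Equiv.Perm (Fin 2)) (t : Equiv.Perm (Fin n)) :
    Equiv.Perm.sign (blockPerm s t) = Equiv.Perm.sign s * Equiv.Perm.sign t := by
  rw [blockPerm, Equiv.Perm.sign_permCongr, Equiv.Perm.sign_sumCongr]

theorem mem_unshuffles_two {n : ℕ} {u : Equiv.Perm (Fin (n + 2))} : u ∈ unshuffles (n + 2) 2 ↔
    Monotone (fun a => u (JetAlgebra.splitTwo n (Sum.inl a))) ∧
      Monotone (fun a => u (JetAlgebra.splitTwo n (Sum.inr a))) := by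
  have hl : ∀ a : Fin 2, ((JetAlgebra.splitTwo n (Sum.inl a) : Fin (n + 2)) : ℕ) = a := fun a => by
    simp [JetAlgebra.splitTwo]
  have hr : ∀ a : Fin n, ((JetAlgebra.splitTwo n (Sum.inr a) : Fin (n + 2)) : ℕ) = a + 2 :=
    fun a => by rw [JetAlgebra.splitTwo_inr]; simp
  simp only [unshuffles, Finset.mem_filter, Finset.mem_univ, true_and]
  constructor
  · intro h
    refine ⟨fun a b hab => ?_, fun a b hab => ?_⟩
    · rcases hab.eq_or_lt with rfl | hab
      · exact le_rfl
      · refine (h _ _ ?_ (Or.inl ?_)).le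
        · rw [Fin.lt_def, hl, hl]; exact hab
        · rw [hl]; exact b.2
    · rcases hab.eq_or_lt with rfl | hab
      · exact le_rfl
      · refine (h _ _ ?_ (Or.inr ?_)).le
        · rw [Fin.lt_def, hr, hr]; simpa using hab
        · rw [hr]; omega
  · rintro ⟨h1, h2⟩ a b hab hk
    obtain ⟨a', rfl⟩ := (JetAlgebra.splitTwo n).surjective a
    obtain ⟨b', rfl⟩ := (JetAlgebra.splitTwo n).surjective b
    refine lt_of_le_of_ne ?_ fun h => hab.ne (u.injective h)
    rcases a' with a | a <;> rcases b' with b | b <;> rw [Fin.lt_def] at hab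
    · rw [hl, hl] at hab; exact h1 (Fin.le_def.2 hab.le)
    · rw [hr, hl] at hk
      have := a.2
      omega
    · rw [hr, hl] at hab
      have := b.2
      omega
    · rw [hr, hr] at hab; exact h2 (Fin.le_def.2 (by omega))

/-- A sum over all permutations of a function that is invariant under permutations of the blocks
is a multiple of the sum over the unshuffles. -/
theorem sum_unshuffles {W : Type*} [AddCommGroup W] {n : ℕ} (F : Equiv.Perm (Fin (n + 2)) → W)
    (hF : ∀ u s t, F (u * blockPerm s t) = F u) :
    ∑ σ, F σ = (2 * n.factorial) • ∑ u ∈ unshuffles (n + 2) 2, F u := by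
  -- Every permutation is uniquely an unshuffle followed on the right by a permutation of the
  -- blocks: existence by sorting each block, uniqueness because monotone rearrangements are unique.
  have h1 : ∑ p ∈ unshuffles (n + 2) 2 ×ˢ
      (Finset.univ : Finset (Equiv.Perm (Fin 2) × Equiv.Perm (Fin n))),
        F (p.1 * blockPerm p.2.1 p.2.2) = ∑ σ, F σ := by
    have mono : ∀ {u : Equiv.Perm (Fin (n + 2))} (s : Equiv.Perm (Fin 2)) (t : Equiv.Perm (Fin n)),
        u ∈ unshuffles (n + 2) 2 →
        Monotone ((fun a => (u * blockPerm s t) (JetAlgebra.splitTwo n (Sum.inl a))) ∘ ⇑s⁻¹) ∧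
        Monotone ((fun a => (u * blockPerm s t) (JetAlgebra.splitTwo n (Sum.inr a))) ∘ ⇑t⁻¹) := by
      intro u s t hu
      obtain ⟨h1, h2⟩ := mem_unshuffles_two.1 hu
      constructor
      · convert h1 using 1
        funext a
        simp [Equiv.Perm.mul_apply, blockPerm_inl]
      · convert h2 using 1
        funext a
        simp [Equiv.Perm.mul_apply, blockPerm_inr]
    refine Finset.sum_bij (fun p _ => p.1 * blockPerm p.2.1 p.2.2) (fun _ _ => Finset.mem_univ _)
      ?_ ?_ fun _ _ => rfl
    · rintro ⟨u, s, t⟩ hp ⟨u', s', t'⟩ hp' h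
      simp only [Finset.mem_product, Finset.mem_univ, and_true] at hp hp' h
      have m := mono s t hp
      have m' := mono s' t' hp'
      rw [← h] at m'
      have hs := Tuple.unique_monotone m.1 m'.1
      have ht := Tuple.unique_monotone m.2 m'.2
      have hs' : s = s' := by
        refine inv_injective (Equiv.ext fun a => ?_)
        have := congrFun hs a
        simp only [Function.comp_apply, EmbeddingLike.apply_eq_iff_eq, Sum.inl.injEq] at this
        exact this
      have ht' : t = t' := by
        refine inv_injective (Equiv.ext fun a => ?_)
        have := congrFun ht a
        simp only [Function.comp_apply, EmbeddingLike.apply_eq_iff_eq, Sum.inr.injEq] at this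
        exact this
      subst hs' ht'
      rw [mul_right_cancel h]
    · intro σ _
      let s := Tuple.sort fun a => σ (JetAlgebra.splitTwo n (Sum.inl a))
      let t := Tuple.sort fun a => σ (JetAlgebra.splitTwo n (Sum.inr a))
      refine ⟨(σ * blockPerm s t, s⁻¹, t⁻¹), ?_, ?_⟩
      · simp only [Finset.mem_product, Finset.mem_univ, and_true]
        rw [mem_unshuffles_two]
        constructor
        · simp only [Equiv.Perm.mul_apply, blockPerm_inl]
          exact Tuple.monotone_sort fun a => σ (JetAlgebra.splitTwo n (Sum.inl a))
        · simp only [Equiv.Perm.mul_apply, blockPerm_inr]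
          exact Tuple.monotone_sort fun a => σ (JetAlgebra.splitTwo n (Sum.inr a))
      · refine Equiv.ext fun x => ?_
        obtain ⟨x, rfl⟩ := (JetAlgebra.splitTwo n).surjective x
        rcases x with a | a
        · simp [Equiv.Perm.mul_apply, blockPerm_inl]
        · simp [Equiv.Perm.mul_apply, blockPerm_inr]
  rw [← h1, Finset.sum_product]
  simp only [hF, Finset.sum_const, Finset.card_univ, Fintype.card_prod, Fintype.card_perm,
    Fintype.card_fin]
  rw [Finset.smul_sum]
  rfl

namespace JetAlgebra

variable {N : ℕ} {A : Type} [CommRing A] [Algebra ℝ A] [JetAlgebra N A] {n : ℕ}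

/-- For skew-symmetric operators the Chevalley–Eilenberg operator is the sum over unshuffles. -/
theorem delta_apply {M : LDO A 2} (hM : Skew M) {L : LDO A (n + 1)} (hL : Skew L)
    (f : Fin (n + 2) → A) : (delta M L).1 f
      = ∑ u ∈ unshuffles (n + 2) 2, Equiv.Perm.sign u •
        L.1 (Fin.cons (M.1 ![f (u 0), f (u 1)]) fun k => f (u k.succ.succ)) := by
  -- Skewness of `M` and of `L` gives the sign of a block permutation, so the signed summand depends
  -- on the unshuffle only, and the normalisation `1 / (2 n!)` cancels the number of block
  -- permutations. The permutation `decomposeFin.symm (0, t)` lets `t` act while fixing the first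
  -- slot of `L`.
  have key : ∀ (g : Fin (n + 2) → A) s t, (ins M L).1 (fun i => g (blockPerm s t i))
      = (Equiv.Perm.sign s * Equiv.Perm.sign t) • (ins M L).1 g := by
    intro g s t
    have e1 : (![g (blockPerm s t 0), g (blockPerm s t 1)] : Fin 2 → A)
        = fun i => ![g 0, g 1] (s i) := by
      have : ∀ a, ![g 0, g 1] a = g (splitTwo n (Sum.inl a)) := fun a => by
        fin_cases a <;> rfl
      funext a
      rw [this, ← blockPerm_inl s t]
      fin_cases a <;> rfl
    have e2 : (Fin.cons (M.1 fun i => ![g 0, g 1] (s i))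
        fun k : Fin n => g (blockPerm s t k.succ.succ) : Fin (n + 1) → A)
        = Fin.cons (Equiv.Perm.sign s • M.1 ![g 0, g 1]) fun k : Fin n => g (t k).succ.succ := by
      rw [hM]
      congr 1
      funext k
      rw [← splitTwo_inr, blockPerm_inr, splitTwo_inr]
    have e3 : (Fin.cons (M.1 ![g 0, g 1]) fun k : Fin n => g (t k).succ.succ : Fin (n + 1) → A)
        = fun i => (Fin.cons (M.1 ![g 0, g 1]) fun k : Fin n => g k.succ.succ : Fin (n + 1) → A)
          (Equiv.Perm.decomposeFin.symm (0, t) i) := by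
      funext i
      refine Fin.cases ?_ (fun k => ?_) i
      · simp [Equiv.Perm.decomposeFin_symm_apply_zero]
      · simp [Equiv.Perm.decomposeFin_symm_apply_succ]
    rw [ins_apply, ins_apply, e1, e2, Units.smul_def, ← Int.cast_smul_eq_zsmul ℝ,
      MultilinearMap.cons_smul, e3, hL, Equiv.Perm.decomposeFin.symm_sign, if_pos rfl, one_mul,
      Int.cast_smul_eq_zsmul, ← Units.smul_def, smul_smul]
  rw [delta_eq, LDO.smul_apply, asym_apply, sum_unshuffles, ← Nat.cast_smul_eq_nsmul ℝ, smul_smul]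
  · have : ((2 : ℝ) * n.factorial) ≠ 0 := by positivity
    push_cast
    rw [inv_mul_cancel₀ this, one_smul]
    simp only [ins_apply]
  · intro u s t
    have := key (fun i => f (u i)) s t
    simp only [Equiv.Perm.mul_apply, Equiv.Perm.sign_mul, sign_blockPerm]
    rw [this, smul_smul, mul_assoc, Int.units_mul_self, mul_one]

end JetAlgebra

/-! ### Normal ordering: abstract operators are given by coefficient families. -/

namespace JetAlgebra

variable {N : ℕ} {A : Type} [CommRing A] [Algebra ℝ A] [JetAlgebra N A] {n : ℕ}

/-! ### Coefficients of local differential operators -/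

theorem verD_mul_comm (J K : MultiIdx N) : (verD J * verD K : diffOp A) = verD K * verD J :=
  Subtype.ext (LinearMap.ext fun f => derU_comm J K f)

/-- The monoid generated by the vertical derivatives. -/
abbrev verMonoid (A : Type) [CommRing A] [Algebra ℝ A] [JetAlgebra N A] : Submonoid (diffOp A) :=
  Submonoid.closure (Set.range verD)

instance : CommMonoid (verMonoid A) :=
  { (inferInstance : Monoid (verMonoid A)) with
    mul_comm := (Submonoid.isMulCommutative_closure (diffOp A) (by
      rintro _ ⟨J, rfl⟩ _ ⟨K, rfl⟩; exact verD_mul_comm J K)).is_comm.comm }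

/-- `∂/∂u_J` as an element of the commutative monoid of vertical derivatives. -/
def verGen (J : MultiIdx N) : verMonoid A := ⟨verD J, Submonoid.subset_closure ⟨J, rfl⟩⟩

/-- `(∂/∂u)^α`. -/
def verPow (α : MultiIdx N →₀ ℕ) : diffOp A := (α.prod fun J k => (verGen J : verMonoid A) ^ k).1

theorem verPow_zero : (verPow 0 : diffOp A) = 1 := by rw [verPow, Finsupp.prod_zero_index]; rfl

theorem verPow_add (α β : MultiIdx N →₀ ℕ) : (verPow (α + β) : diffOp A) = verPow α * verPow β := by
  rw [verPow, Finsupp.prod_add_index' (fun _ => pow_zero _) fun _ _ _ => pow_add _ _ _]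
  rfl

theorem verPow_single (J : MultiIdx N) (k : ℕ) :
    (verPow (Finsupp.single J k) : diffOp A) = verD J ^ k := by
  rw [verPow, Finsupp.prod_single_index (h := fun J k => (verGen J : verMonoid A) ^ k)
    (pow_zero _)]
  rfl

theorem verPow_eq_list (α : MultiIdx N →₀ ℕ) : (verPow α : diffOp A)
    = (α.support.toList.map fun J => verD J ^ α J).prod := by
  rw [verPow, Finsupp.prod, ← Finset.prod_map_toList, Submonoid.coe_list_prod, List.map_map]
  rfl

theorem verPow_mem (α : MultiIdx N →₀ ℕ) : (verPow α : diffOp A).1 ∈ finDiffOp A := by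
  induction α using Finsupp.induction_linear with
  | zero => rw [verPow_zero]; exact one_mem _
  | add α β hα hβ => rw [verPow_add]; exact mul_mem hα hβ
  | single J k => rw [verPow_single]; exact pow_mem (opU_mem J) k

theorem totPow_mem (L : MultiIdx N) : (totPow L : diffOp A).1 ∈ finDiffOp A := by
  induction L using MultiIdx.induct with
  | h0 => rw [totPow, MultiIdx.pow_zero']; exact one_mem _
  | hs L i ih =>
    rw [totPow, MultiIdx.pow_add_single totD_commute']
    exact mul_mem (opD_mem i) ih

/-- Exponents of a monomial `(d/dx)^I (∂/∂u)^α`. -/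
abbrev Expo (N : ℕ) : Type := MultiIdx N × (MultiIdx N →₀ ℕ)

/-- The operator `(d/dx)^I (∂/∂u)^α`. -/
def monoOp (x : Expo N) : Op A := (totPow x.1 * verPow x.2 : diffOp A).1

theorem monoOp_apply (x : Expo N) (f : A) : monoOp x f = (totPow x.1).1 ((verPow x.2).1 f) := rfl

theorem monoOp_mem (x : Expo N) : (monoOp x : Op A) ∈ finDiffOp A :=
  mul_mem (totPow_mem _) (verPow_mem _)

theorem opMul_add (g h : A) : opMul (g + h) = opMul g + opMul h := by
  ext1 f; exact add_mul g h f

/-- Finite sums `∑ g (d/dx)^I (∂/∂u)^α`. -/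
def sumOp : (Expo N →₀ A) →+ Op A := Finsupp.liftAddHom fun x =>
  { toFun := fun g => opMul g * monoOp x
    map_zero' := by ext1 f; exact zero_mul _
    map_add' := fun g h => by rw [opMul_add, add_mul] }

theorem sumOp_single (x : Expo N) (g : A) : sumOp (Finsupp.single x g) = opMul g * monoOp x :=
  Finsupp.liftAddHom_apply_single _ _ _

theorem mul_mem_range_sumOp {P : Op A} (h : ∀ x g, P * (opMul g * monoOp x) ∈ (sumOp (A := A)).range)
    {Q : Op A} (hQ : Q ∈ (sumOp (A := A)).range) : P * Q ∈ (sumOp (A := A)).range := by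
  obtain ⟨g, rfl⟩ := hQ
  induction g using Finsupp.induction_linear with
  | zero => rw [map_zero, mul_zero]; exact zero_mem _
  | add a b ha hb => rw [map_add, mul_add]; exact add_mem ha hb
  | single x g => rw [sumOp_single]; exact h x g

theorem opMul_monoOp_mem (g : A) (x : Expo N) : opMul g * monoOp x ∈ (sumOp (A := A)).range :=
  ⟨_, sumOp_single x g⟩

theorem opMul_mul_mem (h : A) {Q : Op A} (hQ : Q ∈ (sumOp (A := A)).range) :
    opMul h * Q ∈ (sumOp (A := A)).range := by
  refine mul_mem_range_sumOp (fun x g => ?_) hQ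
  have : opMul h * (opMul g * monoOp x) = opMul (h * g) * (monoOp x : Op A) := by
    ext1 f; exact (mul_assoc h g _).symm
  rw [this]; exact opMul_monoOp_mem _ _

theorem opD_mul_mem (i : Fin N) {Q : Op A} (hQ : Q ∈ (sumOp (A := A)).range) :
    opD i * Q ∈ (sumOp (A := A)).range := by
  refine mul_mem_range_sumOp (fun x g => ?_) hQ
  have : opD i * (opMul g * monoOp x)
      = opMul g * monoOp (x.1 + Pi.single i 1, x.2) + opMul (derD i g) * (monoOp x : Op A) := by
    ext1 f
    show derD i (g * monoOp x f) = g * monoOp _ f + derD i g * monoOp x f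
    rw [Derivation.leibniz, monoOp_apply, monoOp_apply, totPow_add_single, smul_eq_mul,
      smul_eq_mul, mul_comm (derD i g)]
  rw [this]; exact add_mem (opMul_monoOp_mem _ _) (opMul_monoOp_mem _ _)

/-- A vertical derivative is moved past `(d/dx)^I` by induction on `I`; the commutator with `d/dx^i`
is again a vertical derivative, so the claim is proved for all `K` simultaneously. -/
theorem opU_mul_mem (K : MultiIdx N) {Q : Op A} (hQ : Q ∈ (sumOp (A := A)).range) :
    opU K * Q ∈ (sumOp (A := A)).range := by
  have key : ∀ (I : MultiIdx N) (α : MultiIdx N →₀ ℕ) (K : MultiIdx N),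
      opU K * monoOp (I, α) ∈ (sumOp (A := A)).range := by
    intro I α
    induction I using MultiIdx.induct with
    | h0 =>
      intro K
      have : opU K * monoOp (0, α) = opMul 1 * (monoOp (0, α + Finsupp.single K 1) : Op A) := by
        ext1 f
        show derU K (monoOp (0, α) f) = 1 * monoOp _ f
        rw [monoOp_apply, monoOp_apply, totPow_zero_apply, totPow_zero_apply, add_comm, verPow_add,
          verPow_single, pow_one, one_mul]
        rfl
      rw [this]; exact opMul_monoOp_mem _ _
    | hs I i ih =>
      intro K
      have : opU K * monoOp (I + Pi.single i 1, α) = opD i * (opU K * monoOp (I, α))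
          + if K i = 0 then 0 else opU (K - Pi.single i 1) * (monoOp (I, α) : Op A) := by
        ext1 f
        show derU K (monoOp _ f) = _
        rw [monoOp_apply, totPow_add_single, derU_derD]
        split_ifs <;> rfl
      rw [this]
      refine add_mem (opD_mul_mem i (ih K)) ?_
      split_ifs
      · exact zero_mem _
      · exact ih _
  refine mul_mem_range_sumOp (fun x g => ?_) hQ
  have : opU K * (opMul g * monoOp x)
      = opMul g * (opU K * monoOp x) + opMul (derU K g) * (monoOp x : Op A) := by
    ext1 f
    show derU K (g * monoOp x f) = g * derU K (monoOp x f) + derU K g * monoOp x f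
    rw [Derivation.leibniz, smul_eq_mul, smul_eq_mul, mul_comm (derU K g)]
  rw [this]
  exact add_mem (opMul_mul_mem g (key _ _ K)) (opMul_monoOp_mem _ _)

/-- Preserving the normally ordered operators under left multiplication is stable under composition;
applying this to the identity gives the claim. -/
theorem finDiffOp_mem_range {P : Op A} (hP : P ∈ finDiffOp A) : P ∈ (sumOp (A := A)).range := by
  have key : ∀ Q ∈ (sumOp (A := A)).range, P * Q ∈ (sumOp (A := A)).range := by
    refine finDiffOp_induction (p := fun P => ∀ Q ∈ (sumOp (A := A)).range,
      P * Q ∈ (sumOp (A := A)).range) ?_ ?_ ?_ ?_ ?_ hP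
    · exact fun g Q hQ => opMul_mul_mem g hQ
    · exact fun i Q hQ => opD_mul_mem i hQ
    · exact fun J Q hQ => opU_mul_mem J hQ
    · intro P P' h h' Q hQ
      rw [add_mul]; exact add_mem (h Q hQ) (h' Q hQ)
    · intro P P' _ _ h h' Q hQ
      rw [mul_assoc]; exact h _ (h' Q hQ)
  have h1 : (1 : Op A) = opMul 1 * (monoOp (0, 0) : Op A) := by
    ext1 f
    show f = 1 * monoOp (0, 0) f
    rw [monoOp_apply, totPow_zero_apply, verPow_zero, one_mul]; rfl
  rw [← mul_one P]
  refine key 1 ?_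
  rw [h1]
  exact opMul_monoOp_mem _ _

/-- Exponents of a multilinear monomial. -/
abbrev MultiExpo (N n : ℕ) : Type := (Fin n → MultiIdx N) × (Fin n → (MultiIdx N →₀ ℕ))

/-- The operator `f ↦ p ∏ⱼ (d/dx)^{I_j} (∂/∂u)^{α_j} fⱼ`. -/
def monoTerm (c : MultiExpo N n) (p : A) : LDO A n :=
  ⟨prodOp p fun j => monoOp (c.1 j, c.2 j), finMulti_le (prodOp_mem p fun _ => monoOp_mem _)⟩

theorem monoTerm_apply (c : MultiExpo N n) (p : A) (f : Fin n → A) :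
    (monoTerm c p).1 f = p * ∏ j, (totPow (c.1 j)).1 ((verPow (c.2 j)).1 (f j)) := rfl

/-- Finite sums of multilinear monomials. -/
def sumTerm : (MultiExpo N n →₀ A) →+ LDO A n := Finsupp.liftAddHom fun c =>
  { toFun := monoTerm c
    map_zero' := by ext f; rw [monoTerm_apply, zero_mul]; rfl
    map_add' := fun g h => by
      ext f; rw [LDO.add_apply, monoTerm_apply, monoTerm_apply, monoTerm_apply, add_mul] }

theorem sumTerm_single (c : MultiExpo N n) (g : A) :
    sumTerm (Finsupp.single c g) = monoTerm c g := Finsupp.liftAddHom_apply_single _ _ _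

theorem sumTerm_apply (p : MultiExpo N n →₀ A) (f : Fin n → A) :
    (sumTerm p).1 f = ∑ c ∈ p.support, (monoTerm c (p c)).1 f := by
  rw [← LDO.sum_apply]; rfl

theorem exists_sumTerm {F : LDO A n} (hF : F.1 ∈ finMulti A n) : ∃ p, sumTerm p = F := by
  obtain ⟨F, hF'⟩ := F
  replace hF : F ∈ finMulti A n := hF
  revert hF'
  refine finMulti_induction (q := fun F => ∀ hF', ∃ p, sumTerm p = (⟨F, hF'⟩ : LDO A n)) ?_ ?_ hF
  · intro p P hP hF'
    choose g hg using fun j => finDiffOp_mem_range (hP j)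
    refine ⟨∑ x ∈ Fintype.piFinset fun j => (g j).support,
      Finsupp.single (fun j => (x j).1, fun j => (x j).2) (p * ∏ j, g j (x j)), ?_⟩
    rw [map_sum]
    simp only [sumTerm_single]
    ext f
    have e : ∀ j, P j (f j) = ∑ x ∈ (g j).support, g j x * monoOp x (f j) := fun j => by
      rw [← hg j]
      exact LinearMap.sum_apply _ _ _
    rw [LDO.sum_apply]
    show _ = p * ∏ j, P j (f j)
    simp only [e]
    rw [Finset.prod_univ_sum, Finset.mul_sum]
    refine Finset.sum_congr rfl fun x _ => ?_
    rw [monoTerm_apply, Finset.prod_mul_distrib, mul_assoc]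
    rfl
  · intro S T hS hT ihS ihT hF'
    obtain ⟨p, hp⟩ := ihS (finMulti_le hS)
    obtain ⟨q, hq⟩ := ihT (finMulti_le hT)
    exact ⟨p + q, by rw [map_add, hp, hq]; rfl⟩

/-- Operators with at most `d` vertical derivatives, all of order at most `m`. -/
inductive GenDeg (m : ℕ) : ℕ → LDO A n → Prop
  | mulProd (d : ℕ) (g : A) : GenDeg m d (mulProd n g)
  | add {d : ℕ} {X Y : LDO A n} : GenDeg m d X → GenDeg m d Y → GenDeg m d (X + Y)
  | totD {d : ℕ} {X : LDO A n} (k : Fin n) (i : Fin N) :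
      GenDeg m d X → GenDeg m d (rgt k (totD i) X)
  | verD {d : ℕ} {X : LDO A n} (k : Fin n) (J : MultiIdx N) (hJ : J.order ≤ m) :
      GenDeg m d X → GenDeg m (d + 1) (rgt k (verD J) X)

theorem GenDeg.zero (m d : ℕ) : GenDeg m d (0 : LDO A n) := by
  have : (0 : LDO A n) = JetAlgebra.mulProd n 0 := by ext f; simp [mulProd_apply]
  rw [this]; exact GenDeg.mulProd d 0

theorem GenDeg.succ {m d : ℕ} {X : LDO A n} (h : GenDeg m d X) : GenDeg m (d + 1) X := by
  induction h with
  | mulProd d g => exact .mulProd _ g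
  | add _ _ hX hY => exact hX.add hY
  | totD k i _ hX => exact hX.totD k i
  | verD k J hJ _ hX => exact hX.verD k J hJ

theorem GenDeg.mono {m d d' : ℕ} (hd : d ≤ d') {X : LDO A n} (h : GenDeg m d X) :
    GenDeg m d' X := by
  induction hd with
  | refl => exact h
  | step _ ih => exact ih.succ

theorem GenDeg.symDer_of_lt {m d : ℕ} {X : LDO A n} (h : GenDeg m d X) (j : Fin n) :
    ∀ J : MultiIdx N, m < J.order → symDer j J X = 0 := by
  induction h with
  | mulProd d g => exact fun J _ => symDer_mulProd J g
  | add _ _ hX hY => intro J hJ; rw [map_add, hX J hJ, hY J hJ, add_zero]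
  | totD k i _ hX =>
    intro J hJ
    by_cases hk : j = k
    · subst hk
      rw [symDer_rgt_totD, hX J hJ, hX _ (by rw [MultiIdx.order_add_single]; omega), map_zero,
        add_zero]
    · rw [symDer_rgt J hk, hX J hJ, map_zero]
  | verD k K hK _ hX =>
    intro J hJ
    by_cases hk : j = k
    · subst hk
      rw [symDer_verD, hX J hJ, if_neg (by rintro rfl; omega), map_zero, add_zero]
    · rw [symDer_rgt J hk, hX J hJ, map_zero]

theorem GenDeg.symDer {m d : ℕ} {X : LDO A n} (h : GenDeg m d X) (j : Fin n) :
    ∀ J : MultiIdx N, (d = 0 → JetAlgebra.symDer j J X = 0) ∧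
      GenDeg m (d - 1) (JetAlgebra.symDer j J X) := by
  induction h with
  | mulProd d g => intro J; rw [symDer_mulProd]; exact ⟨fun _ => rfl, .zero _ _⟩
  | add _ _ hX hY =>
    intro J
    rw [map_add]
    exact ⟨fun h => by rw [(hX J).1 h, (hY J).1 h, add_zero], (hX J).2.add (hY J).2⟩
  | totD k i _ hX =>
    intro J
    by_cases hk : j = k
    · subst hk
      rw [symDer_rgt_totD]
      exact ⟨fun h => by rw [(hX J).1 h, (hX _).1 h, map_zero, add_zero],
        ((hX J).2.totD j i).add (hX _).2⟩
    · rw [symDer_rgt J hk]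
      exact ⟨fun h => by rw [(hX J).1 h, map_zero], (hX J).2.totD k i⟩
  | @verD d X k K hK hX' hX =>
    intro J
    refine ⟨fun h => absurd h (Nat.succ_ne_zero d), ?_⟩
    rw [Nat.add_sub_cancel]
    have h1 : GenDeg m d (rgt k (JetAlgebra.verD K) (JetAlgebra.symDer j J X)) := by
      rcases Nat.eq_zero_or_pos d with h0 | h0
      · rw [(hX J).1 h0, map_zero]; exact .zero _ _
      · have := (hX J).2.verD k K hK
        rwa [Nat.sub_add_cancel h0] at this
    by_cases hk : j = k
    · subst hk
      rw [symDer_verD]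
      refine h1.add ?_
      split_ifs
      · exact hX'
      · exact .zero _ _
    · rw [symDer_rgt J hk]; exact h1

theorem GenDeg.gen_univ {m d : ℕ} {X : LDO A n} (h : GenDeg m d X) : Gen Set.univ X := by
  induction h with
  | mulProd d g => exact .mulProd g
  | add _ _ hX hY => exact hX.add hY
  | totD k i _ hX => exact hX.totD k i
  | verD k K hK _ hX => exact hX.verD k K trivial

/-- For an operator of weight zero the polynomials `binom s` act as the identity, so they identify
it with its component `G 0`, which is built without vertical derivatives in the slot. -/
theorem Gen.of_count_eq_zero {j : Fin n} {X : LDO A n} (hX : Gen Set.univ X)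
    (h : count j X = 0) : Gen {j}ᶜ X := by
  obtain ⟨K, G, hG, h0, hs⟩ := hX.exists_decomposition j
  have : X - G 0 = 0 := eq_zero_of_vanish fun m => by
    have h1 := binom_sum_vanish (X := X) (m := m) (K := K) hG
      (by rw [← hs K le_rfl, sub_self]; exact zero_mem _) (le_refl K)
    rwa [binom_of_count_eq_zero h] at h1
  rw [sub_eq_zero.1 this]
  exact h0

/-- Without vertical derivatives Taylor's formula applies in every slot. One slot after the other,
vanishing on functions of `x` extends to arbitrary arguments. -/
theorem eq_zero_of_jetFree {X : LDO A n} (hX : ∀ j, Gen {j}ᶜ X)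
    (h : ∀ f : Fin n → A, (∀ j, f j ∈ jetFree A) → X.1 f = 0) : X = 0 := by
  have key : ∀ s : Finset (Fin n), ∀ f : Fin n → A, (∀ j ∉ s, f j ∈ jetFree A) → X.1 f = 0 := by
    intro s
    induction s using Finset.induction_on with
    | empty => exact fun f hf => h f fun j => hf j (Finset.notMem_empty j)
    | insert a s ha ih =>
      intro f hf
      rw [(hX a).taylor a f]
      refine (finsum_congr fun L => ?_).trans finsum_zero
      have hu : ∀ (f : Fin n → A) (g : A), (∀ j ∉ insert a s, f j ∈ jetFree A) → g ∈ jetFree A →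
          ∀ j ∉ s, Function.update f a g j ∈ jetFree A := by
        intro f g hf hg j hj
        by_cases hja : j = a
        · subst hja; rwa [Function.update_self]
        · rw [Function.update_of_ne hja]
          exact hf j (by simp [hja, hj])
      rw [adPow_apply_eq_zero (S := {f | ∀ j ∉ s, f j ∈ jetFree A})
        (fun f hf i => hu f _ (fun j hj => hf j fun h => hj (Finset.mem_insert_of_mem h))
          (mul_mem (coordX_mem_jetFree i) (hf a ha))) ih L _ (hu f 1 hf (one_mem _)),
        zero_mul, smul_zero]
  ext f
  exact key Finset.univ f fun j hj => absurd (Finset.mem_univ j) hj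

/-- Functions of jet order `m` already detect operators whose vertical derivatives have order at
most `m`. Induct on the number of vertical derivatives: symbol derivatives lower it and preserve
vanishing, and if all of them are zero there are no vertical derivatives left. -/
theorem GenDeg.eq_zero {m : ℕ} : ∀ {d : ℕ} {X : LDO A n}, GenDeg m d X → X ∈ vanish A n m →
    X = 0 := by
  have step : ∀ {d : ℕ} {X : LDO A n}, GenDeg m d X → X ∈ vanish A n m →
      (∀ j J, JetAlgebra.symDer j J X = 0) → X = 0 := by
    intro d X hX hv hs
    refine eq_zero_of_jetFree (fun j => hX.gen_univ.of_count_eq_zero ?_)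
      fun f hf => hv f fun j => jetFree_le m (hf j)
    rw [count_eq]
    simp only [hs, map_zero]
    exact lsum_zero
  intro d
  induction d with
  | zero => exact fun {X} hX hv => step hX hv fun j J => (hX.symDer j J).1 rfl
  | succ d ih =>
    refine fun {X} hX hv => step hX hv fun j J => ?_
    by_cases hJ : J.order ≤ m
    · exact ih (hX.symDer j J).2 (symDer_vanish J hJ hv)
    · exact hX.symDer_of_lt j J (by omega)

theorem GenDeg.totPow {m d : ℕ} {X : LDO A n} (hX : GenDeg m d X) (k : Fin n) (L : MultiIdx N) :
    GenDeg m d (rgt k (JetAlgebra.totPow L) X) := by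
  induction L using MultiIdx.induct generalizing X with
  | h0 =>
    have : rgt k (JetAlgebra.totPow 0) X = X := by
      ext f; rw [rgt_apply, totPow_zero_apply, Function.update_eq_self]
    rwa [this]
  | hs L i ih =>
    have : (JetAlgebra.totPow (L + Pi.single i 1) : diffOp A)
        = JetAlgebra.totD i * JetAlgebra.totPow L := by
      rw [JetAlgebra.totPow, MultiIdx.pow_add_single totD_commute']; rfl
    rw [this, rgt_mul]
    exact ih (hX.totD k i)

/-- The largest order of a vertical derivative in a multilinear monomial. -/
def level (c : MultiExpo N n) : ℕ := Finset.univ.sup fun j => degF (c.2 j)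

theorem order_le_level {c : MultiExpo N n} {j : Fin n} {J : MultiIdx N} (hJ : c.2 j J ≠ 0) :
    J.order ≤ level c :=
  (Finset.le_sup (f := MultiIdx.order) (Finsupp.mem_support_iff.2 hJ)).trans
    (Finset.le_sup (f := fun j => degF (c.2 j)) (Finset.mem_univ j))

theorem rgt_pow_succ (k : Fin n) (Q : diffOp A) (r : ℕ) (X : LDO A n) :
    rgt k (Q ^ (r + 1)) X = rgt k (Q ^ r) (rgt k Q X) := by
  rw [pow_succ', rgt_mul]

theorem rgt_one (k : Fin n) (X : LDO A n) : rgt k 1 X = X := by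
  ext f; rw [rgt_apply]
  show X.1 (Function.update f k (f k)) = _
  rw [Function.update_eq_self]

theorem GenDeg.verPow {m : ℕ} (k : Fin n) (α : MultiIdx N →₀ ℕ)
    (hα : ∀ J, α J ≠ 0 → J.order ≤ m) : ∀ {d : ℕ} {X : LDO A n}, GenDeg m d X →
      ∃ d', GenDeg m d' (rgt k (JetAlgebra.verPow α) X) := by
  induction α using Finsupp.induction with
  | zero =>
    intro d X hX
    rw [verPow_zero, rgt_one]; exact ⟨d, hX⟩
  | single_add J r α hJ hr ih =>
    intro d X hX
    rw [verPow_add, rgt_mul, verPow_single]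
    refine Exists.elim (?_ : ∃ d', GenDeg m d' (rgt k (JetAlgebra.verD J ^ r) X)) fun d' h => ih
      (fun K hK => hα K ?_) h
    · have hJm : J.order ≤ m := hα J (by simp [Finsupp.notMem_support_iff.1 hJ, hr])
      clear ih hα hr
      induction r generalizing d X with
      | zero => rw [pow_zero, rgt_one]; exact ⟨d, hX⟩
      | succ r ih' => rw [rgt_pow_succ]; exact ih' (hX.verD k J hJm)
    · rw [Finsupp.add_apply]; omega

theorem GenDeg.monoTerm {m : ℕ} {c : MultiExpo N n} (hc : level c ≤ m) (p : A) :
    ∃ d, GenDeg m d (monoTerm c p) := by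
  have key : ∀ s : Finset (Fin n), ∃ d, ∃ X : LDO A n, GenDeg m d X ∧ ∀ f,
      X.1 f = p * ∏ j, if j ∈ s then (JetAlgebra.totPow (c.1 j)).1
        ((JetAlgebra.verPow (c.2 j)).1 (f j)) else f j := by
    intro s
    induction s using Finset.induction_on with
    | empty => exact ⟨0, _, .mulProd 0 p, fun f => by simp [mulProd_apply]⟩
    | insert a s ha ih =>
      obtain ⟨d, X, hX, he⟩ := ih
      obtain ⟨d', h⟩ := (hX.totPow a (c.1 a)).verPow a (c.2 a)
        fun J hJ => (order_le_level hJ).trans hc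
      refine ⟨d', _, h, fun f => ?_⟩
      rw [rgt_apply, rgt_apply, he]
      congr 1
      refine Finset.prod_congr rfl fun j _ => ?_
      by_cases hj : j = a
      · subst hj; simp [ha]
      · simp [hj]
  obtain ⟨d, X, hX, he⟩ := key Finset.univ
  refine ⟨d, ?_⟩
  have : JetAlgebra.monoTerm c p = X := by
    ext f; rw [he, monoTerm_apply]; simp
  rwa [this]

theorem verPow_apply_eq_zero {m : ℕ} {α : MultiIdx N →₀ ℕ} {J : MultiIdx N} (hJ : m < J.order)
    (hα : α J ≠ 0) {f : A} (hf : f ∈ jetLE A m) : (verPow α : diffOp A).1 f = 0 := by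
  obtain ⟨β, rfl⟩ : ∃ β, α = β + Finsupp.single J 1 :=
    ⟨α - Finsupp.single J 1, (tsub_add_cancel_of_le (by
      rw [Finsupp.single_le_iff]; omega)).symm⟩
  rw [verPow_add, verPow_single, pow_one]
  show (verPow β : diffOp A).1 (derU J f) = 0
  rw [hf J hJ, map_zero]

theorem exists_order_of_lt_level {m : ℕ} {c : MultiExpo N n} (h : m < level c) :
    ∃ j J, c.2 j J ≠ 0 ∧ m < J.order := by
  obtain ⟨j, -, hj⟩ := (Finset.lt_sup_iff).1 h
  obtain ⟨J, hJ, hm⟩ := (Finset.lt_sup_iff).1 hj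
  exact ⟨j, J, Finsupp.mem_support_iff.1 hJ, hm⟩

theorem monoTerm_eq_zero {m : ℕ} {c : MultiExpo N n} (h : m < level c) (p : A) {f : Fin n → A}
    (hf : f ∈ box A n m) : p * ∏ j, (totPow (c.1 j)).1 ((verPow (c.2 j)).1 (f j)) = 0 := by
  obtain ⟨j, J, hc, hJ⟩ := exists_order_of_lt_level h
  rw [Finset.prod_eq_zero (Finset.mem_univ j), mul_zero]
  rw [verPow_apply_eq_zero hJ hc (hf j), map_zero]

theorem level_le_sum (c : MultiExpo N n) : level c ≤ ∑ j, degF (c.2 j) :=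
  Finset.sup_le fun j _ => Finset.single_le_sum (f := fun j => degF (c.2 j))
    (fun _ _ => Nat.zero_le _) (Finset.mem_univ j)

theorem sum_le_level (c : MultiExpo N n) : ∑ j, degF (c.2 j) ≤ n * level c := by
  refine (Finset.sum_le_card_nsmul _ _ (level c) fun j hj =>
    Finset.le_sup (f := fun j => degF (c.2 j)) hj).trans ?_
  simp

theorem GenDeg.sumTerm {m : ℕ} (p : MultiExpo N n →₀ A) (hp : ∀ c, p c ≠ 0 → level c ≤ m) :
    ∃ d, GenDeg m d (sumTerm p) := by
  induction p using Finsupp.induction with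
  | zero => rw [map_zero]; exact ⟨0, .zero _ _⟩
  | single_add c g p hc hg ih =>
    obtain ⟨d, hd⟩ := ih fun c' hc' => hp c' (by
      have : c ≠ c' := by rintro rfl; exact hc' (Finsupp.notMem_support_iff.1 hc)
      rwa [Finsupp.add_apply, Finsupp.single_eq_of_ne this.symm, zero_add])
    obtain ⟨d', hd'⟩ := GenDeg.monoTerm (hp c (by
      rwa [Finsupp.add_apply, Finsupp.single_eq_same, Finsupp.notMem_support_iff.1 hc,
        add_zero])) g
    rw [map_add, sumTerm_single]
    exact ⟨max d' d, (hd'.mono (le_max_left _ _)).add (hd.mono (le_max_right _ _))⟩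

theorem sumTerm_vanish {m : ℕ} (p : MultiExpo N n →₀ A) (hp : ∀ c, p c ≠ 0 → m < level c) :
    sumTerm p ∈ vanish A n m := fun f hf => by
  rw [sumTerm_apply]
  refine Finset.sum_eq_zero fun c hc => ?_
  rw [monoTerm_apply]
  exact monoTerm_eq_zero (hp c (Finsupp.mem_support_iff.1 hc)) _ hf

theorem sumTerm_filter_add (p : MultiExpo N n →₀ A) (P : MultiExpo N n → Prop)
    [DecidablePred P] : sumTerm (p.filter P) + sumTerm (p.filter fun c => ¬P c) = sumTerm p := by
  rw [← map_add, Finsupp.filter_add_filter_not]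

/-- Every local differential operator is given by coefficients. -/
theorem exists_coefficients (X : LDO A n) : ∃ p : MultiExpo N n → A,
    (∀ m : ℕ, {c | ∑ j, degF (c.2 j) ≤ m ∧ p c ≠ 0}.Finite) ∧
    ∀ f, X.1 f = ∑ᶠ c, p c * ∏ j, (totPow (c.1 j)).1 ((verPow (c.2 j)).1 (f j)) := by
  -- One finite coefficient family per jet order, with no compatibility yet. The global coefficient
  -- of a monomial is taken from the family whose index is the level of the monomial.
  have h : ∀ m, ∃ p : MultiExpo N n →₀ A, X - sumTerm p ∈ vanish A n m := fun m => by
    obtain ⟨F, hF, hX⟩ := exists_finMulti X m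
    obtain ⟨p, rfl⟩ := exists_sumTerm hF
    exact ⟨p, hX⟩
  choose p hp using h
  have hlow : ∀ m, X - sumTerm ((p m).filter fun c => level c ≤ m) ∈ vanish A n m := by
    intro m
    have h1 := hp m
    rw [← sumTerm_filter_add (p m) fun c => level c ≤ m] at h1
    have h2 := sumTerm_vanish (m := m) ((p m).filter fun c => ¬level c ≤ m) fun c hc => by
      by_contra h
      exact hc (Finsupp.filter_apply_neg _ _ (by omega))
    have := add_mem h1 h2
    rwa [← sub_sub, sub_add_cancel] at this
  have hfin : ∀ m, {c | level c ≤ m ∧ p (level c) c ≠ 0}.Finite := by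
    intro m
    refine ((Finset.range (m + 1)).biUnion fun k => (p k).support).finite_toSet.subset
      fun c hc => ?_
    simp only [Finset.coe_biUnion, Set.mem_iUnion, Finset.mem_coe]
    exact ⟨level c, Finset.mem_range.2 (by have := hc.1; omega), Finsupp.mem_support_iff.2 hc.2⟩
  -- Compatibility is shown for operators rather than for coefficients: the parts of level at most
  -- `m` of two successive families define operators that agree at jet order `m`, hence equal
  -- operators by `GenDeg.eq_zero`.
  have hsum : ∀ m, sumTerm ((p m).filter fun c => level c ≤ m)
      = ∑ k ∈ Finset.range (m + 1), sumTerm ((p k).filter fun c => level c = k) := by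
    intro m
    induction m with
    | zero => simp
    | succ m ih =>
      rw [Finset.sum_range_succ, ← ih]
      have e : sumTerm ((p (m + 1)).filter fun c => level c ≤ m + 1)
          = sumTerm ((p (m + 1)).filter fun c => level c ≤ m)
            + sumTerm ((p (m + 1)).filter fun c => level c = m + 1) := by
        rw [← map_add]
        congr 1
        ext c
        rw [Finsupp.add_apply, Finsupp.filter_apply, Finsupp.filter_apply, Finsupp.filter_apply]
        split_ifs <;> first | omega | simp
      rw [e]
      congr 1
      have hv : sumTerm ((p (m + 1)).filter fun c => level c = m + 1) ∈ vanish A n m :=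
        sumTerm_vanish _ fun c hc => by
          by_contra h
          exact hc (Finsupp.filter_apply_neg _ _ (by omega))
      have h1 := vanish_anti (Nat.le_succ m) (hlow (m + 1))
      rw [e] at h1
      have h2 := add_mem h1 hv
      rw [← sub_sub, sub_add_cancel] at h2
      have h3 := sub_mem (hlow m) h2
      rw [sub_sub_sub_cancel_left] at h3
      obtain ⟨d, hd⟩ := GenDeg.sumTerm (m := m)
        (((p (m + 1)).filter fun c => level c ≤ m) - (p m).filter fun c => level c ≤ m)
        fun c hc => by
          by_contra h
          refine hc ?_
          rw [Finsupp.sub_apply, Finsupp.filter_apply, Finsupp.filter_apply, if_neg h, if_neg h,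
            sub_zero]
      rw [map_sub] at hd
      exact sub_eq_zero.1 (hd.eq_zero h3)
  refine ⟨fun c => p (level c) c, fun m => (hfin m).subset fun c hc =>
    ⟨(level_le_sum c).trans hc.1, hc.2⟩, fun f => ?_⟩
  obtain ⟨m, hm⟩ := exists_box f
  have h1 := hlow m f hm
  rw [LDO.sub_apply, sub_eq_zero] at h1
  rw [h1, hsum, LDO.sum_apply]
  have h2 : ∀ k ∈ Finset.range (m + 1), (sumTerm ((p k).filter fun c => level c = k)).1 f
      = ∑ c ∈ (hfin m).toFinset, if level c = k then (p (level c) c) *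
        ∏ j, (totPow (c.1 j)).1 ((verPow (c.2 j)).1 (f j)) else 0 := by
    intro k hk
    rw [sumTerm_apply, ← Finset.sum_filter]
    have hs : ((p k).filter fun c => level c = k).support
        = (hfin m).toFinset.filter fun c => level c = k := by
      ext c
      rw [Finsupp.support_filter, Finset.mem_filter, Finset.mem_filter, Set.Finite.mem_toFinset,
        Finsupp.mem_support_iff]
      have := Finset.mem_range.1 hk
      constructor
      · rintro ⟨h, rfl⟩; exact ⟨⟨by omega, h⟩, rfl⟩
      · rintro ⟨⟨_, h⟩, rfl⟩; exact ⟨h, rfl⟩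
    rw [hs]
    refine Finset.sum_congr rfl fun c hc => ?_
    obtain ⟨_, rfl⟩ := Finset.mem_filter.1 hc
    rw [monoTerm_apply, Finsupp.filter_apply, if_pos rfl]
  rw [Finset.sum_congr rfl h2, Finset.sum_comm, finsum_eq_sum_of_support_subset]
  · refine Finset.sum_congr rfl fun c hc => ?_
    rw [Finset.sum_ite_eq, if_pos]
    have := ((hfin m).mem_toFinset.1 hc).1
    exact Finset.mem_range.2 (by omega)
  · intro c hc
    rw [Set.Finite.coe_toFinset]
    refine ⟨?_, fun h => hc (by simp only [h, zero_mul])⟩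
    by_contra h
    exact hc (monoTerm_eq_zero (by omega) _ hm)

/-- A multilinear map given by coefficients is a local differential operator. -/
theorem mem_ldo_of_coefficients {T : MultilinearMap ℝ (fun _ : Fin n => A) A}
    (p : MultiExpo N n → A) (hp : ∀ m : ℕ, {c | ∑ j, degF (c.2 j) ≤ m ∧ p c ≠ 0}.Finite)
    (hT : ∀ f, T f = ∑ᶠ c, p c * ∏ j, (totPow (c.1 j)).1 ((verPow (c.2 j)).1 (f j))) :
    T ∈ ldo A n := by
  intro m
  -- The definition of an LDO bounds the sum of the formal degrees over the slots, whereas `level`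
  -- is their maximum; this accounts for the factor `n`.
  have hfin : {c | level c ≤ m ∧ p c ≠ 0}.Finite := (hp (n * m)).subset fun c hc =>
    ⟨(sum_le_level c).trans (Nat.mul_le_mul_left n hc.1), hc.2⟩
  refine ⟨∑ c ∈ hfin.toFinset, (prodOp (p c) fun j => monoOp (c.1 j, c.2 j)),
    sum_mem fun c _ => prodOp_mem _ fun _ => monoOp_mem _, fun f hf => ?_⟩
  rw [hT, sum_apply, finsum_eq_sum_of_support_subset]
  · rfl
  · intro c hc
    rw [Set.Finite.coe_toFinset]
    refine ⟨?_, fun h => hc (by simp only [h, zero_mul])⟩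
    by_contra h
    exact hc (monoTerm_eq_zero (by omega) _ hf)

end JetAlgebra

/-! ### Integrals depending on a parameter -/

open MeasureTheory in
/-- Differentiation under the integral sign, for derivatives supported in a compact set. -/
theorem hasDerivAt_integral_of_compact {α : Type*} [TopologicalSpace α] [MeasurableSpace α]
    [OpensMeasurableSpace α] {μ : Measure α} [IsFiniteMeasureOnCompacts μ] {K : Set α}
    (hK : IsCompact K) (hKm : MeasurableSet K) {F F' : ℝ → α → ℝ} (hF : ∀ ε, Integrable (F ε) μ)
    (hF' : Continuous (Function.uncurry F')) (h0 : ∀ᵐ a ∂μ, a ∉ K → ∀ ε, F' ε a = 0)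
    (hd : ∀ ε a, HasDerivAt (fun ε => F ε a) (F' ε a) ε) (x : ℝ) :
    HasDerivAt (fun ε => ∫ a, F ε a ∂μ) (∫ a, F' x a ∂μ) x := by
  obtain ⟨C, hC⟩ := ((isCompact_Icc (a := x - 1) (b := x + 1)).prod hK).exists_bound_of_continuousOn
    hF'.continuousOn
  refine (hasDerivAt_integral_of_dominated_loc_of_deriv_le (s := Set.Icc (x - 1) (x + 1))
    (bound := K.indicator fun _ => C) (Icc_mem_nhds (by linarith) (by linarith))
    (Filter.Eventually.of_forall fun ε => (hF ε).aestronglyMeasurable) (hF x)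
    (hF'.comp (by fun_prop : Continuous fun a => (x, a))).aestronglyMeasurable ?_ ?_
    (Filter.Eventually.of_forall fun a ε _ => hd ε a)).2
  · filter_upwards [h0] with a ha ε hε
    by_cases h : a ∈ K
    · rw [Set.indicator_of_mem h]
      exact hC (ε, a) ⟨hε, h⟩
    · rw [ha h, Set.indicator_of_notMem h, norm_zero]
  · exact (integrable_indicator_iff hKm).2 (integrableOn_const hK.measure_lt_top.ne)

/-- Smoothness of integrals over the unit interval in a parameter. -/
theorem contDiff_integral_unit {P : Type*} [NormedAddCommGroup P] [NormedSpace ℝ P]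
    {h : P × ℝ → ℝ} (hh : ContDiff ℝ ∞ h) :
    ContDiff ℝ ∞ fun p => ∫ t in (0 : ℝ)..1, h (p, t) := by
  obtain ⟨χ, hχ, hχc, hχ1⟩ : ∃ χ : ℝ → ℝ, ContDiff ℝ ∞ χ ∧ HasCompactSupport χ ∧
      ∀ t ∈ Set.Icc (0 : ℝ) 1, χ (-t) = 1 := by
    let b : ContDiffBump (0 : ℝ) := ⟨1, 2, by norm_num, by norm_num⟩
    refine ⟨b, b.contDiff, b.hasCompactSupport, fun t ht => b.one_of_mem_closedBall ?_⟩
    simpa [abs_of_nonneg ht.1] using ht.2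
  -- The integral is written as the value at `0` of the convolution of this indicator with `y ↦ χ(y)
  -- h(p, -y)`, where `χ(-t) = 1` on the unit interval; smoothness of parametrised convolutions then
  -- applies.
  let f : ℝ → ℝ := (Set.Ioc (0 : ℝ) 1).indicator fun _ => 1
  have hf : MeasureTheory.LocallyIntegrable f MeasureTheory.volume :=
    ((MeasureTheory.integrable_indicator_iff measurableSet_Ioc).2
      (MeasureTheory.integrableOn_const (by simp))).locallyIntegrable
  have key := MeasureTheory.contDiffOn_convolution_right_with_param (𝕜 := ℝ) (μ := MeasureTheory.volume)
    (f := f) (n := ⊤) (ContinuousLinearMap.mul ℝ ℝ) (g := fun (p : P) y => χ y * h (p, -y))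
    (s := Set.univ) (k := tsupport χ) isOpen_univ hχc
    (fun p y _ hy => by simp only [image_eq_zero_of_notMem_tsupport hy, zero_mul]) hf
    (by
      refine ContDiff.contDiffOn ?_
      show ContDiff ℝ ∞ fun q : P × ℝ => χ q.2 * h (q.1, -q.2)
      fun_prop)
  rw [Set.univ_prod_univ, contDiffOn_univ] at key
  have h2 : ContDiff ℝ ∞ fun p : P => (p, (0 : ℝ)) := by fun_prop
  convert key.comp h2 using 1
  funext p
  symm
  simp only [Function.comp, MeasureTheory.convolution_def, ContinuousLinearMap.mul_apply',
    zero_sub, neg_neg]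
  rw [intervalIntegral.integral_of_le zero_le_one, ← MeasureTheory.integral_indicator
    measurableSet_Ioc]
  refine MeasureTheory.integral_congr_ae (Filter.Eventually.of_forall fun t => ?_)
  by_cases ht : t ∈ Set.Ioc (0 : ℝ) 1
  · simp only [f, Set.indicator_of_mem ht]
    rw [hχ1 t ⟨ht.1.le, ht.2⟩, one_mul, one_mul]
  · simp only [f, Set.indicator_of_notMem ht, zero_mul]

/-! ### The algebra of local functions -/

namespace Loc

variable {N : ℕ}

instance : JetAlgebra N (Loc N) where
  coordX := coordX
  coordU := coordU
  derD := derD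
  derU := derU
  finite_derU := finite_derU
  derU_comm := derU_comm
  derD_comm := derD_comm
  derU_derD := derU_derD
  derD_coordX := derD_coordX
  derD_coordU := derD_coordU
  derU_coordX := derU_coordX
  derU_coordU := derU_coordU

theorem Rep.derU_apply {f : Loc N} {s g} (h : Rep (f : Jet N → ℝ) s g) (J : MultiIdx N)
    (z : Jet N) : (derU J f : Jet N → ℝ) z
      = fderiv ℝ g (Jet.proj s z) (Jet.proj s (0, Pi.single J 1)) := by
  rw [Loc.derU_apply, dU_coe, h.dirD_eq]

theorem proj_eq_sum (s : Finset (MultiIdx N)) (z : Jet N) :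
    Jet.proj s (0, z.2) = ∑ J ∈ s, z.2 J • Jet.proj s ((0, Pi.single J 1) : Jet N) := by
  refine Prod.ext ?_ (funext fun K => ?_)
  · rw [Prod.fst_sum]
    simp [Jet.proj]
  · rw [Prod.snd_sum, Finset.sum_apply, Finset.sum_eq_single (K : MultiIdx N)]
    · simp [Jet.proj]
    · intro J _ hJ
      simp [Jet.proj, hJ.symm]
    · exact fun h => absurd K.2 h

/-- The finite sum of partial derivatives is taken over the coordinates on which the representative
depends; all others contribute nothing. -/
theorem Rep.fderiv_vertical {f : Loc N} {s g} (h : Rep (f : Jet N → ℝ) s g) (z w : Jet N) :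
    fderiv ℝ g (Jet.proj s z) (Jet.proj s (0, w.2))
      = ∑ J ∈ s, w.2 J * (derU J f : Jet N → ℝ) z := by
  rw [proj_eq_sum, map_sum]
  refine Finset.sum_congr rfl fun J _ => ?_
  rw [map_smul, h.derU_apply, smul_eq_mul]

theorem coe_sum {ι : Type*} (s : Finset ι) (f : ι → Loc N) (z : Jet N) :
    ((∑ k ∈ s, f k : Loc N) : Jet N → ℝ) z = ∑ k ∈ s, (f k : Jet N → ℝ) z := by
  rw [AddSubmonoidClass.coe_finsetSum, Finset.sum_apply]

/-- The direction of the total derivative at a point of the jet bundle. -/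
def shift (i : Fin N) (z : Jet N) : Jet N := (Pi.single i 1, fun J => z.2 (J + Pi.single i 1))

theorem Rep.derD_apply {f : Loc N} {s g} (h : Rep (f : Jet N → ℝ) s g) (i : Fin N) (z : Jet N) :
    (derD i f : Jet N → ℝ) z = fderiv ℝ g (Jet.proj s z) (Jet.proj s (shift i z)) := by
  have e : Jet.proj s (shift i z) = Jet.proj s ((Pi.single i 1, 0) : Jet N)
      + Jet.proj s (0, (shift i z).2) :=
    Prod.ext (add_zero _).symm (zero_add _).symm
  rw [e, map_add, h.fderiv_vertical, derD_eq_sum i fun J hJ => h.derU_eq_zero hJ]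
  show (derX i f : Jet N → ℝ) z + _ = _
  rw [derX_apply, dX_coe, h.dirD_eq, coe_sum]
  rfl

/-! ### Functions on the base -/

/-- A smooth function on `ℝ^N` as a local function. -/
def ofBase (g : (Fin N → ℝ) → ℝ) (hg : ContDiff ℝ ∞ g) : Loc N :=
  ⟨fun z => g z.1, ∅, fun w => g w.1, by fun_prop, fun _ => rfl⟩

theorem rep_ofBase (g : (Fin N → ℝ) → ℝ) (hg : ContDiff ℝ ∞ g) :
    Rep (ofBase g hg : Jet N → ℝ) ∅ fun w => g w.1 := ⟨by fun_prop, fun _ => rfl⟩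

theorem derU_ofBase (J : MultiIdx N) (g : (Fin N → ℝ) → ℝ) (hg : ContDiff ℝ ∞ g) :
    derU J (ofBase g hg) = 0 := (rep_ofBase g hg).derU_eq_zero (Finset.notMem_empty J)

theorem contDiff_baseD (i : Fin N) {g : (Fin N → ℝ) → ℝ} (hg : ContDiff ℝ ∞ g) :
    ContDiff ℝ ∞ (baseD i g) :=
  (hg.fderiv_right (m := ∞) (by simp)).clm_apply contDiff_const

theorem derD_ofBase (i : Fin N) (g : (Fin N → ℝ) → ℝ) (hg : ContDiff ℝ ∞ g) :
    derD i (ofBase g hg) = ofBase (baseD i g) (contDiff_baseD i hg) := by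
  refine Subtype.ext (funext fun z => ?_)
  rw [(rep_ofBase g hg).derD_apply]
  have h1 : HasFDerivAt (fun w : (Fin N → ℝ) × ((∅ : Finset (MultiIdx N)) → ℝ) => g w.1)
      ((fderiv ℝ g z.1).comp (ContinuousLinearMap.fst ℝ _ _)) (Jet.proj ∅ z) :=
    (hg.differentiable (by simp) z.1).hasFDerivAt.comp (Jet.proj ∅ z) hasFDerivAt_fst
  rw [h1.fderiv]
  rfl

theorem contDiff_atZero (f : Loc N) : ContDiff ℝ ∞ fun x => (f : Jet N → ℝ) (x, 0) := by
  obtain ⟨s, g, h⟩ := exists_rep f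
  simp only [h.eq]
  have : ContDiff ℝ ∞ fun x : Fin N → ℝ => (x, (0 : s → ℝ)) := contDiff_id.prodMk contDiff_const
  exact h.smooth.comp this

/-- The restriction of a local function to the zero section. -/
def atZero (f : Loc N) : Loc N := ofBase _ (contDiff_atZero f)

/-- A function of `x` has an antiderivative along any one coordinate, so it is a divergence as soon
as `N ≥ 1`. -/
theorem ofBase_mem_exact [Nonempty (Fin N)] (g : (Fin N → ℝ) → ℝ) (hg : ContDiff ℝ ∞ g) :
    ofBase g hg ∈ JetAlgebra.exact (Loc N) := by
  obtain ⟨i⟩ := ‹Nonempty (Fin N)›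
  have hc : ∀ x, Continuous fun t => g (Function.update x i t) := fun x =>
    hg.continuous.comp (continuous_const.update i continuous_id)
  let G : (Fin N → ℝ) → ℝ := fun x => ∫ t in (0 : ℝ)..x i, g (Function.update x i t)
  have hG : ContDiff ℝ ∞ G := by
    -- Rescaling to a fixed interval removes the variable endpoint, so that smoothness follows from
    -- smooth dependence on parameters.
    have e : G = fun x => x i * ∫ t in (0 : ℝ)..1, g (Function.update x i (t * x i)) := by
      funext x
      have := intervalIntegral.smul_integral_comp_mul_right (a := 0) (b := 1)
        (fun t => g (Function.update x i t)) (x i)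
      rw [smul_eq_mul, zero_mul, one_mul] at this
      exact this.symm
    rw [e]
    refine (contDiff_apply ℝ ℝ i).mul (contDiff_integral_unit
      (h := fun q : (Fin N → ℝ) × ℝ => g (Function.update q.1 i (q.2 * q.1 i))) (hg.comp ?_))
    refine contDiff_pi.2 fun k => ?_
    by_cases hk : k = i
    · subst hk
      simp only [Function.update_self]
      fun_prop
    · simp only [Function.update_of_ne hk]
      fun_prop
  have hD : baseD i G = g := by
    funext x
    have h1 : HasDerivAt (fun t => G (Function.update x i t)) (baseD i G x) (x i) := by
      have h2 : HasFDerivAt G (fderiv ℝ G x) (Function.update x i (x i)) := by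
        rw [Function.update_eq_self]
        exact (hG.differentiable (by simp) x).hasFDerivAt
      exact h2.comp_hasDerivAt (x i) (hasDerivAt_update x i (x i))
    have h3 : HasDerivAt (fun t => G (Function.update x i t)) (g x) (x i) := by
      have h4 := intervalIntegral.integral_hasDerivAt_right
        ((hc x).intervalIntegrable 0 (x i))
        (hc x).stronglyMeasurable.stronglyMeasurableAtFilter (hc x).continuousAt
      rw [Function.update_eq_self] at h4
      refine h4.congr_of_eventuallyEq (Filter.Eventually.of_forall fun t => ?_)
      simp only [G, Function.update_idem, Function.update_self]
    exact h1.unique h3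
  have e : ofBase g hg = derD i (ofBase G hG) := by
    rw [derD_ofBase]
    simp only [hD]
  rw [e]
  exact JetAlgebra.derD_mem_exact (A := Loc N) i _

/-! ### The homotopy operator in the fibres -/

theorem Rep.homotopy {f : Loc N} {s g} (h : Rep (f : Jet N → ℝ) s g) :
    Rep (fun z : Jet N => ∫ t in (0 : ℝ)..1, (f : Jet N → ℝ) (z.1, t • z.2)) s
      fun w => ∫ t in (0 : ℝ)..1, g (w.1, t • w.2) := by
  refine ⟨contDiff_integral_unit (h := fun q : ((Fin N → ℝ) × (s → ℝ)) × ℝ =>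
    g (q.1.1, q.2 • q.1.2)) (h.smooth.comp (by fun_prop)), fun z => ?_⟩
  simp only [h.eq]
  rfl

/-- `(𝓘 f)(x, u) = ∫₀¹ f(x, t u) dt`. -/
def homotopy (f : Loc N) : Loc N :=
  ⟨fun z => ∫ t in (0 : ℝ)..1, (f : Jet N → ℝ) (z.1, t • z.2), by
    obtain ⟨s, g, h⟩ := exists_rep f
    exact ⟨s, _, h.homotopy.smooth, h.homotopy.eq⟩⟩

theorem homotopy_coe (f : Loc N) (z : Jet N) :
    (homotopy f : Jet N → ℝ) z = ∫ t in (0 : ℝ)..1, (f : Jet N → ℝ) (z.1, t • z.2) := rfl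

theorem continuous_ray (f : Loc N) (z : Jet N) :
    Continuous fun t : ℝ => (f : Jet N → ℝ) (z.1, t • z.2) := by
  obtain ⟨s, g, h⟩ := exists_rep f
  simp only [h.eq]
  refine h.smooth.continuous.comp (continuous_const.prodMk (continuous_pi fun J => ?_))
  simp only [Pi.smul_apply]
  fun_prop

theorem intervalIntegrable_ray (f : Loc N) (z : Jet N) : IntervalIntegrable
    (fun t : ℝ => (f : Jet N → ℝ) (z.1, t • z.2)) MeasureTheory.volume 0 1 :=
  (continuous_ray f z).intervalIntegrable 0 1

theorem homotopy_add (f g : Loc N) : homotopy (f + g) = homotopy f + homotopy g := by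
  refine Subtype.ext (funext fun z => ?_)
  show (homotopy (f + g) : Jet N → ℝ) z = (homotopy f : Jet N → ℝ) z + (homotopy g : Jet N → ℝ) z
  rw [homotopy_coe, homotopy_coe, homotopy_coe,
    ← intervalIntegral.integral_add (intervalIntegrable_ray f z) (intervalIntegrable_ray g z)]
  rfl

theorem homotopy_smul (c : ℝ) (f : Loc N) : homotopy (c • f) = c • homotopy f := by
  refine Subtype.ext (funext fun z => ?_)
  show (homotopy (c • f) : Jet N → ℝ) z = c • (homotopy f : Jet N → ℝ) z
  rw [homotopy_coe, homotopy_coe, ← intervalIntegral.integral_smul]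
  rfl

/-- The homotopy operator as a linear map. -/
def homotopyₗ : Loc N →ₗ[ℝ] Loc N := ⟨⟨homotopy, homotopy_add⟩, homotopy_smul⟩

/-- The total derivative differentiates along `shift i z`, whose vertical part is linear in `u`.
Scaling the fibre by `t` therefore commutes with it, and it remains to differentiate under the
integral. -/
theorem derD_homotopy (i : Fin N) (f : Loc N) : derD i (homotopy f) = homotopy (derD i f) := by
  obtain ⟨s, g, h⟩ := exists_rep f
  refine Subtype.ext (funext fun z => ?_)
  have hr : Rep (homotopy f : Jet N → ℝ) s _ := h.homotopy
  have h1 := hr.line z (shift i z)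
  rw [← hr.derD_apply] at h1
  have hcurve : Continuous fun q : ℝ × ℝ =>
      ((z.1 + q.1 • (shift i z).1, fun J : s => q.2 * (z.2 J + q.1 * (shift i z).2 J)) :
        (Fin N → ℝ) × (s → ℝ)) := by fun_prop
  have h2 := hasDerivAt_integral_of_compact
    (μ := MeasureTheory.volume.restrict (Set.Ioc (0 : ℝ) 1)) (K := Set.Icc 0 1) isCompact_Icc
    measurableSet_Icc
    (F := fun ε t => (f : Jet N → ℝ) ((z + ε • shift i z).1, t • (z + ε • shift i z).2))
    (F' := fun ε t => fderiv ℝ g (z.1 + ε • (shift i z).1,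
      fun J : s => t * (z.2 J + ε * (shift i z).2 J))
      ((shift i z).1, fun J : s => t * (shift i z).2 J))
    (fun ε => (intervalIntegrable_iff_integrableOn_Ioc_of_le zero_le_one).1
      (intervalIntegrable_ray f _))
    (((h.smooth.continuous_fderiv (by simp)).comp hcurve).clm_apply (by fun_prop))
    (by
      filter_upwards [MeasureTheory.ae_restrict_mem measurableSet_Ioc] with t ht h'
      exact absurd (Set.Ioc_subset_Icc_self ht) h')
    (fun ε t => by
      have h3 : HasDerivAt (fun ε : ℝ => ((z.1 + ε • (shift i z).1,
          fun J : s => t * (z.2 J + ε * (shift i z).2 J)) : (Fin N → ℝ) × (s → ℝ)))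
          ((shift i z).1, fun J : s => t * (shift i z).2 J) ε := by
        refine HasDerivAt.prodMk ?_ (hasDerivAt_pi.2 fun J => ?_)
        · simpa using ((hasDerivAt_id ε).smul_const (shift i z).1).const_add z.1
        · simpa using (((hasDerivAt_id ε).mul_const ((shift i z).2 J)).const_add
            (z.2 J)).const_mul t
      have h4 := (h.smooth.differentiable (by simp) (z.1 + ε • (shift i z).1,
          fun J : s => t * (z.2 J + ε * (shift i z).2 J))).hasFDerivAt.comp_hasDerivAt ε h3
      refine h4.congr_of_eventuallyEq (Filter.Eventually.of_forall fun ε => ?_)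
      exact h.eq _) 0
  have h5 := h1.unique (h2.congr_of_eventuallyEq (Filter.Eventually.of_forall fun ε => by
    show (homotopy f : Jet N → ℝ) _ = _
    rw [homotopy_coe, intervalIntegral.integral_of_le zero_le_one]))
  rw [h5, homotopy_coe, intervalIntegral.integral_of_le zero_le_one]
  refine MeasureTheory.integral_congr_ae (Filter.Eventually.of_forall fun t => ?_)
  simp only [h.derD_apply]
  congr 2
  simp [Jet.proj]

/-- The fundamental theorem of calculus along the ray `t ↦ (x, t u)`. -/
theorem sub_atZero {f : Loc N} {s g} (h : Rep (f : Jet N → ℝ) s g) :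
    f - atZero f = ∑ J ∈ s, coordU J * homotopy (derU J f) := by
  refine Subtype.ext (funext fun z => ?_)
  rw [coe_sum]
  show (f : Jet N → ℝ) z - (f : Jet N → ℝ) (z.1, 0)
    = ∑ J ∈ s, z.2 J * (homotopy (derU J f) : Jet N → ℝ) z
  have hd : ∀ t ∈ Set.uIcc (0 : ℝ) 1, HasDerivAt (fun t : ℝ => (f : Jet N → ℝ) (z.1, t • z.2))
      (∑ J ∈ s, z.2 J * (derU J f : Jet N → ℝ) (z.1, t • z.2)) t := by
    intro t _
    rw [← h.fderiv_vertical]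
    have h3 : HasDerivAt (fun t : ℝ => Jet.proj s (z.1, t • z.2)) (Jet.proj s (0, z.2)) t := by
      refine HasDerivAt.prodMk (hasDerivAt_const _ _) (hasDerivAt_pi.2 fun J => ?_)
      simpa using (hasDerivAt_id t).mul_const (z.2 J)
    have h4 := (h.smooth.differentiable (by simp)
      (Jet.proj s (z.1, t • z.2))).hasFDerivAt.comp_hasDerivAt t h3
    refine h4.congr_of_eventuallyEq (Filter.Eventually.of_forall fun ε => ?_)
    exact h.eq _
  have hi : ∀ J ∈ s, IntervalIntegrable (fun t : ℝ => z.2 J * (derU J f : Jet N → ℝ)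
      (z.1, t • z.2)) MeasureTheory.volume 0 1 :=
    fun J _ => (intervalIntegrable_ray (derU J f) z).const_mul (z.2 J)
  have hF := intervalIntegral.integral_eq_sub_of_hasDerivAt hd (by
    simpa only [Finset.sum_fn] using IntervalIntegrable.sum s hi)
  rw [one_smul, zero_smul, intervalIntegral.integral_finsetSum hi] at hF
  rw [← hF]
  refine Finset.sum_congr rfl fun J _ => ?_
  rw [intervalIntegral.integral_const_mul, homotopy_coe]

theorem negPow_homotopy (J : MultiIdx N) (f : Loc N) :
    (JetAlgebra.negPow J).1 (homotopy f) = homotopy ((JetAlgebra.negPow J).1 f) := by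
  induction J using MultiIdx.induct generalizing f with
  | h0 => rw [JetAlgebra.negPow_zero]; rfl
  | hs J i ih =>
    rw [JetAlgebra.negPow_add_single_apply, JetAlgebra.negPow_add_single_apply, ih]
    have e : ∀ g : Loc N, homotopy (-g) = -homotopy g := fun g => homotopyₗ.map_neg g
    rw [e]
    exact congrArg Neg.neg (derD_homotopy i _)

/-- A local function with vanishing Euler-Lagrange derivative is a total divergence. -/
theorem mem_exact_of_euler [Nonempty (Fin N)] {f : Loc N}
    (hf : (JetAlgebra.euler (Loc N)).1 f = 0) : f ∈ JetAlgebra.exact (Loc N) := by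
  obtain ⟨s, g, h⟩ := exists_rep f
  obtain ⟨m, hm⟩ := JetAlgebra.exists_jetLE f
  obtain ⟨g', hg', e⟩ := IsLocalFun.enlarge (t := s ∪ MultiIdx.upTo N m)
    Finset.subset_union_left h.smooth
  have hs : Rep (f : Jet N → ℝ) (s ∪ MultiIdx.upTo N m) g' :=
    ⟨hg', fun z => (h.eq z).trans (e z)⟩
  have h1 : f - atZero f = ∑ J ∈ MultiIdx.upTo N m, coordU J * homotopy (derU J f) := by
    rw [sub_atZero hs]
    refine (Finset.sum_subset Finset.subset_union_right fun J _ hJ => ?_).symm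
    rw [show derU J f = 0 from hm J (by simpa [MultiIdx.mem_upTo] using hJ),
      show homotopy (0 : Loc N) = 0 from homotopyₗ.map_zero, mul_zero]
  have h2 : ∑ J ∈ MultiIdx.upTo N m, homotopy ((JetAlgebra.negPow J).1 (derU J f)) = 0 := by
    rw [JetAlgebra.euler_apply hm] at hf
    have := congrArg homotopyₗ hf
    rwa [map_sum, map_zero] at this
  have h3 : ∀ J : MultiIdx N, (JetAlgebra.totPow J).1 (coordU (0 : MultiIdx N) : Loc N)
      = coordU J := by
    intro J
    induction J using MultiIdx.induct with
    | h0 => rw [JetAlgebra.totPow_zero_apply]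
    | hs J i ih => rw [JetAlgebra.totPow_add_single, ih]; exact derD_coordU i J
  -- As `u_J = (d/dx)^J u_0`, integration by parts turns the sum into `u_0` times the homotopy of
  -- the Euler derivative, which is zero. The restriction to the zero section is a function of `x`
  -- and exact as well.
  have h4 : ∑ J ∈ MultiIdx.upTo N m, coordU J * homotopy (derU J f)
      ∈ JetAlgebra.exact (Loc N) := by
    have h5 := (JetAlgebra.exact (Loc N)).sum_mem (t := MultiIdx.upTo N m) fun J _ =>
      JetAlgebra.mul_totPow_sub_mem J (homotopy (derU J f)) (coordU (0 : MultiIdx N))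
    rw [Finset.sum_sub_distrib, ← Finset.sum_mul] at h5
    simp only [negPow_homotopy, h2, zero_mul, sub_zero, h3] at h5
    simpa only [mul_comm] using h5
  rw [← sub_add_cancel f (atZero f), h1]
  exact add_mem h4 (ofBase_mem_exact _ _)

end Loc

/-! ### Jets of test sections and the kernel of `∫`. -/

namespace Loc

variable {N : ℕ}

/-! ### Ordered powers of commuting operators -/

theorem totPow_eq_foldr (J : MultiIdx N) (f : Loc N) :
    (JetAlgebra.totPow J).1 f = totalDPow J f := by
  have key : ∀ l : List (Fin N), (l.map fun i => (JetAlgebra.totD i : JetAlgebra.diffOp (Loc N))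
      ^ J i).prod.1 f = l.foldr (fun i g => (totalD i)^[J i] g) f := by
    intro l
    induction l with
    | nil => rfl
    | cons i l ih =>
      rw [List.map_cons, List.prod_cons, List.foldr_cons, ← ih]
      show ((JetAlgebra.totD i : JetAlgebra.diffOp (Loc N)) ^ J i).1 _ = _
      rw [SubmonoidClass.coe_pow, Module.End.pow_apply]
      rfl
  exact key _

theorem verPow_eq_foldr (α : MultiIdx N →₀ ℕ) (f : Loc N) :
    (JetAlgebra.verPow α).1 f = dUPow α f := by
  have key : ∀ l : List (MultiIdx N), (l.map fun J =>
      (JetAlgebra.verD J : JetAlgebra.diffOp (Loc N)) ^ α J).prod.1 f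
        = l.foldr (fun J g => (dU J)^[α J] g) f := by
    intro l
    induction l with
    | nil => rfl
    | cons J l ih =>
      rw [List.map_cons, List.prod_cons, List.foldr_cons, ← ih]
      show ((JetAlgebra.verD J : JetAlgebra.diffOp (Loc N)) ^ α J).1 _ = _
      rw [SubmonoidClass.coe_pow, Module.End.pow_apply]
      rfl
  rw [JetAlgebra.verPow_eq_list]
  exact key _

theorem isLDO_of_ldo {n : ℕ} (X : JetAlgebra.LDO (Loc N) n) :
    IsLDO fun f : Fin n → Loc N => X.1 f := by
  obtain ⟨p, hp, h⟩ := JetAlgebra.exists_coefficients X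
  refine ⟨p, hp, fun f => ?_⟩
  simp only [h f, totPow_eq_foldr, verPow_eq_foldr]

theorem mem_ldo_of_isLDO {n : ℕ} {T : MultilinearMap ℝ (fun _ : Fin n => Loc N) (Loc N)}
    (hT : IsLDO fun f => T f) : T ∈ JetAlgebra.ldo (Loc N) n := by
  obtain ⟨p, hp, h⟩ := hT
  refine JetAlgebra.mem_ldo_of_coefficients p hp fun f => ?_
  simp only [totPow_eq_foldr, verPow_eq_foldr]
  exact h f

/-! ### Jets of functions -/

theorem totPow_ofBase (J : MultiIdx N) {φ : (Fin N → ℝ) → ℝ} (hφ : ContDiff ℝ ∞ φ) :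
    (JetAlgebra.totPow J).1 (ofBase φ hφ) = ofBase (baseDPow J φ) (baseDPow_prop J hφ).1 := by
  have iter : ∀ (i : Fin N) (n : ℕ) (g : (Fin N → ℝ) → ℝ) (hg : ContDiff ℝ ∞ g),
      ∃ h, (totalD i)^[n] (ofBase g hg) = ofBase ((baseD i)^[n] g) h := by
    intro i n
    induction n with
    | zero => exact fun g hg => ⟨hg, rfl⟩
    | succ n ih =>
      intro g hg
      obtain ⟨h, e⟩ := ih (baseD i g) (contDiff_baseD i hg)
      refine ⟨h, ?_⟩
      rw [Function.iterate_succ_apply, ← Loc.derD_apply, derD_ofBase, e]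
      rfl
  have key : ∀ l : List (Fin N), ∃ h, l.foldr (fun i g => (totalD i)^[J i] g) (ofBase φ hφ)
      = ofBase (l.foldr (fun i g => (baseD i)^[J i] g) φ) h := by
    intro l
    induction l with
    | nil => exact ⟨hφ, rfl⟩
    | cons i l ih =>
      obtain ⟨h, e⟩ := ih
      obtain ⟨h', e'⟩ := iter i (J i) _ h
      refine ⟨h', ?_⟩
      rw [List.foldr_cons, e, e']
      rfl
  rw [totPow_eq_foldr]
  exact (key _).2

theorem totPow_ofBase_coe (J : MultiIdx N) {φ : (Fin N → ℝ) → ℝ} (hφ : ContDiff ℝ ∞ φ)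
    (z : Jet N) : ((JetAlgebra.totPow J).1 (ofBase φ hφ) : Loc N).1 z = baseDPow J φ z.1 := by
  rw [totPow_ofBase]; rfl

/-- `baseDPow` uses a fixed order of differentiation, so this needs commuting partial derivatives.
They are inherited from the total derivatives through `ofBase`. -/
theorem baseDPow_add_single (J : MultiIdx N) (i : Fin N) {φ : (Fin N → ℝ) → ℝ}
    (hφ : ContDiff ℝ ∞ φ) : baseDPow (J + Pi.single i 1) φ = baseD i (baseDPow J φ) := by
  funext x
  have h := congrArg (fun f : Loc N => f.1 (x, 0))
    (JetAlgebra.totPow_add_single J i (ofBase φ hφ))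
  simp only [totPow_ofBase_coe] at h
  rw [h, totPow_ofBase]
  show (derD i (ofBase _ _)).1 _ = _
  rw [derD_ofBase]
  rfl

theorem baseDPow_add (J : MultiIdx N) {φ ψ : (Fin N → ℝ) → ℝ} (hφ : ContDiff ℝ ∞ φ)
    (hψ : ContDiff ℝ ∞ ψ) : baseDPow J (φ + ψ) = baseDPow J φ + baseDPow J ψ := by
  funext x
  have h := congrArg (fun f : Loc N => f.1 (x, 0))
    ((JetAlgebra.totPow J).1.map_add (ofBase φ hφ) (ofBase ψ hψ))
  have e : ofBase φ hφ + ofBase ψ hψ = ofBase (φ + ψ) (hφ.add hψ) := rfl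
  rw [e] at h
  simp only [totPow_ofBase_coe] at h
  rw [h]
  show ((JetAlgebra.totPow J).1 (ofBase φ hφ)).1 _ + ((JetAlgebra.totPow J).1 (ofBase ψ hψ)).1 _ = _
  rw [totPow_ofBase_coe, totPow_ofBase_coe]
  rfl

theorem baseDPow_smul (J : MultiIdx N) (c : ℝ) {φ : (Fin N → ℝ) → ℝ} (hφ : ContDiff ℝ ∞ φ) :
    baseDPow J (c • φ) = c • baseDPow J φ := by
  funext x
  have h := congrArg (fun f : Loc N => f.1 (x, 0))
    ((JetAlgebra.totPow J).1.map_smul c (ofBase φ hφ))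
  have e : c • ofBase φ hφ = ofBase (c • φ) (hφ.const_smul c) := rfl
  rw [e] at h
  simp only [totPow_ofBase_coe] at h
  rw [h]
  show c • ((JetAlgebra.totPow J).1 (ofBase φ hφ)).1 _ = _
  rw [totPow_ofBase_coe]
  rfl

theorem jetAt_shift {φ : (Fin N → ℝ) → ℝ} (hφ : ContDiff ℝ ∞ φ) (i : Fin N) (x : Fin N → ℝ) :
    shift i (jetAt φ x) = (Pi.single i 1, fun J => fderiv ℝ (baseDPow J φ) x (Pi.single i 1)) :=
  Prod.ext rfl (funext fun J => congrFun (baseDPow_add_single J i hφ) x)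

theorem contDiff_pullback (f : Loc N) {φ : (Fin N → ℝ) → ℝ} (hφ : ContDiff ℝ ∞ φ) :
    ContDiff ℝ ∞ fun x => (f : Jet N → ℝ) (jetAt φ x) := by
  obtain ⟨s, g, h⟩ := exists_rep f
  simp only [h.eq]
  have : ContDiff ℝ ∞ fun x => Jet.proj s (jetAt φ x) :=
    contDiff_id.prodMk (contDiff_pi.2 fun J => (baseDPow_prop (J : MultiIdx N) hφ).1)
  exact h.smooth.comp this

theorem fderiv_pullback (f : Loc N) {φ : (Fin N → ℝ) → ℝ} (hφ : ContDiff ℝ ∞ φ) (i : Fin N)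
    (x : Fin N → ℝ) : fderiv ℝ (fun x => (f : Jet N → ℝ) (jetAt φ x)) x (Pi.single i 1)
      = (derD i f : Jet N → ℝ) (jetAt φ x) := by
  obtain ⟨s, g, h⟩ := exists_rep f
  have h1 : HasFDerivAt (fun x => Jet.proj s (jetAt φ x))
      ((ContinuousLinearMap.id ℝ _).prod (ContinuousLinearMap.pi fun J : s =>
        fderiv ℝ (baseDPow J φ) x)) x :=
    (hasFDerivAt_id x).prodMk (hasFDerivAt_pi.2 fun J =>
      ((baseDPow_prop (J : MultiIdx N) hφ).1.differentiable (by simp) x).hasFDerivAt)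
  have h2 := (h.smooth.differentiable (by simp) (Jet.proj s (jetAt φ x))).hasFDerivAt.comp x h1
  have e : (fun x => (f : Jet N → ℝ) (jetAt φ x)) = g ∘ fun x => Jet.proj s (jetAt φ x) :=
    funext fun x => h.eq _
  rw [e, h2.fderiv, h.derD_apply, jetAt_shift hφ]
  rfl

theorem baseDPow_zero (J : MultiIdx N) : baseDPow J (0 : (Fin N → ℝ) → ℝ) = 0 := by
  have := baseDPow_smul J 0 (φ := (0 : (Fin N → ℝ) → ℝ)) contDiff_const
  simpa using this

theorem jetAt_zero (x : Fin N → ℝ) : jetAt 0 x = (x, 0) :=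
  Prod.ext rfl (funext fun J => congrFun (baseDPow_zero J) x)

theorem baseDPow_congr (J : MultiIdx N) {φ ψ : (Fin N → ℝ) → ℝ} {x : Fin N → ℝ}
    (h : φ =ᶠ[nhds x] ψ) : baseDPow J φ =ᶠ[nhds x] baseDPow J ψ := by
  have step : ∀ (i : Fin N) (n : ℕ) {g k : (Fin N → ℝ) → ℝ}, g =ᶠ[nhds x] k →
      (baseD i)^[n] g =ᶠ[nhds x] (baseD i)^[n] k := by
    intro i n
    induction n with
    | zero => exact fun h => h
    | succ n ih =>
      intro g k h
      exact ih (h.fderiv.mono fun y hy => by rw [baseD, baseD, hy])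
  unfold baseDPow
  induction List.finRange N with
  | nil => exact h
  | cons i L ih => exact step i (J i) ih

/-! ### Prescribed jets -/

/-- The monomial `∏ᵢ (xⁱ - aⁱ)^{Kᵢ}`. -/
def centered (a : Fin N → ℝ) (K : MultiIdx N) : Loc N :=
  ∏ i, (coordX i - algebraMap ℝ (Loc N) (a i)) ^ K i

theorem derD_centered (a : Fin N → ℝ) (K : MultiIdx N) (i : Fin N) :
    derD i (centered a K) = (K i : ℝ) • centered a (K - Pi.single i 1) := by
  have h1 : ∀ k, derD i (coordX k - algebraMap ℝ (Loc N) (a k)) = if i = k then 1 else 0 :=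
    fun k => by rw [map_sub, derD_coordX, Derivation.map_algebraMap, sub_zero]
  have h0 : ∀ s : Finset (Fin N), i ∉ s →
      derD i (∏ k ∈ s, (coordX k - algebraMap ℝ (Loc N) (a k)) ^ K k) = 0 := by
    intro s
    induction s using Finset.induction_on with
    | empty => intro _; rw [Finset.prod_empty]; exact Derivation.map_one_eq_zero _
    | insert k s hk ih =>
      intro hi
      rw [Finset.prod_insert hk, Derivation.leibniz, ih fun h => hi (Finset.mem_insert_of_mem h),
        Derivation.leibniz_pow, h1, if_neg (by rintro rfl; exact hi (Finset.mem_insert_self _ _))]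
      simp
  have e : ∀ L : MultiIdx N, centered a L = (coordX i - algebraMap ℝ (Loc N) (a i)) ^ L i *
      ∏ k ∈ Finset.univ.erase i, (coordX k - algebraMap ℝ (Loc N) (a k)) ^ L k :=
    fun L => (Finset.mul_prod_erase Finset.univ _ (Finset.mem_univ i)).symm
  have e' : ∏ k ∈ Finset.univ.erase i, (coordX k - algebraMap ℝ (Loc N) (a k))
        ^ (K - Pi.single i 1 : MultiIdx N) k
      = ∏ k ∈ Finset.univ.erase i, (coordX k - algebraMap ℝ (Loc N) (a k)) ^ K k :=
    Finset.prod_congr rfl fun k hk => by simp [(Finset.mem_erase.1 hk).1]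
  rw [e K, e (K - Pi.single i 1), e', Derivation.leibniz, h0 _ (Finset.notMem_erase i _),
    smul_zero, zero_add, Derivation.leibniz_pow, h1, if_pos rfl, Pi.sub_apply, Pi.single_eq_same,
    Nat.cast_smul_eq_nsmul]
  simp only [smul_eq_mul, nsmul_eq_mul, mul_one]
  ring

theorem totPow_centered (a : Fin N → ℝ) (v : MultiIdx N → ℝ) (J K : MultiIdx N) :
    ((JetAlgebra.totPow J).1 (centered a K)).1 (a, v)
      = if J = K then (MultiIdx.fact J : ℝ) else 0 := by
  induction J using MultiIdx.induct generalizing K with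
  | h0 =>
    rw [JetAlgebra.totPow_zero_apply]
    have e : (centered a K).1 (a, v) = ∏ i, (0 : ℝ) ^ K i := by
      rw [centered]
      refine (map_prod ((Pi.evalRingHom (fun _ : Jet N => ℝ) (a, v)).comp (Loc N).val.toRingHom)
        _ _).trans (Finset.prod_congr rfl fun i _ => ?_)
      rw [map_pow]
      congr 1
      exact sub_self (a i)
    rw [e]
    split_ifs with h
    · subst h; simp [MultiIdx.fact]
    · obtain ⟨i, hi⟩ : ∃ i, K i ≠ 0 := by
        by_contra hK
        push Not at hK
        exact h (funext fun i => (hK i).symm)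
      exact Finset.prod_eq_zero (Finset.mem_univ i) (zero_pow hi)
  | hs J i ih =>
    rw [← JetAlgebra.totPow_derD]
    have e : JetAlgebra.derD i (centered a K) = (K i : ℝ) • centered a (K - Pi.single i 1) :=
      derD_centered a K i
    rw [e, map_smul]
    show (K i : ℝ) * ((JetAlgebra.totPow J).1 (centered a (K - Pi.single i 1))).1 (a, v) = _
    rw [ih]
    by_cases h0 : K i = 0
    · rw [h0, Nat.cast_zero, zero_mul, if_neg]
      rintro rfl
      simp at h0
    · by_cases h : J = K - Pi.single i 1
      · have hK : J + Pi.single i 1 = K := by rw [h, MultiIdx.sub_add_single h0]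
        rw [if_pos h, if_pos hK, MultiIdx.fact_add_single, ← hK]
        simp
      · rw [if_neg h, if_neg, mul_zero]
        rintro rfl
        exact h (by simp)

/-- A Taylor polynomial with the prescribed coefficients at the base point, times a bump function
that is one nearby. -/
theorem exists_test_of_jet (z : Jet N) (s : Finset (MultiIdx N)) :
    ∃ φ : TestSection N, Jet.proj s (jetAt φ.1 z.1) = Jet.proj s z := by
  let p : Loc N := ∑ K ∈ s, (z.2 K * (MultiIdx.fact K : ℝ)⁻¹) • centered z.1 K
  have hp := contDiff_atZero p
  have hfree : p = ofBase _ hp := by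
    have hc : ∀ K, ∀ w : Jet N, (centered z.1 K).1 w = (centered z.1 K).1 (w.1, 0) := by
      intro K w
      have e : ∀ w : Jet N, (centered z.1 K).1 w = ∏ i, (w.1 i - z.1 i) ^ K i := fun w => by
        rw [centered]
        refine (map_prod ((Pi.evalRingHom (fun _ : Jet N => ℝ) w).comp (Loc N).val.toRingHom)
          _ _).trans (Finset.prod_congr rfl fun i _ => ?_)
        rw [map_pow]
        rfl
      rw [e, e]
    refine Subtype.ext (funext fun w => ?_)
    show (p : Jet N → ℝ) w = (p : Jet N → ℝ) (w.1, 0)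
    simp only [p, coe_sum]
    refine Finset.sum_congr rfl fun K _ => ?_
    exact congrArg (fun r : ℝ => (z.2 K * (MultiIdx.fact K : ℝ)⁻¹) * r) (hc K w)
  let b : ContDiffBump z.1 := ⟨1, 2, by norm_num, by norm_num⟩
  let φ : (Fin N → ℝ) → ℝ := fun x => b x * (p : Jet N → ℝ) (x, 0)
  have hφ : φ =ᶠ[nhds z.1] fun x => (p : Jet N → ℝ) (x, 0) :=
    b.eventuallyEq_one.mono fun x hx => by simp only [φ, hx, Pi.one_apply, one_mul]
  refine ⟨⟨φ, b.contDiff.mul hp, b.hasCompactSupport.mul_right⟩, Prod.ext rfl (funext fun J => ?_)⟩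
  show baseDPow J φ z.1 = z.2 J
  rw [(baseDPow_congr (J : MultiIdx N) hφ).eq_of_nhds]
  have h1 := totPow_ofBase_coe (J : MultiIdx N) hp (z.1, 0)
  rw [← hfree] at h1
  rw [← h1]
  simp only [p, map_sum, map_smul]
  rw [coe_sum, Finset.sum_eq_single (J : MultiIdx N)]
  · show (z.2 J * (MultiIdx.fact (J : MultiIdx N) : ℝ)⁻¹)
      * ((JetAlgebra.totPow (J : MultiIdx N)).1 (centered z.1 J)).1 (z.1, 0) = _
    rw [totPow_centered, if_pos rfl, mul_assoc, inv_mul_cancel₀ (MultiIdx.fact_ne_zero _), mul_one]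
  · intro K _ hK
    show (z.2 K * (MultiIdx.fact K : ℝ)⁻¹)
      * ((JetAlgebra.totPow (J : MultiIdx N)).1 (centered z.1 K)).1 (z.1, 0) = _
    rw [totPow_centered, if_neg (Ne.symm hK), mul_zero]
  · exact fun h => absurd J.2 h

/-! ### Local functionals -/

/-- The functional `∫ f dx`. -/
def functional : Loc N →ₗ[ℝ] (TestSection N → ℝ) :=
  (integralForm N).comp (LinearMap.single ℝ (fun _ : Finset (Fin N) => Loc N) Finset.univ)

theorem functional_apply (f : Loc N) (φ : TestSection N) : functional f φ
    = ∫ x, (f : Jet N → ℝ) (jetAt φ.1 x) - (f : Jet N → ℝ) (x, 0) := by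
  show ∫ x, ((Pi.single Finset.univ f : HForm N) Finset.univ).1 _
    - ((Pi.single Finset.univ f : HForm N) Finset.univ).1 _ = _
  rw [Pi.single_eq_same]

/-- The pull-back of a total derivative is an ordinary derivative of a compactly supported function;
its integral vanishes by integration by parts against the constant `1`. -/
theorem functional_derD (i : Fin N) (f : Loc N) : functional (derD i f) = 0 := by
  funext φ
  rw [functional_apply]
  let F : (Fin N → ℝ) → ℝ := fun x => (f : Jet N → ℝ) (jetAt φ.1 x) - (f : Jet N → ℝ) (x, 0)
  have h1 := contDiff_pullback f φ.2.1
  have h2 := contDiff_atZero f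
  have e : ∀ x, fderiv ℝ F x (Pi.single i 1)
      = (derD i f : Jet N → ℝ) (jetAt φ.1 x) - (derD i f : Jet N → ℝ) (x, 0) := by
    intro x
    have h3 := fderiv_pullback f (φ := 0) contDiff_const i x
    simp only [jetAt_zero] at h3
    rw [← h3, ← fderiv_pullback f φ.2.1]
    show fderiv ℝ (fun x => _ - _) x _ = _
    rw [fderiv_fun_sub (h1.differentiable (by simp) x) (h2.differentiable (by simp) x)]
    rfl
  have hF : MeasureTheory.Integrable F := integrand_prop f φ
  have hF' := integrand_prop (derD i f) φ
  simp only [← e] at hF' ⊢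
  have := integral_mul_fderiv_eq_neg_fderiv_mul_of_integrable (μ := MeasureTheory.volume)
    (f := fun _ : Fin N → ℝ => (1 : ℝ)) (g := F) (v := Pi.single i 1) (by simp)
    (by simpa using hF') (by simpa using hF) (by simp)
    fun x _ => ((h1.sub h2).differentiable (by simp) x)
  simpa using this

theorem functional_of_exact {f : Loc N} (hf : f ∈ JetAlgebra.exact (Loc N)) :
    functional f = 0 := by
  obtain ⟨β, rfl⟩ := hf
  rw [map_sum]
  exact Finset.sum_eq_zero fun i _ => functional_derD i (β i)

theorem jetAt_add_smul {φ ψ : (Fin N → ℝ) → ℝ} (hφ : ContDiff ℝ ∞ φ) (hψ : ContDiff ℝ ∞ ψ)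
    (ε : ℝ) (x : Fin N → ℝ) :
    jetAt (φ + ε • ψ) x = (x, fun J => baseDPow J φ x + ε * baseDPow J ψ x) :=
  Prod.ext rfl (funext fun J => by
    show baseDPow J (φ + ε • ψ) x = _
    rw [baseDPow_add J hφ (ψ := ε • ψ) (hψ.const_smul ε), baseDPow_smul J ε hψ]
    rfl)

/-- The first variation of a local functional. -/
theorem hasDerivAt_functional (f : Loc N) {s g} (h : Rep (f : Jet N → ℝ) s g)
    (φ ψ : TestSection N) :
    HasDerivAt (fun ε : ℝ => ∫ x, (f : Jet N → ℝ) (jetAt (φ.1 + ε • ψ.1) x)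
      - (f : Jet N → ℝ) (x, 0))
      (∫ x, ((∑ J ∈ s, derU J f * (JetAlgebra.totPow J).1 (ofBase ψ.1 ψ.2.1) : Loc N) : Jet N → ℝ)
        (jetAt φ.1 x)) 0 := by
  have hc : ∀ (χ : TestSection N) J, Continuous (baseDPow J χ.1) :=
    fun χ J => (baseDPow_prop J χ.2.1).1.continuous
  have hcurve : Continuous fun q : ℝ × (Fin N → ℝ) =>
      ((q.2, fun J : s => baseDPow J φ.1 q.2 + q.1 * baseDPow J ψ.1 q.2) :
        (Fin N → ℝ) × (s → ℝ)) :=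
    continuous_snd.prodMk (continuous_pi fun J => ((hc φ J).comp continuous_snd).add
      (continuous_fst.mul ((hc ψ J).comp continuous_snd)))
  have hdir : Continuous fun q : ℝ × (Fin N → ℝ) =>
      ((0, fun J : s => baseDPow J ψ.1 q.2) : (Fin N → ℝ) × (s → ℝ)) :=
    continuous_const.prodMk (continuous_pi fun J => (hc ψ J).comp continuous_snd)
  have key := hasDerivAt_integral_of_compact (μ := MeasureTheory.volume) (K := tsupport ψ.1)
    ψ.2.2 (isClosed_tsupport ψ.1).measurableSet
    (F := fun ε x => (f : Jet N → ℝ) (jetAt (φ.1 + ε • ψ.1) x) - (f : Jet N → ℝ) (x, 0))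
    (F' := fun ε x => fderiv ℝ g (x, fun J : s => baseDPow J φ.1 x + ε * baseDPow J ψ.1 x)
      (0, fun J : s => baseDPow J ψ.1 x))
    (fun ε => integrand_prop f ⟨φ.1 + ε • ψ.1, φ.2.1.add (ψ.2.1.const_smul ε),
      φ.2.2.add (ψ.2.2.smul_left (f := fun _ => ε))⟩)
    (((h.smooth.continuous_fderiv (by simp)).comp hcurve).clm_apply hdir)
    (Filter.Eventually.of_forall fun x hx ε => by
      have : (fun J : s => baseDPow J ψ.1 x) = 0 := funext fun J =>
        image_eq_zero_of_notMem_tsupport fun h => hx ((baseDPow_prop J ψ.2.1).2 h)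
      simp only [this]
      exact map_zero _)
    (fun ε x => by
      have h3 : HasDerivAt (fun ε : ℝ => ((x, fun J : s =>
          baseDPow J φ.1 x + ε * baseDPow J ψ.1 x) : (Fin N → ℝ) × (s → ℝ)))
          (0, fun J : s => baseDPow J ψ.1 x) ε := by
        refine HasDerivAt.prodMk (hasDerivAt_const _ _) (hasDerivAt_pi.2 fun J => ?_)
        simpa using ((hasDerivAt_id ε).mul_const (baseDPow J ψ.1 x)).const_add (baseDPow J φ.1 x)
      have h4 := ((h.smooth.differentiable (by simp) _).hasFDerivAt.comp_hasDerivAt ε h3).sub_const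
        ((f : Jet N → ℝ) (x, 0))
      refine h4.congr_of_eventuallyEq (Filter.Eventually.of_forall fun ε => ?_)
      show (f : Jet N → ℝ) (jetAt (φ.1 + ε • ψ.1) x) - _ = g _ - _
      rw [jetAt_add_smul φ.2.1 ψ.2.1, h.eq]
      rfl) 0
  convert key using 2
  funext x
  rw [coe_sum]
  have e := h.fderiv_vertical (jetAt φ.1 x) (jetAt ψ.1 x)
  simp only [zero_mul, add_zero]
  refine Eq.trans ?_ e.symm
  refine Finset.sum_congr rfl fun J _ => ?_
  show (derU J f).1 _ * ((JetAlgebra.totPow J).1 (ofBase ψ.1 ψ.2.1)).1 _ = _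
  rw [totPow_ofBase_coe, mul_comm]
  rfl

theorem integral_variation {f : Loc N} (hf : functional f = 0) {s g}
    (h : Rep (f : Jet N → ℝ) s g) (φ ψ : TestSection N) :
    ∫ x, ((∑ J ∈ s, derU J f * (JetAlgebra.totPow J).1 (ofBase ψ.1 ψ.2.1) : Loc N) : Jet N → ℝ)
        (jetAt φ.1 x) = 0 := by
  refine (hasDerivAt_functional f h φ ψ).unique ?_
  refine (hasDerivAt_const (0 : ℝ) (0 : ℝ)).congr_of_eventuallyEq
    (Filter.Eventually.of_forall fun ε => ?_)
  have := congrFun hf ⟨φ.1 + ε • ψ.1, φ.2.1.add (ψ.2.1.const_smul ε),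
    φ.2.2.add (ψ.2.2.smul_left (f := fun _ => ε))⟩
  rwa [functional_apply] at this

theorem eq_zero_of_integral {f : (Fin N → ℝ) → ℝ} (hf : Continuous f)
    (h : ∀ ψ : TestSection N, ∫ x, ψ.1 x * f x = 0) : f = 0 := by
  have h1 := ae_eq_zero_of_integral_contDiff_smul_eq_zero (μ := MeasureTheory.volume)
    hf.locallyIntegrable fun g hg hc => h ⟨g, hg, hc⟩
  exact (MeasureTheory.Measure.eq_of_ae_eq h1 hf continuous_const)

/-- The first variation of the zero functional, integrated by parts, tests the Euler derivative
against every `ψ`. Because densities are normalised by subtracting their value on the zero section,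
only the difference of the Euler derivatives at `φ` and at `0` is shown to vanish. -/
theorem euler_pullback {f : Loc N} (hf : functional f = 0) (φ : TestSection N) (x : Fin N → ℝ) :
    ((JetAlgebra.euler (Loc N)).1 f).1 (jetAt φ.1 x)
      = ((JetAlgebra.euler (Loc N)).1 f).1 (x, 0) := by
  obtain ⟨s, g, h⟩ := exists_rep f
  obtain ⟨m, hm⟩ := JetAlgebra.exists_jetLE f
  obtain ⟨g', hg', e⟩ := IsLocalFun.enlarge (t := s ∪ MultiIdx.upTo N m)
    Finset.subset_union_left h.smooth
  have hs : Rep (f : Jet N → ℝ) (s ∪ MultiIdx.upTo N m) g' :=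
    ⟨hg', fun z => (h.eq z).trans (e z)⟩
  set E := (JetAlgebra.euler (Loc N)).1 f with hE
  have hEc : ∀ χ : TestSection N, Continuous fun x => (E : Jet N → ℝ) (jetAt χ.1 x) :=
    fun χ => (contDiff_pullback E χ.2.1).continuous
  have key := eq_zero_of_integral (f := fun x => (E : Jet N → ℝ) (jetAt φ.1 x)
    - (E : Jet N → ℝ) (x, 0)) ((hEc φ).sub (contDiff_atZero E).continuous) fun ψ => by
    set Ψ := ofBase ψ.1 ψ.2.1 with hΨ
    set V : Loc N := ∑ J ∈ s ∪ MultiIdx.upTo N m, derU J f * (JetAlgebra.totPow J).1 Ψ with hV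
    have h1 : V - E * Ψ ∈ JetAlgebra.exact (Loc N) := by
      have h2 := (JetAlgebra.exact (Loc N)).sum_mem (t := MultiIdx.upTo N m) fun J _ =>
        JetAlgebra.mul_totPow_sub_mem J (derU J f) Ψ
      rw [Finset.sum_sub_distrib, ← Finset.sum_mul] at h2
      have h3 : E = ∑ J ∈ MultiIdx.upTo N m, (JetAlgebra.negPow J).1 (derU J f) :=
        JetAlgebra.euler_apply hm
      have h4 : V = ∑ J ∈ MultiIdx.upTo N m, derU J f * (JetAlgebra.totPow J).1 Ψ := by
        refine (Finset.sum_subset Finset.subset_union_right fun J _ hJ => ?_).symm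
        rw [show derU J f = 0 from hm J (by simpa [MultiIdx.mem_upTo] using hJ), zero_mul]
      rwa [h4, h3]
    have h5 := functional_of_exact h1
    rw [map_sub, sub_eq_zero] at h5
    have h6 := congrFun h5 φ
    rw [functional_apply, functional_apply] at h6
    have hint : ∀ χ : TestSection N, MeasureTheory.Integrable
        fun x => (V : Jet N → ℝ) (jetAt χ.1 x) := fun χ => by
      refine (contDiff_pullback V χ.2.1).continuous.integrable_of_hasCompactSupport ?_
      refine HasCompactSupport.intro ψ.2.2 fun x hx => ?_
      rw [hV, coe_sum]
      refine Finset.sum_eq_zero fun J _ => ?_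
      show (derU J f).1 _ * ((JetAlgebra.totPow J).1 Ψ).1 _ = 0
      rw [totPow_ofBase_coe, mul_eq_zero]
      exact Or.inr (image_eq_zero_of_notMem_tsupport fun h => hx ((baseDPow_prop J ψ.2.1).2 h))
    have hz : ∀ x : Fin N → ℝ, (V : Jet N → ℝ) (x, 0)
        = (V : Jet N → ℝ) (jetAt (0 : (Fin N → ℝ) → ℝ) x) := fun x => by rw [jetAt_zero]
    let χ : TestSection N := ⟨0, contDiff_const, HasCompactSupport.zero⟩
    simp only [hz] at h6
    rw [MeasureTheory.integral_sub (hint φ) (hint χ), integral_variation hf hs φ ψ,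
      integral_variation hf hs χ ψ, sub_zero] at h6
    refine Eq.trans ?_ h6.symm
    refine MeasureTheory.integral_congr_ae (Filter.Eventually.of_forall fun x => ?_)
    show ψ.1 x * (E.1 _ - E.1 _) = E.1 _ * ψ.1 x - E.1 _ * ψ.1 x
    ring
  exact sub_eq_zero.1 (congrFun key x)

theorem euler_eq_ofBase {f : Loc N} (hf : functional f = 0) :
    (JetAlgebra.euler (Loc N)).1 f = atZero ((JetAlgebra.euler (Loc N)).1 f) := by
  obtain ⟨s, g, h⟩ := exists_rep ((JetAlgebra.euler (Loc N)).1 f)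
  refine Subtype.ext (funext fun z => ?_)
  obtain ⟨φ, hφ⟩ := exists_test_of_jet z s
  refine Eq.trans ?_ (euler_pullback hf φ z.1)
  rw [h.eq, h.eq, hφ]

theorem euler_mul_coordU (a : (Fin N → ℝ) → ℝ) (ha : ContDiff ℝ ∞ a) :
    (JetAlgebra.euler (Loc N)).1 (ofBase a ha * coordU 0) = ofBase a ha := by
  have hd : ∀ J, JetAlgebra.derU J (ofBase a ha * coordU 0 : Loc N)
      = if J = 0 then ofBase a ha else 0 := by
    intro J
    show derU J _ = _
    rw [Derivation.leibniz, derU_ofBase, derU_coordU]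
    split_ifs <;> simp
  have hm : (ofBase a ha * coordU 0 : Loc N) ∈ JetAlgebra.jetLE (Loc N) 0 := fun J hJ => by
    rw [hd, if_neg]; rintro rfl; simp [MultiIdx.order_zero] at hJ
  rw [JetAlgebra.euler_apply hm, Finset.sum_eq_single (0 : MultiIdx N)]
  · rw [JetAlgebra.negPow_zero, hd, if_pos rfl]; rfl
  · intro J _ hJ
    rw [hd, if_neg hJ, map_zero]
  · exact fun h => absurd (MultiIdx.mem_upTo.2 (by simp [MultiIdx.order_zero])) h

/-- A local functional vanishes only if its density is a total divergence. -/
theorem functional_eq_zero_iff [Nonempty (Fin N)] {f : Loc N} :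
    functional f = 0 ↔ f ∈ JetAlgebra.exact (Loc N) := by
  refine ⟨fun hf => ?_, functional_of_exact⟩
  set E := (JetAlgebra.euler (Loc N)).1 f with hE
  have h0 : E = atZero E := euler_eq_ofBase hf
  -- The Euler derivative is so far only known to be a function `a(x)`. Subtracting `a u`, whose
  -- Euler derivative is `a`, leaves an exact density; hence `a u` also has zero functional. This
  -- functional is `ψ ↦ ∫ a ψ`, so `a = 0`.
  have h1 : f - atZero E * coordU 0 ∈ JetAlgebra.exact (Loc N) := by
    refine mem_exact_of_euler ?_
    rw [map_sub, atZero, euler_mul_coordU]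
    exact sub_eq_zero.2 h0
  have h2 := functional_of_exact h1
  rw [map_sub, hf, zero_sub, neg_eq_zero] at h2
  have h3 := eq_zero_of_integral (contDiff_atZero E).continuous fun ψ => by
    have h4 := congrFun h2 ψ
    rw [functional_apply] at h4
    refine Eq.trans ?_ h4
    refine MeasureTheory.integral_congr_ae (Filter.Eventually.of_forall fun x => ?_)
    show ψ.1 x * E.1 (x, 0) = E.1 (x, 0) * baseDPow 0 ψ.1 x - E.1 (x, 0) * (0 : ℝ)
    have h5 : baseDPow 0 ψ.1 x = ψ.1 x := by
      rw [← totPow_ofBase_coe 0 ψ.2.1 (x, 0), JetAlgebra.totPow_zero_apply]; rfl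
    rw [h5]; ring
  refine mem_exact_of_euler ?_
  rw [← hE, h0]
  exact Subtype.ext (funext fun z => congrFun h3 z.1)

end Loc

/-! ### Brackets on horizontal forms and the strong homotopy relations. -/

namespace Loc

variable {N : ℕ}

/-! ### Horizontal forms -/

theorem dH_eq_diff (w : HForm N) :
    dH w = Koszul.diff (fun i => (derD i : Loc N →ₗ[ℝ] Loc N).toAddMonoidHom) w := rfl

theorem dH_dH (w : HForm N) : dH (dH w) = 0 := by
  rw [dH_eq_diff, dH_eq_diff]
  exact Koszul.diff_diff _ (fun i k f => derD_comm i k f) w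

theorem dH_apply_mem (w : HForm N) (T : Finset (Fin N)) : dH w T ∈ JetAlgebra.exact (Loc N) :=
  sum_mem fun i _ => zsmul_mem (JetAlgebra.derD_mem_exact (A := Loc N) i (w (T.erase i))) _

theorem dH_mem {w : HForm N} {k : ℤ} (hw : w ∈ Omega N k) : dH w ∈ Omega N (k + 1) := by
  rw [dH_eq_diff]
  exact Koszul.IsForm.diff hw _

theorem dH_top {w : HForm N} (hw : w ∈ Omega N N) : dH w = 0 := by
  funext T
  refine dH_mem hw T fun h => ?_
  have := Finset.card_le_univ T
  simp only [Fintype.card_fin] at this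
  omega

theorem mem_omega_apply_univ {w : HForm N} {k : ℤ} (hw : w ∈ Omega N k) (hk : k ≠ N) :
    w Finset.univ = 0 := hw _ (by simpa using hk.symm)

/-- `d_H` as a linear map. -/
def dHₗ : HForm N →ₗ[ℝ] HForm N where
  toFun := dH
  map_add' w v := by rw [dH_eq_diff, Koszul.diff_add]; rfl
  map_smul' c w := by
    funext T
    show ∑ i ∈ T, _ • derD i (c • w (T.erase i)) = c • ∑ i ∈ T, _ • derD i (w (T.erase i))
    rw [Finset.smul_sum]
    refine Finset.sum_congr rfl fun i _ => ?_
    rw [Derivation.map_smul, smul_comm]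

/-- The top form with given density, as a linear map. -/
def topFormₗ : Loc N →ₗ[ℝ] Omega N N where
  toFun := topForm
  map_add' f g := Subtype.ext (Pi.single_add (f := fun _ : Finset (Fin N) => Loc N) _ f g)
  map_smul' c f := Subtype.ext (Pi.single_smul (f := fun _ : Finset (Fin N) => Loc N) _ c f)

theorem topForm_apply_univ (f : Loc N) : (topForm f : HForm N) Finset.univ = f :=
  Pi.single_eq_same _ _

theorem topForm_univ (α : Omega N N) : topForm ((α : HForm N) Finset.univ) = α := by
  refine Subtype.ext (funext fun S => ?_)
  by_cases h : S = Finset.univ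
  · subst h; exact topForm_apply_univ _
  · have hS : (S.card : ℤ) ≠ N := fun h' => h (Finset.card_eq_iff_eq_univ S |>.1 (by
      simpa using h'))
    rw [α.2 S hS]
    exact Pi.single_eq_of_ne h _

theorem isDHExact_iff {α : Omega N N} :
    IsDHExact α ↔ (α : HForm N) Finset.univ ∈ JetAlgebra.exact (Loc N) := by
  constructor
  · rintro ⟨β, -, h⟩
    rw [← h]
    exact dH_apply_mem β _
  · rintro ⟨γ, hγ⟩
    have herase : ∀ i k : Fin N, Finset.univ.erase i = Finset.univ.erase k → k = i := by
      intro i k h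
      by_contra hik
      have : k ∈ (Finset.univ.erase k : Finset (Fin N)) := by
        rw [← h]; exact Finset.mem_erase.2 ⟨hik, Finset.mem_univ k⟩
      exact absurd rfl (Finset.mem_erase.1 this).1
    -- At most one summand is nonzero, since `i` is determined by `univ ∖ {i}`. The sign in the
    -- component is undone by the same sign in `d_H`.
    let β : HForm N := fun S =>
      ∑ i, if S = Finset.univ.erase i then Koszul.sgn i Finset.univ • γ i else 0
    have hβ : β ∈ Omega N ((N : ℤ) - 1) := by
      intro S hS
      refine Finset.sum_eq_zero fun i _ => if_neg ?_
      rintro rfl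
      have := Finset.card_erase_add_one (Finset.mem_univ i)
      rw [Finset.card_univ, Fintype.card_fin] at this
      omega
    refine ⟨β, hβ, ?_⟩
    have hmem := dH_mem hβ
    rw [sub_add_cancel] at hmem
    have h₁ := congrArg Subtype.val (topForm_univ ⟨dH β, hmem⟩)
    have h₂ := congrArg Subtype.val (topForm_univ α)
    suffices h₃ : dH β Finset.univ = (α : HForm N) Finset.univ from
      h₁.symm.trans ((congrArg (fun f : Loc N => ((topForm f : Omega N N) : HForm N)) h₃).trans h₂)
    rw [hγ]
    refine Finset.sum_congr rfl fun i _ => ?_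
    have : β (Finset.univ.erase i) = Koszul.sgn i Finset.univ • γ i := by
      refine (Finset.sum_eq_single i (fun k _ hk => if_neg fun h => hk (herase i k h)) ?_).trans
        (if_pos rfl)
      exact fun h => absurd (Finset.mem_univ i) h
    rw [this]
    show Koszul.sgn i Finset.univ • derD i (Koszul.sgn i Finset.univ • γ i) = derD i (γ i)
    rw [map_zsmul, smul_smul, Koszul.sgn_mul_self, one_smul]

theorem integralForm_eq (w : HForm N) : integralForm N w = functional (w Finset.univ) := by
  funext φ
  rw [functional_apply]
  rfl

theorem integralForm_eq_zero_iff [Nonempty (Fin N)] {α : Omega N N} :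
    integralForm N (α : HForm N) = 0 ↔ IsDHExact α := by
  rw [integralForm_eq, functional_eq_zero_iff, isDHExact_iff]

theorem isInternal_regraded : DirectSum.IsInternal (regraded N) := by
  rw [DirectSum.isInternal_submodule_iff_iSupIndep_and_iSup_eq_top]
  constructor
  · intro d
    rw [Submodule.disjoint_def]
    intro w hw hw'
    let Y : Submodule ℝ (HForm N) :=
      { carrier := {w | ∀ S, (S.card : ℤ) = N - d → w S = 0}
        add_mem' := fun h₁ h₂ S hS => by simp [h₁ S hS, h₂ S hS]
        zero_mem' := fun S _ => rfl
        smul_mem' := fun c w h S hS => by simp [h S hS] }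
    have hY : (⨆ j, ⨆ (_ : j ≠ d), regraded N j) ≤ Y :=
      iSup₂_le fun j hj w hw S hS => hw S (by rw [hS]; omega)
    funext S
    by_cases h : (S.card : ℤ) = N - d
    · exact hY hw' S h
    · exact hw S h
  · rw [eq_top_iff]
    intro w _
    have hw : w = ∑ S, (Pi.single S (w S) : HForm N) := (Finset.univ_sum_single w).symm
    rw [hw]
    refine sum_mem fun S _ => Submodule.mem_iSup_of_mem ((N : ℤ) - S.card) fun T hT => ?_
    have : T ≠ S := by rintro rfl; simp at hT
    exact Pi.single_eq_of_ne this _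

/-! ### Brackets on horizontal forms -/

/-- The operation on horizontal forms that applies form-valued operators to the top components. -/
def topOp {k : ℕ} (L : Finset (Fin N) → JetAlgebra.LDO (Loc N) k) :
    MultilinearMap ℝ (fun _ : Fin k => HForm N) (HForm N) :=
  MultilinearMap.pi fun S => (L S).1.compLinearMap fun _ => LinearMap.proj Finset.univ

/-- The brackets `l₁ = d_H` and `l_{k+2} = L_k`. -/
def brackets (L : ∀ k : ℕ, Finset (Fin N) → JetAlgebra.LDO (Loc N) (k + 2)) :
    ∀ k : ℕ, MultilinearMap ℝ (fun _ : Fin k => HForm N) (HForm N)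
  | 0 => 0
  | 1 => dHₗ.compMultilinearMap (MultilinearMap.ofSubsingleton ℝ (HForm N) (HForm N) (0 : Fin 1)
      LinearMap.id)
  | k + 2 => topOp (L k)

theorem brackets_one (L : ∀ k : ℕ, Finset (Fin N) → JetAlgebra.LDO (Loc N) (k + 2))
    (w : Fin 1 → HForm N) : brackets L 1 w = dH (w 0) := rfl

theorem brackets_of_eq_one (L : ∀ k : ℕ, Finset (Fin N) → JetAlgebra.LDO (Loc N) (k + 2))
    {m : ℕ} (hm : m = 1) (w : Fin m → HForm N) :
    brackets L m w = dH (w ⟨0, by omega⟩) := by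
  subst hm; rfl

/-- The single source of all vanishing in the relations. It covers values of `d_H` as well as forms
of positive complex degree, whose top component is zero. -/
theorem brackets_eq_zero {L : ∀ k : ℕ, Finset (Fin N) → JetAlgebra.LDO (Loc N) (k + 2)}
    (hK : ∀ k S, JetAlgebra.Kills (L k S)) {m : ℕ} (hm : 2 ≤ m) (w : Fin m → HForm N) (a : Fin m)
    (ha : w a Finset.univ ∈ JetAlgebra.exact (Loc N)) : brackets L m w = 0 := by
  obtain ⟨k, rfl⟩ := Nat.exists_eq_add_of_le' hm
  funext S
  have := (hK k S).exact (fun i => w i Finset.univ) a ha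
  rwa [Function.update_eq_self] at this

theorem brackets_apply_univ {L : ∀ k : ℕ, Finset (Fin N) → JetAlgebra.LDO (Loc N) (k + 2)}
    (hF : ∀ k : ℕ, Koszul.IsForm ((N : ℤ) - k) (L k)) {m : ℕ} (hm : 3 ≤ m) (w : Fin m → HForm N) :
    brackets L m w Finset.univ = 0 := by
  obtain ⟨k, rfl⟩ := Nat.exists_eq_add_of_le' hm
  show (L (k + 1) Finset.univ).1 _ = 0
  rw [hF (k + 1) Finset.univ (by simp; omega)]
  rfl

theorem isFormLDO_brackets (L : ∀ k : ℕ, Finset (Fin N) → JetAlgebra.LDO (Loc N) (k + 2)) (k : ℕ)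
    (hk : 1 ≤ k) : IsFormLDO (brackets L k) := by
  intro S T
  match k, hk with
  | 1, _ =>
    -- The matrix coefficients of `d_H` are those of the Koszul differential of the identity
    -- operator placed at `(dx)^S`.
    have h := isLDO_of_ldo (Koszul.diff JetAlgebra.ldoD
      (Pi.single (S 0) (JetAlgebra.mulProd 1 (1 : Loc N))) T)
    convert h using 2 with f
    rw [brackets_one, JetAlgebra.diff_ldoD_apply]
    refine Finset.sum_congr rfl fun i _ => ?_
    congr 1
    show derD i _ = derD i _
    congr 1
    by_cases hS : T.erase i = S 0
    · rw [hS, Pi.single_eq_same, JetAlgebra.mulProd_apply, monoForm, Pi.single_eq_same]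
      simp
    · rw [Pi.single_eq_of_ne hS, monoForm, Pi.single_eq_of_ne hS]
      rfl
  | k + 2, _ =>
    by_cases hS : ∀ i, S i = Finset.univ
    · convert isLDO_of_ldo (L k T) using 2 with f
      show (L k T).1 _ = _
      congr 1
      funext i
      show monoForm (S i) (f i) Finset.univ = f i
      rw [hS i, monoForm, Pi.single_eq_same]
    · push Not at hS
      obtain ⟨i, hi⟩ := hS
      convert isLDO_of_ldo (0 : JetAlgebra.LDO (Loc N) (k + 2)) using 2 with f
      show (L k T).1 _ = 0
      exact MultilinearMap.map_coord_zero _ i (Pi.single_eq_of_ne hi.symm _)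

theorem koszulSign_of_zero {n : ℕ} {d : Fin n → ℤ} (hd : ∀ i, d i = 0)
    (σ : Equiv.Perm (Fin n)) : koszulSign d σ = 1 :=
  Finset.prod_eq_one fun p _ => by rw [hd, hd, mul_zero, Int.negOnePow_zero]

theorem mem_unshuffles_self {n : ℕ} {σ : Equiv.Perm (Fin n)} : σ ∈ unshuffles n n ↔ σ = 1 := by
  simp only [unshuffles, Finset.mem_filter, Finset.mem_univ, true_and]
  refine ⟨fun h => ?_, ?_⟩
  · have hm : StrictMono σ := fun a b hab => h a b hab (Or.inl b.2)
    have : (⇑σ : Fin n → Fin n) = id := by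
      have := Tuple.unique_monotone (f := fun i : Fin n => i) (σ := σ) (τ := 1) hm.monotone
        monotone_id
      exact this
    exact Equiv.ext (congrFun this)
  · rintro rfl a b hab _
    exact hab

theorem isStrongHomotopyLie_brackets {M : JetAlgebra.LDO (Loc N) 2}
    {L : ∀ k : ℕ, Finset (Fin N) → JetAlgebra.LDO (Loc N) (k + 2)} (hM : JetAlgebra.Skew M)
    (h0 : L 0 = Pi.single Finset.univ M) (hF : ∀ k : ℕ, Koszul.IsForm ((N : ℤ) - k) (L k))
    (hS : ∀ k S, JetAlgebra.Skew (L k S)) (hK : ∀ k S, JetAlgebra.Kills (L k S))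
    (hd : ∀ k, Koszul.diff JetAlgebra.ldoD (L (k + 1)) = fun S => -JetAlgebra.delta M (L k S)) :
    IsStrongHomotopyLie (regraded N) (brackets L) := by
  have hreg : ∀ {d : ℤ} {x : HForm N}, x ∈ regraded N d → d ≠ 0 →
      x Finset.univ ∈ JetAlgebra.exact (Loc N) := fun hx hd => by
    rw [mem_omega_apply_univ hx (by omega)]; exact zero_mem _
  refine ⟨isInternal_regraded, ?_, ?_, ?_⟩
  · intro k hk d x hx
    match k, hk with
    | 1, _ =>
      rw [brackets_one]
      have h := dH_mem (hx 0)
      have e : ((N : ℤ) - d 0 + 1) = (N : ℤ) - (∑ i, d i + (1 : ℕ) - 2) := by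
        rw [Fin.sum_univ_one]; push_cast; ring
      rw [e] at h
      exact h
    | k + 2, _ =>
      by_cases h : ∀ i, d i = 0
      · intro S hS'
        show (L k S).1 _ = 0
        rw [hF k S]
        · rfl
        · intro h'
          apply hS'
          simp only [h, Finset.sum_const_zero, h']
          push_cast; ring
      · push Not at h
        obtain ⟨i, hi⟩ := h
        rw [brackets_eq_zero hK (by omega) x i (hreg (hx i) hi)]
        exact zero_mem _
  · intro k hk d x hx σ
    match k, hk with
    | 1, _ =>
      have hσ : σ = 1 := Subsingleton.elim _ _
      subst hσ
      have : koszulSign d 1 = 1 := Finset.prod_eq_one fun p hp => by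
        have := (Finset.mem_filter.1 hp).2.1
        exact absurd (Subsingleton.elim p.1 p.2) this.ne
      rw [this, Equiv.Perm.sign_one, one_mul, one_smul]
      rfl
    | k + 2, _ =>
      by_cases h : ∀ i, d i = 0
      · rw [koszulSign_of_zero h, one_mul]
        funext S
        exact hS k S σ fun i => x i Finset.univ
      · push Not at h
        obtain ⟨i, hi⟩ := h
        rw [brackets_eq_zero hK (by omega) x i (hreg (hx i) hi),
          brackets_eq_zero hK (by omega) (fun i => x (σ i)) (σ.symm i)
            (by rw [Equiv.apply_symm_apply]; exact hreg (hx i) hi), smul_zero]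
  · intro n hn d x hx
    rcases Nat.lt_or_ge n 2 with hn2 | hn2
    · obtain rfl : n = 1 := by omega
      refine Finset.sum_eq_zero fun i _ => Finset.sum_eq_zero fun σ _ => ?_
      have hi : i = 0 := Subsingleton.elim _ _
      subst hi
      refine (congrArg _ ?_).trans (smul_zero _)
      exact dH_dH _
    by_cases h : ∀ i, d i = 0
    swap
    · push Not at h
      obtain ⟨j, hj⟩ := h
      refine Finset.sum_eq_zero fun i _ => Finset.sum_eq_zero fun σ _ => ?_
      refine (congrArg _ ?_).trans (smul_zero _)
      have hxj := hreg (hx j) hj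
      -- The argument `x j` of nonzero degree sits either in the inner bracket, of arity `i + 1`, or
      -- in the outer one. An inner `l_1` produces a divergence, which the outer bracket kills;
      -- otherwise a bracket of arity at least two contains `x j` itself.
      by_cases hp : ((σ.symm j : Fin n) : ℕ) ≤ i
      · by_cases hi : (i : ℕ) = 0
        · refine brackets_eq_zero hK (by omega) _ ⟨0, by omega⟩ ?_
          rw [if_pos rfl, brackets_of_eq_one L (by omega)]
          exact dH_apply_mem _ _
        · have hz : brackets L ((i : ℕ) + 1) (fun a : Fin ((i : ℕ) + 1) =>
              x (σ ⟨(a : ℕ), lt_of_lt_of_le a.2 i.2⟩)) = 0 := by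
            refine brackets_eq_zero hK (by omega) _ ⟨(σ.symm j : Fin n), by omega⟩ ?_
            simpa using hxj
          refine MultilinearMap.map_coord_zero _ ⟨0, by omega⟩ ?_
          rw [if_pos rfl, hz]
      · have hlt := (σ.symm j).2
        refine brackets_eq_zero hK (by omega) _ ⟨(σ.symm j : Fin n) - i, by omega⟩ ?_
        rw [if_neg (by simp only; omega)]
        have e : (⟨(i : ℕ) + (((σ.symm j : Fin n) : ℕ) - i), by omega⟩ : Fin n) = σ.symm j :=
          Fin.ext (by simp only; omega)
        simp only [e, Equiv.apply_symm_apply]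
        exact hxj
    -- All arguments now have degree zero. The outer bracket has arity at least two, so it vanishes
    -- if the inner value is a divergence (`l_1`) or has no top component (arity at least three).
    -- Only the inner `l_2` and the outer `l_1` remain.
    have hzero : ∀ i : Fin n, (i : ℕ) ≠ 1 → (i : ℕ) + 1 ≠ n → ∑ σ ∈ unshuffles n ((i : ℕ) + 1),
      (koszulSign d σ * Equiv.Perm.sign σ * (-1) ^ (((i : ℕ) + 1) * (n - (i : ℕ) - 1))) •
        brackets L (n - (i : ℕ)) (fun b : Fin (n - (i : ℕ)) =>
          if (b : ℕ) = 0 then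
            brackets L ((i : ℕ) + 1) (fun a : Fin ((i : ℕ) + 1) =>
              x (σ ⟨(a : ℕ), lt_of_lt_of_le a.2 i.2⟩))
          else x (σ ⟨(i : ℕ) + (b : ℕ), by omega⟩)) = 0 := by
      intro i h1 h2
      refine Finset.sum_eq_zero fun σ _ => (congrArg _ ?_).trans (smul_zero _)
      refine brackets_eq_zero hK (by omega) _ ⟨0, by omega⟩ ?_
      rw [if_pos rfl]
      by_cases hi : (i : ℕ) = 0
      · rw [brackets_of_eq_one L (by omega)]
        exact dH_apply_mem _ _
      · rw [brackets_apply_univ hF (by omega)]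
        exact zero_mem _
    have hlast : ∀ i : Fin n, (i : ℕ) + 1 = n → ∑ σ ∈ unshuffles n ((i : ℕ) + 1),
      (koszulSign d σ * Equiv.Perm.sign σ * (-1) ^ (((i : ℕ) + 1) * (n - (i : ℕ) - 1))) •
        brackets L (n - (i : ℕ)) (fun b : Fin (n - (i : ℕ)) =>
          if (b : ℕ) = 0 then
            brackets L ((i : ℕ) + 1) (fun a : Fin ((i : ℕ) + 1) =>
              x (σ ⟨(a : ℕ), lt_of_lt_of_le a.2 i.2⟩))
          else x (σ ⟨(i : ℕ) + (b : ℕ), by omega⟩)) = dH (brackets L n x) := by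
      intro i hi
      obtain ⟨i, hi'⟩ := i
      simp only at hi
      subst hi
      rw [Finset.sum_eq_single (1 : Equiv.Perm (Fin (i + 1)))]
      · rw [koszulSign_of_zero h, Equiv.Perm.sign_one, one_mul, one_mul,
          brackets_of_eq_one L (by simp), if_pos rfl]
        have : (i + 1) * (i + 1 - i - 1) = 0 := by simp
        rw [this, pow_zero, one_smul]
        rfl
      · exact fun σ hσ h1 => absurd (mem_unshuffles_self.1 hσ) h1
      · exact fun h1 => absurd (mem_unshuffles_self.2 rfl) h1
    rcases Nat.lt_or_ge n 3 with hn3 | hn3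
    · obtain rfl : n = 2 := by omega
      rw [Fin.sum_univ_two, hzero 0 (by simp) (by simp), hlast 1 (by simp), zero_add]
      -- For `n = 2` the only remaining term is `d_H` of a top form.
      refine dH_top fun S hS' => ?_
      show (L 0 S).1 _ = 0
      rw [hF 0 S (by simpa using hS')]
      rfl
    · obtain ⟨k, rfl⟩ := Nat.exists_eq_add_of_le' hn3
      rw [Finset.sum_eq_add (⟨1, by omega⟩ : Fin (k + 3)) (⟨k + 2, by omega⟩ : Fin (k + 3))
        (by simp [Fin.ext_iff]) (fun i _ hi => hzero i
          (fun h' => hi.1 (Fin.ext h')) (fun h' => hi.2 (Fin.ext (by simp only; omega))))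
        (fun h' => absurd (Finset.mem_univ _) h') (fun h' => absurd (Finset.mem_univ _) h'),
        hlast ⟨k + 2, by omega⟩ (by simp)]
      funext S
      have hdS : dH (brackets L (k + 3) x) S
          = -(JetAlgebra.delta M (L k S)).1 fun i => x i Finset.univ := by
        have := congrFun (hd k) S
        have h2 := congrArg (fun X : JetAlgebra.LDO (Loc N) (k + 3) =>
          X.1 fun i => x i Finset.univ) this
        simp only [JetAlgebra.diff_ldoD_apply] at h2
        exact h2
      rw [Pi.add_apply, hdS, ← sub_eq_add_neg, Pi.zero_apply, sub_eq_zero,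
        JetAlgebra.delta_apply hM (hS k S), Finset.sum_apply]
      refine Finset.sum_congr rfl fun σ _ => ?_
      rw [koszulSign_of_zero h, one_mul]
      -- The inner arity is two, so the sign `(-1)^{i(j-1)}` is trivial and the sum over unshuffles
      -- is exactly `δ L_k`.
      have hpow : ((-1 : ℤˣ)) ^ ((1 + 1) * (k + 3 - 1 - 1)) = 1 := by
        rw [pow_mul]; simp
      simp only [hpow, mul_one]
      show Equiv.Perm.sign σ • (L k S).1 _ = Equiv.Perm.sign σ • (L k S).1 _
      congr 2
      funext b
      refine Fin.cases ?_ (fun b => ?_) b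
      · rw [Fin.cons_zero]
        show ((L 0 Finset.univ).1 _ : Loc N) = _
        rw [h0, Pi.single_eq_same]
        congr 1
        funext a
        fin_cases a <;> rfl
      · rw [Fin.cons_succ]
        show x (σ ⟨1 + (b.succ : ℕ), by simp only [Fin.val_succ]; omega⟩) Finset.univ
          = x (σ b.succ.succ) Finset.univ
        congr 3
        simp only [Fin.val_succ]
        omega

end Loc

/-! ### Descent to functionals and the final assembly. -/

namespace Loc

variable {N : ℕ}

/-- `∫` as a linear map on top forms. -/
def functionalₗ (N : ℕ) : Omega N N →ₗ[ℝ] LocalFunctional N :=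
  (integralForm N).submoduleMap (Omega N N)

theorem functionalₗ_apply (α : Omega N N) : functionalₗ N α = functionalOf α := rfl

theorem functionalₗ_eq_zero_iff [Nonempty (Fin N)] {α : Omega N N} :
    functionalₗ N α = 0 ↔ IsDHExact α := by
  rw [← integralForm_eq_zero_iff, ← Submodule.coe_eq_zero]
  rfl

/-- A bilinear map that is a Lie bracket up to the kernel of a surjection `I` descends along `I`. -/
theorem exists_isLieBracket {V F : Type*} [AddCommGroup V] [Module ℝ V] [AddCommGroup F]
    [Module ℝ F] (I : V →ₗ[ℝ] F) (hsurj : Function.Surjective I) (b : V →ₗ[ℝ] V →ₗ[ℝ] V)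
    (hr : ∀ α γ, I γ = 0 → I (b α γ) = 0) (ha : ∀ α β, I (b α β + b β α) = 0)
    (hj : ∀ α : Fin 3 → V, I (∑ σ ∈ unshuffles 3 2,
      Equiv.Perm.sign σ • b (b (α (σ 0)) (α (σ 1))) (α (σ 2))) = 0) :
    ∃ B : F →ₗ[ℝ] F →ₗ[ℝ] F, (∀ α β, B (I α) (I β) = I (b α β)) ∧ IsLieBracket B := by
  -- The bracket is defined through a linear section; vanishing on the kernel in either argument
  -- makes it independent of the chosen representatives.
  obtain ⟨s, hs⟩ := I.exists_rightInverse_of_surjective (LinearMap.range_eq_top.2 hsurj)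
  have hs' : ∀ x, I (s x) = x := LinearMap.congr_fun hs
  have hanti : ∀ α β, I (b α β) = -I (b β α) := fun α β => by
    rw [eq_neg_iff_add_eq_zero, ← map_add]; exact ha α β
  have hl : ∀ γ α, I γ = 0 → I (b γ α) = 0 := fun γ α h => by rw [hanti, hr α γ h, neg_zero]
  let B : F →ₗ[ℝ] F →ₗ[ℝ] F := (b.compl₁₂ s s).compr₂ I
  have hB : ∀ α β, B (I α) (I β) = I (b α β) := by
    intro α β
    show I (b (s (I α)) (s (I β))) = _
    have h1 : ∀ α, I (s (I α) - α) = 0 := fun α => by rw [map_sub, hs', sub_self]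
    have h2 := hl _ (s (I β)) (h1 α)
    have h3 := hr α _ (h1 β)
    rw [map_sub, LinearMap.sub_apply, map_sub, sub_eq_zero] at h2
    rw [map_sub, map_sub, sub_eq_zero] at h3
    rw [h2, h3]
  have hBanti : ∀ x y, B x y = -B y x := fun x y => by
    rw [← hs' x, ← hs' y, hB, hB, hanti]
  refine ⟨B, hB, fun x => ?_, fun x y z => ?_⟩
  · have h : (2 : ℝ) • B x x = 0 := by
      rw [two_smul]
      nth_rewrite 1 [hBanti]
      exact neg_add_cancel _
    exact (smul_eq_zero.1 h).resolve_left (by norm_num)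
  · have hu : unshuffles 3 2 = {1, Equiv.swap 1 2, Equiv.swap 0 1 * Equiv.swap 1 2} := by decide
    have h := hj ![s x, s y, s z]
    rw [hu, Finset.sum_insert (by decide), Finset.sum_pair (by decide)] at h
    have e : ∀ i : Fin 3, ((Equiv.swap 0 1 * Equiv.swap 1 2 : Equiv.Perm (Fin 3)) i)
        = ![1, 2, 0] i := by decide
    have e' : ∀ i : Fin 3, ((Equiv.swap 1 2 : Equiv.Perm (Fin 3)) i) = ![0, 2, 1] i := by decide
    simp only [e, e', Equiv.Perm.sign_mul, Equiv.Perm.sign_one, Equiv.Perm.one_apply,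
      Equiv.Perm.sign_swap (show (1 : Fin 3) ≠ 2 by decide),
      Equiv.Perm.sign_swap (show (0 : Fin 3) ≠ 1 by decide)] at h
    simp only [Matrix.cons_val_zero, Matrix.cons_val_one, Matrix.cons_val,
      one_smul, Units.neg_smul, neg_mul_neg, one_mul, map_add, map_neg, ← hB, hs'] at h
    rw [hBanti z x, map_neg, LinearMap.neg_apply, ← h]
    abel

theorem exists_lieBracket [Nonempty (Fin N)] (b : Omega N N →ₗ[ℝ] Omega N N →ₗ[ℝ] Omega N N)
    (h_i : ∀ α γ : Omega N N, IsDHExact γ → IsDHExact (b α γ))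
    (h_ii : ∀ α β : Omega N N, IsDHExact (b α β + b β α))
    (h_iii : ∀ α : Fin 3 → Omega N N,
      IsDHExact (∑ σ ∈ unshuffles 3 2,
        Equiv.Perm.sign σ • b (b (α (σ 0)) (α (σ 1))) (α (σ 2)))) :
    ∃ B : LocalFunctional N →ₗ[ℝ] LocalFunctional N →ₗ[ℝ] LocalFunctional N,
      (∀ α β : Omega N N, B (functionalOf α) (functionalOf β) = functionalOf (b α β)) ∧
      IsLieBracket B := by
  have hI : ∀ α : Omega N N, functionalₗ N α = 0 ↔ IsDHExact α := fun α =>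
    functionalₗ_eq_zero_iff
  exact exists_isLieBracket (functionalₗ N)
    ((integralForm N).submoduleMap_surjective (Omega N N)) b
    (fun α γ h => (hI _).2 (h_i α γ ((hI γ).1 h))) (fun α β => (hI _).2 (h_ii α β))
    (fun α => (hI _).2 (h_iii α))

/-- A bilinear operation on top forms as a multilinear operation on local functions. -/
def densityMap (b : Omega N N →ₗ[ℝ] Omega N N →ₗ[ℝ] Omega N N) :
    MultilinearMap ℝ (fun _ : Fin 2 => Loc N) (Loc N) :=
  MultilinearMap.mk' (fun f => (b (topForm (f 0)) (topForm (f 1)) : HForm N) Finset.univ)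
    (fun f i x y => by
      have h : ∀ f g : Loc N, topForm (f + g) = topForm f + topForm g := topFormₗ.map_add
      fin_cases i <;> simp only [Fin.zero_eta, Fin.mk_one, Function.update_self, h,
        LinearMap.map_add, LinearMap.add_apply, Submodule.coe_add, Pi.add_apply,
        Function.update_of_ne (show (1 : Fin 2) ≠ 0 by decide),
        Function.update_of_ne (show (0 : Fin 2) ≠ 1 by decide)])
    (fun f i c x => by
      have h : ∀ (c : ℝ) (f : Loc N), topForm (c • f) = c • topForm f := topFormₗ.map_smul
      fin_cases i <;> simp only [Fin.zero_eta, Fin.mk_one, Function.update_self, h,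
        LinearMap.map_smul, LinearMap.smul_apply, Submodule.coe_smul, Pi.smul_apply,
        Function.update_of_ne (show (1 : Fin 2) ≠ 0 by decide),
        Function.update_of_ne (show (0 : Fin 2) ≠ 1 by decide)])

theorem densityMap_apply (b : Omega N N →ₗ[ℝ] Omega N N →ₗ[ℝ] Omega N N) (f g : Loc N) :
    densityMap b ![f, g] = (b (topForm f) (topForm g) : HForm N) Finset.univ := rfl

theorem topForm_densityMap (b : Omega N N →ₗ[ℝ] Omega N N →ₗ[ℝ] Omega N N) (f g : Loc N) :
    topForm (densityMap b ![f, g]) = b (topForm f) (topForm g) := topForm_univ _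

end Loc

theorem theorem6p6 (N : ℕ) (hN : 1 ≤ N)
    (b : Omega N N →ₗ[ℝ] Omega N N →ₗ[ℝ] Omega N N)
    (hLDO : IsTopLDO b)
    (h_i : ∀ α γ : Omega N N, IsDHExact γ → IsDHExact (b α γ))
    (h_ii : ∀ α β : Omega N N, IsDHExact (b α β + b β α))
    (h_iii : ∀ α : Fin 3 → Omega N N,
      IsDHExact (∑ σ ∈ unshuffles 3 2,
        Equiv.Perm.sign σ • b (b (α (σ 0)) (α (σ 1))) (α (σ 2)))) :
    ∃ B : LocalFunctional N →ₗ[ℝ] LocalFunctional N →ₗ[ℝ] LocalFunctional N,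
      (∀ α β : Omega N N, B (functionalOf α) (functionalOf β) = functionalOf (b α β)) ∧
      IsLieBracket B ∧
      ∃ l : ∀ k : ℕ, MultilinearMap ℝ (fun _ : Fin k => HForm N) (HForm N),
        IsStrongHomotopyLie (regraded N) l ∧
        (∀ w : HForm N, l 1 ![w] = dH w) ∧
        (∀ α β : Omega N N,
          integralForm N (l 2 ![(α : HForm N), (β : HForm N)]) =
            (B (functionalOf α) (functionalOf β) : TestSection N → ℝ)) ∧
        ∀ k, 1 ≤ k → IsFormLDO (l k) := by
  have : Nonempty (Fin N) := ⟨⟨0, hN⟩⟩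
  obtain ⟨B, hB, hLie⟩ := Loc.exists_lieBracket b h_i h_ii h_iii
  let c : JetAlgebra.LDO (Loc N) 2 := ⟨Loc.densityMap b, Loc.mem_ldo_of_isLDO hLDO⟩
  have hc : ∀ f g, topForm (c.1 ![f, g]) = b (topForm f) (topForm g) := Loc.topForm_densityMap b
  have hex : ∀ f : Loc N, IsDHExact (topForm f) ↔ f ∈ JetAlgebra.exact (Loc N) := fun f => by
    rw [Loc.isDHExact_iff, Loc.topForm_apply_univ]
  have hadd : ∀ f g : Loc N, topForm (f + g) = topForm f + topForm g := Loc.topFormₗ.map_add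
  obtain ⟨M, hMs, hMk, hMc⟩ := JetAlgebra.exists_bracket (b := c)
    (fun f g i => by
      rw [← hex, hc]
      exact h_i _ _ ((hex _).2 (JetAlgebra.derD_mem_exact i g)))
    (fun f g => by rw [← hex, hadd, hc, hc]; exact h_ii _ _)
  have hJ : JetAlgebra.JacobiExact M := JetAlgebra.jacobiExact_of_sub_mem hMk hMc fun f g h => by
    rw [← hex, hadd, hadd, hc, hc, hc, hc, hc, hc, ← Loc.functionalₗ_eq_zero_iff, map_add, map_add]
    -- The cyclic Jacobi identity of the density, modulo exact forms, is read off from the Lie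
    -- bracket on functionals.
    simp only [Loc.functionalₗ_apply, ← hB]
    exact hLie.jacobi _ _ _
  obtain ⟨L, h0, hF, hS, hK, hd⟩ := JetAlgebra.exists_brackets hMs hMk hJ
  refine ⟨B, hB, hLie, Loc.brackets L,
    Loc.isStrongHomotopyLie_brackets hMs h0 hF hS hK hd, fun w => rfl, fun α β => ?_,
    Loc.isFormLDO_brackets L⟩
  rw [hB]
  show integralForm N _ = integralForm N (b α β : HForm N)
  rw [Loc.integralForm_eq, Loc.integralForm_eq, ← sub_eq_zero, ← map_sub]
  refine Loc.functional_of_exact ?_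
  have h1 := hMc ![(α : HForm N) Finset.univ, (β : HForm N) Finset.univ]
  have h2 : c.1 ![(α : HForm N) Finset.univ, (β : HForm N) Finset.univ]
      = (b α β : HForm N) Finset.univ := by
    refine (Loc.densityMap_apply b _ _).trans ?_
    rw [Loc.topForm_univ, Loc.topForm_univ]
  rw [JetAlgebra.LDO.sub_apply, h2] at h1
  convert h1 using 2
  show (L 0 Finset.univ).1 _ = _
  rw [h0, Pi.single_eq_same]
  congr 1
  funext a
  fin_cases a <;> rfl

end
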